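/- **Setting.** Let $\gamma>1$ and consider, for $U=(u,v,p,\rho)$, the steady full Euler system $W(U)_x+H(U)_y=0$ with $W=(\rho u,\rho u^2+p,\rho uv,\rho u(h+\tfrac{u^2+v^2}{2}))$, $H=(\rho v,\rho uv,\rho v^2+p,\rho v(h+\tfrac{u^2+v^2}{2}))$, $h=\tfrac{\gamma p}{(\gamma-1)\rho}$, $c=\sqrt{\gamma p/\rho}$, in the region $y>g(x)$, $x\ge 0$, with the flow tangent to the wall $y=g(x)$. Here $g$ is Lipschitz with right derivative $g'$ on $[0,\infty)$, $g(0)=g'(0+)=0$ and $g'(x)\to0$ as $x\to\infty$. The incoming flow at $x=0$ is $\overline U=U_0^b+\widetilde U_0$ with $\widetilde U_0\in L^1\cap BV(\mathbb R;\mathbb R^4)$ and $U_0^b=U_-$ for $y<y_0^*$, $U_0^b=U_+$ for $y>y_0^*$, where $y_0^*>0$, $p_\pm,\rho_\pm>0$, $v_\pm=0$, $p_+=p_-$, $u_\pm>c_\pm$. *Waves.* $\lambda_{1,4}=\frac{uv\mp c\sqrt{u^2+v^2-c^2}}{u^2-c^2}$ are the genuinely nonlinear eigenvalues, with eigenvectors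 $\mathbf r_d=\kappa_d\big(-\lambda_d,1,\rho(\lambda_du-v),\rho(\lambda_du-v)/c^2\big)$ normalized by $\mathbf r_d\cdot\nabla\lambda_d=1$. A $1$- or $4$-wave $\{U_b,U_a\}$ ($U_b$ below, $U_a$ above) is a rarefaction wave or a Lax shock; its strength is $\alpha=\lambda_d(U_a)-\lambda_d(U_b)$ (positive for rarefactions, negative for shocks). A vortex sheet/entropy wave of strengths $(\sigma_2,\sigma_3)$ joins $(u,v,p,\rho)$ to $(ue^{\sigma_2},ve^{\sigma_2},p,\rho e^{\sigma_3})$; if it is weak it counts with $|\sigma_2|+|\sigma_3|$. The strong front joins states near $U_-$ and $U_+$, and $(\sigma_{20},\sigma_{30})$ denotes its background strengths. A non-physical front counts with the norm of its jump. *Front tracking approximations.* Parameters: $\vartheta,\delta_\vartheta,\omega_\vartheta>0$, a tolerance $\eta\ge0$ for the adjustment of front speeds, the speed $\hat\lambda>\lambda_4(U_\pm)$ of non-physical fronts, and a bound $r>0$ for the size (norm of the jump) of every weak $1$-, $4$- and vortex sheet/entropy wave produced by the Riemann solvers. The wall is replaced by a polygon $g^\vartheta$ starting at the origin with $|g^\vartheta-g|\le\vartheta$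 on $[0,1/\vartheta]$ and $\mathrm{TV}((g^\vartheta)')\le\mathrm{TV}(g')$ (counting the initial slope as a jump from $0$), and $\widetilde U_0$ by a step function $\widetilde U_0^\vartheta$ on $(0,\infty)$ with finitely many jumps, $\|\widetilde U_0^\vartheta-\widetilde U_0\|_{L^1(0,\infty)}\le\vartheta$ and $\mathrm{TV}(\widetilde U_0^\vartheta)\le\mathrm{TV}(\widetilde U_0)$. A front tracking approximation $U^\vartheta$ is piecewise constant, with finitely many straight fronts between consecutive interaction abscissas $0=\tau_0<\tau_1<\dots$; it is defined for $0\le x<\sup_n\tau_n$. Rarefaction fronts travel at a speed between the values of $\lambda_d$ on both sides, shocks at the Rankine–Hugoniot speed, vortex sheets/entropy waves at speed $v/u$, all up to $\eta$, and non-physical fronts at speed $\hat\lambda$. At each $\tau_n$, $n\ge1$, at most one of the following occurs: two fronts collide, one front meets the wall, or the wall has a vertex. - *Accurate solver*: exact solution by a $1$-wave, a (weak or strong) vortex sheet/entropy wave and a $4$-wave, each rarefaction being split into fronts of equal strength at most $\delta_\vartheta$; at the wall, a new state tangent to the wall followed by a $4$-wave. - *Simplified solver*: two weak physical fronts of different families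 cross with unchanged strengths, two of the same family merge with added strengths; when a non-physical front meets a weak physical front, or a weak or non-physical front meets the strong front, the weak physical front, respectively the strong front, keeps its strength. The remaining jump is one non-physical front above. At $x=0$ (including the origin) the accurate solver is used. For two weak physical fronts $\alpha,\beta$ the accurate solver is used if $|\alpha\beta|>\omega_\vartheta$ and the simplified one if $|\alpha\beta|<\omega_\vartheta$; for a weak physical front $\alpha$ meeting the strong front, likewise with $|\alpha|$; collisions involving a non-physical front use the simplified solver. A change of wall angle larger than $\omega_\vartheta$ is treated by the accurate solver and a smaller one is ignored; in case of equality with $\omega_\vartheta$ either choice is allowed. A physical weak front meeting the wall is treated by the accurate solver; a non-physical one leaves the domain. *Weighted strength.* Let $$K_{11}=\left|\frac{\lambda_4(U_+)e^{2\sigma_{20}+\sigma_{30}}-\lambda_4(U_-)}{\lambda_4(U_+)e^{2\sigma_{20}+\sigma_{30}}+\lambda_4(U_-)}\right|,\qquad K_{21}=\left|\frac{2\kappa_1(U_+)\lambda_4(U_+)e^{\sigma_{20}+\sigma_{30}}}{\kappa_1(U_-)\big(\lambda_4(U_+)e^{2\sigma_{20}+\sigma_{30}}+\lambda_4(U_-)\big)}\right|,$$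 fix $K^*\in(K_{11},1)$, and let $\mathcal V(x)=\sum_\alpha|b_\alpha|$ be the sum over all weak fronts (including non-physical ones) of $U^\vartheta(x,\cdot)$, where $|b_\alpha|=\frac{2K_{21}}{K^*}|\alpha|$ for $1$-fronts above the strong front and $|b_\alpha|=|\alpha|$ for all others. **Proposition 3.1.** Given $\gamma,U_\pm,y_0^*,K^*,\hat\lambda$ as above, there are constants $r,\eta_0,\delta_0,C>0$ such that, whenever $\mathrm{TV}(\widetilde U_0)+\mathrm{TV}(g')\le\delta_0$, every front tracking approximation $U^\vartheta$, with the weak wave size bound $r$, with any $\vartheta,\delta_\vartheta,\omega_\vartheta>0$ and any $0\le\eta\le\eta_0$, satisfies, for all $x>0$ for which it is defined, $$\mathcal V(x)\le C\big(\mathrm{TV}(\widetilde U_0)+\mathrm{TV}(g')\big)\qquad\text{and}\qquad \mathrm{TV}\big(U^\vartheta(x,\cdot);(g^\vartheta(x),\infty)\big)\le C .$$ In particular $\mathcal V(x)$ stays small for all $x>0$, and the total variation is bounded uniformly in $\vartheta$ and $x$. -/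

import Mathlib

open Set Filter Topology MeasureTheory

noncomputable section

namespace SteadyEuler

/-- A state `U = (u, v, p, ρ)` of the gas, with the Euclidean norm of `ℝ⁴`. -/
abbrev State := EuclideanSpace ℝ (Fin 4)

/-- Horizontal velocity. -/
def uu (U : State) : ℝ := U 0
/-- Vertical velocity. -/
def vv (U : State) : ℝ := U 1
/-- Pressure. -/
def pp (U : State) : ℝ := U 2
/-- Density. -/
def rr (U : State) : ℝ := U 3

/-- Sonic speed `c = √(γ p / ρ)`. -/
def sonic (γ : ℝ) (U : State) : ℝ := Real.sqrt (γ * pp U / rr U)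

/-- Positive pressure and density, and `u > c`. -/
def Supersonic (γ : ℝ) (U : State) : Prop := 0 < pp U ∧ 0 < rr U ∧ sonic γ U < uu U

/-- The fluxes of the steady Euler system `W(U)_x + H(U)_y = 0`, where
`h = γ p / ((γ - 1) ρ)`. -/
def fluxW (γ : ℝ) (U : State) : State :=
  !₂[rr U * uu U,
     rr U * uu U ^ 2 + pp U,
     rr U * uu U * vv U,
     rr U * uu U * (γ * pp U / ((γ - 1) * rr U) + (uu U ^ 2 + vv U ^ 2) / 2)]

def fluxH (γ : ℝ) (U : State) : State :=
  !₂[rr U * vv U,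
     rr U * uu U * vv U,
     rr U * vv U ^ 2 + pp U,
     rr U * vv U * (γ * pp U / ((γ - 1) * rr U) + (uu U ^ 2 + vv U ^ 2) / 2)]

/-- The two genuinely nonlinear families, `d = 1` and `d = 4`. -/
inductive NLFamily
  | one
  | four

/-- The sign `(-1)^d`. -/
def NLFamily.sign : NLFamily → ℝ
  | .one => -1
  | .four => 1

/-- The eigenvalues `λ_1` and `λ_4`. -/
def lam (γ : ℝ) (d : NLFamily) (U : State) : ℝ :=
  (uu U * vv U + d.sign * sonic γ U * Real.sqrt (uu U ^ 2 + vv U ^ 2 - sonic γ U ^ 2)) /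
    (uu U ^ 2 - sonic γ U ^ 2)

/-- The eigenvector of family `d` before normalization. -/
def rvec (γ : ℝ) (d : NLFamily) (U : State) : State :=
  !₂[-lam γ d U, 1, rr U * (lam γ d U * uu U - vv U),
     rr U * (lam γ d U * uu U - vv U) / sonic γ U ^ 2]

/-- The normalization factor `κ_d`, determined by `κ_d rvec_d · ∇ λ_d = 1`. -/
def kap (γ : ℝ) (d : NLFamily) (U : State) : ℝ :=
  (fderiv ℝ (lam γ d) U (rvec γ d U))⁻¹

/-- The normalized eigenvector `r_d`, with `r_d · ∇ λ_d = 1`. -/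
def reig (γ : ℝ) (d : NLFamily) (U : State) : State := kap γ d U • rvec γ d U

/-! ### Elementary waves

In `{lo, hi}` the state `lo` is below and `hi` is above the discontinuity. -/

/-- `{lo, hi}` is a rarefaction wave of family `d`: `hi` is on the forward integral curve of `r_d`
through `lo`. By the normalization of `r_d` the length `α` of the parameter interval is
`λ_d(hi) - λ_d(lo)`. -/
def IsRarefaction (γ : ℝ) (d : NLFamily) (lo hi : State) : Prop :=
  ∃ α : ℝ, 0 < α ∧ ∃ w : ℝ → State, w 0 = lo ∧ w α = hi ∧
    ∀ s ∈ Icc 0 α, Supersonic γ (w s) ∧ HasDerivWithinAt w (reig γ d (w s)) (Icc 0 α) s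

/-- `{lo, hi}` is a shock of family `d` and speed `σ`: the Rankine-Hugoniot conditions and the Lax
entropy condition hold. -/
def IsShock (γ : ℝ) (d : NLFamily) (σ : ℝ) (lo hi : State) : Prop :=
  Supersonic γ lo ∧ Supersonic γ hi ∧
    σ • (fluxW γ hi - fluxW γ lo) = fluxH γ hi - fluxH γ lo ∧
    lam γ d hi < σ ∧ σ < lam γ d lo

/-- `G(σ₃, σ₂; U) = (u e^{σ₂}, v e^{σ₂}, p, ρ e^{σ₃})`: a vortex sheet of strength `σ₂` followed by
an entropy wave of strength `σ₃`. -/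
def contactMap (σ₃ σ₂ : ℝ) (U : State) : State :=
  !₂[uu U * Real.exp σ₂, vv U * Real.exp σ₂, pp U, rr U * Real.exp σ₃]

/-! ### Fronts and configurations -/

/-- Types of fronts: weak `1`- and `4`-fronts, weak vortex sheet/entropy waves (families `2` and
`3`, which coincide in the physical plane), the strong vortex sheet/entropy wave, and
non-physical fronts. -/
inductive FrontKind
  | nonlinear (d : NLFamily)
  | contact
  | strong
  | nonphysical

/-- A front is a segment of the line `y = intercept + speed * x` with the state `lo` below and the
state `hi` above. -/
structure Front where
  kind : FrontKind
  lo : State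
  hi : State
  intercept : ℝ
  speed : ℝ

def Front.pos (f : Front) (x : ℝ) : ℝ := f.intercept + f.speed * x

/-- Strength of the vortex sheet in a contact discontinuity, `u_hi = u_lo e^{σ₂}`. -/
def Front.sigma2 (f : Front) : ℝ := Real.log (uu f.hi / uu f.lo)

/-- Strength of the entropy wave in a contact discontinuity, `ρ_hi = ρ_lo e^{σ₃}`. -/
def Front.sigma3 (f : Front) : ℝ := Real.log (rr f.hi / rr f.lo)

/-- Signed strength of a `d`-wave in the parametrization normalized by `r_d · ∇ λ_d = 1`: positive
for rarefaction fronts and negative for shocks. -/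
def Front.signed (γ : ℝ) (d : NLFamily) (f : Front) : ℝ := lam γ d f.hi - lam γ d f.lo

/-- The strength `|α|` of a weak front; the strong front is not counted. -/
def Front.strength (γ : ℝ) (f : Front) : ℝ :=
  match f.kind with
  | .nonlinear d => |f.signed γ d|
  | .contact => |f.sigma2| + |f.sigma3|
  | .strong => 0
  | .nonphysical => ‖f.hi - f.lo‖

def Front.isStrong (f : Front) : Bool :=
  match f.kind with
  | .strong => true
  | _ => false

/-- The front is a physical weak front. -/
def Front.WeakPhysical (f : Front) : Prop :=
  match f.kind with
  | .nonlinear _ => True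
  | .contact => True
  | .strong => False
  | .nonphysical => False

/-- Order of the families of weak physical fronts. -/
def FrontKind.rank : FrontKind → ℕ
  | .nonlinear .one => 1
  | .contact => 2
  | .strong => 2
  | .nonlinear .four => 4
  | .nonphysical => 5

/-- The weighted strength `|b_α|` of a weak front above the strong vortex sheet/entropy wave. -/
def Front.weightedAbove (γ kplus : ℝ) (f : Front) : ℝ :=
  match f.kind with
  | .nonlinear .one => kplus * f.strength γ
  | _ => f.strength γ

/-- A piecewise constant flow on a vertical line: the state at the wall and the list of fronts,
from below to above. -/
structure Config where
  bot : State
  fronts : List Front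

/-- The state at `(x, y)`. -/
def Config.state (c : Config) (x y : ℝ) : State :=
  c.fronts.foldl (fun U f => if f.pos x < y then f.hi else U) c.bot

/-- The total weighted strength of the weak waves: weight `1` below the strong front; above it
weight `kplus` for `1`-waves and weight `1` for all others. -/
def Config.totalStrength (γ kplus : ℝ) (c : Config) : ℝ :=
  ((c.fronts.takeWhile (fun f => !f.isStrong)).map (Front.strength γ)).sum +
    ((c.fronts.dropWhile (fun f => !f.isStrong)).map (Front.weightedAbove γ kplus)).sum

/-- Consecutive fronts fit together and lead from the state `U` to the state `V`. -/
def Linked : State → List Front → State → Prop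
  | U, [], V => U = V
  | U, f :: fs, V => f.lo = U ∧ Linked f.hi fs V

/-! ### Riemann solvers -/

/-- Parameters of the front tracking algorithm. -/
structure Params where
  /-- adiabatic exponent -/
  γ : ℝ
  /-- initial approximation parameter -/
  ϑ : ℝ
  /-- maximal strength of a rarefaction front -/
  δ : ℝ
  /-- threshold that decides which Riemann solver is used -/
  ω : ℝ
  /-- bound for the adjustments of front speeds -/
  η : ℝ
  /-- speed of the non-physical fronts -/
  speedNP : ℝ
  /-- maximal size of a weak wave: the Riemann solvers use only the local, small-amplitude
  branches of the wave curves -/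
  weak : ℝ

/-- The front carries a wave of its type and has the speed of this wave, up to the adjustment `η`.
The Rankine-Hugoniot quotients `[H_i]/[W_i]` of a jump along a rarefaction curve are values of `λ_d`
between its end states. -/
def Front.Admissible (P : Params) (f : Front) : Prop :=
  match f.kind with
  | .nonlinear d => dist f.lo f.hi ≤ P.weak ∧
      ((IsRarefaction P.γ d f.lo f.hi ∧ lam P.γ d f.lo - P.η ≤ f.speed ∧
          f.speed ≤ lam P.γ d f.hi + P.η) ∨
        ∃ σ, IsShock P.γ d σ f.lo f.hi ∧ |f.speed - σ| ≤ P.η)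
  | .contact => dist f.lo f.hi ≤ P.weak ∧ (∃ σ₃ σ₂, f.hi = contactMap σ₃ σ₂ f.lo) ∧
      |f.speed - vv f.lo / uu f.lo| ≤ P.η
  | .strong => (∃ σ₃ σ₂, f.hi = contactMap σ₃ σ₂ f.lo) ∧
      |f.speed - vv f.lo / uu f.lo| ≤ P.η
  | .nonphysical => f.speed = P.speedNP

/-- `fs` replaces the `d`-wave `{lo, hi}`: nothing for a trivial wave, one front for a shock, and
fronts of equal strength, at most `δ`, for a rarefaction wave. -/
def IsFan (P : Params) (d : NLFamily) (lo hi : State) (fs : List Front) : Prop :=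
  dist lo hi ≤ P.weak ∧ Linked lo fs hi ∧
    (∀ f ∈ fs, f.kind = .nonlinear d ∧ f.Admissible P) ∧
    ((lo = hi ∧ fs = []) ∨
      ((∃ σ, IsShock P.γ d σ lo hi) ∧ fs.length = 1) ∨
      (IsRarefaction P.γ d lo hi ∧ fs ≠ [] ∧
        ∀ f ∈ fs, IsRarefaction P.γ d f.lo f.hi ∧
          f.signed P.γ d = (lam P.γ d hi - lam P.γ d lo) / fs.length ∧ f.signed P.γ d ≤ P.δ))

/-- Accurate Riemann solver for weak waves: a `1`-wave, a weak vortex sheet/entropy wave, and a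
`4`-wave lead from `lo` to `hi`. -/
def AccurateWeak (P : Params) (lo hi : State) (new : List Front) : Prop :=
  ∃ (m₁ m₂ : State) (F₁ F₂ F₄ : List Front), new = F₁ ++ F₂ ++ F₄ ∧
    IsFan P .one lo m₁ F₁ ∧
    ((m₁ = m₂ ∧ F₂ = []) ∨
      ∃ f : Front, f.kind = .contact ∧ f.lo = m₁ ∧ f.hi = m₂ ∧ f.Admissible P ∧ F₂ = [f]) ∧
    IsFan P .four m₂ hi F₄

/-- Accurate Riemann solver across the strong vortex sheet/entropy wave: a weak `1`-wave, the strong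
front, and a weak `4`-wave lead from `lo` to `hi`. -/
def AccurateStrong (P : Params) (lo hi : State) (new : List Front) : Prop :=
  ∃ (F₁ : List Front) (f : Front) (F₄ : List Front), new = F₁ ++ f :: F₄ ∧
    IsFan P .one lo f.lo F₁ ∧ f.kind = .strong ∧ f.Admissible P ∧ IsFan P .four f.hi hi F₄

/-- Accurate solver of the lateral Riemann problem at a wall of the given slope: the new state `bot`
at the wall is parallel to the wall and is joined to `Ua` by a `4`-wave. -/
def AccurateLateral (P : Params) (slope : ℝ) (bot Ua : State) (new : List Front) : Prop :=
  vv bot = slope * uu bot ∧ IsFan P .four bot Ua new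

/-- `f'` is a wave of the same type and strength as `f`, from another state. -/
def SameWave (γ : ℝ) (f f' : Front) : Prop :=
  f'.kind = f.kind ∧
    match f.kind with
    | .nonlinear d => f'.signed γ d = f.signed γ d
    | .contact => f'.sigma2 = f.sigma2 ∧ f'.sigma3 = f.sigma3
    | .strong => f'.sigma2 = f.sigma2 ∧ f'.sigma3 = f.sigma3
    | .nonphysical => False

/-- `h` is a wave of the common type of `f` and `g`, and its strength is the sum of theirs. -/
def MergedWave (γ : ℝ) (f g h : Front) : Prop :=
  g.kind = f.kind ∧ h.kind = f.kind ∧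
    match f.kind with
    | .nonlinear d => h.signed γ d = f.signed γ d + g.signed γ d
    | .contact => h.sigma2 = f.sigma2 + g.sigma2 ∧ h.sigma3 = f.sigma3 + g.sigma3
    | .strong => False
    | .nonphysical => False

/-- The strengths of the waves `f` and `g`, which have the same type, add up to zero. -/
def CancellingWaves (γ : ℝ) (f g : Front) : Prop :=
  g.kind = f.kind ∧
    match f.kind with
    | .nonlinear d => f.signed γ d + g.signed γ d = 0
    | .contact => f.sigma2 + g.sigma2 = 0 ∧ f.sigma3 + g.sigma3 = 0
    | .strong => False
    | .nonphysical => False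

/-- At most one front, a non-physical one. -/
def NPTail (t : List Front) : Prop :=
  t = [] ∨ ∃ n : Front, n.kind = .nonphysical ∧ t = [n]

/-- Simplified Riemann solver for two weak physical fronts, `f` below `g`: waves of different
families cross with unchanged strengths, waves of the same family are merged, and the error goes
into one non-physical front above them. -/
def SimplifiedWeak (P : Params) (f g : Front) (new : List Front) : Prop :=
  Linked f.lo new g.hi ∧ (∀ h ∈ new, h.Admissible P) ∧ ∃ t, NPTail t ∧
    ((g.kind.rank < f.kind.rank ∧
        ∃ g' f', SameWave P.γ g g' ∧ SameWave P.γ f f' ∧ new = g' :: f' :: t) ∨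
      (∃ h, MergedWave P.γ f g h ∧ new = h :: t) ∨
      (CancellingWaves P.γ f g ∧ new = t))

/-- Simplified Riemann solver in all other cases: the front `k`, one of the two incoming fronts,
keeps its type and strength and starts from the state `lo`; everything else goes into one
non-physical front above it. -/
def SimplifiedKeep (P : Params) (k : Front) (lo hi : State) (new : List Front) : Prop :=
  Linked lo new hi ∧ (∀ h ∈ new, h.Admissible P) ∧
    ∃ t k', NPTail t ∧ SameWave P.γ k k' ∧ new = k' :: t

/-- The fronts `new` that leave a collision of the front `f` with the front `g` above it. -/
inductive CollisionRule (P : Params) (f g : Front) (new : List Front) : Prop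
  | weakAccurate : f.WeakPhysical → g.WeakPhysical → P.ω ≤ f.strength P.γ * g.strength P.γ →
      AccurateWeak P f.lo g.hi new → CollisionRule P f g new
  | weakSimplified : f.WeakPhysical → g.WeakPhysical → f.strength P.γ * g.strength P.γ ≤ P.ω →
      SimplifiedWeak P f g new → CollisionRule P f g new
  | nonphysicalWeak : f.kind = .nonphysical → g.WeakPhysical →
      SimplifiedKeep P g f.lo g.hi new → CollisionRule P f g new
  | belowAccurate : f.WeakPhysical → g.kind = .strong → P.ω ≤ f.strength P.γ →
      AccurateStrong P f.lo g.hi new → CollisionRule P f g new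
  | belowSimplified : f.WeakPhysical → g.kind = .strong → f.strength P.γ ≤ P.ω →
      SimplifiedKeep P g f.lo g.hi new → CollisionRule P f g new
  | belowNonphysical : f.kind = .nonphysical → g.kind = .strong →
      SimplifiedKeep P g f.lo g.hi new → CollisionRule P f g new
  | aboveAccurate : f.kind = .strong → g.WeakPhysical → P.ω ≤ g.strength P.γ →
      AccurateStrong P f.lo g.hi new → CollisionRule P f g new
  | aboveSimplified : f.kind = .strong → g.WeakPhysical → g.strength P.γ ≤ P.ω →
      SimplifiedKeep P f f.lo g.hi new → CollisionRule P f g new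

/-! ### The polygonal wall -/

/-- A polygonal wall with vertices `(a_l, b_l)`, starting at the origin. -/
structure Wall where
  a : ℕ → ℝ
  b : ℕ → ℝ
  a_zero : a 0 = 0
  b_zero : b 0 = 0
  a_strictMono : StrictMono a
  a_tendsto : Tendsto a atTop atTop

/-- Slope of the wall between the vertices `l` and `l + 1`. -/
def Wall.slope (W : Wall) (l : ℕ) : ℝ := (W.b (l + 1) - W.b l) / (W.a (l + 1) - W.a l)

/-- The index `l` with `a_l ≤ x < a_{l+1}`. -/
def Wall.index (W : Wall) (x : ℝ) : ℕ := sSup {l : ℕ | W.a l ≤ x}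

/-- The polygonal function. -/
def Wall.height (W : Wall) (x : ℝ) : ℝ :=
  W.b (W.index x) + W.slope (W.index x) * (x - W.a (W.index x))

/-- The change `θ_{l+1}` of the angle of the wall at the vertex `l + 1`. -/
def Wall.turn (W : Wall) (l : ℕ) : ℝ := Real.arctan (W.slope (l + 1)) - Real.arctan (W.slope l)

/-- The total variation of the slope of the wall, the initial slope being compared with `0`. -/
def Wall.slopeVariation (W : Wall) : ENNReal :=
  ENNReal.ofReal |W.slope 0| + ∑' l : ℕ, ENNReal.ofReal |W.slope (l + 1) - W.slope l|

/-- `x` is not the abscissa of a vertex of the wall other than the origin. -/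
def Wall.NoVertex (W : Wall) (x : ℝ) : Prop := ∀ l : ℕ, W.a (l + 1) ≠ x

/-! ### Front tracking approximations -/

/-- At `x`, the fronts are above the wall and are at different points, in the order of the list. -/
def Separated (W : Wall) (fs : List Front) (x : ℝ) : Prop :=
  (∀ f ∈ fs, W.height x < f.pos x) ∧ fs.Pairwise (fun f g => f.pos x < g.pos x)

/-- All fronts in `fs` pass through `(x, y)`. -/
def EmittedAt (x y : ℝ) (fs : List Front) : Prop := ∀ f ∈ fs, f.pos x = y

/-- The possible changes of the configuration at `x`. At most one thing happens at a time: a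
collision of two fronts, a collision of one front with the wall, or a vertex of the wall. -/
inductive Step (P : Params) (W : Wall) (x : ℝ) : Config → Config → Prop
  | nothing (c : Config) : W.NoVertex x → Separated W c.fronts x → Step P W x c c
  | collision (U : State) (pre : List Front) (f g : Front) (post new : List Front) :
      W.NoVertex x → f.pos x = g.pos x → Separated W (pre ++ f :: post) x →
      EmittedAt x (f.pos x) new → CollisionRule P f g new →
      Step P W x ⟨U, pre ++ f :: g :: post⟩ ⟨U, pre ++ new ++ post⟩
  | wallPhysical (U : State) (f : Front) (post : List Front) (U' : State) (new : List Front) :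
      W.NoVertex x → f.pos x = W.height x → Separated W post x →
      EmittedAt x (W.height x) new → f.WeakPhysical →
      AccurateLateral P (W.slope (W.index x)) U' f.hi new →
      Step P W x ⟨U, f :: post⟩ ⟨U', new ++ post⟩
  | wallNonphysical (U : State) (f : Front) (post : List Front) :
      W.NoVertex x → f.pos x = W.height x → Separated W post x → f.kind = .nonphysical →
      Step P W x ⟨U, f :: post⟩ ⟨f.hi, post⟩
  | vertexAccurate (U : State) (fs : List Front) (l : ℕ) (U' : State) (new : List Front) :
      x = W.a (l + 1) → Separated W fs x → EmittedAt x (W.height x) new → P.ω ≤ |W.turn l| →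
      AccurateLateral P (W.slope (l + 1)) U' U new →
      Step P W x ⟨U, fs⟩ ⟨U', new ++ fs⟩
  | vertexIgnored (c : Config) (l : ℕ) :
      x = W.a (l + 1) → Separated W c.fronts x → |W.turn l| ≤ P.ω → Step P W x c c

/-- The step function with value `U` near `0+` that takes the value `w` above the point `y`, for the
pairs `(y, w)` of the list (in the order of the list). -/
def stepFun (U : State) (js : List (ℝ × State)) (y : ℝ) : State :=
  js.foldl (fun V j => if j.1 < y then j.2 else V) U

/-- The background flow at `x = 0`: `U_-` below `y₀` and `U_+` above. -/
def background (Um Up : State) (y₀ : ℝ) (y : ℝ) : State := if y₀ < y then Up else Um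

/-- At `x = 0` all Riemann problems of a step function are solved by the accurate solver, with the
strong front leaving from `y₀`. -/
inductive InitialFronts (P : Params) (y₀ : ℝ) : State → List (ℝ × State) → List Front → Prop
  | nil (U : State) : InitialFronts P y₀ U [] []
  | weak (U : State) (y : ℝ) (w : State) (js : List (ℝ × State)) (new fs : List Front) :
      y ≠ y₀ → AccurateWeak P U w new → EmittedAt 0 y new → InitialFronts P y₀ w js fs →
      InitialFronts P y₀ U ((y, w) :: js) (new ++ fs)
  | strong (U : State) (y : ℝ) (w : State) (js : List (ℝ × State)) (new fs : List Front) :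
      y = y₀ → AccurateStrong P U w new → EmittedAt 0 y new → InitialFronts P y₀ w js fs →
      InitialFronts P y₀ U ((y, w) :: js) (new ++ fs)

/-- A front tracking approximation for the problem with incoming flow
`background Um Up y₀ + pert` and wall `y = g x`, where `dg` is `g'`. It is given by a strictly
increasing sequence of abscissas `τ n`, with `τ 0 = 0`, and by the configuration on
`[τ n, τ (n + 1))`, and is defined for `0 ≤ x < sup τ`. -/
structure FrontTracking (P : Params) (Um Up : State) (y₀ : ℝ) (pert : ℝ → State)
    (g dg : ℝ → ℝ) where
  /-- the approximate wall -/
  wall : Wall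
  wall_close : ∀ x ∈ Icc 0 (1 / P.ϑ), |wall.height x - g x| ≤ P.ϑ
  wall_variation : wall.slopeVariation ≤ eVariationOn dg (Ici 0)
  /-- the value of the approximate incoming flow near `0+` -/
  initBot : State
  /-- the jumps of the approximate incoming flow -/
  jumps : List (ℝ × State)
  jumps_pos : ∀ j ∈ jumps, 0 < j.1
  jumps_sorted : jumps.Pairwise (fun i j => i.1 < j.1)
  jumps_strong : ∃ j ∈ jumps, j.1 = y₀
  init_close : ∫⁻ y in Ioi (0 : ℝ),
    ‖stepFun initBot jumps y - background Um Up y₀ y - pert y‖ₑ ≤ ENNReal.ofReal P.ϑ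
  init_variation : eVariationOn (fun y => stepFun initBot jumps y - background Um Up y₀ y)
    (Ioi 0) ≤ eVariationOn pert univ
  τ : ℕ → ℝ
  τ_zero : τ 0 = 0
  τ_strictMono : StrictMono τ
  cfg : ℕ → Config
  init : ∃ lat fs : List Front, (cfg 0).fronts = lat ++ fs ∧
    AccurateLateral P (wall.slope 0) (cfg 0).bot initBot lat ∧ EmittedAt 0 0 lat ∧
    InitialFronts P y₀ initBot jumps fs
  slab : ∀ n, ∀ x ∈ Ioo (τ n) (τ (n + 1)), wall.NoVertex x ∧ Separated wall (cfg n).fronts x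
  step : ∀ n, Step P wall (τ (n + 1)) (cfg n) (cfg (n + 1))

namespace FrontTracking

variable {P : Params} {Um Up : State} {y₀ : ℝ} {pert : ℝ → State} {g dg : ℝ → ℝ}

/-- The index `n` with `τ n ≤ x < τ (n + 1)`. -/
def index (A : FrontTracking P Um Up y₀ pert g dg) (x : ℝ) : ℕ := sSup {n : ℕ | A.τ n ≤ x}

/-- The approximate solution at `(x, y)`, for `y > A.wall.height x`. -/
def sol (A : FrontTracking P Um Up y₀ pert g dg) (x y : ℝ) : State :=
  (A.cfg (A.index x)).state x y

/-- The total weighted strength of the weak waves at `x`. -/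
def totalStrength (A : FrontTracking P Um Up y₀ pert g dg) (kplus x : ℝ) : ℝ :=
  (A.cfg (A.index x)).totalStrength P.γ kplus

end FrontTracking

/-! ### Coefficients of the strong vortex sheet/entropy wave -/

/-- `e^{σ₂₀}` for the background vortex sheet, `u_+ = u_- e^{σ₂₀}`. -/
def expSigma2 (Um Up : State) : ℝ := uu Up / uu Um

/-- `e^{σ₃₀}` for the background entropy wave, `ρ_+ = ρ_- e^{σ₃₀}`. -/
def expSigma3 (Um Up : State) : ℝ := rr Up / rr Um

/-- The reflection coefficient `|K₁₁|` at the background: a weak `4`-wave `α` that hits the strong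
front from below produces a reflected `1`-wave `K₁₁ α`, up to higher order. -/
def K11 (γ : ℝ) (Um Up : State) : ℝ :=
  |(lam γ .four Up * (expSigma2 Um Up ^ 2 * expSigma3 Um Up) - lam γ .four Um) /
    (lam γ .four Up * (expSigma2 Um Up ^ 2 * expSigma3 Um Up) + lam γ .four Um)|

/-- The transmission coefficient `|K₂₁|` at the background: a weak `1`-wave `β` that hits the strong
front from above produces a transmitted `1`-wave `K₂₁ β`, up to higher order. -/
def K21 (γ : ℝ) (Um Up : State) : ℝ :=
  |2 * kap γ .one Up * lam γ .four Up * (expSigma2 Um Up * expSigma3 Um Up) /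
    (kap γ .one Um *
      (lam γ .four Up * (expSigma2 Um Up ^ 2 * expSigma3 Um Up) + lam γ .four Um))|

end SteadyEuler

end

open Set Filter Topology MeasureTheory

noncomputable section

namespace SteadyEuler

/-! The proof is a Glimm functional argument in the coordinates $(\log\rho,\log q,\log p,\varphi)$,
where $q$ is the flow speed and $\varphi$ the flow angle. There a contact discontinuity of any size
is a translation in the first two coordinates (`coord_contactMap`). A $1$- or $4$-wave is a
displacement `disp` given in closed form by the change $s$ of $\log p$ and by the Mach number
(`IsRarefaction.coord_eq`, `IsShock.coord_eq`). The two families are mirror images: the turning of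
$\varphi$ and the sign of $s$ that belongs to rarefactions are reversed. The rarefaction and shock
branches are $C^2$ and tangent at $s=0$, so the displacement is $s$ times a Lipschitz function, and
all interaction estimates follow from this (`exists_waveBounds`). Waves are measured by $|s|$; near
the background this is comparable with the jump of $\lambda_d$.

Weak interactions. The total displacement of two incoming fronts differs from that of the same waves
in increasing order of families by a multiple of the product of approaching strengths
(`Region.norm_incoming_sub_le`). The map from a triple ($1$-wave, contact, $4$-wave) to its total
displacement has a Lipschitz inverse (`exists_fanDisp_stability`), since $\log p$ gives the sum and
$\varphi$ the difference of the two wave sizes. Hence a collision changes the strengths by at most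
that product (`Region.exists_collisionBound`). Two contacts, or two rarefactions of one family,
combine without error, and such pairs are not counted as approaching.

The strong front and the wall. Let $F_1,F_2>0$ be the rates at which $\varphi$ turns with $\log p$
below and above the strong front. Pressure and angle are continuous across it, so a $4$-wave of size
$p$ from below is reflected with size $a$, where $(F_1+F_2)a=(F_2-F_1)p$ to first order. In this
measure the reflection coefficient is always less than $1$, however large the vortex sheet is
(`exists_strong_bound`). At the wall a $1$-wave is reflected as a $4$-wave of the same size to first
order (`Region.exists_lateral_bound`). Since the product of the two coefficients is less than $1$,
weights can be chosen (`exists_weights`): below the strong front $1$ for $1$-waves, $\kappa<1$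
slightly above the reflection coefficient for $4$-waves, and a large $W$ for the rest; above it $W$
for $1$-waves and contacts, which may still reach the strong front, and a small $e$ for $4$-waves
and non-physical fronts, which cannot return.

The functional adds to these weighted strengths $\Lambda$ times the interaction potential on each
side, $e$ times the deviation of the strong jump from the background, and $k_w$ times the sum of the
wall turning still to come and the present mismatch between flow angle and wall. The mismatch is
needed because small changes of the wall are ignored. No step increases the functional
(`Setup.step`). The separation of the front speeds excludes all collisions that this accounting
would not cover.

The estimates hold only near the background, so the argument is a bootstrap. The top state is
exactly $U_+$, because the perturbation is integrable (`lastState_eq`); descending from it,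
smallness of the functional confines all states (`Layout.refine`, `Setup.invariant`). The initial
value of the functional is bounded linearly by the variation of the data. The weighted strength is
at most a constant times the functional, and the total variation is at most the sum of the jumps,
with the single strong jump near its background value. -/

/-! ### Dividing increments that vanish at $s=0$ by $s$. -/

/-- Hadamard's lemma with a parameter: $k(s,e)=\int_0^1\partial_sf(ts,e)\,dt$, and $f\in C^2$ makes
the integrand locally Lipschitz. It serves twice, for the wave curves with the Mach number as
parameter and for the eigenvalue along a segment with direction and base point as parameter. -/
theorem exists_lipschitz_quotient {E F : Type*} [NormedAddCommGroup E] [NormedSpace ℝ E]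
    [NormedAddCommGroup F] [NormedSpace ℝ F] [CompleteSpace F] {f : ℝ × E → F} {e₀ : E}
    (hf : ContDiffAt ℝ 2 f (0, e₀)) (h0 : ∀ᶠ e in 𝓝 e₀, f (0, e) = 0) :
    ∃ k : ℝ → E → F, ∃ C > (0 : ℝ), ∃ ρ > (0 : ℝ),
      (∀ s e, |s| ≤ ρ → ‖e - e₀‖ ≤ ρ → f (s, e) = s • k s e) ∧
      (∀ s s' e e', |s| ≤ ρ → |s'| ≤ ρ → ‖e - e₀‖ ≤ ρ → ‖e' - e₀‖ ≤ ρ →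
        ‖k s e - k s' e'‖ ≤ C * (|s - s'| + ‖e - e'‖)) ∧
      ∀ e, ‖e - e₀‖ ≤ ρ → HasDerivAt (fun s => f (s, e)) (k 0 e) 0 := by
  have hd : ContDiffAt ℝ 1 (fderiv ℝ f) (0, e₀) := hf.fderiv_right (by norm_num)
  obtain ⟨K, t, ht, hK⟩ := hd.exists_lipschitzOnWith
  have hdiff : ∀ᶠ x in 𝓝 ((0 : ℝ), e₀), DifferentiableAt ℝ f x := by
    filter_upwards [hf.eventually (by simp)] with x hx
    exact hx.differentiableAt (by norm_num)
  obtain ⟨ρ, hρ, hball⟩ := Metric.eventually_nhds_iff_ball.1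
    ((hdiff.and ht).and ((continuous_snd.tendsto ((0 : ℝ), e₀)).eventually h0))
  have key : ∀ s e, |s| ≤ ρ / 2 → ‖e - e₀‖ ≤ ρ / 2 →
      (s, e) ∈ Metric.ball ((0 : ℝ), e₀) ρ := by
    intro s e hs he
    rw [Metric.mem_ball, Prod.dist_eq, max_lt_iff, dist_eq_norm, dist_eq_norm]
    constructor <;> simp <;> linarith
  have hseg : ∀ t s : ℝ, t ∈ uIcc (0 : ℝ) 1 → |s| ≤ ρ / 2 → |t * s| ≤ ρ / 2 := by
    intro t s ht hs
    rw [uIcc_of_le zero_le_one] at ht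
    rw [abs_mul, abs_of_nonneg ht.1]
    nlinarith [ht.1, ht.2, abs_nonneg s]
  have hcont : ∀ s e, |s| ≤ ρ / 2 → ‖e - e₀‖ ≤ ρ / 2 →
      ContinuousOn (fun t : ℝ => fderiv ℝ f (t * s, e) ((1 : ℝ), (0 : E))) (uIcc 0 1) := by
    intro s e hs he
    have h1 : ContinuousOn (fun t : ℝ => fderiv ℝ f (t * s, e)) (uIcc 0 1) := by
      refine hK.continuousOn.comp (f := fun t : ℝ => (t * s, e)) (by fun_prop) ?_
      intro t ht
      exact (hball _ (key _ _ (hseg t s ht hs) he)).1.2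
    exact h1.clm_apply continuousOn_const
  refine ⟨fun s e => ∫ t in (0 : ℝ)..1, fderiv ℝ f (t * s, e) ((1 : ℝ), (0 : E)),
    K + 1, by positivity, ρ / 2, by positivity, ?_, ?_, ?_⟩
  · intro s e hs he
    have h1 : ∀ t ∈ uIcc (0 : ℝ) 1, HasDerivAt (fun t : ℝ => f (t * s, e))
        (s • fderiv ℝ f (t * s, e) ((1 : ℝ), (0 : E))) t := by
      intro t ht
      have hx := (hball _ (key _ _ (hseg t s ht hs) he)).1.1.hasFDerivAt
      have hg : HasDerivAt (fun t : ℝ => (t * s, e)) (s, (0 : E)) t :=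
        HasDerivAt.prodMk (by simpa using (hasDerivAt_id t).mul_const s) (hasDerivAt_const t e)
      have h3 : HasDerivAt (fun t : ℝ => f (t * s, e)) (fderiv ℝ f (t * s, e) (s, (0 : E))) t :=
        hx.comp_hasDerivAt t hg
      convert h3 using 1
      rw [← map_smul]
      simp
    have h2 := intervalIntegral.integral_eq_sub_of_hasDerivAt h1
      ((hcont s e hs he).const_smul s).intervalIntegrable
    rw [intervalIntegral.integral_smul] at h2
    have h3 := (hball _ (key 0 e (by simp; positivity) he)).2
    simp only [one_mul, zero_mul] at h2
    rw [h2]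
    simp only at h3
    rw [h3, sub_zero]
  · intro s s' e e' hs hs' he he'
    rw [← intervalIntegral.integral_sub (hcont s e hs he).intervalIntegrable
      (hcont s' e' hs' he').intervalIntegrable]
    have hb := intervalIntegral.norm_integral_le_of_norm_le_const (a := 0) (b := 1)
      (C := (K + 1) * (|s - s'| + ‖e - e'‖))
      (f := fun t : ℝ => fderiv ℝ f (t * s, e) ((1 : ℝ), (0 : E)) -
        fderiv ℝ f (t * s', e') ((1 : ℝ), (0 : E))) ?_
    · simpa using hb
    intro t ht
    have ht' := uIoc_subset_uIcc ht
    have h1 := (hK.dist_le_mul _ (hball _ (key _ _ (hseg t s ht' hs) he)).1.2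
      _ (hball _ (key _ _ (hseg t s' ht' hs') he')).1.2)
    rw [dist_eq_norm] at h1
    rw [← sub_apply]
    refine (ContinuousLinearMap.le_opNorm _ _).trans ?_
    have h2 : ‖((1 : ℝ), (0 : E))‖ = 1 := by simp
    rw [h2, mul_one]
    refine h1.trans ?_
    have h3 : dist (t * s, e) (t * s', e') ≤ |s - s'| + ‖e - e'‖ := by
      rw [Prod.dist_eq, dist_eq_norm, dist_eq_norm, ← mul_sub]
      rw [uIcc_of_le zero_le_one] at ht'
      apply max_le
      · rw [norm_mul, Real.norm_eq_abs, Real.norm_eq_abs, abs_of_nonneg ht'.1]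
        nlinarith [ht'.1, ht'.2, abs_nonneg (s - s'), norm_nonneg (e - e')]
      · nlinarith [abs_nonneg (s - s')]
    have hK0 : (0 : ℝ) ≤ K := K.2
    nlinarith [abs_nonneg (s - s'), norm_nonneg (e - e'), mul_le_mul_of_nonneg_left h3 hK0]
  · intro e he
    have hx := (hball _ (key 0 e (by simp; positivity) he)).1.1.hasFDerivAt
    have hg : HasDerivAt (fun s : ℝ => (s, e)) ((1 : ℝ), (0 : E)) 0 :=
      HasDerivAt.prodMk (hasDerivAt_id 0) (hasDerivAt_const 0 e)
    have h3 : HasDerivAt (fun s : ℝ => f (s, e)) (fderiv ℝ f (0, e) ((1 : ℝ), (0 : E))) 0 :=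
      hx.comp_hasDerivAt (0 : ℝ) hg
    simpa using h3

/-! ### Rarefaction and shock branches as functions of $s$ and the squared Mach number. -/

/-- Square of the Mach number after an isentropic change of `log p` by `s`. -/
def machStep (γ s N : ℝ) : ℝ :=
  (N + 2 / (γ - 1)) * Real.exp (-(s * ((γ - 1) / γ))) - 2 / (γ - 1)

/-- The Prandtl-Meyer function of the square of the Mach number. -/
def prandtlMeyer (γ N : ℝ) : ℝ :=
  Real.sqrt ((γ + 1) / (γ - 1)) * Real.arctan (Real.sqrt ((γ - 1) / (γ + 1)) * Real.sqrt (N - 1)) -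
    Real.arctan (Real.sqrt (N - 1))

/-- Changes of `(log ρ, log q, φ)` in a rarefaction `4`-wave in which `log p` changes by `s`. -/
def rareIncr (γ : ℝ) (x : ℝ × ℝ) : ℝ × ℝ × ℝ :=
  (x.1 / γ, (Real.log (machStep γ x.1 x.2 / x.2) + x.1 - x.1 / γ) / 2,
    prandtlMeyer γ x.2 - prandtlMeyer γ (machStep γ x.1 x.2))

/-- Density ratio across a shock. -/
def densityRatio (γ s : ℝ) : ℝ :=
  ((γ + 1) * Real.exp s + (γ - 1)) / ((γ - 1) * Real.exp s + (γ + 1))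

/-- Ratio of the squared flow speeds across a shock. -/
def speedRatio (γ s N : ℝ) : ℝ :=
  1 + 2 / ((γ - 1) * N) * (1 - Real.exp s / densityRatio γ s)

/-- Dimensionless squared mass flux through a shock. -/
def massFlux (γ s : ℝ) : ℝ := ((γ + 1) * Real.exp s + (γ - 1)) / 2

/-- Sine of the turning angle in a shock of the fourth family. -/
def turnSine (γ s N : ℝ) : ℝ :=
  (Real.exp s - 1) * (Real.sqrt (N - massFlux γ s / γ) /
    (Real.sqrt (massFlux γ s) * Real.sqrt γ * N * Real.sqrt (speedRatio γ s N)))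

/-- Changes of `(log ρ, log q, φ)` in a `4`-shock in which `log p` changes by `s`. -/
def shockIncr (γ : ℝ) (x : ℝ × ℝ) : ℝ × ℝ × ℝ :=
  (Real.log (densityRatio γ x.1), Real.log (speedRatio γ x.1 x.2) / 2,
    Real.arcsin (turnSine γ x.1 x.2))

/-- Changes of `(log ρ, log q, ±φ)` in a wave of family `d`. -/
def waveIncr (γ : ℝ) (d : NLFamily) (s N : ℝ) : ℝ × ℝ × ℝ :=
  if 0 ≤ d.sign * s then rareIncr γ (s, N) else shockIncr γ (s, N)

/-- The common slope of the wave curves. -/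
def waveSlope (γ N : ℝ) : ℝ × ℝ × ℝ := (1 / γ, -1 / (γ * N), Real.sqrt (N - 1) / (γ * N))

theorem machStep_zero (γ N : ℝ) : machStep γ 0 N = N := by simp [machStep]

/-- Bernoulli's law along an isentrope keeps $(N+2/(\gamma-1))\,p^{(\gamma-1)/\gamma}$ constant, so
these maps form a one-parameter group. This is the source of the exact composition of rarefactions.
-/
theorem machStep_add (γ s t N : ℝ) :
    machStep γ (s + t) N = machStep γ t (machStep γ s N) := by
  simp only [machStep]
  rw [show -((s + t) * ((γ - 1) / γ)) = -(s * ((γ - 1) / γ)) + -(t * ((γ - 1) / γ)) by ring,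
    Real.exp_add]
  ring

theorem hasDerivAt_machStep {γ : ℝ} (hγ : 1 < γ) (s N : ℝ) :
    HasDerivAt (fun s => machStep γ s N) (-(((γ - 1) * machStep γ s N + 2) / γ)) s := by
  have h1 : HasDerivAt (fun s : ℝ => -(s * ((γ - 1) / γ))) (-((γ - 1) / γ)) s := by
    have h := ((hasDerivAt_id s).mul_const ((γ - 1) / γ)).neg
    rw [one_mul] at h
    exact h
  have h := (h1.exp.const_mul (N + 2 / (γ - 1))).sub_const (2 / (γ - 1))
  refine HasDerivAt.congr_deriv (f := fun s => machStep γ s N) h ?_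
  have : γ - 1 ≠ 0 := by linarith
  unfold machStep
  field_simp
  ring

theorem hasDerivAt_prandtlMeyer {γ N : ℝ} (hγ : 1 < γ) (hN : 1 < N) :
    HasDerivAt (prandtlMeyer γ) (Real.sqrt (N - 1) / (N * ((γ - 1) * N + 2))) N := by
  have hg1 : 0 < γ - 1 := by linarith
  have hN1 : 0 < N - 1 := by linarith
  have hs : HasDerivAt (fun N : ℝ => Real.sqrt (N - 1)) (1 / (2 * Real.sqrt (N - 1))) N := by
    simpa using ((hasDerivAt_id N).sub_const 1).sqrt hN1.ne'
  have h := ((hs.const_mul (Real.sqrt ((γ - 1) / (γ + 1)))).arctan.const_mul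
    (Real.sqrt ((γ + 1) / (γ - 1)))).sub hs.arctan
  refine h.congr_deriv ?_
  set r := Real.sqrt (N - 1) with hr
  have hr0 : 0 < r := Real.sqrt_pos.2 hN1
  have hr2 : r ^ 2 = N - 1 := Real.sq_sqrt hN1.le
  have hk : Real.sqrt ((γ - 1) / (γ + 1)) ^ 2 = (γ - 1) / (γ + 1) := Real.sq_sqrt (by positivity)
  have hkk : Real.sqrt ((γ + 1) / (γ - 1)) * Real.sqrt ((γ - 1) / (γ + 1)) = 1 := by
    rw [← Real.sqrt_mul (by positivity)]
    rw [show (γ + 1) / (γ - 1) * ((γ - 1) / (γ + 1)) = 1 by field_simp]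
    exact Real.sqrt_one
  have e1 : Real.sqrt ((γ + 1) / (γ - 1)) * (1 / (1 + (Real.sqrt ((γ - 1) / (γ + 1)) * r) ^ 2) *
      (Real.sqrt ((γ - 1) / (γ + 1)) * (1 / (2 * r)))) =
      1 / (1 + (γ - 1) / (γ + 1) * r ^ 2) * (1 / (2 * r)) := by
    rw [mul_pow, hk]
    linear_combination (1 / (1 + (γ - 1) / (γ + 1) * r ^ 2) * (1 / (2 * r))) * hkk
  rw [e1]
  have hN' : N = r ^ 2 + 1 := by linarith
  rw [hN']
  have : 0 < γ + 1 := by linarith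
  have h5 : (γ - 1) * (r ^ 2 + 1) + 2 ≠ 0 := by positivity
  have h6 : (γ + 1) + (γ - 1) * r ^ 2 ≠ 0 := by positivity
  have h7 : 1 + r ^ 2 ≠ 0 := by positivity
  have h8 : 1 + (γ - 1) / (γ + 1) * r ^ 2 ≠ 0 := by positivity
  rw [show 1 + (γ - 1) / (γ + 1) * r ^ 2 = ((γ - 1) * (r ^ 2 + 1) + 2) / (γ + 1) by
    field_simp; ring]
  field_simp
  ring

theorem hasDerivAt_rareIncr {γ N : ℝ} (hγ : 1 < γ) (hN : 1 < N) :
    HasDerivAt (fun s => rareIncr γ (s, N)) (waveSlope γ N) 0 := by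
  have hm := hasDerivAt_machStep hγ 0 N
  rw [machStep_zero] at hm
  have hN0 : 0 < N := by linarith
  have hpm : HasDerivAt (prandtlMeyer γ) (Real.sqrt (N - 1) / (N * ((γ - 1) * N + 2)))
      (machStep γ 0 N) := by
    rw [machStep_zero]; exact hasDerivAt_prandtlMeyer hγ hN
  have hpos : 0 < (γ - 1) * N + 2 := by nlinarith
  refine HasDerivAt.prodMk ?_ (HasDerivAt.prodMk ?_ ?_)
  · simpa using (hasDerivAt_id (0 : ℝ)).div_const γ
  · have h := ((((hm.div_const N).log (by simp [machStep_zero, hN0.ne'])).add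
      (hasDerivAt_id 0)).sub ((hasDerivAt_id (0 : ℝ)).div_const γ)).div_const 2
    refine h.congr_deriv ?_
    rw [machStep_zero]
    field_simp
    ring
  · refine ((hpm.comp (0 : ℝ) hm).const_sub (prandtlMeyer γ N)).congr_deriv ?_
    have : N * (γ - 1) + 2 ≠ 0 := by linarith
    field_simp

theorem densityRatio_zero {γ : ℝ} (hγ : 1 < γ) : densityRatio γ 0 = 1 := by
  have : γ ≠ 0 := by linarith
  simp only [densityRatio, Real.exp_zero, mul_one]
  rw [show γ + 1 + (γ - 1) = 2 * γ by ring, show γ - 1 + (γ + 1) = 2 * γ by ring]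
  field_simp

theorem densityRatio_pos {γ : ℝ} (hγ : 1 < γ) (s : ℝ) : 0 < densityRatio γ s := by
  have := Real.exp_pos s
  have : 0 < γ - 1 := by linarith
  unfold densityRatio
  positivity

theorem hasDerivAt_densityRatio {γ : ℝ} (hγ : 1 < γ) : HasDerivAt (densityRatio γ) (1 / γ) 0 := by
  have h0 : 0 < γ - 1 := by linarith
  have h := (((Real.hasDerivAt_exp 0).const_mul (γ + 1)).add_const (γ - 1)).div
    (((Real.hasDerivAt_exp 0).const_mul (γ - 1)).add_const (γ + 1)) (by positivity)
  refine h.congr_deriv ?_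
  simp only [Real.exp_zero]
  field_simp
  ring

theorem speedRatio_zero {γ : ℝ} (hγ : 1 < γ) (N : ℝ) : speedRatio γ 0 N = 1 := by
  simp [speedRatio, densityRatio_zero hγ]

theorem massFlux_zero (γ : ℝ) : massFlux γ 0 = γ := by
  simp [massFlux]

/-- Weak shocks are isentropic to first order, so the slope agrees with that of
`hasDerivAt_rareIncr`. This tangency is what allows the two branches to be glued with a Lipschitz
quotient. -/
theorem hasDerivAt_shockIncr {γ N : ℝ} (hγ : 1 < γ) (hN : 1 < N) :
    HasDerivAt (fun s => shockIncr γ (s, N)) (waveSlope γ N) 0 := by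
  have hd := hasDerivAt_densityRatio hγ
  have hd0 := densityRatio_zero hγ
  have hγ0 : 0 < γ - 1 := by linarith
  have hN0 : 0 < N := by linarith
  refine HasDerivAt.prodMk ?_ (HasDerivAt.prodMk ?_ ?_)
  · simpa [hd0] using hd.log (by rw [hd0]; norm_num)
  · have h1 : HasDerivAt (fun s => speedRatio γ s N) (-2 / (γ * N)) 0 := by
      have h := ((((Real.hasDerivAt_exp 0).div hd (by rw [hd0]; norm_num)).const_sub 1).const_mul
        (2 / ((γ - 1) * N))).const_add 1
      refine h.congr_deriv ?_
      rw [hd0]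
      simp only [Real.exp_zero]
      field_simp
    refine ((h1.log (by rw [speedRatio_zero hγ]; norm_num)).div_const 2).congr_deriv ?_
    rw [speedRatio_zero hγ]
    field_simp
  · have h1 : HasDerivAt (fun s => turnSine γ s N) (Real.sqrt (N - 1) / (γ * N)) 0 := by
      have he : HasDerivAt (fun s : ℝ => Real.exp s - 1) 1 0 := by
        simpa using (Real.hasDerivAt_exp 0).sub_const 1
      have hJ : ContinuousAt (massFlux γ) 0 := by
        unfold massFlux; fun_prop
      have hR : ContinuousAt (fun s => speedRatio γ s N) 0 := by
        unfold speedRatio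
        have := hd.continuousAt
        exact continuousAt_const.add (continuousAt_const.mul (continuousAt_const.sub
          (Real.continuous_exp.continuousAt.div this (by rw [hd0]; norm_num))))
      have hc : ContinuousAt (fun s => Real.sqrt (N - massFlux γ s / γ) /
          (Real.sqrt (massFlux γ s) * Real.sqrt γ * N * Real.sqrt (speedRatio γ s N))) 0 := by
        refine ContinuousAt.div ?_ ?_ ?_
        · exact (continuousAt_const.sub (hJ.div_const γ)).sqrt
        · exact ((hJ.sqrt.mul continuousAt_const).mul continuousAt_const).mul hR.sqrt
        · rw [massFlux_zero, speedRatio_zero hγ]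
          have : 0 < Real.sqrt γ := Real.sqrt_pos.2 (by linarith)
          simp only [Real.sqrt_one]
          positivity
      have h := HasDerivAt.congr_deriv (f := fun s => turnSine γ s N)
        (f' := Real.sqrt (N - massFlux γ 0 / γ) /
          (Real.sqrt (massFlux γ 0) * Real.sqrt γ * N * Real.sqrt (speedRatio γ 0 N)))
        (g' := Real.sqrt (N - 1) / (γ * N)) (x := 0) ?_ ?_
      · exact h
      -- The factor $e^s-1$ vanishes at $0$, so the difference quotient of the product tends to the
      -- value of the other factor there; continuity of that factor suffices.
      · rw [hasDerivAt_iff_tendsto_slope] at he ⊢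
        have h2 := he.mul (hc.tendsto.mono_left (nhdsWithin_le_nhds (s := {(0 : ℝ)}ᶜ)))
        rw [one_mul] at h2
        refine h2.congr ?_
        intro s
        simp only [slope_def_field, turnSine, Real.exp_zero, sub_self, zero_mul, sub_zero]
        ring
      · rw [massFlux_zero, speedRatio_zero hγ, div_self (by linarith), Real.sqrt_one,
          Real.mul_self_sqrt (by linarith), mul_one]
    have h0 : turnSine γ 0 N = 0 := by simp [turnSine]
    have h2 := (Real.hasDerivAt_arcsin (x := turnSine γ 0 N) (by rw [h0]; norm_num)
      (by rw [h0]; norm_num)).comp (0 : ℝ) h1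
    refine HasDerivAt.congr_deriv (f := fun s => Real.arcsin (turnSine γ s N)) h2 ?_
    simp [h0]

theorem contDiffAt_prandtlMeyer {γ N : ℝ} (hN : 1 < N) :
    ContDiffAt ℝ 2 (prandtlMeyer γ) N := by
  have h : ContDiffAt ℝ 2 (fun N : ℝ => Real.sqrt (N - 1)) N :=
    ContDiffAt.sqrt (f := fun N : ℝ => N - 1) (by fun_prop) (by linarith)
  have h1 : ContDiffAt ℝ 2 (fun N : ℝ => Real.sqrt ((γ - 1) / (γ + 1)) * Real.sqrt (N - 1)) N :=
    contDiffAt_const.mul h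
  have h2 : ContDiffAt ℝ 2 (fun N : ℝ => Real.sqrt ((γ + 1) / (γ - 1)) *
      Real.arctan (Real.sqrt ((γ - 1) / (γ + 1)) * Real.sqrt (N - 1))) N :=
    contDiffAt_const.mul h1.arctan
  exact h2.sub h.arctan

theorem contDiffAt_rareIncr {γ N : ℝ} (hN : 1 < N) :
    ContDiffAt ℝ 2 (rareIncr γ) (0, N) := by
  have hm : ContDiffAt ℝ 2 (fun x : ℝ × ℝ => machStep γ x.1 x.2) (0, N) := by
    unfold machStep
    fun_prop
  have h0 : machStep γ ((0 : ℝ), N).1 ((0 : ℝ), N).2 = N := machStep_zero γ N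
  have hN0 : N ≠ 0 := by linarith
  refine ContDiffAt.prodMk ?_ (ContDiffAt.prodMk ?_ ?_)
  · fun_prop
  · refine ContDiffAt.div_const ?_ 2
    have h1 : ContDiffAt ℝ 2 (fun x : ℝ × ℝ => machStep γ x.1 x.2 / x.2) (0, N) :=
      hm.div contDiffAt_snd hN0
    refine ContDiffAt.sub (ContDiffAt.add (ContDiffAt.log h1 ?_) ?_) ?_
    · rw [h0]; simp [hN0]
    · fun_prop
    · fun_prop
  · refine ContDiffAt.sub ?_ ?_
    · exact (contDiffAt_prandtlMeyer hN).comp ((0 : ℝ), N) contDiffAt_snd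
    · refine ContDiffAt.comp ((0 : ℝ), N) (g := prandtlMeyer γ) ?_ hm
      rw [h0]
      exact contDiffAt_prandtlMeyer hN

/-- At $s=0$ the radicand in `turnSine` equals $N-1>0$ and the argument of the arcsine is $0$, so no
factor is near a singular point. -/
theorem contDiffAt_shockIncr {γ N : ℝ} (hγ : 1 < γ) (hN : 1 < N) :
    ContDiffAt ℝ 2 (shockIncr γ) (0, N) := by
  have hγ1 : 0 < γ - 1 := by linarith
  have hN0 : 0 < N := by linarith
  have hsγ : 0 < Real.sqrt γ := Real.sqrt_pos.2 (by linarith)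
  have hd : ContDiffAt ℝ 2 (fun x : ℝ × ℝ => densityRatio γ x.1) (0, N) := by
    unfold densityRatio
    refine ContDiffAt.div (by fun_prop) (by fun_prop) ?_
    positivity
  have hd0 : densityRatio γ ((0 : ℝ), N).1 = 1 := densityRatio_zero hγ
  have hq : ContDiffAt ℝ 2 (fun x : ℝ × ℝ => speedRatio γ x.1 x.2) (0, N) := by
    unfold speedRatio
    refine contDiffAt_const.add (ContDiffAt.mul ?_ (contDiffAt_const.sub ?_))
    · refine contDiffAt_const.div (contDiffAt_const.mul contDiffAt_snd) ?_
      exact (mul_pos hγ1 hN0).ne'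
    · refine ContDiffAt.div (by fun_prop) hd ?_
      rw [hd0]; norm_num
  have hq0 : speedRatio γ ((0 : ℝ), N).1 ((0 : ℝ), N).2 = 1 := speedRatio_zero hγ N
  have hJ : ContDiffAt ℝ 2 (fun x : ℝ × ℝ => massFlux γ x.1) (0, N) := by
    unfold massFlux; fun_prop
  have hJ0 : massFlux γ ((0 : ℝ), N).1 = γ := massFlux_zero γ
  have ht : ContDiffAt ℝ 2 (fun x : ℝ × ℝ => turnSine γ x.1 x.2) (0, N) := by
    unfold turnSine
    refine ContDiffAt.mul (by fun_prop) (ContDiffAt.div ?_ ?_ ?_)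
    · refine ContDiffAt.sqrt (ContDiffAt.sub contDiffAt_snd (hJ.div_const γ)) ?_
      rw [hJ0, div_self (by linarith)]
      simp; linarith
    · refine ContDiffAt.mul (ContDiffAt.mul (ContDiffAt.mul (hJ.sqrt ?_) contDiffAt_const)
        contDiffAt_snd) (hq.sqrt ?_)
      · rw [hJ0]; linarith
      · rw [hq0]; norm_num
    · rw [hJ0, hq0, Real.sqrt_one]
      simp only
      positivity
  refine ContDiffAt.prodMk ?_ (ContDiffAt.prodMk ?_ ?_)
  · exact hd.log (by rw [hd0]; norm_num)
  · exact (hq.log (by rw [hq0]; norm_num)).div_const 2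
  · refine ContDiffAt.comp ((0 : ℝ), N) (g := Real.arcsin) ?_ ht
    have h0 : turnSine γ ((0 : ℝ), N).1 ((0 : ℝ), N).2 = 0 := by simp [turnSine]
    rw [h0]
    exact Real.contDiffAt_arcsin (by norm_num) (by norm_num)

theorem rareIncr_zero {γ N : ℝ} (hN : 1 < N) : rareIncr γ (0, N) = 0 := by
  have : N ≠ 0 := by linarith
  simp [rareIncr, machStep_zero, this]

theorem shockIncr_zero {γ : ℝ} (hγ : 1 < γ) (N : ℝ) : shockIncr γ (0, N) = 0 := by
  simp [shockIncr, densityRatio_zero hγ, speedRatio_zero hγ, turnSine]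

/-- A function made of two Lipschitz pieces that agree at `s = 0` is Lipschitz. -/
theorem lipschitz_glue {E F : Type*} [NormedAddCommGroup E] [NormedAddCommGroup F]
    {k₁ k₂ : ℝ → E → F} {e₀ : E} {C ρ : ℝ} (hρ : 0 ≤ ρ)
    (h₁ : ∀ s s' e e', |s| ≤ ρ → |s'| ≤ ρ → ‖e - e₀‖ ≤ ρ → ‖e' - e₀‖ ≤ ρ →
        ‖k₁ s e - k₁ s' e'‖ ≤ C * (|s - s'| + ‖e - e'‖))
    (h₂ : ∀ s s' e e', |s| ≤ ρ → |s'| ≤ ρ → ‖e - e₀‖ ≤ ρ → ‖e' - e₀‖ ≤ ρ →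
        ‖k₂ s e - k₂ s' e'‖ ≤ C * (|s - s'| + ‖e - e'‖))
    (h0 : ∀ e, ‖e - e₀‖ ≤ ρ → k₁ 0 e = k₂ 0 e) (σ : ℝ) :
    ∀ s s' e e', |s| ≤ ρ → |s'| ≤ ρ → ‖e - e₀‖ ≤ ρ → ‖e' - e₀‖ ≤ ρ →
      ‖(if 0 ≤ σ * s then k₁ s e else k₂ s e) - (if 0 ≤ σ * s' then k₁ s' e' else k₂ s' e')‖ ≤
        C * (|s - s'| + ‖e - e'‖) := by
  intro s s' e e' hs hs' he he'
  -- Parameters on different branches lie on opposite sides of $0$, so passing through the common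
  -- value at $0$ does not worsen the Lipschitz constant.
  have habs : ∀ s s' : ℝ, 0 ≤ σ * s → ¬ 0 ≤ σ * s' → |s| + |s'| = |s - s'| := by
    intro s s' h h'
    push Not at h'
    rcases le_total 0 σ with hσ | hσ
    · have h1 : s' < 0 := by
        by_contra hc; push Not at hc; nlinarith
      have h2 : 0 ≤ s := by
        by_contra hc
        push Not at hc
        have : σ ≠ 0 := by rintro rfl; simp at h'
        have : 0 < σ := lt_of_le_of_ne hσ this.symm
        nlinarith
      rw [abs_of_nonneg h2, abs_of_neg h1, abs_of_nonneg (by linarith)]; ring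
    · have h1 : 0 < s' := by
        by_contra hc; push Not at hc; nlinarith
      have h2 : s ≤ 0 := by
        by_contra hc
        push Not at hc
        have : σ ≠ 0 := by rintro rfl; simp at h'
        have : σ < 0 := lt_of_le_of_ne hσ this
        nlinarith
      rw [abs_of_nonpos h2, abs_of_pos h1, abs_of_nonpos (by linarith)]; ring
  have hz : |(0 : ℝ)| ≤ ρ := by simpa using hρ
  by_cases h : 0 ≤ σ * s <;> by_cases h' : 0 ≤ σ * s' <;> simp only [h, h', if_true, if_false]
  · exact h₁ s s' e e' hs hs' he he'
  · have a1 := h₁ s 0 e e hs hz he he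
    have a2 := h₂ 0 s' e e' hz hs' he he'
    have := norm_sub_le_norm_sub_add_norm_sub (k₁ s e) (k₁ 0 e) (k₂ s' e')
    rw [h0 e he] at this a1
    have e1 := habs s s' h h'
    simp only [sub_zero, zero_sub, abs_neg, sub_self, norm_zero, add_zero] at a1 a2
    rw [← e1]
    linarith
  · have a1 := h₂ s 0 e e hs hz he he
    have a2 := h₁ 0 s' e e' hz hs' he he'
    have := norm_sub_le_norm_sub_add_norm_sub (k₂ s e) (k₂ 0 e) (k₁ s' e')
    rw [← h0 e he] at this a1
    have e1 := habs s' s h' h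
    rw [abs_sub_comm s' s] at e1
    simp only [sub_zero, zero_sub, abs_neg, sub_self, norm_zero, add_zero] at a1 a2
    rw [← e1]
    linarith
  · exact h₂ s s' e e' hs hs' he he'

/-- The increments along the wave curves are `s` times a Lipschitz function. -/
theorem exists_waveIncr_quotient {γ N₀ : ℝ} (hγ : 1 < γ) (hN : 1 < N₀) :
    ∃ k : NLFamily → ℝ → ℝ → ℝ × ℝ × ℝ, ∃ C > (0 : ℝ), ∃ ρ > (0 : ℝ), ∀ d,
      (∀ s N, |s| ≤ ρ → ‖N - N₀‖ ≤ ρ → waveIncr γ d s N = s • k d s N) ∧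
      (∀ s s' N N', |s| ≤ ρ → |s'| ≤ ρ → ‖N - N₀‖ ≤ ρ → ‖N' - N₀‖ ≤ ρ →
        ‖k d s N - k d s' N'‖ ≤ C * (|s - s'| + ‖N - N'‖)) ∧
      k d 0 N₀ = waveSlope γ N₀ := by
  obtain ⟨k₁, C₁, hC₁, ρ₁, hρ₁, e₁, l₁, d₁⟩ :=
    exists_lipschitz_quotient (contDiffAt_rareIncr (γ := γ) hN)
      ((eventually_gt_nhds hN).mono fun N h => rareIncr_zero h)
  obtain ⟨k₂, C₂, hC₂, ρ₂, hρ₂, e₂, l₂, d₂⟩ :=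
    exists_lipschitz_quotient (contDiffAt_shockIncr hγ hN)
      (Eventually.of_forall fun N => shockIncr_zero hγ N)
  -- The bound $(N_0-1)/2$ keeps $N>1$, where both branches have the slope `waveSlope`; their
  -- quotients then agree at $s=0$, as `lipschitz_glue` requires.
  have hmin : 0 < min (min ρ₁ ρ₂) ((N₀ - 1) / 2) := by
    refine lt_min (lt_min hρ₁ hρ₂) (by linarith)
  refine ⟨fun d s N => if 0 ≤ d.sign * s then k₁ s N else k₂ s N, max C₁ C₂,
    lt_max_of_lt_left hC₁, min (min ρ₁ ρ₂) ((N₀ - 1) / 2), hmin, fun d => ⟨?_, ?_, ?_⟩⟩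
  · intro s N hs hN'
    simp only [le_min_iff] at hs hN'
    unfold waveIncr
    beta_reduce
    split_ifs with h
    · exact e₁ s N hs.1.1 hN'.1.1
    · exact e₂ s N hs.1.2 hN'.1.2
  · refine lipschitz_glue hmin.le ?_ ?_ ?_ d.sign
    · intro s s' e e' hs hs' he he'
      simp only [le_min_iff] at hs he hs' he'
      refine (l₁ s s' e e' hs.1.1 hs'.1.1 he.1.1 he'.1.1).trans ?_
      exact mul_le_mul_of_nonneg_right (le_max_left _ _) (by positivity)
    · intro s s' e e' hs hs' he he'
      simp only [le_min_iff] at hs he hs' he'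
      refine (l₂ s s' e e' hs.1.2 hs'.1.2 he.1.2 he'.1.2).trans ?_
      exact mul_le_mul_of_nonneg_right (le_max_right _ _) (by positivity)
    · intro N hN'
      simp only [le_min_iff] at hN'
      have hN1 : 1 < N := by
        have := (abs_le.1 hN'.2).1
        linarith
      rw [(d₁ N hN'.1.1).unique (hasDerivAt_rareIncr hγ hN1),
        (d₂ N hN'.1.2).unique (hasDerivAt_shockIncr hγ hN1)]
  · simp only [mul_zero, le_refl, if_true]
    exact (d₁ N₀ (by simp [hρ₁.le])).unique (hasDerivAt_rareIncr hγ hN)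

/-! ### Wave curves in the coordinates $(\log\rho,\log q,\log p,\varphi)$. -/

/-- Coordinates `(log ρ, log q, log p, φ)` with the flow speed `q` and the flow angle `φ`. -/
abbrev FlowCoord := ℝ × ℝ × ℝ × ℝ

/-- Square of the Mach number. -/
def machSq (γ : ℝ) (z : FlowCoord) : ℝ := Real.exp (z.1 + 2 * z.2.1 - z.2.2.1) / γ

/-- The change of the coordinates in a wave of family `d` in which `log p` changes by `s`. -/
def disp (γ : ℝ) (d : NLFamily) (s : ℝ) (z : FlowCoord) : FlowCoord :=
  ((waveIncr γ d s (machSq γ z)).1, (waveIncr γ d s (machSq γ z)).2.1, s,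
    d.sign * (waveIncr γ d s (machSq γ z)).2.2)

/-- The eigenvalues in the coordinates `(log ρ, log q, log p, φ)`. -/
def lamC (γ : ℝ) (d : NLFamily) (z : FlowCoord) : ℝ :=
  (machSq γ z * Real.cos z.2.2.2 * Real.sin z.2.2.2 + d.sign * Real.sqrt (machSq γ z - 1)) /
    (machSq γ z * Real.cos z.2.2.2 ^ 2 - 1)

/-- The signed strength, as change of the eigenvalue, of a wave in which `log p` changes by `s`. -/
def lamJump (γ : ℝ) (d : NLFamily) (s : ℝ) (z : FlowCoord) : ℝ :=
  lamC γ d (z + disp γ d s z) - lamC γ d z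

/-- The rate of change of the flow angle with respect to `log p`. -/
def turnRate (γ N : ℝ) : ℝ := Real.sqrt (N - 1) / (γ * N)

/-- Bounds for the wave curves of family `d` near the state `z₀`. -/
structure WaveBounds (γ : ℝ) (z₀ : FlowCoord) (C ρ : ℝ) (d : NLFamily) : Prop where
  disp_sub : ∀ s s' z z', |s| ≤ ρ → |s'| ≤ ρ → ‖z - z₀‖ ≤ ρ → ‖z' - z₀‖ ≤ ρ →
    ‖disp γ d s z - disp γ d s' z'‖ ≤ C * (|s - s'| + |s| * ‖z - z'‖)
  disp_zero : ∀ z, ‖z - z₀‖ ≤ ρ → disp γ d 0 z = 0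
  disp_merge : ∀ s t z, |s| ≤ ρ → |t| ≤ ρ → ‖z - z₀‖ ≤ ρ →
    ‖disp γ d s z + disp γ d t (z + disp γ d s z) - disp γ d (s + t) z‖ ≤ C * (|s| * |t|)
  disp_merge_rare : ∀ s t z, |s| ≤ ρ → |t| ≤ ρ → ‖z - z₀‖ ≤ ρ → 0 ≤ d.sign * s →
    0 ≤ d.sign * t → disp γ d s z + disp γ d t (z + disp γ d s z) = disp γ d (s + t) z
  angle : ∀ s s' z, |s| ≤ ρ → |s'| ≤ ρ → ‖z - z₀‖ ≤ ρ →
    |(disp γ d s z).2.2.2 - (disp γ d s' z).2.2.2 -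
      d.sign * turnRate γ (machSq γ z₀) * (s - s')| ≤ C * (|s| + |s'| + ‖z - z₀‖) * |s - s'|
  lamJump_zsub : ∀ s z z', |s| ≤ ρ → ‖z - z₀‖ ≤ ρ → ‖z' - z₀‖ ≤ ρ →
    |lamJump γ d s z - lamJump γ d s z'| ≤ C * (|s| * ‖z - z'‖)
  lamJump_mono : ∀ s s' z, |s| ≤ ρ → |s'| ≤ ρ → ‖z - z₀‖ ≤ ρ →
    (s - s') ^ 2 ≤ C * (d.sign * (s - s') * (lamJump γ d s z - lamJump γ d s' z))
  lamC_sub : ∀ z z', ‖z - z₀‖ ≤ ρ → ‖z' - z₀‖ ≤ ρ → |lamC γ d z - lamC γ d z'| ≤ C * ‖z - z'‖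

theorem NLFamily.sign_mul_self (d : NLFamily) : d.sign * d.sign = 1 := by
  cases d <;> norm_num [NLFamily.sign]

theorem NLFamily.abs_sign (d : NLFamily) : |d.sign| = 1 := by
  cases d <;> norm_num [NLFamily.sign]

theorem contDiff_machSq (γ : ℝ) : ContDiff ℝ 2 (machSq γ) := by
  unfold machSq
  fun_prop

theorem contDiffAt_lamC {γ : ℝ} {z₀ : FlowCoord} (hN : 1 < machSq γ z₀) (hφ : z₀.2.2.2 = 0)
    (d : NLFamily) : ContDiffAt ℝ 2 (lamC γ d) z₀ := by
  have hm := (contDiff_machSq γ).contDiffAt (x := z₀)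
  have hs : ContDiffAt ℝ 2 (fun z : FlowCoord => Real.sin z.2.2.2) z₀ := by fun_prop
  have hc : ContDiffAt ℝ 2 (fun z : FlowCoord => Real.cos z.2.2.2) z₀ := by fun_prop
  have hr : ContDiffAt ℝ 2 (fun z => Real.sqrt (machSq γ z - 1)) z₀ :=
    ContDiffAt.sqrt (f := fun z => machSq γ z - 1) (hm.sub contDiffAt_const) (by linarith)
  unfold lamC
  refine ContDiffAt.div (((hm.mul hc).mul hs).add (contDiffAt_const.mul hr))
    ((hm.mul (hc.pow 2)).sub contDiffAt_const) ?_
  rw [hφ, Real.cos_zero]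
  linarith

/-- Genuine nonlinearity in terms of $\log p$. At $\varphi=0$, with $r=\sqrt{N-1}$, turning rate $F$
and $A$ the rate at which $N$ decreases, the derivative times the sign of the family is
$NF/r^2+A/(2r^3)$. Turning of the flow and loss of Mach number act in the same direction. -/
theorem exists_pos_hasDerivAt_lamC {γ : ℝ} (hγ : 1 < γ) {z₀ : FlowCoord} (hN : 1 < machSq γ z₀)
    (hφ : z₀.2.2.2 = 0) (d : NLFamily) {κ : FlowCoord}
    (hκ : κ = (1 / γ, -1 / (γ * machSq γ z₀), 1, d.sign * turnRate γ (machSq γ z₀))) :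
    ∃ l : ℝ, 0 < d.sign * l ∧ HasDerivAt (fun s : ℝ => lamC γ d (z₀ + s • κ) - lamC γ d z₀) l 0 := by
  set N := machSq γ z₀ with hNdef
  have hN1 : 0 < N - 1 := by linarith
  have hr : 0 < Real.sqrt (N - 1) := Real.sqrt_pos.2 hN1
  have hm : HasDerivAt (fun s : ℝ => machSq γ (z₀ + s • κ)) (-((γ - 1) * N + 2) / γ) 0 := by
    have h1 : HasDerivAt (fun s : ℝ => (z₀.1 + s * κ.1) + 2 * (z₀.2.1 + s * κ.2.1) -
        (z₀.2.2.1 + s * κ.2.2.1)) (κ.1 + 2 * κ.2.1 - κ.2.2.1) 0 := by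
      have h (a b : ℝ) : HasDerivAt (fun s : ℝ => a + s * b) b 0 := by
        simpa using ((hasDerivAt_id (0 : ℝ)).mul_const b).const_add a
      exact ((h _ _).add ((h _ _).const_mul 2)).sub (h _ _)
    refine HasDerivAt.congr_deriv (f := fun s : ℝ => machSq γ (z₀ + s • κ))
      (h1.exp.div_const γ) ?_
    have hE : Real.exp (z₀.1 + 2 * z₀.2.1 - z₀.2.2.1) = γ * N := by
      rw [hNdef]; unfold machSq; field_simp
    simp only [zero_mul, add_zero]
    rw [hE, hκ]
    field_simp
    ring
  have hp : HasDerivAt (fun s : ℝ => (z₀ + s • κ).2.2.2) (d.sign * turnRate γ N) 0 := by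
    have := ((hasDerivAt_id (0 : ℝ)).mul_const (κ.2.2.2)).const_add (z₀.2.2.2)
    rw [hκ, one_mul] at this
    rw [hκ]
    exact this
  have hz : z₀ + (0 : ℝ) • κ = z₀ := by simp
  have hnum := ((hm.mul hp.cos).mul hp.sin).add (((hm.sub_const 1).sqrt (by
    rw [hz]; linarith)).const_mul d.sign)
  have hden := (hm.mul (hp.cos.pow 2)).sub_const 1
  have h := (hnum.div hden (by
    simp only [Pi.mul_apply, Pi.pow_apply]
    rw [hz, hφ, Real.cos_zero]; linarith)).sub_const (lamC γ d z₀)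
  refine ⟨_, ?_, h⟩
  simp only [Pi.mul_apply, Pi.pow_apply, Pi.add_apply, hz, hφ, Real.cos_zero, Real.sin_zero,
    ← hNdef]
  have hs := d.sign_mul_self
  have hr2 : Real.sqrt (N - 1) ^ 2 = N - 1 := Real.sq_sqrt hN1.le
  have hF : 0 < turnRate γ N := by unfold turnRate; positivity
  set r := Real.sqrt (N - 1)
  rw [show N * (1 : ℝ) ^ 2 - 1 = r ^ 2 by rw [hr2]; ring]
  have hA : 0 < ((γ - 1) * N + 2) / γ := by
    apply div_pos _ (by linarith)
    nlinarith
  set A := ((γ - 1) * N + 2) / γ with hAdef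
  have e1 : -((γ - 1) * N + 2) / γ = -A := by rw [hAdef]; ring
  rw [e1]
  set F := turnRate γ N
  have : 0 < N * F / r ^ 2 + A / (2 * r ^ 3) := by positivity
  convert this using 1
  field_simp
  ring_nf
  linear_combination (r * (2 * r * N * F + A)) * hs

theorem exists_disp_quotient {γ : ℝ} (hγ : 1 < γ) {z₀ : FlowCoord} (hN : 1 < machSq γ z₀) :
    ∃ k : NLFamily → ℝ → FlowCoord → FlowCoord, ∃ C > (0 : ℝ), ∃ ρ > (0 : ℝ), ∀ d,
      (∀ s z, |s| ≤ ρ → ‖z - z₀‖ ≤ ρ → disp γ d s z = s • k d s z) ∧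
      (∀ s s' z z', |s| ≤ ρ → |s'| ≤ ρ → ‖z - z₀‖ ≤ ρ → ‖z' - z₀‖ ≤ ρ →
        ‖k d s z - k d s' z'‖ ≤ C * (|s - s'| + ‖z - z'‖)) ∧
      k d 0 z₀ = (1 / γ, -1 / (γ * machSq γ z₀), 1, d.sign * turnRate γ (machSq γ z₀)) := by
  obtain ⟨k, C, hC, ρ, hρ, hk⟩ := exists_waveIncr_quotient hγ hN
  obtain ⟨M, t, ht, hM⟩ :=
    ((contDiff_machSq γ).contDiffAt (x := z₀)).of_le one_le_two |>.exists_lipschitzOnWith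
  obtain ⟨ε, hε, hεt⟩ := Metric.mem_nhds_iff.1 ht
  have hM0 : (0 : ℝ) ≤ M := M.2
  -- Within $\varepsilon/2$ the squared Mach number is $M$-Lipschitz, and within $\rho/(M+1)$ its
  -- values stay in the domain of the quotient of the increments.
  set ρ' := min ρ (min (ε / 2) (ρ / (M + 1))) with hρ'
  have hρ'pos : 0 < ρ' := lt_min hρ (lt_min (by positivity) (by positivity))
  have hmach : ∀ z z', ‖z - z₀‖ ≤ ρ' → ‖z' - z₀‖ ≤ ρ' →
      ‖machSq γ z - machSq γ z'‖ ≤ M * ‖z - z'‖ := by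
    intro z z' hz hz'
    have hin : ∀ z, ‖z - z₀‖ ≤ ρ' → z ∈ t := by
      intro z hz
      apply hεt
      rw [Metric.mem_ball, dist_eq_norm]
      have : ρ' ≤ ε / 2 := (min_le_right _ _).trans (min_le_left _ _)
      linarith
    have := hM.dist_le_mul z (hin z hz) z' (hin z' hz')
    rwa [dist_eq_norm, dist_eq_norm] at this
  have hmach0 : ∀ z, ‖z - z₀‖ ≤ ρ' → ‖machSq γ z - machSq γ z₀‖ ≤ ρ := by
    intro z hz
    refine (hmach z z₀ hz (by simp [hρ'pos.le])).trans ?_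
    have h1 : ρ' ≤ ρ / (M + 1) := (min_le_right _ _).trans (min_le_right _ _)
    have h2 := hz.trans h1
    rw [le_div_iff₀ (by positivity)] at h2
    nlinarith [norm_nonneg (z - z₀)]
  refine ⟨fun d s z => ((k d s (machSq γ z)).1, (k d s (machSq γ z)).2.1, 1,
    d.sign * (k d s (machSq γ z)).2.2), C * (M + 1), by positivity, ρ', hρ'pos,
    fun d => ⟨?_, ?_, ?_⟩⟩
  · intro s z hs hz
    have h := (hk d).1 s _ (hs.trans (min_le_left _ _)) (hmach0 z hz)
    unfold disp
    rw [h]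
    simp only [Prod.smul_mk, Prod.smul_fst, Prod.smul_snd, smul_eq_mul]
    refine Prod.ext rfl (Prod.ext rfl (Prod.ext ?_ ?_))
    · simp
    · simp only; ring
  · intro s s' z z' hs hs' hz hz'
    have h := (hk d).2.1 s s' _ _ (hs.trans (min_le_left _ _)) (hs'.trans (min_le_left _ _))
      (hmach0 z hz) (hmach0 z' hz')
    have h1 := hmach z z' hz hz'
    have h2 : C * (|s - s'| + ‖machSq γ z - machSq γ z'‖) ≤
        C * (M + 1) * (|s - s'| + ‖z - z'‖) := by
      have : |s - s'| + ‖machSq γ z - machSq γ z'‖ ≤ (M + 1) * (|s - s'| + ‖z - z'‖) := by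
        nlinarith [abs_nonneg (s - s'), norm_nonneg (z - z')]
      nlinarith
    have h3 := h.trans h2
    set a := k d s (machSq γ z)
    set b := k d s' (machSq γ z')
    rw [Prod.norm_def, Prod.norm_def, max_le_iff, max_le_iff] at h3
    rw [Prod.norm_def, Prod.norm_def, Prod.norm_def]
    refine max_le h3.1 (max_le h3.2.1 (max_le ?_ ?_))
    · simp only [Prod.snd_sub, Prod.fst_sub, sub_self, norm_zero]; positivity
    · simp only [Prod.snd_sub]
      rw [← mul_sub, norm_mul, Real.norm_eq_abs, d.abs_sign, one_mul]
      exact h3.2.2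
  · simp only [(hk d).2.2, waveSlope, turnRate]

/-- Rarefaction waves of the same family compose exactly. -/
theorem disp_add_of_rarefaction {γ : ℝ} (hγ : 1 < γ) (d : NLFamily) {s t : ℝ} (hs : 0 ≤ d.sign * s)
    (ht : 0 ≤ d.sign * t) (z : FlowCoord) (hm : 0 < machStep γ s (machSq γ z))
    (hm' : 0 < machStep γ (s + t) (machSq γ z)) :
    disp γ d s z + disp γ d t (z + disp γ d s z) = disp γ d (s + t) z ∧
      machSq γ (z + disp γ d s z) = machStep γ s (machSq γ z) := by
  have hst : 0 ≤ d.sign * (s + t) := by rw [mul_add]; exact add_nonneg hs ht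
  have hz0 : 0 < machSq γ z := by
    unfold machSq
    have : 0 < γ := by linarith
    positivity
  have hN : machSq γ (z + disp γ d s z) = machStep γ s (machSq γ z) := by
    set N := machSq γ z with hNd
    have e1 : machSq γ (z + disp γ d s z) =
        N * Real.exp ((disp γ d s z).1 + 2 * (disp γ d s z).2.1 - s) := by
      rw [hNd]
      unfold machSq
      rw [div_mul_eq_mul_div, ← Real.exp_add]
      simp only [Prod.fst_add, Prod.snd_add]
      congr 2
      simp only [disp]
      ring
    rw [e1]
    have e2 : (disp γ d s z).1 + 2 * (disp γ d s z).2.1 - s = Real.log (machStep γ s N / N) := by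
      simp only [disp, waveIncr, hs, if_true, rareIncr, ← hNd]
      ring
    rw [e2, Real.exp_log (by positivity)]
    field_simp
  refine ⟨?_, hN⟩
  have e3 : ∀ r z, 0 ≤ d.sign * r → disp γ d r z = ((rareIncr γ (r, machSq γ z)).1,
      (rareIncr γ (r, machSq γ z)).2.1, r, d.sign * (rareIncr γ (r, machSq γ z)).2.2) := by
    intro r z hr
    simp only [disp, waveIncr, hr, if_true]
  rw [e3 t _ ht, hN, e3 s z hs, e3 (s + t) z hst]
  simp only [rareIncr]
  rw [← machStep_add]
  refine Prod.ext ?_ (Prod.ext ?_ (Prod.ext rfl ?_))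
  · simp only [Prod.fst_add]; ring
  · simp only [Prod.snd_add, Prod.fst_add]
    rw [Real.log_div hm'.ne' hm.ne', Real.log_div hm'.ne' hz0.ne', Real.log_div hm.ne' hz0.ne']
    ring
  · simp only [Prod.snd_add]; ring

theorem WaveBounds.mono {γ : ℝ} {z₀ : FlowCoord} {C C' ρ ρ' : ℝ} {d : NLFamily}
    (h : WaveBounds γ z₀ C ρ d) (hC : C ≤ C') (hρ : ρ' ≤ ρ) : WaveBounds γ z₀ C' ρ' d where
  disp_sub s s' z z' hs hs' hz hz' :=
    (h.disp_sub s s' z z' (hs.trans hρ) (hs'.trans hρ) (hz.trans hρ) (hz'.trans hρ)).trans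
      (mul_le_mul_of_nonneg_right hC (by positivity))
  disp_zero z hz := h.disp_zero z (hz.trans hρ)
  disp_merge s t z hs ht hz :=
    (h.disp_merge s t z (hs.trans hρ) (ht.trans hρ) (hz.trans hρ)).trans
      (mul_le_mul_of_nonneg_right hC (by positivity))
  disp_merge_rare s t z hs ht hz :=
    h.disp_merge_rare s t z (hs.trans hρ) (ht.trans hρ) (hz.trans hρ)
  angle s s' z hs hs' hz :=
    (h.angle s s' z (hs.trans hρ) (hs'.trans hρ) (hz.trans hρ)).trans
      (mul_le_mul_of_nonneg_right (mul_le_mul_of_nonneg_right hC (by positivity)) (abs_nonneg _))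
  lamJump_zsub s z z' hs hz hz' :=
    (h.lamJump_zsub s z z' (hs.trans hρ) (hz.trans hρ) (hz'.trans hρ)).trans
      (mul_le_mul_of_nonneg_right hC (by positivity))
  lamJump_mono s s' z hs hs' hz := by
    have h1 := h.lamJump_mono s s' z (hs.trans hρ) (hs'.trans hρ) (hz.trans hρ)
    -- If $C>0$, the inequality itself forces the factor of $C$ to be nonnegative. If $C\le0$,
    -- `disp_sub` read in the $\log p$ component forces $s=s'$.
    rcases lt_or_ge 0 C with hC0 | hC0
    · have h2 : 0 ≤ d.sign * (s - s') * (lamJump γ d s z - lamJump γ d s' z) := by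
        by_contra hneg
        push Not at hneg
        nlinarith [sq_nonneg (s - s')]
      nlinarith
    · have h4 := h.disp_sub s s' z z (hs.trans hρ) (hs'.trans hρ) (hz.trans hρ) (hz.trans hρ)
      have h5 : (disp γ d s z - disp γ d s' z).2.2.1 = s - s' := rfl
      have h6 : ‖(disp γ d s z - disp γ d s' z).2.2.1‖ ≤ ‖disp γ d s z - disp γ d s' z‖ :=
        (norm_fst_le _).trans ((norm_snd_le _).trans (norm_snd_le _))
      rw [h5, Real.norm_eq_abs] at h6
      have h7 : |s - s'| ≤ 0 := by
        refine h6.trans (h4.trans (mul_nonpos_of_nonpos_of_nonneg hC0 (by positivity)))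
      have h8 : s - s' = 0 := abs_nonpos_iff.1 h7
      simp [h8]
  lamC_sub z z' hz hz' :=
    (h.lamC_sub z z' (hz.trans hρ) (hz'.trans hρ)).trans
      (mul_le_mul_of_nonneg_right hC (norm_nonneg _))

-- All bounds come from two factorizations: the displacement is $s\,k(s,z)$ and the jump of
-- $\lambda_d$ is $s\,L(s,k(s,z),z)$, with Lipschitz $k$, $L$ and with $L$ of the sign of the
-- family. For example, with $z'=z+s\,k(s,z)$ the merging error is
-- $s(k(s,z)-k(s+t,z))+t(k(t,z')-k(s+t,z))$. The first difference is $O(t)$ and the second $O(s)$,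
-- so the error is $O(|s||t|)$.
set_option maxHeartbeats 1000000 in
theorem exists_waveBounds_aux {γ : ℝ} (hγ : 1 < γ) {z₀ : FlowCoord} (hN : 1 < machSq γ z₀)
    (hφ : z₀.2.2.2 = 0) (d : NLFamily) :
    ∃ C > (0 : ℝ), ∃ ρ > (0 : ℝ), WaveBounds γ z₀ C ρ d := by
  obtain ⟨k', C₁, hC₁, ρ₁, hρ₁, hk'⟩ := exists_disp_quotient hγ hN
  obtain ⟨hk, hkl, hk0⟩ := hk' d
  generalize k' d = k at hk hkl hk0
  obtain ⟨M, t, ht, hM⟩ :=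
    (contDiffAt_lamC hN hφ d).of_le one_le_two |>.exists_lipschitzOnWith
  obtain ⟨ε, hε, hεt⟩ := Metric.mem_nhds_iff.1 ht
  obtain ⟨l₀, hl₀, hderiv⟩ := exists_pos_hasDerivAt_lamC hγ hN hφ d hk0
  -- The direction $k(s,z)$ is only Lipschitz in $s$, so it is made a separate parameter. Along a
  -- straight segment with fixed direction $\lambda_d$ is $C^2$, and the Lipschitz dependence on the
  -- direction is put back afterwards.
  have hquot : ContDiffAt ℝ 2 (fun x : ℝ × (FlowCoord × FlowCoord) =>
      lamC γ d (x.2.2 + x.1 • x.2.1) - lamC γ d x.2.2) (0, (k 0 z₀, z₀)) := by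
    refine ContDiffAt.sub ?_ ?_
    · refine ContDiffAt.comp _ (g := lamC γ d) ?_ (by fun_prop)
      simpa using contDiffAt_lamC hN hφ d
    · exact ContDiffAt.comp _ (g := lamC γ d) (contDiffAt_lamC hN hφ d) (by fun_prop)
  obtain ⟨L, C₂, hC₂, ρ₂, hρ₂, hL, hLl, hL0⟩ := exists_lipschitz_quotient hquot (by simp)
  have hL0' : L 0 (k 0 z₀, z₀) = l₀ := (hL0 _ (by simp [hρ₂.le])).unique hderiv
  have hmpos : ∀ᶠ x : ℝ × FlowCoord in 𝓝 (0, z₀), 0 < machStep γ x.1 (machSq γ x.2) := by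
    have hc : ContinuousAt (fun x : ℝ × FlowCoord => machStep γ x.1 (machSq γ x.2)) (0, z₀) := by
      have := (contDiff_machSq γ).continuous
      unfold machStep
      fun_prop
    refine hc.eventually (eventually_gt_nhds ?_)
    simp only [machStep_zero]
    linarith
  obtain ⟨ρ₃, hρ₃, hm3⟩ := Metric.eventually_nhds_iff_ball.1 hmpos
  obtain ⟨B, hB⟩ : ∃ B, B = C₁ * (2 * ρ₁) + ‖k 0 z₀‖ := ⟨_, rfl⟩
  have hB0 : 0 ≤ B := by rw [hB]; positivity
  have hbound : ∀ s z, |s| ≤ ρ₁ → ‖z - z₀‖ ≤ ρ₁ → ‖k s z‖ ≤ B := by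
    intro s z hs hz
    have h1 := hkl s 0 z z₀ hs (by simp [hρ₁.le]) hz (by simp [hρ₁.le])
    have h2 := norm_le_norm_add_norm_sub' (k s z) (k 0 z₀)
    rw [sub_zero] at h1
    nlinarith
  obtain ⟨Cl, hCl⟩ : ∃ Cl, Cl = C₂ * (2 * C₁ + 2) := ⟨_, rfl⟩
  have hCl0 : 0 < Cl := by rw [hCl]; positivity
  obtain ⟨l, hl⟩ : ∃ l, l = d.sign * l₀ := ⟨_, rfl⟩
  rw [← hl] at hl₀
  -- In order, the conditions keep a state and its image under one wave in the domain of $k$, the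
  -- pair (direction, state) in the domain of $L$, the updated Mach number positive, the states
  -- where $\lambda_d$ is Lipschitz, and the variation of $L$ below a quarter of its central value.
  -- The final radius is $\rho/2$, so that $s+t$ is still admissible.
  obtain ⟨ρ, hρ, hρ1, hρ2, hρ3, hρ4, hρ5⟩ : ∃ ρ > 0, ρ * (2 + B) ≤ ρ₁ ∧
      ρ * (2 * C₁ + 2) ≤ ρ₂ ∧ ρ * 4 ≤ ρ₃ ∧ ρ * (2 + B) ≤ ε / 2 ∧ ρ * (4 * Cl) ≤ l / 2 := by
    refine ⟨min (min (ρ₁ / (2 + B)) (ρ₂ / (2 * C₁ + 2)))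
      (min (ρ₃ / 4) (min (ε / 2 / (2 + B)) (l / 2 / (4 * Cl)))), by positivity, ?_, ?_, ?_, ?_, ?_⟩
    · rw [← le_div_iff₀ (by positivity)]
      exact (min_le_left _ _).trans (min_le_left _ _)
    · rw [← le_div_iff₀ (by positivity)]
      exact (min_le_left _ _).trans (min_le_right _ _)
    · rw [← le_div_iff₀ (by positivity)]
      exact (min_le_right _ _).trans (min_le_left _ _)
    · rw [← le_div_iff₀ (by positivity)]
      exact (min_le_right _ _).trans ((min_le_right _ _).trans (min_le_left _ _))
    · rw [← le_div_iff₀ (by positivity)]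
      exact (min_le_right _ _).trans ((min_le_right _ _).trans (min_le_right _ _))
  have hρ1' : 2 * ρ ≤ ρ₁ := by nlinarith
  have hle1 : ∀ {a : ℝ}, a ≤ ρ → a ≤ ρ₁ := fun h => by linarith
  have hdisp_norm : ∀ s z, |s| ≤ ρ → ‖z - z₀‖ ≤ ρ → ‖disp γ d s z‖ ≤ |s| * B := by
    intro s z hs hz
    rw [hk s z (hle1 hs) (hle1 hz), norm_smul, Real.norm_eq_abs]
    exact mul_le_mul_of_nonneg_left (hbound s z (hle1 hs) (hle1 hz)) (abs_nonneg s)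
  have hnext : ∀ s z, |s| ≤ ρ → ‖z - z₀‖ ≤ ρ → ‖z + disp γ d s z - z₀‖ ≤ ρ * (1 + B) := by
    intro s z hs hz
    have h1 := norm_add_le (z - z₀) (disp γ d s z)
    rw [show z - z₀ + disp γ d s z = z + disp γ d s z - z₀ by abel] at h1
    have h2 := hdisp_norm s z hs hz
    nlinarith
  have hlamlip : ∀ z z', ‖z - z₀‖ ≤ ρ * (1 + B) → ‖z' - z₀‖ ≤ ρ * (1 + B) →
      |lamC γ d z - lamC γ d z'| ≤ M * ‖z - z'‖ := by
    have hin : ∀ z, ‖z - z₀‖ ≤ ρ * (1 + B) → z ∈ t := by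
      intro z hz
      apply hεt
      rw [Metric.mem_ball, dist_eq_norm]
      nlinarith
    intro z z' hz hz'
    have := hM.dist_le_mul z (hin z hz) z' (hin z' hz')
    rwa [dist_eq_norm, dist_eq_norm] at this
  have hkk : ∀ s z, |s| ≤ ρ → ‖z - z₀‖ ≤ ρ → ‖(k s z, z) - (k 0 z₀, z₀)‖ ≤ ρ₂ := by
    intro s z hs hz
    have h1 := hkl s 0 z z₀ (hle1 hs) (by simp [hρ₁.le]) (hle1 hz) (by simp [hρ₁.le])
    rw [sub_zero] at h1
    rw [Prod.mk_sub_mk, Prod.norm_mk]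
    apply max_le
    · nlinarith
    · nlinarith
  have hρ₂' : ρ ≤ ρ₂ := by nlinarith
  have hjump : ∀ s z, |s| ≤ ρ → ‖z - z₀‖ ≤ ρ → lamJump γ d s z = s * L s (k s z, z) := by
    intro s z hs hz
    have := hL s (k s z, z) (hs.trans hρ₂') (hkk s z hs hz)
    rw [smul_eq_mul] at this
    rw [← this]
    simp only [lamJump, hk s z (hle1 hs) (hle1 hz)]
  have hLL : ∀ s s' z z', |s| ≤ ρ → |s'| ≤ ρ → ‖z - z₀‖ ≤ ρ → ‖z' - z₀‖ ≤ ρ →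
      |L s (k s z, z) - L s' (k s' z', z')| ≤ Cl * (|s - s'| + ‖z - z'‖) := by
    intro s s' z z' hs hs' hz hz'
    have h1 := hLl s s' (k s z, z) (k s' z', z') (hs.trans hρ₂') (hs'.trans hρ₂')
      (hkk s z hs hz) (hkk s' z' hs' hz')
    have h2 := hkl s s' z z' (hle1 hs) (hle1 hs') (hle1 hz) (hle1 hz')
    have h3 : ‖(k s z, z) - (k s' z', z')‖ ≤ (C₁ + 1) * (|s - s'| + ‖z - z'‖) := by
      rw [Prod.mk_sub_mk, Prod.norm_mk]
      apply max_le
      · nlinarith [abs_nonneg (s - s'), norm_nonneg (z - z')]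
      · nlinarith [abs_nonneg (s - s'), norm_nonneg (z - z')]
    rw [Real.norm_eq_abs] at h1
    refine h1.trans ?_
    rw [hCl, mul_assoc]
    refine mul_le_mul_of_nonneg_left ?_ hC₂.le
    nlinarith [abs_nonneg (s - s'), norm_nonneg (z - z')]
  have hz0 : ‖z₀ - z₀‖ ≤ ρ := by simp [hρ.le]
  have h00 : |(0 : ℝ)| ≤ ρ := by simp [hρ.le]
  have hLpos : ∀ s z, |s| ≤ ρ → ‖z - z₀‖ ≤ ρ → l - l / 4 ≤ d.sign * L s (k s z, z) := by
    intro s z hs hz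
    have h1 := hLL s 0 z z₀ hs h00 hz hz0
    rw [hL0', sub_zero] at h1
    have h2 : |d.sign * (L s (k s z, z) - l₀)| ≤ l / 4 := by
      rw [abs_mul, d.abs_sign, one_mul]
      refine h1.trans ?_
      nlinarith
    have := (abs_le.1 h2).1
    rw [mul_sub, ← hl] at this
    linarith
  have hhalf : ∀ {a : ℝ}, a ≤ ρ / 2 → a ≤ ρ := fun h => by linarith
  obtain ⟨A, hA⟩ : ∃ A, A = max (C₁ * ρ + B + C₁ * (2 + B))
    (max (2 * C₁) (max Cl (max (4 / l) (M + 1)))) := ⟨_, rfl⟩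
  have hA1 : C₁ * ρ + B + C₁ * (2 + B) ≤ A := hA ▸ le_max_left _ _
  have hA2 : 2 * C₁ ≤ A := hA ▸ (le_max_left _ _).trans (le_max_right _ _)
  have hA3 : Cl ≤ A := hA ▸ (le_max_left _ _).trans ((le_max_right _ _).trans (le_max_right _ _))
  have hA4 : 4 / l ≤ A := hA ▸ (le_max_left _ _).trans ((le_max_right _ _).trans
    ((le_max_right _ _).trans (le_max_right _ _)))
  have hA5 : (M : ℝ) + 1 ≤ A := hA ▸ (le_max_right _ _).trans ((le_max_right _ _).trans
    ((le_max_right _ _).trans (le_max_right _ _)))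
  refine ⟨A, lt_of_lt_of_le hCl0 hA3, ρ / 2, by positivity, ?_⟩
  constructor
  · intro s s' z z' hs hs' hz hz'
    rw [hk s z (hle1 (hhalf hs)) (hle1 (hhalf hz)), hk s' z' (hle1 (hhalf hs')) (hle1 (hhalf hz'))]
    have h1 := hkl s s' z z' (hle1 (hhalf hs)) (hle1 (hhalf hs')) (hle1 (hhalf hz))
      (hle1 (hhalf hz'))
    have h2 := hbound s' z' (hle1 (hhalf hs')) (hle1 (hhalf hz'))
    have h3 : s • k s z - s' • k s' z' = s • (k s z - k s' z') + (s - s') • k s' z' := by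
      rw [smul_sub, sub_smul]; abel
    rw [h3]
    refine (norm_add_le _ _).trans ?_
    rw [norm_smul, norm_smul, Real.norm_eq_abs, Real.norm_eq_abs]
    have e1 : |s| * ‖k s z - k s' z'‖ ≤ |s| * (C₁ * (|s - s'| + ‖z - z'‖)) :=
      mul_le_mul_of_nonneg_left h1 (abs_nonneg s)
    have e2 : |s - s'| * ‖k s' z'‖ ≤ |s - s'| * B :=
      mul_le_mul_of_nonneg_left h2 (abs_nonneg _)
    have e3 : |s| * |s - s'| ≤ ρ * |s - s'| :=
      mul_le_mul_of_nonneg_right (hhalf hs) (abs_nonneg _)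
    have e4 : 0 ≤ |s| * ‖z - z'‖ := by positivity
    have e5 := abs_nonneg (s - s')
    have e6 : C₁ * (2 + B) ≥ C₁ := by nlinarith
    nlinarith
  · intro z hz
    rw [hk 0 z (by simp [hρ₁.le]) (hle1 (hhalf hz)), zero_smul]
  · intro s t z hs ht hz
    have hst : |s + t| ≤ ρ₁ := by
      have := abs_add_le s t
      linarith
    have hz' : ‖z + disp γ d s z - z₀‖ ≤ ρ₁ := by
      have := hnext s z (hhalf hs) (hhalf hz)
      nlinarith
    set z' := z + disp γ d s z with hz'd
    have hn := hdisp_norm s z (hhalf hs) (hhalf hz)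
    rw [hk t z' (hle1 (hhalf ht)) hz', hk s z (hle1 (hhalf hs)) (hle1 (hhalf hz)),
      hk (s + t) z hst (hle1 (hhalf hz))]
    have h1 := hkl s (s + t) z z (hle1 (hhalf hs)) hst (hle1 (hhalf hz)) (hle1 (hhalf hz))
    have h2 := hkl t (s + t) z' z (hle1 (hhalf ht)) hst hz' (hle1 (hhalf hz))
    have h3 : s • k s z + t • k t z' - (s + t) • k (s + t) z =
        s • (k s z - k (s + t) z) + t • (k t z' - k (s + t) z) := by
      rw [smul_sub, smul_sub, add_smul]; abel
    rw [h3]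
    refine (norm_add_le _ _).trans ?_
    rw [norm_smul, norm_smul, Real.norm_eq_abs, Real.norm_eq_abs]
    have e0 : z' - z = disp γ d s z := by rw [hz'd]; abel
    rw [e0] at h2
    rw [show s - (s + t) = -t by ring, abs_neg, sub_self, norm_zero, add_zero] at h1
    rw [show t - (s + t) = -s by ring, abs_neg] at h2
    have e1 : |s| * ‖k s z - k (s + t) z‖ ≤ |s| * (C₁ * |t|) :=
      mul_le_mul_of_nonneg_left h1 (abs_nonneg s)
    have e2 : |t| * ‖k t z' - k (s + t) z‖ ≤ |t| * (C₁ * (|s| + |s| * B)) :=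
      mul_le_mul_of_nonneg_left (h2.trans (mul_le_mul_of_nonneg_left (by linarith) hC₁.le))
        (abs_nonneg t)
    have e3 : 0 ≤ |s| * |t| := by positivity
    have e4 : C₁ * (2 + B) ≤ A := by nlinarith
    nlinarith [mul_le_mul_of_nonneg_right e4 e3]
  · intro s t z hs ht hz h1 h2
    have hin : ∀ r, |r| ≤ ρ → 0 < machStep γ r (machSq γ z) := by
      intro r hr
      refine hm3 (r, z) ?_
      rw [Metric.mem_ball, Prod.dist_eq, max_lt_iff, dist_eq_norm, dist_eq_norm, sub_zero,
        Real.norm_eq_abs]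
      constructor <;> simp only <;> linarith
    refine (disp_add_of_rarefaction hγ d h1 h2 z (hin s (hhalf hs)) (hin _ ?_)).1
    have := abs_add_le s t
    linarith
  · intro s s' z hs hs' hz
    have h1 := hkl s 0 z z₀ (hle1 (hhalf hs)) (by simp [hρ₁.le]) (hle1 (hhalf hz))
      (by simp [hρ₁.le])
    have h2 := hkl s s' z z (hle1 (hhalf hs)) (hle1 (hhalf hs')) (hle1 (hhalf hz))
      (hle1 (hhalf hz))
    rw [hk s z (hle1 (hhalf hs)) (hle1 (hhalf hz)), hk s' z (hle1 (hhalf hs')) (hle1 (hhalf hz))]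
    have hcomp : ∀ w : FlowCoord, |w.2.2.2| ≤ ‖w‖ := fun w =>
      (norm_snd_le w.2.2).trans ((norm_snd_le w.2).trans (norm_snd_le w))
    have h3 := (hcomp _).trans h1
    have h4 := (hcomp _).trans h2
    simp only [Prod.snd_sub, hk0, sub_zero] at h3 h4
    simp only [Prod.smul_snd, smul_eq_mul]
    set F := d.sign * turnRate γ (machSq γ z₀)
    rw [show s * (k s z).2.2.2 - s' * (k s' z).2.2.2 - F * (s - s') =
      (s - s') * ((k s z).2.2.2 - F) + s' * ((k s z).2.2.2 - (k s' z).2.2.2) by ring]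
    refine (abs_add_le _ _).trans ?_
    rw [abs_mul, abs_mul]
    rw [sub_self, norm_zero, add_zero] at h4
    have e1 := mul_le_mul_of_nonneg_left h3 (abs_nonneg (s - s'))
    have e2 := mul_le_mul_of_nonneg_left h4 (abs_nonneg s')
    have e3 : 0 ≤ (|s| + |s'| + ‖z - z₀‖) * |s - s'| := by positivity
    nlinarith [mul_le_mul_of_nonneg_right hA2 e3]
  · intro s z z' hs hz hz'
    rw [hjump s z (hhalf hs) (hhalf hz), hjump s z' (hhalf hs) (hhalf hz'), ← mul_sub, abs_mul]
    have h1 := hLL s s z z' (hhalf hs) (hhalf hs) (hhalf hz) (hhalf hz')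
    rw [sub_self, abs_zero, zero_add] at h1
    have e1 := mul_le_mul_of_nonneg_left h1 (abs_nonneg s)
    have e2 : 0 ≤ |s| * ‖z - z'‖ := by positivity
    nlinarith [mul_le_mul_of_nonneg_right hA3 e2]
  · intro s s' z hs hs' hz
    rw [hjump s z (hhalf hs) (hhalf hz), hjump s' z (hhalf hs') (hhalf hz)]
    have h1 := hLL s s' z z (hhalf hs) (hhalf hs') (hhalf hz) (hhalf hz)
    rw [sub_self, norm_zero, add_zero] at h1
    have h2 := hLpos s z (hhalf hs) (hhalf hz)
    set x := L s (k s z, z)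
    set x' := L s' (k s' z, z)
    -- In $sx-s'x'=(s-s')x+s'(x-x')$ the second term is absorbed by the first, because $s'$ is small
    -- and $x-x'$ is $O(s-s')$.
    have h3 : |d.sign * (s - s') * (s' * (x - x'))| ≤ l / 4 * (s - s') ^ 2 := by
      rw [abs_mul, abs_mul, abs_mul, d.abs_sign, one_mul, ← sq_abs (s - s')]
      have e1 : |s'| * |x - x'| ≤ ρ * (Cl * |s - s'|) := by
        apply mul_le_mul (hhalf hs') h1 (abs_nonneg _) hρ.le
      have e2 := mul_le_mul_of_nonneg_left e1 (abs_nonneg (s - s'))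
      nlinarith [sq_nonneg (|s - s'|)]
    have h4 := (abs_le.1 h3).1
    have h5 : l / 4 * (s - s') ^ 2 ≤ d.sign * (s - s') * (s * x - s' * x') := by
      nlinarith [sq_nonneg (s - s'), mul_le_mul_of_nonneg_right h2 (sq_nonneg (s - s'))]
    have h6 : (s - s') ^ 2 ≤ 4 / l * (d.sign * (s - s') * (s * x - s' * x')) := by
      rw [div_mul_eq_mul_div, le_div_iff₀ hl₀]
      linarith
    refine h6.trans (mul_le_mul_of_nonneg_right hA4 ?_)
    refine le_trans ?_ h5
    positivity
  · intro z z' hz hz'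
    refine (hlamlip z z' (by nlinarith) (by nlinarith)).trans ?_
    exact mul_le_mul_of_nonneg_right (by linarith) (norm_nonneg _)

/-- The wave curves near a supersonic state with horizontal velocity. -/
theorem exists_waveBounds {γ : ℝ} (hγ : 1 < γ) {z₀ : FlowCoord} (hN : 1 < machSq γ z₀)
    (hφ : z₀.2.2.2 = 0) : ∃ C > (0 : ℝ), ∃ ρ > (0 : ℝ), ∀ d, WaveBounds γ z₀ C ρ d := by
  obtain ⟨C₁, hC₁, ρ₁, hρ₁, h₁⟩ := exists_waveBounds_aux hγ hN hφ .one
  obtain ⟨C₄, hC₄, ρ₄, hρ₄, h₄⟩ := exists_waveBounds_aux hγ hN hφ .four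
  refine ⟨max C₁ C₄, lt_max_of_lt_left hC₁, min ρ₁ ρ₄, lt_min hρ₁ hρ₄, fun d => ?_⟩
  cases d
  · exact h₁.mono (le_max_left _ _) (min_le_left _ _)
  · exact h₄.mono (le_max_right _ _) (min_le_right _ _)

/-! ### Physical states and the change of coordinates. -/

/-- Positive horizontal velocity, pressure and density. -/
structure Physical (U : State) : Prop where
  uu_pos : 0 < uu U
  pp_pos : 0 < pp U
  rr_pos : 0 < rr U

/-- The coordinates `(log ρ, log q, log p, φ)` of a state. -/
def coord (U : State) : FlowCoord :=
  (Real.log (rr U), Real.log (uu U ^ 2 + vv U ^ 2) / 2, Real.log (pp U), Real.arctan (vv U / uu U))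

/-- The state with given coordinates. -/
def coordInv (z : FlowCoord) : State :=
  !₂[Real.exp z.2.1 * Real.cos z.2.2.2, Real.exp z.2.1 * Real.sin z.2.2.2, Real.exp z.2.2.1,
    Real.exp z.1]

theorem Supersonic.physical {γ : ℝ} {U : State} (h : Supersonic γ U) : Physical U :=
  ⟨(Real.sqrt_nonneg _).trans_lt h.2.2, h.1, h.2.1⟩

theorem Physical.speed_pos {U : State} (h : Physical U) : 0 < uu U ^ 2 + vv U ^ 2 := by
  have := h.uu_pos
  positivity

theorem contDiff_uu : ContDiff ℝ 2 uu := (EuclideanSpace.proj (𝕜 := ℝ) (0 : Fin 4)).contDiff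
theorem contDiff_vv : ContDiff ℝ 2 vv := (EuclideanSpace.proj (𝕜 := ℝ) (1 : Fin 4)).contDiff
theorem contDiff_pp : ContDiff ℝ 2 pp := (EuclideanSpace.proj (𝕜 := ℝ) (2 : Fin 4)).contDiff
theorem contDiff_rr : ContDiff ℝ 2 rr := (EuclideanSpace.proj (𝕜 := ℝ) (3 : Fin 4)).contDiff

theorem contDiffAt_coord {U : State} (h : Physical U) : ContDiffAt ℝ 2 coord U := by
  have hu := contDiff_uu.contDiffAt (x := U)
  have hv := contDiff_vv.contDiffAt (x := U)
  have hp := contDiff_pp.contDiffAt (x := U)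
  have hr := contDiff_rr.contDiffAt (x := U)
  have hq : ContDiffAt ℝ 2 (fun U => uu U ^ 2 + vv U ^ 2) U := (hu.pow 2).add (hv.pow 2)
  have ht : ContDiffAt ℝ 2 (fun U => vv U / uu U) U := hv.div hu h.uu_pos.ne'
  exact ContDiffAt.prodMk (hr.log h.rr_pos.ne') (ContDiffAt.prodMk
    ((hq.log h.speed_pos.ne').div_const 2) (ContDiffAt.prodMk (hp.log h.pp_pos.ne') ht.arctan))

theorem contDiff_coordInv : ContDiff ℝ 2 coordInv := by
  rw [contDiff_euclidean]
  intro i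
  fin_cases i <;> simp [coordInv] <;> fun_prop

theorem exp_half_log {x : ℝ} (hx : 0 < x) : Real.exp (Real.log x / 2) = Real.sqrt x := by
  rw [← Real.log_sqrt hx.le, Real.exp_log (Real.sqrt_pos.2 hx)]

theorem Physical.sqrt_speed {U : State} (h : Physical U) :
    Real.sqrt (uu U ^ 2 + vv U ^ 2) = uu U * Real.sqrt (1 + (vv U / uu U) ^ 2) := by
  have hu := h.uu_pos
  rw [← Real.sqrt_sq hu.le, ← Real.sqrt_mul (by positivity), Real.sqrt_sq hu.le]
  congr 1
  field_simp

theorem Physical.uu_eq {U : State} (h : Physical U) :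
    uu U = Real.sqrt (uu U ^ 2 + vv U ^ 2) * Real.cos (Real.arctan (vv U / uu U)) := by
  have hu := h.uu_pos
  rw [Real.cos_arctan, h.sqrt_speed]
  have : 0 < Real.sqrt (1 + (vv U / uu U) ^ 2) := Real.sqrt_pos.2 (by positivity)
  field_simp

theorem Physical.vv_eq {U : State} (h : Physical U) :
    vv U = Real.sqrt (uu U ^ 2 + vv U ^ 2) * Real.sin (Real.arctan (vv U / uu U)) := by
  have hu := h.uu_pos
  rw [Real.sin_arctan, h.sqrt_speed]
  have : 0 < Real.sqrt (1 + (vv U / uu U) ^ 2) := Real.sqrt_pos.2 (by positivity)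
  field_simp

theorem coordInv_coord {U : State} (h : Physical U) : coordInv (coord U) = U := by
  ext i
  fin_cases i
  · change Real.exp (Real.log (uu U ^ 2 + vv U ^ 2) / 2) *
      Real.cos (Real.arctan (vv U / uu U)) = uu U
    rw [exp_half_log h.speed_pos, ← h.uu_eq]
  · change Real.exp (Real.log (uu U ^ 2 + vv U ^ 2) / 2) *
      Real.sin (Real.arctan (vv U / uu U)) = vv U
    rw [exp_half_log h.speed_pos, ← h.vv_eq]
  · exact Real.exp_log h.pp_pos
  · exact Real.exp_log h.rr_pos

theorem machSq_coord {γ : ℝ} {U : State} (h : Physical U) :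
    machSq γ (coord U) = rr U * (uu U ^ 2 + vv U ^ 2) / (γ * pp U) := by
  simp only [machSq, coord]
  rw [mul_div_cancel₀ _ (two_ne_zero), Real.exp_sub, Real.exp_add, Real.exp_log h.rr_pos,
    Real.exp_log h.speed_pos, Real.exp_log h.pp_pos]
  rw [div_div, mul_comm (pp U)]

theorem sonic_sq {γ : ℝ} (hγ : 1 < γ) {U : State} (h : Physical U) :
    sonic γ U ^ 2 = γ * pp U / rr U := by
  have := h.pp_pos
  have := h.rr_pos
  have : 0 < γ := by linarith
  exact Real.sq_sqrt (by positivity)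

theorem sonic_pos {γ : ℝ} (hγ : 1 < γ) {U : State} (h : Physical U) : 0 < sonic γ U := by
  have := h.pp_pos
  have := h.rr_pos
  have : 0 < γ := by linarith
  exact Real.sqrt_pos.2 (by positivity)

theorem speed_eq_machSq {γ : ℝ} (hγ : 1 < γ) {U : State} (h : Physical U) :
    uu U ^ 2 + vv U ^ 2 = sonic γ U ^ 2 * machSq γ (coord U) := by
  have := h.pp_pos
  have := h.rr_pos
  have : 0 < γ := by linarith
  rw [sonic_sq hγ h, machSq_coord h]
  field_simp

/-- Numerator and denominator are both homogeneous: after division by $c^2$ only the Mach number and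
the flow angle remain. -/
theorem lam_eq_lamC {γ : ℝ} (hγ : 1 < γ) {U : State} (h : Physical U) (d : NLFamily) :
    lam γ d U = lamC γ d (coord U) := by
  have hc := sonic_pos hγ h
  have hq := speed_eq_machSq hγ h
  set N := machSq γ (coord U)
  set φ := (coord U).2.2.2 with hφ
  have hu : uu U ^ 2 = sonic γ U ^ 2 * (N * Real.cos φ ^ 2) := by
    rw [h.uu_eq, mul_pow, Real.sq_sqrt h.speed_pos.le, hq, mul_assoc]; rfl
  have huv : uu U * vv U = sonic γ U ^ 2 * (N * Real.cos φ * Real.sin φ) := by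
    have e1 : uu U = Real.sqrt (sonic γ U ^ 2 * N) * Real.cos φ := hq ▸ h.uu_eq
    have e2 : vv U = Real.sqrt (sonic γ U ^ 2 * N) * Real.sin φ := hq ▸ h.vv_eq
    have e3 : Real.sqrt (sonic γ U ^ 2 * N) ^ 2 = sonic γ U ^ 2 * N :=
      Real.sq_sqrt (hq ▸ h.speed_pos.le)
    rw [e1, e2]
    linear_combination Real.cos φ * Real.sin φ * e3
  have hr : Real.sqrt (uu U ^ 2 + vv U ^ 2 - sonic γ U ^ 2) =
      sonic γ U * Real.sqrt (N - 1) := by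
    rw [hq, show sonic γ U ^ 2 * N - sonic γ U ^ 2 = sonic γ U ^ 2 * (N - 1) by ring,
      Real.sqrt_mul (by positivity), Real.sqrt_sq hc.le]
  unfold lam lamC
  rw [hr, huv, hu]
  rw [show sonic γ U ^ 2 * (N * Real.cos φ * Real.sin φ) +
      d.sign * sonic γ U * (sonic γ U * Real.sqrt (N - 1)) = sonic γ U ^ 2 *
        (N * Real.cos φ * Real.sin φ + d.sign * Real.sqrt (N - 1)) by ring,
    show sonic γ U ^ 2 * (N * Real.cos φ ^ 2) - sonic γ U ^ 2 =
      sonic γ U ^ 2 * (N * Real.cos φ ^ 2 - 1) by ring]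
  exact mul_div_mul_left _ _ (by positivity)

theorem uu_contactMap (σ₃ σ₂ : ℝ) (U : State) :
    uu (contactMap σ₃ σ₂ U) = uu U * Real.exp σ₂ := rfl
theorem vv_contactMap (σ₃ σ₂ : ℝ) (U : State) :
    vv (contactMap σ₃ σ₂ U) = vv U * Real.exp σ₂ := rfl
theorem pp_contactMap (σ₃ σ₂ : ℝ) (U : State) : pp (contactMap σ₃ σ₂ U) = pp U := rfl
theorem rr_contactMap (σ₃ σ₂ : ℝ) (U : State) :
    rr (contactMap σ₃ σ₂ U) = rr U * Real.exp σ₃ := rfl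

theorem Physical.contactMap {U : State} (h : Physical U) (σ₃ σ₂ : ℝ) :
    Physical (contactMap σ₃ σ₂ U) :=
  ⟨mul_pos h.uu_pos (Real.exp_pos _), h.pp_pos, mul_pos h.rr_pos (Real.exp_pos _)⟩

/-- The main reason for these coordinates. A vortex sheet/entropy wave of arbitrary strength becomes
an exact translation that does not depend on the base state, so even the strong front can be treated
linearly. -/
theorem coord_contactMap {U : State} (h : Physical U) (σ₃ σ₂ : ℝ) :
    coord (contactMap σ₃ σ₂ U) = coord U + (σ₃, σ₂, 0, 0) := by
  have hE := Real.exp_pos σ₂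
  unfold coord
  rw [uu_contactMap, vv_contactMap, pp_contactMap, rr_contactMap]
  refine Prod.ext ?_ (Prod.ext ?_ (Prod.ext ?_ ?_))
  · simp only [Prod.fst_add]
    rw [Real.log_mul h.rr_pos.ne' (Real.exp_pos _).ne', Real.log_exp]
  · simp only [Prod.fst_add, Prod.snd_add]
    rw [show (uu U * Real.exp σ₂) ^ 2 + (vv U * Real.exp σ₂) ^ 2 =
      (uu U ^ 2 + vv U ^ 2) * Real.exp σ₂ ^ 2 by ring,
      Real.log_mul h.speed_pos.ne' (by positivity), Real.log_pow, Real.log_exp]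
    push_cast
    ring
  · simp
  · simp only [Prod.snd_add, add_zero]
    rw [mul_div_mul_right _ _ hE.ne']

theorem sigma_of_contactMap {U : State} (h : Physical U) (σ₃ σ₂ : ℝ) :
    Real.log (uu (contactMap σ₃ σ₂ U) / uu U) = σ₂ ∧
      Real.log (rr (contactMap σ₃ σ₂ U) / rr U) = σ₃ := by
  rw [uu_contactMap, rr_contactMap, mul_div_cancel_left₀ _ h.uu_pos.ne',
    mul_div_cancel_left₀ _ h.rr_pos.ne', Real.log_exp, Real.log_exp]
  exact ⟨rfl, rfl⟩

/-- Near a physical state the coordinates are bi-Lipschitz. -/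
structure CoordBounds (U₀ : State) (L R : ℝ) : Prop where
  physical : ∀ U, dist U U₀ ≤ R → Physical U
  coord_sub : ∀ U U', dist U U₀ ≤ R → dist U' U₀ ≤ R → ‖coord U - coord U'‖ ≤ L * dist U U'
  dist_le : ∀ U U', Physical U → Physical U' → ‖coord U - coord U₀‖ ≤ R →
    ‖coord U' - coord U₀‖ ≤ R → dist U U' ≤ L * ‖coord U - coord U'‖

theorem exists_coordBounds {U₀ : State} (h : Physical U₀) :
    ∃ L > (0 : ℝ), ∃ R > (0 : ℝ), CoordBounds U₀ L R := by
  obtain ⟨K₁, t₁, ht₁, hK₁⟩ := (contDiffAt_coord h).of_le one_le_two |>.exists_lipschitzOnWith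
  obtain ⟨K₂, t₂, ht₂, hK₂⟩ := (contDiff_coordInv.contDiffAt (x := coord U₀)).of_le one_le_two
    |>.exists_lipschitzOnWith
  obtain ⟨ε₂, hε₂, hs₂⟩ := Metric.nhds_basis_closedBall.mem_iff.1 ht₂
  have hphys : ∀ᶠ U in 𝓝 U₀, Physical U := by
    have h1 := contDiff_uu.continuous.continuousAt.eventually (eventually_gt_nhds h.uu_pos)
    have h2 := contDiff_pp.continuous.continuousAt.eventually (eventually_gt_nhds h.pp_pos)
    have h3 := contDiff_rr.continuous.continuousAt.eventually (eventually_gt_nhds h.rr_pos)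
    filter_upwards [h1, h2, h3] with U a b c using ⟨a, b, c⟩
  obtain ⟨ε₁, hε₁, hs₁⟩ := Metric.nhds_basis_closedBall.mem_iff.1 (hphys.and ht₁)
  refine ⟨max (K₁ : ℝ) K₂ + 1, by positivity, min ε₁ ε₂, lt_min hε₁ hε₂, ?_, ?_, ?_⟩
  · intro U hU
    exact (hs₁ (hU.trans (min_le_left _ _))).1
  · intro U U' hU hU'
    have := hK₁.dist_le_mul U (hs₁ (hU.trans (min_le_left _ _))).2 U'
      (hs₁ (hU'.trans (min_le_left _ _))).2
    rw [dist_eq_norm] at this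
    refine this.trans (mul_le_mul_of_nonneg_right ?_ dist_nonneg)
    have := le_max_left (K₁ : ℝ) K₂
    linarith
  · intro U U' hP hP' hU hU'
    rw [← dist_eq_norm] at hU hU'
    have := hK₂.dist_le_mul _ (hs₂ (hU.trans (min_le_right _ _))) _
      (hs₂ (hU'.trans (min_le_right _ _)))
    rw [coordInv_coord hP, coordInv_coord hP', dist_eq_norm (coord U)] at this
    refine this.trans (mul_le_mul_of_nonneg_right ?_ (norm_nonneg _))
    have := le_max_right (K₁ : ℝ) K₂
    linarith

/-- The state is physical and its coordinates are close to those of `U₀`. -/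
def Near (U₀ : State) (ρ : ℝ) (U : State) : Prop := Physical U ∧ ‖coord U - coord U₀‖ ≤ ρ

theorem Near.mono {U₀ U : State} {ρ ρ' : ℝ} (h : Near U₀ ρ U) (hρ : ρ ≤ ρ') : Near U₀ ρ' U :=
  ⟨h.1, h.2.trans hρ⟩

/-- The Riemann solvers bound a wave by the Euclidean distance of its end states. This turns such a
bound into closeness of coordinates and yields positivity of $u$, $p$ and $\rho$ at the new state,
which the coordinates alone do not show. -/
theorem CoordBounds.near {U₀ : State} {L R : ℝ} (hB : CoordBounds U₀ L R) {U U' : State}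
    {ρ r : ℝ} (h₀ : Physical U₀) (hL : 0 ≤ L) (hU : Near U₀ ρ U) (hd : dist U U' ≤ r)
    (hρR : ρ ≤ R) (hR : L * ρ + r ≤ R) : Near U₀ (ρ + L * r) U' := by
  have hρ : 0 ≤ ρ := (norm_nonneg _).trans hU.2
  have h1 : dist U U₀ ≤ L * ρ := (hB.dist_le U U₀ hU.1 h₀ (hU.2.trans hρR)
    (by simpa using hρ.trans hρR)).trans (mul_le_mul_of_nonneg_left hU.2 hL)
  have hr : 0 ≤ r := dist_nonneg.trans hd
  have h2 : dist U' U₀ ≤ R := by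
    have := dist_triangle U' U U₀
    rw [dist_comm U' U] at this
    linarith
  refine ⟨hB.physical U' h2, ?_⟩
  have h3 := hB.coord_sub U' U h2 (by linarith)
  rw [dist_comm] at h3
  have h4 := norm_sub_le_norm_sub_add_norm_sub (coord U') (coord U) (coord U₀)
  have := mul_le_mul_of_nonneg_left hd hL
  linarith [hU.2]

/-! ### Eigenvalues, genuine nonlinearity and the differential equation of rarefactions. -/

section Eigen

variable {γ : ℝ} {U : State}

theorem Supersonic.sq_lt (h : Supersonic γ U) : 0 < uu U ^ 2 - sonic γ U ^ 2 := by
  have h1 : 0 ≤ sonic γ U := Real.sqrt_nonneg _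
  nlinarith [h.2.2]

theorem Supersonic.sqrt_pos (h : Supersonic γ U) :
    0 < Real.sqrt (uu U ^ 2 + vv U ^ 2 - sonic γ U ^ 2) := by
  have := h.sq_lt
  exact Real.sqrt_pos.2 (by nlinarith [sq_nonneg (vv U)])

theorem lam_mul (h : Supersonic γ U) (d : NLFamily) :
    lam γ d U * (uu U ^ 2 - sonic γ U ^ 2) = uu U * vv U +
      d.sign * sonic γ U * Real.sqrt (uu U ^ 2 + vv U ^ 2 - sonic γ U ^ 2) :=
  div_mul_cancel₀ _ h.sq_lt.ne'

/-- The component of the velocity normal to a characteristic is the sonic speed. -/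
theorem lam_quadratic (h : Supersonic γ U) (d : NLFamily) :
    (lam γ d U * uu U - vv U) ^ 2 = sonic γ U ^ 2 * (1 + lam γ d U ^ 2) := by
  have h1 := lam_mul h d
  have h2 := h.sq_lt
  have h3 : Real.sqrt (uu U ^ 2 + vv U ^ 2 - sonic γ U ^ 2) ^ 2 =
      uu U ^ 2 + vv U ^ 2 - sonic γ U ^ 2 :=
    Real.sq_sqrt (by nlinarith [sq_nonneg (vv U)])
  have h4 := d.sign_mul_self
  set R := Real.sqrt (uu U ^ 2 + vv U ^ 2 - sonic γ U ^ 2)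
  set c := sonic γ U
  set l := lam γ d U
  have h5 : (l * (uu U ^ 2 - c ^ 2) - uu U * vv U) ^ 2 = c ^ 2 * R ^ 2 := by
    rw [h1]; linear_combination (c ^ 2 * R ^ 2) * h4
  rw [h3] at h5
  have h6 : (uu U ^ 2 - c ^ 2) * ((l * uu U - vv U) ^ 2 - c ^ 2 * (1 + l ^ 2)) = 0 := by
    linear_combination h5
  rcases mul_eq_zero.1 h6 with h7 | h7
  · exact absurd h7 h2.ne'
  · linarith

/-- Multiplied by $u^2-c^2$, the quantity is $c(uR\pm cv)$ with $R=\sqrt{u^2+v^2-c^2}$, and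
$uR>c|v|$ because $(uR)^2-(cv)^2=(u^2+v^2)(u^2-c^2)>0$. -/
theorem lam_sub_sign (hγ : 1 < γ) (h : Supersonic γ U) (d : NLFamily) :
    0 < d.sign * (lam γ d U * uu U - vv U) := by
  have h1 := lam_mul h d
  have h2 := h.sq_lt
  have hR := h.sqrt_pos
  have hc := sonic_pos hγ h.physical
  have hu := h.physical.uu_pos
  have h3 : Real.sqrt (uu U ^ 2 + vv U ^ 2 - sonic γ U ^ 2) ^ 2 =
      uu U ^ 2 + vv U ^ 2 - sonic γ U ^ 2 :=
    Real.sq_sqrt (by nlinarith [sq_nonneg (vv U)])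
  have h4 := d.sign_mul_self
  set R := Real.sqrt (uu U ^ 2 + vv U ^ 2 - sonic γ U ^ 2)
  set c := sonic γ U
  set l := lam γ d U
  have h5 : (uu U ^ 2 - c ^ 2) * (d.sign * (l * uu U - vv U)) =
      c * (uu U * R + d.sign * (c * vv U)) := by
    linear_combination (d.sign * uu U) * h1 + (uu U * c * R) * h4
  have h6 : |d.sign * (c * vv U)| < uu U * R := by
    rw [abs_mul, d.abs_sign, one_mul]
    apply abs_lt_of_sq_lt_sq _ (by positivity)
    rw [mul_pow, mul_pow, h3]
    have : 0 < (uu U ^ 2 + vv U ^ 2) * (uu U ^ 2 - c ^ 2) := by positivity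
    nlinarith
  have h7 := (abs_lt.1 h6).1
  have h8 : 0 < (uu U ^ 2 - c ^ 2) * (d.sign * (l * uu U - vv U)) := by
    rw [h5]; apply mul_pos hc; linarith
  exact pos_of_mul_pos_right h8 h2.le

/-- Relates the velocity components along and across a characteristic; their ratio $\pm
R/c=\pm\sqrt{N-1}$ becomes the numerator of `turnRate`. -/
theorem lam_tangential (hγ : 1 < γ) (h : Supersonic γ U) (d : NLFamily) :
    sonic γ U * (uu U + lam γ d U * vv U) =
      d.sign * Real.sqrt (uu U ^ 2 + vv U ^ 2 - sonic γ U ^ 2) * (lam γ d U * uu U - vv U) := by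
  have h1 := lam_mul h d
  have h2 := h.sq_lt
  have hc := sonic_pos hγ h.physical
  have h3 : Real.sqrt (uu U ^ 2 + vv U ^ 2 - sonic γ U ^ 2) ^ 2 =
      uu U ^ 2 + vv U ^ 2 - sonic γ U ^ 2 :=
    Real.sq_sqrt (by nlinarith [sq_nonneg (vv U)])
  have h4 := d.sign_mul_self
  set R := Real.sqrt (uu U ^ 2 + vv U ^ 2 - sonic γ U ^ 2)
  set c := sonic γ U
  set l := lam γ d U
  have h5 : (uu U ^ 2 - c ^ 2) * (c * (uu U + l * vv U) -
      d.sign * R * (l * uu U - vv U)) = 0 := by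
    linear_combination (c * vv U - d.sign * R * uu U) * h1 - (uu U * R ^ 2 * c) * h4 -
      uu U * c * h3
  rcases mul_eq_zero.1 h5 with h7 | h7
  · exact absurd h7 h2.ne'
  · linarith

theorem eventually_supersonic (h : Supersonic γ U) : ∀ᶠ V in 𝓝 U, Supersonic γ V := by
  have h2 := contDiff_pp.continuous.continuousAt.eventually (eventually_gt_nhds h.1)
  have h3 := contDiff_rr.continuous.continuousAt.eventually (eventually_gt_nhds h.2.1)
  have h4 : ContinuousAt (fun V => uu V - sonic γ V) U := by
    unfold sonic
    refine contDiff_uu.continuous.continuousAt.sub (ContinuousAt.sqrt ?_)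
    exact (continuousAt_const.mul contDiff_pp.continuous.continuousAt).div
      contDiff_rr.continuous.continuousAt h.2.1.ne'
  have h5 := h4.eventually (eventually_gt_nhds (sub_pos.2 h.2.2))
  filter_upwards [h2, h3, h5] with V a b c using ⟨a, b, sub_pos.1 c⟩

theorem differentiableAt_lam (hγ : 1 < γ) (h : Supersonic γ U) (d : NLFamily) :
    DifferentiableAt ℝ (lam γ d) U := by
  have hP := h.physical
  have hp := hP.pp_pos
  have hr := hP.rr_pos
  have h0 : 0 < γ := by linarith
  have du := contDiff_uu.contDiffAt (x := U)
  have dv := contDiff_vv.contDiffAt (x := U)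
  have dp := contDiff_pp.contDiffAt (x := U)
  have dr := contDiff_rr.contDiffAt (x := U)
  have dq : ContDiffAt ℝ 2 (fun U => γ * pp U / rr U) U := (contDiffAt_const.mul dp).div dr hr.ne'
  have dc : ContDiffAt ℝ 2 (sonic γ) U := dq.sqrt (by positivity)
  have dR : ContDiffAt ℝ 2 (fun U => uu U ^ 2 + vv U ^ 2 - sonic γ U ^ 2) U :=
    ((du.pow 2).add (dv.pow 2)).sub (dc.pow 2)
  have dl : ContDiffAt ℝ 2 (lam γ d) U :=
    ((du.mul dv).add ((contDiffAt_const.mul dc).mul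
      (dR.sqrt (Real.sqrt_pos.1 h.sqrt_pos).ne'))).div ((du.pow 2).sub (dc.pow 2)) h.sq_lt.ne'
  exact dl.differentiableAt (by norm_num)

/-- The fields of the first and the fourth family are genuinely nonlinear. -/
theorem kap_pos (hγ : 1 < γ) (h : Supersonic γ U) (d : NLFamily) : 0 < kap γ d U := by
  unfold kap
  rw [inv_pos]
  have hP := h.physical
  have hp := hP.pp_pos
  have hr := hP.rr_pos
  have hc := sonic_pos hγ hP
  have hc2 := sonic_sq hγ hP
  have hquad := lam_quadratic h d
  have hsign := lam_sub_sign hγ h d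
  have hmul := lam_mul h d
  have hR := h.sqrt_pos
  have hline : HasDerivAt (fun t : ℝ => U + t • rvec γ d U) (rvec γ d U) 0 := by
    simpa using ((hasDerivAt_id (0 : ℝ)).smul_const (rvec γ d U)).const_add U
  have hl : HasDerivAt (fun t : ℝ => lam γ d (U + t • rvec γ d U))
      (fderiv ℝ (lam γ d) U (rvec γ d U)) 0 := by
    have hd := (differentiableAt_lam hγ h d).hasFDerivAt
    exact HasFDerivAt.comp_hasDerivAt_of_eq (0 : ℝ) hd hline (by simp)
  set l' := fderiv ℝ (lam γ d) U (rvec γ d U)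
  have hev : ∀ᶠ t : ℝ in 𝓝 0, Supersonic γ (U + t • rvec γ d U) := by
    have hcont : ContinuousAt (fun t : ℝ => U + t • rvec γ d U) 0 := hline.continuousAt
    apply hcont.eventually
    simpa using eventually_supersonic h
  set A := lam γ d U * uu U - vv U with hA
  have eu : ∀ t : ℝ, uu (U + t • rvec γ d U) = uu U + t * (-lam γ d U) := fun t => rfl
  have ev : ∀ t : ℝ, vv (U + t • rvec γ d U) = vv U + t * 1 := fun t => rfl
  have ep : ∀ t : ℝ, pp (U + t • rvec γ d U) = pp U + t * (rr U * A) := fun t => rfl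
  have er : ∀ t : ℝ, rr (U + t • rvec γ d U) = rr U + t * (rr U * A / sonic γ U ^ 2) :=
    fun t => rfl
  have haff (a b : ℝ) : HasDerivAt (fun s : ℝ => a + s * b) b 0 := by
    simpa using ((hasDerivAt_id (0 : ℝ)).mul_const b).const_add a
  -- The quadratic equation for $\lambda_d$ holds at all nearby states of the line $U+t\,r$.
  -- Differentiating this identity at $t=0$ gives the directional derivative of $\lambda_d$ without
  -- differentiating its explicit formula.
  have hE : (fun t : ℝ => (lam γ d (U + t • rvec γ d U) * (uu U + t * (-lam γ d U)) -
      (vv U + t * 1)) ^ 2 - γ * (pp U + t * (rr U * A)) / (rr U + t * (rr U * A / sonic γ U ^ 2)) *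
        (1 + lam γ d (U + t • rvec γ d U) ^ 2)) =ᶠ[𝓝 0] fun _ => 0 := by
    filter_upwards [hev] with t ht
    have := lam_quadratic ht d
    rw [sonic_sq hγ ht.physical, eu, ev, ep, er] at this
    linarith
  have hD := (((hl.mul (haff (uu U) (-lam γ d U))).sub (haff (vv U) 1)).pow 2).sub
    ((((haff (pp U) (rr U * A)).const_mul γ).div (haff (rr U) (rr U * A / sonic γ U ^ 2))
      (by simpa using hr.ne')).mul ((hl.pow 2).const_add 1))
  have h0 := hD.unique ((hasDerivAt_const (0 : ℝ) (0 : ℝ)).congr_of_eventuallyEq hE)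
  simp only [Pi.mul_apply, Pi.sub_apply, Pi.div_apply, Pi.pow_apply, zero_smul, add_zero, zero_mul] at h0
  norm_num at h0
  rw [← hA, hc2] at h0
  have h1 : l' * (2 * sonic γ U * Real.sqrt (uu U ^ 2 + vv U ^ 2 - sonic γ U ^ 2)) =
      (γ + 1) * (d.sign * A) * (1 + lam γ d U ^ 2) := by
    have h4 := d.sign_mul_self
    have e1 : 2 * l' * (A * uu U - sonic γ U ^ 2 * lam γ d U) =
        (γ + 1) * A * (1 + lam γ d U ^ 2) := by
      rw [hc2]
      have hγ0 : γ ≠ 0 := by linarith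
      field_simp at h0 ⊢
      linear_combination h0
    have e2 : A * uu U - sonic γ U ^ 2 * lam γ d U =
        d.sign * sonic γ U * Real.sqrt (uu U ^ 2 + vv U ^ 2 - sonic γ U ^ 2) := by
      rw [hA]; linear_combination hmul
    rw [e2] at e1
    linear_combination d.sign * e1 - (l' * (2 * sonic γ U *
      Real.sqrt (uu U ^ 2 + vv U ^ 2 - sonic γ U ^ 2))) * h4
  have h2 : 0 < l' * (2 * sonic γ U * Real.sqrt (uu U ^ 2 + vv U ^ 2 - sonic γ U ^ 2)) := by
    rw [h1]
    have : 0 < γ + 1 := by linarith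
    positivity
  exact pos_of_mul_pos_left h2 (by positivity)

/-- The coordinates of the states of a rarefaction wave. -/
theorem hasDerivWithinAt_coord_of_rarefaction (hγ : 1 < γ) {d : NLFamily} {w : ℝ → State}
    {I : Set ℝ} {s : ℝ} (h : Supersonic γ (w s))
    (hw : HasDerivWithinAt w (reig γ d (w s)) I s) :
    1 < machSq γ (coord (w s)) ∧ ∃ P : ℝ, 0 < d.sign * P ∧
      HasDerivWithinAt (fun s => coord (w s)) (P / γ, -(P / (γ * machSq γ (coord (w s)))), P,
        d.sign * turnRate γ (machSq γ (coord (w s))) * P) I s := by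
  have hP := h.physical
  have hp := hP.pp_pos
  have hr := hP.rr_pos
  have hu := hP.uu_pos
  have hc := sonic_pos hγ hP
  have hc2 := sonic_sq hγ hP
  have hq := speed_eq_machSq hγ hP
  have hk := kap_pos hγ h d
  have hγ0 : 0 < γ := by linarith
  have hsign := lam_sub_sign hγ h d
  have htan := lam_tangential hγ h d
  have hsq := d.sign_mul_self
  set N := machSq γ (coord (w s)) with hN
  have hN1 : 1 < N := by
    have h1 := h.sq_lt
    have h2 : 0 < sonic γ (w s) ^ 2 * (N - 1) := by nlinarith [sq_nonneg (vv (w s))]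
    have := pos_of_mul_pos_right h2 (by positivity)
    linarith
  have hR : Real.sqrt (uu (w s) ^ 2 + vv (w s) ^ 2 - sonic γ (w s) ^ 2) =
      sonic γ (w s) * Real.sqrt (N - 1) := by
    rw [hq, show sonic γ (w s) ^ 2 * N - sonic γ (w s) ^ 2 = sonic γ (w s) ^ 2 * (N - 1) by ring,
      Real.sqrt_mul (by positivity), Real.sqrt_sq hc.le]
  rw [hR] at htan
  set A := lam γ d (w s) * uu (w s) - vv (w s) with hA
  have htan' : uu (w s) + lam γ d (w s) * vv (w s) = d.sign * Real.sqrt (N - 1) * A := by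
    apply mul_left_cancel₀ hc.ne'
    rw [htan]; ring
  set κ := kap γ d (w s) with hκ
  -- The witness is the derivative of $\log p$ along the curve. Its sign is that of the family,
  -- since $\kappa_d>0$ and $\lambda_du-v$ has that sign.
  refine ⟨hN1, κ * (rr (w s) * A) / pp (w s), ?_, ?_⟩
  · rw [show d.sign * (κ * (rr (w s) * A) / pp (w s)) =
      κ * rr (w s) * (d.sign * A) / pp (w s) by ring]
    positivity
  have hproj : ∀ i : Fin 4, HasDerivWithinAt (fun s => w s i) (reig γ d (w s) i) I s := fun i =>
    (EuclideanSpace.proj (𝕜 := ℝ) i).hasFDerivAt.comp_hasDerivWithinAt s hw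
  have du : HasDerivWithinAt (fun s => uu (w s)) (κ * -lam γ d (w s)) I s := hproj 0
  have dv : HasDerivWithinAt (fun s => vv (w s)) (κ * 1) I s := hproj 1
  have dp : HasDerivWithinAt (fun s => pp (w s)) (κ * (rr (w s) * A)) I s := hproj 2
  have dr : HasDerivWithinAt (fun s => rr (w s)) (κ * (rr (w s) * A / sonic γ (w s) ^ 2)) I s :=
    hproj 3
  refine HasDerivWithinAt.prodMk ?_ (HasDerivWithinAt.prodMk ?_ (HasDerivWithinAt.prodMk ?_ ?_))
  · refine (dr.log hr.ne').congr_deriv ?_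
    rw [hc2]
    field_simp
  · have h1 := (((du.pow 2).add (dv.pow 2)).log hP.speed_pos.ne').div_const 2
    refine h1.congr_deriv ?_
    simp only [Pi.add_apply, Pi.pow_apply]
    rw [hq, hc2, hA]
    push_cast
    field_simp
    ring
  · exact dp.log hp.ne'
  · have h1 := (dv.div du hu.ne').arctan
    refine h1.congr_deriv ?_
    simp only [Pi.div_apply, turnRate]
    have e1 : 1 + (vv (w s) / uu (w s)) ^ 2 = (sonic γ (w s) ^ 2 * N) / uu (w s) ^ 2 := by
      rw [← hq]; field_simp
    have e2 : κ * 1 * uu (w s) - vv (w s) * (κ * -lam γ d (w s)) =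
        κ * (d.sign * Real.sqrt (N - 1) * A) := by
      rw [← htan']; ring
    rw [e1, e2, hc2]
    field_simp

end Eigen

/-! ### Elementary waves as displacements. -/

/-- Rarefaction waves in the coordinates `(log ρ, log q, log p, φ)`. -/
theorem IsRarefaction.coord_eq {γ : ℝ} (hγ : 1 < γ) {d : NLFamily} {lo hi : State}
    (h : IsRarefaction γ d lo hi) {s : ℝ} (hs : s = (coord hi).2.2.1 - (coord lo).2.2.1) :
    0 < d.sign * s ∧ coord hi = coord lo + disp γ d s (coord lo) ∧
      0 ≤ d.sign * ((coord hi).1 - (coord lo).1) ∧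
      d.sign * ((coord hi).2.1 - (coord lo).2.1) ≤ 0 ∧ (coord lo).2.2.2 ≤ (coord hi).2.2.2 := by
  obtain ⟨α, hα, w, hw0, hwα, hw⟩ := h
  have hγ0 : 0 < γ := by linarith
  have hγ1 : 0 < γ - 1 := by linarith
  have hd := fun t ht => hasDerivWithinAt_coord_of_rarefaction hγ (hw t ht).1 (hw t ht).2
  choose! hN P hP hz using hd
  set z : ℝ → FlowCoord := fun s => coord (w s) with hzdef
  have d1 : ∀ t ∈ Icc 0 α, HasDerivWithinAt (fun s => (z s).1) (P t / γ) (Icc 0 α) t :=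
    fun t ht => (hz t ht).fst
  have d2 : ∀ t ∈ Icc 0 α, HasDerivWithinAt (fun s => (z s).2.1) (-(P t / (γ * machSq γ (z t))))
      (Icc 0 α) t := fun t ht => (hz t ht).snd.fst
  have d3 : ∀ t ∈ Icc 0 α, HasDerivWithinAt (fun s => (z s).2.2.1) (P t) (Icc 0 α) t :=
    fun t ht => (hz t ht).snd.snd.fst
  have d4 : ∀ t ∈ Icc 0 α, HasDerivWithinAt (fun s => (z s).2.2.2)
      (d.sign * turnRate γ (machSq γ (z t)) * P t) (Icc 0 α) t :=
    fun t ht => (hz t ht).snd.snd.snd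
  have dN : ∀ t ∈ Icc 0 α, HasDerivWithinAt (fun s => machSq γ (z s))
      (-(P t * ((γ - 1) * machSq γ (z t) + 2) / γ)) (Icc 0 α) t := by
    intro t ht
    have h1 := (((d1 t ht).add ((d2 t ht).const_mul 2)).sub (d3 t ht)).exp.div_const γ
    refine HasDerivWithinAt.congr_deriv (f := fun s => machSq γ (z s)) h1 ?_
    simp only [Pi.add_apply, Pi.sub_apply]
    have hE : Real.exp ((z t).1 + 2 * (z t).2.1 - (z t).2.2.1) = γ * machSq γ (z t) := by
      unfold machSq; field_simp
    rw [hE]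
    have hNt : 0 < machSq γ (z t) := by linarith [hN t ht]
    field_simp
    ring
  have mvt : ∀ (f f' : ℝ → ℝ), (∀ t ∈ Icc 0 α, HasDerivWithinAt f (f' t) (Icc 0 α) t) →
      ∃ c ∈ Icc 0 α, f α - f 0 = f' c * α := by
    intro f f' hf
    obtain ⟨c, hc, he⟩ := exists_hasDerivAt_eq_slope f f' hα
      (fun t ht => (hf t ht).continuousWithinAt)
      (fun t ht => (hf t (Ioo_subset_Icc_self ht)).hasDerivAt (Icc_mem_nhds ht.1 ht.2))
    refine ⟨c, Ioo_subset_Icc_self hc, ?_⟩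
    rw [he, sub_zero, div_mul_cancel₀ _ hα.ne']
  have hT : ∀ t ∈ Icc 0 α, 0 < turnRate γ (machSq γ (z t)) := by
    intro t ht
    have := hN t ht
    have : 0 < Real.sqrt (machSq γ (z t) - 1) := Real.sqrt_pos.2 (by linarith)
    unfold turnRate
    have : 0 < machSq γ (z t) := by linarith
    positivity
  have h00 : (0 : ℝ) ∈ Icc 0 α := ⟨le_rfl, hα.le⟩
  have hαα : α ∈ Icc 0 α := ⟨hα.le, le_rfl⟩
  have z0 : z 0 = coord lo := by rw [hzdef, ← hw0]
  have zα : z α = coord hi := by rw [hzdef, ← hwα]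
  obtain ⟨c1, hc1, e1⟩ := mvt _ _ d1
  obtain ⟨c2, hc2, e2⟩ := mvt _ _ d2
  obtain ⟨c3, hc3, e3⟩ := mvt _ _ d3
  obtain ⟨c4, hc4, e4⟩ := mvt _ _ d4
  -- Three first integrals of the curve: the entropy, here; then the Bernoulli quantity
  -- $(N+2/(\gamma-1))p^{(\gamma-1)/\gamma}$; then the Riemann invariant $\varphi\pm$
  -- `prandtlMeyer`. Equating their end values gives the closed form of the displacement, and the
  -- mean values `e1` to `e4` give the monotonicity.
  obtain ⟨c5, hc5, e5⟩ := mvt (fun s => (z s).1 - (z s).2.2.1 / γ) (fun _ => 0) (fun t ht =>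
    ((d1 t ht).sub ((d3 t ht).div_const γ)).congr_deriv (by ring))
  obtain ⟨c6, hc6, e6⟩ := mvt (fun s => (machSq γ (z s) + 2 / (γ - 1)) *
      Real.exp ((z s).2.2.1 * ((γ - 1) / γ))) (fun _ => 0) (fun t ht =>
    (((dN t ht).add_const (2 / (γ - 1))).mul ((d3 t ht).mul_const ((γ - 1) / γ)).exp).congr_deriv
      (by field_simp; ring))
  obtain ⟨c7, hc7, e7⟩ := mvt (fun s => (z s).2.2.2 + d.sign * prandtlMeyer γ (machSq γ (z s)))
    (fun _ => 0) (fun t ht => by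
      have h1 := (hasDerivAt_prandtlMeyer hγ (hN t ht)).comp_hasDerivWithinAt t (dN t ht)
      refine ((d4 t ht).add (h1.const_mul d.sign)).congr_deriv ?_
      have : 0 < machSq γ (z t) := by linarith [hN t ht]
      have h2 : 0 < (γ - 1) * machSq γ (z t) + 2 := by positivity
      unfold turnRate
      change _ + d.sign * (Real.sqrt (machSq γ (z t) - 1) /
        (machSq γ (z t) * ((γ - 1) * machSq γ (z t) + 2)) * _) = 0
      field_simp
      ring)
  rw [z0, zα] at e1 e2 e3 e4
  simp only [z0, zα, zero_mul] at e5 e6 e7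
  rw [← hs] at e3
  have hsP : 0 < d.sign * s := by
    rw [e3, ← mul_assoc]; exact mul_pos (hP c3 hc3) hα
  refine ⟨hsP, ?_, ?_, ?_, ?_⟩
  · have hN0 : 0 < machSq γ (coord lo) := by have h1 := hN 0 h00; rw [hw0] at h1; linarith
    have hNα : 0 < machSq γ (coord hi) := by have h1 := hN α hαα; rw [hwα] at h1; linarith
    have hstep : machStep γ s (machSq γ (coord lo)) = machSq γ (coord hi) := by
      unfold machStep
      have hx : Real.exp (-(s * ((γ - 1) / γ))) = Real.exp ((coord lo).2.2.1 * ((γ - 1) / γ)) /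
          Real.exp ((coord hi).2.2.1 * ((γ - 1) / γ)) := by
        rw [← Real.exp_sub, hs]; congr 1; ring
      rw [hx, ← mul_div_assoc, sub_eq_iff_eq_add, div_eq_iff (Real.exp_pos _).ne']
      linarith
    have hlog : Real.log (machSq γ (coord hi) / machSq γ (coord lo)) =
        ((coord hi).1 - (coord lo).1) + 2 * ((coord hi).2.1 - (coord lo).2.1) - s := by
      have hl : ∀ y : FlowCoord, Real.log (machSq γ y) = y.1 + 2 * y.2.1 - y.2.2.1 - Real.log γ := by
        intro y
        unfold machSq
        rw [Real.log_div (Real.exp_pos _).ne' hγ0.ne', Real.log_exp]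
      rw [Real.log_div hNα.ne' hN0.ne', hl, hl, hs]
      ring
    have hr1 : (coord hi).1 - (coord lo).1 = s / γ := by
      rw [hs, sub_div]; linarith
    simp only [disp, waveIncr, hsP.le, if_true, rareIncr, hstep, hlog, hr1]
    refine Prod.ext ?_ (Prod.ext ?_ (Prod.ext ?_ ?_))
    · simp only [Prod.fst_add]; linarith
    · simp only [Prod.fst_add, Prod.snd_add]; ring
    · simp only [Prod.fst_add, Prod.snd_add]; linarith
    · simp only [Prod.snd_add]; linarith
  · rw [e1, show d.sign * (P c1 / γ * α) = d.sign * P c1 * α / γ by ring]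
    have := hP c1 hc1
    positivity
  · have h1 := hP c2 hc2
    have h2 : 0 < machSq γ (z c2) := by linarith [hN c2 hc2]
    rw [e2, show d.sign * (-(P c2 / (γ * machSq γ (z c2))) * α) =
      -(d.sign * P c2 * α / (γ * machSq γ (z c2))) by ring]
    have : 0 ≤ d.sign * P c2 * α / (γ * machSq γ (z c2)) := by positivity
    linarith
  · have h1 := hP c4 hc4
    have h2 := hT c4 hc4
    have : 0 ≤ d.sign * turnRate γ (machSq γ (z c4)) * P c4 * α := by
      rw [show d.sign * turnRate γ (machSq γ (z c4)) * P c4 * α =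
        turnRate γ (machSq γ (z c4)) * (d.sign * P c4) * α by ring]
      positivity
    linarith

/-- The consequences of the Rankine-Hugoniot conditions for a discontinuity with mass flux `m`. -/
theorem IsShock.rankineHugoniot {γ : ℝ} {d : NLFamily} {σ : ℝ} {lo hi : State}
    (h : IsShock γ d σ lo hi) {m : ℝ} (hm : m = rr lo * (vv lo - σ * uu lo)) :
    rr hi * (vv hi - σ * uu hi) = m ∧ m * (uu hi - uu lo) = σ * (pp hi - pp lo) ∧
      m * (vv hi - vv lo) = -(pp hi - pp lo) ∧
      m * (γ * pp hi / ((γ - 1) * rr hi) + (uu hi ^ 2 + vv hi ^ 2) / 2 -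
        (γ * pp lo / ((γ - 1) * rr lo) + (uu lo ^ 2 + vv lo ^ 2) / 2)) = 0 := by
  have hRH := h.2.2.1
  have h0 : σ * (rr hi * uu hi - rr lo * uu lo) = rr hi * vv hi - rr lo * vv lo :=
    congrArg (fun U : State => U 0) hRH
  have h1 : σ * (rr hi * uu hi ^ 2 + pp hi - (rr lo * uu lo ^ 2 + pp lo)) =
      rr hi * uu hi * vv hi - rr lo * uu lo * vv lo := congrArg (fun U : State => U 1) hRH
  have h2 : σ * (rr hi * uu hi * vv hi - rr lo * uu lo * vv lo) =
      rr hi * vv hi ^ 2 + pp hi - (rr lo * vv lo ^ 2 + pp lo) :=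
    congrArg (fun U : State => U 2) hRH
  have h3 : σ * (rr hi * uu hi * (γ * pp hi / ((γ - 1) * rr hi) + (uu hi ^ 2 + vv hi ^ 2) / 2) -
      rr lo * uu lo * (γ * pp lo / ((γ - 1) * rr lo) + (uu lo ^ 2 + vv lo ^ 2) / 2)) =
      rr hi * vv hi * (γ * pp hi / ((γ - 1) * rr hi) + (uu hi ^ 2 + vv hi ^ 2) / 2) -
      rr lo * vv lo * (γ * pp lo / ((γ - 1) * rr lo) + (uu lo ^ 2 + vv lo ^ 2) / 2) :=
    congrArg (fun U : State => U 3) hRH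
  have e0 : rr hi * (vv hi - σ * uu hi) = m := by rw [hm]; linarith
  refine ⟨e0, ?_, ?_, ?_⟩
  · linear_combination -h1 - uu hi * e0 - uu lo * hm
  · linear_combination -h2 - vv hi * e0 - vv lo * hm
  · set H₁ := γ * pp hi / ((γ - 1) * rr hi) + (uu hi ^ 2 + vv hi ^ 2) / 2
    set H₀ := γ * pp lo / ((γ - 1) * rr lo) + (uu lo ^ 2 + vv lo ^ 2) / 2
    linear_combination -h3 - H₁ * e0 - H₀ * hm

/-- Beyond a characteristic direction the normal velocity is supersonic. -/
theorem sonic_lt_normal {γ : ℝ} (hγ : 1 < γ) {U : State} (h : Supersonic γ U) (d : NLFamily)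
    {σ : ℝ} (hσ : 0 < d.sign * (σ - lam γ d U)) :
    sonic γ U ^ 2 * (1 + σ ^ 2) < (vv U - σ * uu U) ^ 2 ∧ 0 < d.sign * (σ * uu U - vv U) := by
  have h1 := lam_quadratic h d
  have h2 := lam_mul h d
  have h3 := h.sq_lt
  have h4 := h.sqrt_pos
  have h5 := sonic_pos hγ h.physical
  have h6 := lam_sub_sign hγ h d
  have hu := h.physical.uu_pos
  refine ⟨?_, ?_⟩
  · have h7 : (vv U - σ * uu U) ^ 2 - sonic γ U ^ 2 * (1 + σ ^ 2) =
        (uu U ^ 2 - sonic γ U ^ 2) * (σ - lam γ d U) ^ 2 + 2 * (d.sign * (σ - lam γ d U)) *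
          (sonic γ U * Real.sqrt (uu U ^ 2 + vv U ^ 2 - sonic γ U ^ 2)) := by
      linear_combination h1 + 2 * (σ - lam γ d U) * h2
    have : 0 ≤ (uu U ^ 2 - sonic γ U ^ 2) * (σ - lam γ d U) ^ 2 := by positivity
    have : 0 < 2 * (d.sign * (σ - lam γ d U)) *
          (sonic γ U * Real.sqrt (uu U ^ 2 + vv U ^ 2 - sonic γ U ^ 2)) := by positivity
    linarith
  · have : 0 < d.sign * (σ - lam γ d U) * uu U := by positivity
    linarith

set_option maxHeartbeats 1000000 in
/-- Shocks in the coordinates `(log ρ, log q, log p, φ)`. -/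
theorem IsShock.coord_eq {γ : ℝ} (hγ : 1 < γ) {d : NLFamily} {σ : ℝ} {lo hi : State}
    (h : IsShock γ d σ lo hi) {s : ℝ} (hs : s = (coord hi).2.2.1 - (coord lo).2.2.1)
    (hT : 0 < uu lo + σ * vv lo) (hφ : |(coord hi).2.2.2 - (coord lo).2.2.2| ≤ Real.pi / 2) :
    d.sign * s < 0 ∧ coord hi = coord lo + disp γ d s (coord lo) := by
  obtain ⟨m, hm⟩ : ∃ m, m = rr lo * (vv lo - σ * uu lo) := ⟨_, rfl⟩
  obtain ⟨r0, r1, r2, r3⟩ := h.rankineHugoniot hm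
  have hP₀ := h.1.physical
  have hP₁ := h.2.1.physical
  have hp₀ := hP₀.pp_pos
  have hp₁ := hP₁.pp_pos
  have hr₀ := hP₀.rr_pos
  have hr₁ := hP₁.rr_pos
  have hγ0 : 0 < γ := by linarith
  have hγ1 : 0 < γ - 1 := by linarith
  have hsgn := d.sign_mul_self
  -- the normal velocity on the upstream side
  have hup : ∃ U : State, (U = lo ∧ d = .one ∨ U = hi ∧ d = .four) ∧
      sonic γ U ^ 2 * (1 + σ ^ 2) < (vv U - σ * uu U) ^ 2 ∧ 0 < d.sign * (σ * uu U - vv U) := by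
    cases d with
    | one => exact ⟨lo, by simp, sonic_lt_normal hγ h.1 .one (by
        have := h.2.2.2.2; simp only [NLFamily.sign]; linarith)⟩
    | four => exact ⟨hi, by simp, sonic_lt_normal hγ h.2.1 .four (by
        have := h.2.2.2.1; simp only [NLFamily.sign]; linarith)⟩
  have hmsign : d.sign * m < 0 := by
    obtain ⟨U, ⟨rfl, -⟩ | ⟨rfl, -⟩, -, hU⟩ := hup
    · have := mul_pos hr₀ hU
      rw [hm]; linarith
    · have := mul_pos hr₁ hU
      rw [← r0]; linarith
  have hm0 : m ≠ 0 := by rintro h0; simp [h0] at hmsign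
  have hEn : γ * pp hi / ((γ - 1) * rr hi) + (uu hi ^ 2 + vv hi ^ 2) / 2 =
        (γ * pp lo / ((γ - 1) * rr lo) + (uu lo ^ 2 + vv lo ^ 2) / 2) := by
    rcases mul_eq_zero.1 r3 with h0 | h0
    · exact absurd h0 hm0
    · linarith
  have hq : uu hi ^ 2 + vv hi ^ 2 - (uu lo ^ 2 + vv lo ^ 2) =
      -(pp hi - pp lo) * (1 / rr lo + 1 / rr hi) := by
    have e1 : vv lo - σ * uu lo = m / rr lo := by rw [hm]; field_simp
    have e2 : vv hi - σ * uu hi = m / rr hi := by rw [← r0]; field_simp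
    have e3 : m * (uu hi ^ 2 + vv hi ^ 2 - (uu lo ^ 2 + vv lo ^ 2)) =
        m * (-(pp hi - pp lo) * (1 / rr lo + 1 / rr hi)) := by
      linear_combination (uu hi + uu lo) * r1 + (vv hi + vv lo) * r2 -
        (pp hi - pp lo) * (e1 + e2)
    exact mul_left_cancel₀ hm0 e3
  set w := Real.exp s with hw
  have hw0 : 0 < w := Real.exp_pos s
  have hpw : pp hi = w * pp lo := by
    rw [hw, hs]
    simp only [coord]
    rw [Real.exp_sub, Real.exp_log hp₁, Real.exp_log hp₀]
    field_simp
  -- Eliminating the squared speeds between the energy equation and `hq` leaves the Hugoniot curve,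
  -- so the pressure ratio determines the density ratio.
  have hH : rr hi * ((γ - 1) * w + (γ + 1)) = rr lo * ((γ + 1) * w + (γ - 1)) := by
    have e1 : uu hi ^ 2 + vv hi ^ 2 - (uu lo ^ 2 + vv lo ^ 2) =
      2 * γ / (γ - 1) * (pp lo / rr lo - pp hi / rr hi) := by
      field_simp at hEn ⊢
      linear_combination hEn
    rw [hq, hpw] at e1
    field_simp at e1
    linear_combination -e1
  set R := densityRatio γ s with hR
  have hR0 : 0 < R := densityRatio_pos hγ s
  have hden : 0 < (γ - 1) * w + (γ + 1) := by positivity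
  have hRr : rr hi = R * rr lo := by
    rw [hR]
    unfold densityRatio
    rw [← hw]
    field_simp
    linarith
  set J := massFlux γ s with hJ
  have hJ0 : 0 < J := by rw [hJ]; unfold massFlux; positivity
  have hRJ : R * ((γ - 1) * w + (γ + 1)) = 2 * J := by
    rw [hR, hJ]
    unfold densityRatio massFlux
    rw [← hw]
    field_simp
  have hJw : 2 * J = (γ + 1) * w + (γ - 1) := by
    rw [hJ]; unfold massFlux; rw [← hw]; ring
  -- the pressure jumps
  have hw1 : w ≠ 1 := by
    intro hw1
    have hpe : pp hi = pp lo := by rw [hpw, hw1, one_mul]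
    have hre : rr hi = rr lo := by
      rw [hw1] at hH
      have : (rr hi - rr lo) * (2 * γ) = 0 := by linear_combination hH
      rcases mul_eq_zero.1 this with h0 | h0
      · linarith
      · linarith
    have hue : uu hi = uu lo := by
      rw [hpe, sub_self, mul_zero] at r1
      rcases mul_eq_zero.1 r1 with h0 | h0
      · exact absurd h0 hm0
      · linarith
    have hve : vv hi = vv lo := by
      rw [hpe, sub_self, neg_zero] at r2
      rcases mul_eq_zero.1 r2 with h0 | h0
      · exact absurd h0 hm0
      · linarith
    have : hi = lo := by
      ext i; fin_cases i
      · exact hue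
      · exact hve
      · exact hpe
      · exact hre
    have h1 := h.2.2.2.1.trans h.2.2.2.2
    rw [this] at h1
    exact lt_irrefl _ h1
  have hmJ : m ^ 2 = rr lo * pp lo * J * (1 + σ ^ 2) := by
    have e1 : m ^ 2 * (1 / rr hi - 1 / rr lo) = -(pp hi - pp lo) * (1 + σ ^ 2) := by
      have e1 : vv lo - σ * uu lo = m / rr lo := by rw [hm]; field_simp
      have e2 : vv hi - σ * uu hi = m / rr hi := by rw [← r0]; field_simp
      linear_combination r2 - σ * r1 + m * (e1 - e2)
    rw [hRr, hpw] at e1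
    have e2 : (w - 1) * (m ^ 2 - rr lo * pp lo * J * (1 + σ ^ 2)) = 0 := by
      field_simp at e1
      have e3 : (R - 1) * ((γ - 1) * w + (γ + 1)) = 2 * (w - 1) := by
        linear_combination hRJ + hJw
      have e4 : 2 * ((w - 1) * (m ^ 2 - rr lo * pp lo * J * (1 + σ ^ 2))) = 0 := by
        linear_combination (-((γ - 1) * w + (γ + 1))) * e1 - m ^ 2 * e3 +
          (rr lo * pp lo * (w - 1) * (1 + σ ^ 2)) * hRJ
      linarith
    rcases mul_eq_zero.1 e2 with h0 | h0
    · exact absurd (by linarith) hw1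
    · linarith
  -- By the Lax condition the velocity normal to the shock is supersonic upstream, that is, below a
  -- $1$-shock and above a $4$-shock. Through `hmJ` this compares $J$ with $\gamma$ or with $\gamma
  -- Rw$, and hence $w=e^s$ with $1$.
  have hs_neg : d.sign * s < 0 := by
    have hσ0 : 0 < 1 + σ ^ 2 := by positivity
    obtain ⟨U, ⟨rfl, rfl⟩ | ⟨rfl, rfl⟩, hU, -⟩ := hup
    · rw [sonic_sq hγ hP₀] at hU
      have e1 : rr U * (γ * pp U) * (1 + σ ^ 2) < m ^ 2 := by
        rw [hm]
        have := mul_lt_mul_of_pos_left hU (by positivity : 0 < rr U ^ 2)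
        calc rr U * (γ * pp U) * (1 + σ ^ 2) = rr U ^ 2 * (γ * pp U / rr U * (1 + σ ^ 2)) := by
              field_simp
          _ < _ := this
          _ = _ := by ring
      rw [hmJ] at e1
      have e2 : 0 < (rr U * pp U * (1 + σ ^ 2)) * (J - γ) := by linarith
      have e3 := pos_of_mul_pos_right e2 (by positivity)
      have e5 : 0 < (γ + 1) * (w - 1) := by linarith
      have e4 : 1 < w := sub_pos.1 (pos_of_mul_pos_right e5 (by linarith))
      have : 0 < s := by rw [hw] at e4; exact Real.one_lt_exp_iff.1 e4
      simp only [NLFamily.sign]; linarith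
    · rw [sonic_sq hγ hP₁] at hU
      have e1 : rr U * (γ * pp U) * (1 + σ ^ 2) < m ^ 2 := by
        rw [← r0]
        have := mul_lt_mul_of_pos_left hU (by positivity : 0 < rr U ^ 2)
        calc rr U * (γ * pp U) * (1 + σ ^ 2) = rr U ^ 2 * (γ * pp U / rr U * (1 + σ ^ 2)) := by
              field_simp
          _ < _ := this
          _ = _ := by ring
      rw [hmJ, hRr, hpw] at e1
      have e2 : 0 < (rr lo * pp lo * (1 + σ ^ 2)) * (J - γ * R * w) := by linarith
      have e3 := pos_of_mul_pos_right e2 (by positivity)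
      have e4 : 0 < R * ((γ + 1) * (1 - w)) := by linarith
      have e5 := pos_of_mul_pos_right e4 hR0.le
      have e6 : w < 1 := sub_pos.1 (pos_of_mul_pos_right e5 (by linarith))
      have : s < 0 := by rw [hw] at e6; exact Real.exp_lt_one_iff.1 e6
      simp only [NLFamily.sign]; linarith
  refine ⟨hs_neg, ?_⟩
  -- the changes of the coordinates
  set N := machSq γ (coord lo) with hN
  have hq₀ : uu lo ^ 2 + vv lo ^ 2 = γ * pp lo / rr lo * N := by
    rw [← sonic_sq hγ hP₀, hN]; exact speed_eq_machSq hγ hP₀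
  have hN0 : 0 < N := by
    have h1 := hP₀.speed_pos
    rw [hq₀] at h1
    exact pos_of_mul_pos_right h1 (by positivity)
  set Q := speedRatio γ s N with hQ
  have hqQ : uu hi ^ 2 + vv hi ^ 2 = Q * (uu lo ^ 2 + vv lo ^ 2) := by
    have e1 : uu hi ^ 2 + vv hi ^ 2 = (uu lo ^ 2 + vv lo ^ 2) +
      2 * γ / (γ - 1) * (pp lo / rr lo - pp hi / rr hi) := by
      field_simp at hEn ⊢
      linear_combination hEn
    rw [e1, hq₀, hpw, hRr, hQ]
    unfold speedRatio
    rw [← hw, ← hR]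
    field_simp
  have hQ0 : 0 < Q := by
    have h1 := hP₁.speed_pos
    rw [hqQ] at h1
    exact pos_of_mul_pos_left h1 hP₀.speed_pos.le
  -- The tangential part of the velocity is what remains after the normal part, known from the mass
  -- flux, is removed from the total speed.
  have hTsq : (uu lo + σ * vv lo) ^ 2 = (1 + σ ^ 2) * (γ * pp lo / rr lo) * (N - J / γ) := by
    have e1 : (vv lo - σ * uu lo) ^ 2 = pp lo * J * (1 + σ ^ 2) / rr lo := by
      have : vv lo - σ * uu lo = m / rr lo := by rw [hm]; field_simp
      rw [this, div_pow, hmJ]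
      field_simp
    have e2 : (uu lo + σ * vv lo) ^ 2 =
        (1 + σ ^ 2) * (uu lo ^ 2 + vv lo ^ 2) - (vv lo - σ * uu lo) ^ 2 := by ring
    rw [e2, e1, hq₀]
    field_simp
  have hNJ : 0 < N - J / γ := by
    have h1 : 0 < (uu lo + σ * vv lo) ^ 2 := by positivity
    rw [hTsq] at h1
    exact pos_of_mul_pos_right h1 (by positivity)
  have hsq₀ := Real.sqrt_pos.2 hP₀.speed_pos
  have hsq₁ := Real.sqrt_pos.2 hP₁.speed_pos
  -- The sine is the normalized cross product of the two velocities, and the momentum jumps express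
  -- this product by the pressure jump and the tangential velocity. Taking the square root needs
  -- `hT` to fix the sign; `hφ` then selects the branch of the arcsine.
  have hsin : Real.sin ((coord hi).2.2.2 - (coord lo).2.2.2) = d.sign * turnSine γ s N := by
    have e1 : Real.sqrt (uu lo ^ 2 + vv lo ^ 2) * Real.sqrt (uu hi ^ 2 + vv hi ^ 2) *
        Real.sin ((coord hi).2.2.2 - (coord lo).2.2.2) = uu lo * vv hi - vv lo * uu hi := by
      rw [Real.sin_sub]
      have a1 := hP₀.uu_eq
      have a2 := hP₀.vv_eq
      have a3 := hP₁.uu_eq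
      have a4 := hP₁.vv_eq
      simp only [coord]
      set x₀ := Real.sqrt (uu lo ^ 2 + vv lo ^ 2)
      set x₁ := Real.sqrt (uu hi ^ 2 + vv hi ^ 2)
      rw [show x₀ * x₁ * (Real.sin (Real.arctan (vv hi / uu hi)) *
        Real.cos (Real.arctan (vv lo / uu lo)) - Real.cos (Real.arctan (vv hi / uu hi)) *
        Real.sin (Real.arctan (vv lo / uu lo))) =
        (x₀ * Real.cos (Real.arctan (vv lo / uu lo))) *
          (x₁ * Real.sin (Real.arctan (vv hi / uu hi))) -
        (x₀ * Real.sin (Real.arctan (vv lo / uu lo))) *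
          (x₁ * Real.cos (Real.arctan (vv hi / uu hi))) by ring, ← a1, ← a2, ← a3, ← a4]
    have e2 : (-(d.sign * m)) * (uu lo * vv hi - vv lo * uu hi) =
        d.sign * ((w - 1) * (pp lo * (uu lo + σ * vv lo))) := by
      have : m * (uu lo * vv hi - vv lo * uu hi) = -(pp hi - pp lo) * (uu lo + σ * vv lo) := by
        linear_combination uu lo * r2 - vv lo * r1
      rw [hpw] at this
      linear_combination (-d.sign) * this
    set D := -(d.sign * m) * (Real.sqrt (uu lo ^ 2 + vv lo ^ 2) *
      Real.sqrt (uu hi ^ 2 + vv hi ^ 2)) with hD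
    have hD0 : 0 < D := by
      have : 0 < -(d.sign * m) := by linarith
      positivity
    have hE0 : 0 < Real.sqrt J * Real.sqrt γ * N * Real.sqrt Q := by
      have := Real.sqrt_pos.2 hJ0
      have := Real.sqrt_pos.2 hγ0
      have := Real.sqrt_pos.2 hQ0
      positivity
    have e3 : pp lo * (uu lo + σ * vv lo) / D =
        Real.sqrt (N - J / γ) / (Real.sqrt J * Real.sqrt γ * N * Real.sqrt Q) := by
      have hb := Real.sqrt_pos.2 hNJ
      have : (pp lo * (uu lo + σ * vv lo) / D) ^ 2 =
          (Real.sqrt (N - J / γ) / (Real.sqrt J * Real.sqrt γ * N * Real.sqrt Q)) ^ 2 := by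
        rw [hD]
        simp only [div_pow, mul_pow, neg_sq]
        rw [Real.sq_sqrt hNJ.le, Real.sq_sqrt hJ0.le, Real.sq_sqrt hγ0.le, Real.sq_sqrt hQ0.le,
          Real.sq_sqrt hP₀.speed_pos.le, Real.sq_sqrt hP₁.speed_pos.le, hqQ, hTsq, hmJ, hq₀,
          sq d.sign, hsgn]
        field_simp
      exact (pow_left_inj₀ (by positivity) (by positivity) two_ne_zero).1 this
    have e4 : D * Real.sin ((coord hi).2.2.2 - (coord lo).2.2.2) =
        d.sign * ((w - 1) * (pp lo * (uu lo + σ * vv lo))) := by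
      rw [← e2, ← e1, hD]; ring
    have e5 : turnSine γ s N = (w - 1) * (pp lo * (uu lo + σ * vv lo) / D) := by
      rw [e3]; rfl
    rw [e5]
    apply mul_left_cancel₀ hD0.ne'
    rw [e4]
    field_simp
  have hang : (coord hi).2.2.2 - (coord lo).2.2.2 = d.sign * Real.arcsin (turnSine γ s N) := by
    have h1 := Real.arcsin_sin (abs_le.1 hφ).1 (abs_le.1 hφ).2
    rw [hsin] at h1
    rw [← h1]
    cases d <;> simp [NLFamily.sign]
  have hnot : ¬ 0 ≤ d.sign * s := not_le.2 hs_neg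
  simp only [disp, waveIncr, hnot, if_false, shockIncr, ← hN]
  refine Prod.ext ?_ (Prod.ext ?_ (Prod.ext ?_ ?_))
  · simp only [Prod.fst_add]
    simp only [coord]
    rw [hRr, Real.log_mul hR0.ne' hr₀.ne', ← hR]
    ring
  · simp only [Prod.fst_add, Prod.snd_add]
    simp only [coord]
    rw [hqQ, Real.log_mul hQ0.ne' hP₀.speed_pos.ne', ← hQ]
    ring
  · simp only [Prod.fst_add, Prod.snd_add]
    rw [hs]; ring
  · simp only [Prod.snd_add]
    rw [← hang]; ring

/-! ### Neighbourhoods of the background states with uniform bounds. -/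

/-- Uniform bounds for the waves between states close to `U₀`. -/
structure Region (γ : ℝ) (U₀ : State) (C ρ : ℝ) : Prop where
  one_lt : 1 < γ
  physical : Physical U₀
  angle_zero : (coord U₀).2.2.2 = 0
  mach : 1 < machSq γ (coord U₀)
  one_le : 1 ≤ C
  pos : 0 < ρ
  waves : ∀ d, WaveBounds γ (coord U₀) C ρ d
  coords : CoordBounds U₀ C ρ
  wave_eq : ∀ d lo hi, Near U₀ ρ lo → Near U₀ ρ hi →
    (IsRarefaction γ d lo hi ∨ ∃ σ, IsShock γ d σ lo hi) →
    coord hi = coord lo + disp γ d ((coord hi).2.2.1 - (coord lo).2.2.1) (coord lo)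

theorem FlowCoord.abs_fst_le (z : FlowCoord) : |z.1| ≤ ‖z‖ := norm_fst_le z
theorem FlowCoord.abs_snd_le (z : FlowCoord) : |z.2.1| ≤ ‖z‖ :=
  (norm_fst_le z.2).trans (norm_snd_le z)
theorem FlowCoord.abs_trd_le (z : FlowCoord) : |z.2.2.1| ≤ ‖z‖ :=
  (norm_fst_le z.2.2).trans ((norm_snd_le z.2).trans (norm_snd_le z))
theorem FlowCoord.abs_fth_le (z : FlowCoord) : |z.2.2.2| ≤ ‖z‖ :=
  (norm_snd_le z.2.2).trans ((norm_snd_le z.2).trans (norm_snd_le z))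

theorem FlowCoord.norm_le {z : FlowCoord} {a : ℝ} (h1 : |z.1| ≤ a) (h2 : |z.2.1| ≤ a)
    (h3 : |z.2.2.1| ≤ a) (h4 : |z.2.2.2| ≤ a) : ‖z‖ ≤ a := by
  rw [Prod.norm_def, Prod.norm_def, Prod.norm_def]
  exact max_le h1 (max_le h2 (max_le h3 h4))

theorem CoordBounds.mono {U₀ : State} {L L' R R' : ℝ} (h : CoordBounds U₀ L R) (hL : L ≤ L')
    (hR : R' ≤ R) : CoordBounds U₀ L' R' where
  physical U hU := h.physical U (hU.trans hR)
  coord_sub U U' hU hU' := (h.coord_sub U U' (hU.trans hR) (hU'.trans hR)).trans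
    (mul_le_mul_of_nonneg_right hL dist_nonneg)
  dist_le U U' hP hP' hU hU' := (h.dist_le U U' hP hP' (hU.trans hR) (hU'.trans hR)).trans
    (mul_le_mul_of_nonneg_right hL (norm_nonneg _))

/-- Close to a horizontal flow the side conditions of `IsShock.coord_eq` hold automatically: the
shock speed lies between eigenvalues and is bounded by $M$, and $M|\tan\varphi|<1$ makes the
tangential velocity positive. The flow angles themselves are below $1/4$. -/
theorem exists_region {γ : ℝ} (hγ : 1 < γ) {U₀ : State} (h : Supersonic γ U₀) (hv : vv U₀ = 0) :
    ∃ C ρ : ℝ, Region γ U₀ C ρ := by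
  have hP := h.physical
  have hφ : (coord U₀).2.2.2 = 0 := by simp [coord, hv]
  have hN : 1 < machSq γ (coord U₀) := by
    have h1 := speed_eq_machSq hγ h.physical
    have h2 := sonic_pos hγ h.physical
    have h3 := h.sq_lt
    rw [hv] at h1
    have h4 : 0 < sonic γ U₀ ^ 2 * (machSq γ (coord U₀) - 1) := by linarith
    have := pos_of_mul_pos_right h4 (by positivity)
    linarith
  obtain ⟨C₁, hC₁, ρ₁, hρ₁, hW⟩ := exists_waveBounds hγ hN hφ
  obtain ⟨L, hL, R, hR, hB⟩ := exists_coordBounds hP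
  set M := |lamC γ .one (coord U₀)| + |lamC γ .four (coord U₀)| + 1 with hM
  have hM0 : 0 < M := by positivity
  have htan : ∀ᶠ φ in 𝓝 (0 : ℝ), M * |Real.tan φ| < 1 := by
    have hc : ContinuousAt (fun φ => M * |Real.tan φ|) 0 :=
      continuousAt_const.mul (Real.continuousAt_tan.2 (by simp)).abs
    exact hc.tendsto.eventually_lt_const (by simp)
  obtain ⟨δ, hδ, htan⟩ := Metric.nhds_basis_closedBall.mem_iff.1 htan
  obtain ⟨ρ, hρ, hρ1, hρ2, hρ3, hρ4, hρ5⟩ : ∃ ρ > 0, ρ ≤ ρ₁ ∧ ρ ≤ R ∧ ρ ≤ δ ∧ ρ ≤ 1 / 4 ∧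
      C₁ * ρ ≤ 1 := by
    refine ⟨min (min ρ₁ R) (min δ (min (1 / 4) (1 / C₁))), by positivity, ?_, ?_, ?_, ?_, ?_⟩
    · exact (min_le_left _ _).trans (min_le_left _ _)
    · exact (min_le_left _ _).trans (min_le_right _ _)
    · exact (min_le_right _ _).trans (min_le_left _ _)
    · exact (min_le_right _ _).trans ((min_le_right _ _).trans (min_le_left _ _))
    · rw [mul_comm, ← le_div_iff₀ hC₁]
      exact (min_le_right _ _).trans ((min_le_right _ _).trans (min_le_right _ _))
  refine ⟨max 1 (max C₁ L), ρ, hγ, hP, hφ, hN, le_max_left _ _, hρ, fun d => (hW d).mono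
    ((le_max_left _ _).trans (le_max_right _ _)) hρ1,
    hB.mono ((le_max_right _ _).trans (le_max_right _ _)) hρ2, ?_⟩
  rintro d lo hi hlo hhi (hr | ⟨σ, hs⟩)
  · exact (hr.coord_eq hγ rfl).2.1
  have hφlo : |(coord lo).2.2.2| ≤ ρ := by
    have := (FlowCoord.abs_fth_le _).trans hlo.2
    rwa [Prod.snd_sub, Prod.snd_sub, Prod.snd_sub, hφ, sub_zero] at this
  have hφhi : |(coord hi).2.2.2| ≤ ρ := by
    have := (FlowCoord.abs_fth_le _).trans hhi.2
    rwa [Prod.snd_sub, Prod.snd_sub, Prod.snd_sub, hφ, sub_zero] at this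
  have hlam : ∀ U, Near U₀ ρ U → |lam γ d U| ≤ M := by
    intro U hU
    rw [lam_eq_lamC hγ hU.1]
    have h1 := (hW d).lamC_sub (coord U) (coord U₀) (hU.2.trans hρ1) (by simp [hρ₁.le])
    have h2 : |lamC γ d (coord U₀)| + 1 ≤ M := by
      have h3 := abs_nonneg (lamC γ .one (coord U₀))
      have h4 := abs_nonneg (lamC γ .four (coord U₀))
      cases d <;> rw [hM] <;> linarith
    have h3 := abs_sub_abs_le_abs_sub (lamC γ d (coord U)) (lamC γ d (coord U₀))
    have h4 := mul_le_mul_of_nonneg_left hU.2 hC₁.le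
    linarith
  have hσ : |σ| ≤ M := by
    have h1 := abs_le.1 (hlam lo hlo)
    have h2 := abs_le.1 (hlam hi hhi)
    exact abs_le.2 ⟨by linarith [hs.2.2.2.1], by linarith [hs.2.2.2.2]⟩
  refine (hs.coord_eq hγ rfl ?_ ?_).2
  · have hu := hlo.1.uu_pos
    have h1 : vv lo = uu lo * Real.tan (coord lo).2.2.2 := by
      simp only [coord]
      rw [Real.tan_arctan]
      field_simp
    have h2 : M * |Real.tan (coord lo).2.2.2| < 1 := by
      refine htan ?_
      rw [Metric.mem_closedBall, dist_zero_right]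
      exact hφlo.trans hρ3
    have h3 : |σ * Real.tan (coord lo).2.2.2| < 1 := by
      rw [abs_mul]
      exact (mul_le_mul_of_nonneg_right hσ (abs_nonneg _)).trans_lt h2
    have h4 := (abs_lt.1 h3).1
    rw [h1, show uu lo + σ * (uu lo * Real.tan (coord lo).2.2.2) =
      uu lo * (1 + σ * Real.tan (coord lo).2.2.2) by ring]
    exact mul_pos hu (by linarith)
  · have := abs_sub (coord hi).2.2.2 (coord lo).2.2.2
    have := Real.pi_gt_three
    linarith

theorem turnRate_pos {γ N : ℝ} (hγ : 1 < γ) (hN : 1 < N) : 0 < turnRate γ N := by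
  have : 0 < Real.sqrt (N - 1) := Real.sqrt_pos.2 (by linarith)
  unfold turnRate
  positivity

/-! ### Algebraic estimates of wave interactions -/

/-- The change of the coordinates in a `1`-wave, a contact discontinuity and a `4`-wave. -/
def fanDisp (γ a : ℝ) (y : FlowCoord) (b : ℝ) (z : FlowCoord) : FlowCoord :=
  disp γ .one a z + y + disp γ .four b (z + disp γ .one a z + y)

section Algebra

variable {γ : ℝ} {z₀ : FlowCoord} {C ρ : ℝ} {d : NLFamily}

theorem WaveBounds.disp_norm (h : WaveBounds γ z₀ C ρ d) (hρ : 0 ≤ ρ) {s : ℝ} {z : FlowCoord}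
    (hs : |s| ≤ ρ) (hz : ‖z - z₀‖ ≤ ρ) : ‖disp γ d s z‖ ≤ C * |s| := by
  have := h.disp_sub s 0 z z hs (by simpa using hρ) hz hz
  rwa [h.disp_zero z hz, sub_zero, sub_zero, sub_self, norm_zero, mul_zero, add_zero] at this

theorem WaveBounds.lamJump_zero (h : WaveBounds γ z₀ C ρ d) {z : FlowCoord}
    (hz : ‖z - z₀‖ ≤ ρ) : lamJump γ d 0 z = 0 := by
  simp [lamJump, h.disp_zero z hz]

/-- Waves whose jumps of the eigenvalue nearly agree nearly have the same size. -/
theorem WaveBounds.abs_sub_le (h : WaveBounds γ z₀ C ρ d) (hC : 0 ≤ C) {s s' : ℝ} {z : FlowCoord}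
    (hs : |s| ≤ ρ) (hs' : |s'| ≤ ρ) (hz : ‖z - z₀‖ ≤ ρ) :
    |s - s'| ≤ C * |lamJump γ d s z - lamJump γ d s' z| := by
  have h1 := h.lamJump_mono s s' z hs hs' hz
  rcases eq_or_ne (s - s') 0 with h0 | h0
  · rw [h0, abs_zero]; positivity
  have h2 : d.sign * (s - s') * (lamJump γ d s z - lamJump γ d s' z) ≤
      |s - s'| * |lamJump γ d s z - lamJump γ d s' z| := by
    refine (le_abs_self _).trans ?_
    rw [abs_mul, abs_mul, d.abs_sign, one_mul]
  have h3 : |s - s'| * |s - s'| ≤ |s - s'| * (C * |lamJump γ d s z - lamJump γ d s' z|) := by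
    rw [abs_mul_abs_self, ← sq]
    refine h1.trans ((mul_le_mul_of_nonneg_left h2 hC).trans (le_of_eq (by ring)))
  exact le_of_mul_le_mul_left h3 (abs_pos.2 h0)

/-- Two waves of the same strength from different states. -/
theorem WaveBounds.abs_sub_le_of_lamJump_eq (h : WaveBounds γ z₀ C ρ d) (hC : 0 ≤ C) {s s' : ℝ}
    {z z' : FlowCoord} (hs : |s| ≤ ρ) (hs' : |s'| ≤ ρ) (hz : ‖z - z₀‖ ≤ ρ) (hz' : ‖z' - z₀‖ ≤ ρ)
    (he : lamJump γ d s' z' = lamJump γ d s z) : |s' - s| ≤ C * C * (|s| * ‖z - z'‖) := by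
  have h1 := h.abs_sub_le hC hs' hs hz'
  rw [he] at h1
  have h2 := mul_le_mul_of_nonneg_left (h.lamJump_zsub s z z' hs hz hz') hC
  linarith

/-- A wave with the strength of two waves of the same family. -/
theorem WaveBounds.abs_sub_add_le (h : WaveBounds γ z₀ C ρ d) (hC : 1 ≤ C) (hρ : 0 ≤ ρ)
    {s t x : ℝ} {z : FlowCoord} (hs : |s| ≤ ρ / (4 * C)) (ht : |t| ≤ ρ / (4 * C)) (hx : |x| ≤ ρ)
    (hz : ‖z - z₀‖ ≤ ρ / (4 * C))
    (he : lamJump γ d x z = lamJump γ d s z + lamJump γ d t (z + disp γ d s z)) :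
    |x - (s + t)| ≤ C * C * ‖disp γ d s z + disp γ d t (z + disp γ d s z) -
      disp γ d (s + t) z‖ := by
  have hq : ρ / (4 * C) ≤ ρ / 4 := by gcongr; linarith
  -- A wave of size $\rho/(4C)$ moves a state by at most $\rho/4$, so a starting state within this
  -- range and two successive waves stay inside the radius $\rho$.
  have hq2 : C * (ρ / (4 * C)) = ρ / 4 := by field_simp
  have hC0 : 0 ≤ C := by linarith
  have hst : |s + t| ≤ ρ / 2 := by
    have := abs_add_le s t; linarith
  have hz1 : ‖z - z₀‖ ≤ ρ := by linarith
  have n1 := h.disp_norm hρ (s := s) (z := z) (by linarith) hz1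
  have n1' := mul_le_mul_of_nonneg_left hs hC0
  have hz2 : ‖z + disp γ d s z - z₀‖ ≤ ρ / 2 := by
    have := norm_add_le (z - z₀) (disp γ d s z)
    rw [show z - z₀ + disp γ d s z = z + disp γ d s z - z₀ by abel] at this
    linarith
  have n2 := h.disp_norm hρ (s := t) (z := z + disp γ d s z) (by linarith) (by linarith)
  have n2' := mul_le_mul_of_nonneg_left ht hC0
  have n3 : ‖z + disp γ d s z + disp γ d t (z + disp γ d s z) - z₀‖ ≤ ρ := by
    have := norm_add_le (z + disp γ d s z - z₀) (disp γ d t (z + disp γ d s z))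
    rw [show z + disp γ d s z - z₀ + disp γ d t (z + disp γ d s z) =
      z + disp γ d s z + disp γ d t (z + disp γ d s z) - z₀ by abel] at this
    linarith
  have n4 := h.disp_norm hρ (s := s + t) (z := z) (by linarith) hz1
  have n5 : ‖z + disp γ d (s + t) z - z₀‖ ≤ ρ := by
    have := norm_add_le (z - z₀) (disp γ d (s + t) z)
    rw [show z - z₀ + disp γ d (s + t) z = z + disp γ d (s + t) z - z₀ by abel] at this
    have := abs_add_le s t
    have := mul_le_mul_of_nonneg_left this hC0
    linarith
  have h1 := h.abs_sub_le hC0 hx (hst.trans (by linarith)) hz1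
  rw [he] at h1
  have h2 := h.lamC_sub _ _ n3 n5
  have h3 : lamJump γ d s z + lamJump γ d t (z + disp γ d s z) - lamJump γ d (s + t) z =
      lamC γ d (z + disp γ d s z + disp γ d t (z + disp γ d s z)) -
        lamC γ d (z + disp γ d (s + t) z) := by
    simp only [lamJump]; ring
  rw [h3] at h1
  have h4 : z + disp γ d s z + disp γ d t (z + disp γ d s z) - (z + disp γ d (s + t) z) =
      disp γ d s z + disp γ d t (z + disp γ d s z) - disp γ d (s + t) z := by abel
  rw [h4] at h2
  have h5 := mul_le_mul_of_nonneg_left h2 hC0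
  linarith

/-- Crossing waves. -/
theorem norm_disp_comm_le {d' : NLFamily} (h : WaveBounds γ z₀ C ρ d)
    (h' : WaveBounds γ z₀ C ρ d') (hC : 1 ≤ C) (hρ : 0 ≤ ρ) {s t : ℝ} {z : FlowCoord}
    (hs : |s| ≤ ρ / (4 * C)) (ht : |t| ≤ ρ / (4 * C)) (hz : ‖z - z₀‖ ≤ ρ / (4 * C)) :
    ‖disp γ d s z + disp γ d' t (z + disp γ d s z) -
      (disp γ d' t z + disp γ d s (z + disp γ d' t z))‖ ≤ 2 * (C * C) * (|s| * |t|) := by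
  have hq : ρ / (4 * C) ≤ ρ / 4 := by gcongr; linarith
  have hq2 : C * (ρ / (4 * C)) = ρ / 4 := by field_simp
  have hC0 : 0 ≤ C := by linarith
  have n1 := h.disp_norm hρ (s := s) (z := z) (by linarith) (by linarith)
  have n1' := mul_le_mul_of_nonneg_left hs hC0
  have n2 := h'.disp_norm hρ (s := t) (z := z) (by linarith) (by linarith)
  have n2' := mul_le_mul_of_nonneg_left ht hC0
  have m1 : ‖z + disp γ d s z - z₀‖ ≤ ρ := by
    have := norm_add_le (z - z₀) (disp γ d s z)
    rw [show z - z₀ + disp γ d s z = z + disp γ d s z - z₀ by abel] at this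
    linarith
  have m2 : ‖z + disp γ d' t z - z₀‖ ≤ ρ := by
    have := norm_add_le (z - z₀) (disp γ d' t z)
    rw [show z - z₀ + disp γ d' t z = z + disp γ d' t z - z₀ by abel] at this
    linarith
  have e1 := h.disp_sub s s z (z + disp γ d' t z) (by linarith) (by linarith) (by linarith) m2
  have e2 := h'.disp_sub t t (z + disp γ d s z) z (by linarith) (by linarith) m1 (by linarith)
  rw [sub_self, abs_zero, zero_add, sub_add_cancel_left, norm_neg] at e1
  rw [sub_self, abs_zero, zero_add, add_sub_cancel_left] at e2
  have e3 := mul_le_mul_of_nonneg_left (mul_le_mul_of_nonneg_left n2 (abs_nonneg s)) hC0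
  have e4 := mul_le_mul_of_nonneg_left (mul_le_mul_of_nonneg_left n1 (abs_nonneg t)) hC0
  rw [show disp γ d s z + disp γ d' t (z + disp γ d s z) -
      (disp γ d' t z + disp γ d s (z + disp γ d' t z)) =
      (disp γ d s z - disp γ d s (z + disp γ d' t z)) +
        (disp γ d' t (z + disp γ d s z) - disp γ d' t z) by abel]
  refine (norm_add_le _ _).trans ?_
  linarith

theorem norm_disp_add_le (h : WaveBounds γ z₀ C ρ d) {s : ℝ} {y z : FlowCoord}
    (hs : |s| ≤ ρ) (hz : ‖z - z₀‖ ≤ ρ) (hy : ‖z + y - z₀‖ ≤ ρ) :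
    ‖disp γ d s (z + y) - disp γ d s z‖ ≤ C * (|s| * ‖y‖) := by
  have := h.disp_sub s s (z + y) z hs hs hy hz
  rwa [sub_self, abs_zero, zero_add, add_sub_cancel_left] at this

/-- The outgoing waves depend Lipschitz continuously on the states on both sides. -/
theorem exists_fanDisp_stability (h : ∀ d, WaveBounds γ z₀ C ρ d) (hC : 1 ≤ C) (hρ : 0 < ρ)
    (hF : 0 < turnRate γ (machSq γ z₀)) :
    ∃ K ≥ (1 : ℝ), ∃ ε > (0 : ℝ), ∀ a a' b b' (y y' z : FlowCoord), |a| ≤ ε → |a'| ≤ ε → |b| ≤ ε →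
      |b'| ≤ ε → ‖y‖ ≤ ε → ‖y'‖ ≤ ε → ‖z - z₀‖ ≤ ε → y.2.2 = 0 → y'.2.2 = 0 →
      |a - a'| + ‖y - y'‖ + |b - b'| ≤ K * ‖fanDisp γ a y b z - fanDisp γ a' y' b' z‖ := by
  obtain ⟨F, hFdef⟩ : ∃ F, F = turnRate γ (machSq γ z₀) := ⟨_, rfl⟩
  rw [← hFdef] at hF
  have hC0 : 0 ≤ C := by linarith
  -- $B$ collects the coefficients of all error terms, each of which is $\varepsilon$ times the
  -- quantity to be estimated; $\varepsilon B\le1/2$ absorbs them.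
  obtain ⟨B, hB⟩ : ∃ B, B = (1 + C) * (C * (C + 5) * (C + 1)) / F + C * (C + 1) := ⟨_, rfl⟩
  have hB0 : 0 < B := by rw [hB]; positivity
  obtain ⟨ε, hε, hε1, hε2⟩ : ∃ ε > 0, ε * (C + 2) ≤ ρ ∧ ε * B ≤ 1 / 2 := by
    refine ⟨min (ρ / (C + 2)) (1 / 2 / B), by positivity, ?_, ?_⟩
    · rw [← le_div_iff₀ (by positivity)]; exact min_le_left _ _
    · rw [← le_div_iff₀ hB0]; exact min_le_right _ _
  refine ⟨2 * ((1 + C) * (1 + 1 / F) + 1), ?_, ε, hε, ?_⟩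
  · have : 0 < 1 / F := by positivity
    nlinarith
  intro a a' b b' y y' z ha ha' hb hb' hy hy' hz hy0 hy0'
  have hερ : ε ≤ ρ := by nlinarith
  have n1 := (h .one).disp_norm hρ.le (ha.trans hερ) (hz.trans hερ)
  have n1' := (h .one).disp_norm hρ.le (ha'.trans hερ) (hz.trans hερ)
  have c1 := mul_le_mul_of_nonneg_left ha hC0
  have c1' := mul_le_mul_of_nonneg_left ha' hC0
  obtain ⟨m, hm⟩ : ∃ m, m = z + disp γ .one a z + y := ⟨_, rfl⟩
  obtain ⟨m', hm'⟩ : ∃ m', m' = z + disp γ .one a' z + y' := ⟨_, rfl⟩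
  have hmz : ‖m - z₀‖ ≤ ε * (C + 2) := by
    have := norm_add₃_le (a := z - z₀) (b := disp γ .one a z) (c := y)
    rw [show z - z₀ + disp γ .one a z + y = m - z₀ by rw [hm]; abel] at this
    linarith
  have hmz' : ‖m' - z₀‖ ≤ ε * (C + 2) := by
    have := norm_add₃_le (a := z - z₀) (b := disp γ .one a' z) (c := y')
    rw [show z - z₀ + disp γ .one a' z + y' = m' - z₀ by rw [hm']; abel] at this
    linarith
  obtain ⟨A, hA⟩ : ∃ A, A = disp γ .one a z - disp γ .one a' z := ⟨_, rfl⟩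
  obtain ⟨B1, hB1⟩ : ∃ B1, B1 = disp γ .four b m - disp γ .four b' m := ⟨_, rfl⟩
  obtain ⟨B2, hB2⟩ : ∃ B2, B2 = disp γ .four b' m - disp γ .four b' m' := ⟨_, rfl⟩
  obtain ⟨e, he⟩ : ∃ e, e = fanDisp γ a y b z - fanDisp γ a' y' b' z := ⟨_, rfl⟩
  have hsum : e = A + (y - y') + (B1 + B2) := by
    rw [he, hA, hB1, hB2]; unfold fanDisp; rw [← hm, ← hm']; abel
  have hmm : m - m' = A + (y - y') := by rw [hm, hm', hA]; abel
  have hAn : ‖A‖ ≤ C * |a - a'| := by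
    have := (h .one).disp_sub a a' z z (ha.trans hερ) (ha'.trans hερ) (hz.trans hερ)
      (hz.trans hερ)
    rwa [sub_self, norm_zero, mul_zero, add_zero, ← hA] at this
  have hB1n : ‖B1‖ ≤ C * |b - b'| := by
    have := (h .four).disp_sub b b' m m (hb.trans hερ) (hb'.trans hερ) (hmz.trans hε1)
      (hmz.trans hε1)
    rwa [sub_self, norm_zero, mul_zero, add_zero, ← hB1] at this
  have hB2n : ‖B2‖ ≤ C * (ε * (C * |a - a'| + ‖y - y'‖)) := by
    have h1 := (h .four).disp_sub b' b' m m' (hb'.trans hερ) (hb'.trans hερ) (hmz.trans hε1)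
      (hmz'.trans hε1)
    rw [sub_self, abs_zero, zero_add, ← hB2, hmm] at h1
    refine h1.trans (mul_le_mul_of_nonneg_left ?_ hC0)
    refine mul_le_mul hb' ((norm_add_le _ _).trans (by linarith)) (norm_nonneg _) hε.le
  have hAφ : |A.2.2.2 + F * (a - a')| ≤ C * (3 * ε) * |a - a'| := by
    have h1 := (h .one).angle a a' z (ha.trans hερ) (ha'.trans hερ) (hz.trans hερ)
    rw [show (disp γ .one a z).2.2.2 - (disp γ .one a' z).2.2.2 = A.2.2.2 by rw [hA]; rfl,
      ← hFdef, show A.2.2.2 - NLFamily.one.sign * F * (a - a') = A.2.2.2 + F * (a - a') by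
        simp only [NLFamily.sign]; ring] at h1
    refine h1.trans (mul_le_mul_of_nonneg_right (mul_le_mul_of_nonneg_left ?_ hC0) (abs_nonneg _))
    linarith
  have hBφ : |B1.2.2.2 - F * (b - b')| ≤ C * (ε * (C + 4)) * |b - b'| := by
    have h1 := (h .four).angle b b' m (hb.trans hερ) (hb'.trans hερ) (hmz.trans hε1)
    rw [show (disp γ .four b m).2.2.2 - (disp γ .four b' m).2.2.2 = B1.2.2.2 by rw [hB1]; rfl,
      ← hFdef, show B1.2.2.2 - NLFamily.four.sign * F * (b - b') = B1.2.2.2 - F * (b - b') by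
        simp only [NLFamily.sign]; ring] at h1
    refine h1.trans (mul_le_mul_of_nonneg_right (mul_le_mul_of_nonneg_left ?_ hC0) (abs_nonneg _))
    linarith
  -- Exact, without error term: the waves are parametrized by the change of $\log p$, and a contact
  -- does not change it.
  have hp : e.2.2.1 = (a - a') + (b - b') := by
    rw [hsum]
    have h1 : A.2.2.1 = a - a' := by rw [hA]; rfl
    have h2 : B1.2.2.1 = b - b' := by rw [hB1]; rfl
    have h3 : B2.2.2.1 = 0 := by rw [hB2]; exact sub_self b'
    have h4 : (y - y').2.2.1 = 0 := by
      rw [Prod.snd_sub, Prod.snd_sub, hy0, hy0', sub_self]; rfl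
    simp only [Prod.snd_add, Prod.fst_add, h1, h2, h3, h4, add_zero]
  have hph : e.2.2.2 = A.2.2.2 + (B1.2.2.2 + B2.2.2.2) := by
    have h4 : (y - y').2.2.2 = 0 := by
      rw [Prod.snd_sub, Prod.snd_sub, hy0, hy0', sub_self]; rfl
    rw [hsum]
    simp only [Prod.snd_add, h4, add_zero]
  have hyn : ‖y - y'‖ ≤ ‖e‖ + ‖A‖ + (‖B1‖ + ‖B2‖) := by
    have h1 : y - y' = e - A - (B1 + B2) := by rw [hsum]; abel
    rw [h1]
    have h2 := norm_sub_le (e - A) (B1 + B2)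
    have h3 := norm_sub_le e A
    have h4 := norm_add_le B1 B2
    linarith
  have hep := FlowCoord.abs_trd_le e
  have heφ := FlowCoord.abs_fth_le e
  have hB2φ := FlowCoord.abs_fth_le B2
  rw [← he]
  clear hm hm' hA hB1 hB2 he hsum hmm hmz hmz' n1 n1' c1 c1' ha ha' hb hb' hy hy' hz hy0 hy0' h
  obtain ⟨x, hx⟩ : ∃ x, x = |a - a'| := ⟨_, rfl⟩
  obtain ⟨w, hw⟩ : ∃ w, w = |b - b'| := ⟨_, rfl⟩
  obtain ⟨Y, hY⟩ : ∃ Y, Y = ‖y - y'‖ := ⟨_, rfl⟩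
  obtain ⟨E, hE⟩ : ∃ E, E = ‖e‖ := ⟨_, rfl⟩
  have hx0 : 0 ≤ x := hx ▸ abs_nonneg _
  have hw0 : 0 ≤ w := hw ▸ abs_nonneg _
  have hY0 : 0 ≤ Y := hY ▸ norm_nonneg _
  have hE0 : 0 ≤ E := hE ▸ norm_nonneg _
  rw [← hx, ← hY] at hB2n
  rw [← hx] at hAφ hAn
  rw [← hw] at hBφ hB1n
  rw [← hE] at hep heφ hyn
  rw [← hY] at hyn
  have hX0 : 0 ≤ x + Y + w := by positivity
  have k1 : C * (ε * (C * x + Y)) ≤ C * (C + 1) * ε * (x + Y + w) := by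
    have : C * x + Y ≤ (C + 1) * (x + Y + w) := by nlinarith
    have := mul_le_mul_of_nonneg_left this (mul_nonneg hC0 hε.le)
    linarith
  -- The two families turn the flow in opposite directions at the rate $F$, so the angle controls
  -- the difference of the wave sizes. Together with the sum from `hp` this controls both, and then
  -- the contact part.
  have hdiff : F * |(b - b') - (a - a')| ≤ E + C * (C + 5) * (C + 1) * ε * (x + Y + w) := by
    rw [show F * |(b - b') - (a - a')| = |F * ((b - b') - (a - a'))| by
      rw [abs_mul, abs_of_pos hF]]
    have h1 : F * ((b - b') - (a - a')) =
        e.2.2.2 - B2.2.2.2 - (A.2.2.2 + F * (a - a')) - (B1.2.2.2 - F * (b - b')) := by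
      rw [hph]; ring
    rw [h1]
    have h2 := abs_sub (e.2.2.2 - B2.2.2.2 - (A.2.2.2 + F * (a - a'))) (B1.2.2.2 - F * (b - b'))
    have h3 := abs_sub (e.2.2.2 - B2.2.2.2) (A.2.2.2 + F * (a - a'))
    have h4 := abs_sub e.2.2.2 B2.2.2.2
    have h5 : C * (3 * ε) * x + C * (ε * (C + 4)) * w ≤ C * (C + 4) * ε * (x + Y + w) := by
      have p1 : 0 ≤ C * ε * x * (C + 1) := by positivity
      have p2 : 0 ≤ C * (C + 4) * ε * Y := by positivity
      linarith
    have h6 : (C * (C + 4) + C * (C + 1)) * (ε * (x + Y + w)) ≤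
        C * (C + 5) * (C + 1) * (ε * (x + Y + w)) := by
      apply mul_le_mul_of_nonneg_right _ (by positivity)
      have : 0 ≤ C * (C * C + 4 * C) := by positivity
      linarith
    linarith
  have hsum2 : x + w ≤ |(a - a') + (b - b')| + |(b - b') - (a - a')| := by
    rw [hx, hw]
    have h1 := abs_add_le ((a - a') + (b - b')) (-((b - b') - (a - a')))
    have h2 := abs_add_le ((a - a') + (b - b')) ((b - b') - (a - a'))
    rw [abs_neg] at h1
    rw [show (a - a') + (b - b') + -((b - b') - (a - a')) = 2 * (a - a') by ring, abs_mul,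
      abs_two] at h1
    rw [show (a - a') + (b - b') + ((b - b') - (a - a')) = 2 * (b - b') by ring, abs_mul,
      abs_two] at h2
    linarith
  rw [hp] at hep
  have hdiff' : |(b - b') - (a - a')| ≤
      1 / F * E + C * (C + 5) * (C + 1) / F * (ε * (x + Y + w)) := by
    rw [show 1 / F * E + C * (C + 5) * (C + 1) / F * (ε * (x + Y + w)) =
      (E + C * (C + 5) * (C + 1) * ε * (x + Y + w)) / F by field_simp, le_div_iff₀ hF]
    linarith
  have hxw : x + w ≤ (1 + 1 / F) * E + C * (C + 5) * (C + 1) / F * (ε * (x + Y + w)) := by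
    linarith
  have hfin : x + Y + w ≤ ((1 + C) * (1 + 1 / F) + 1) * E + B * (ε * (x + Y + w)) := by
    have h1 := mul_le_mul_of_nonneg_left hxw (by linarith : 0 ≤ 1 + C)
    have h2 : B * (ε * (x + Y + w)) = (1 + C) * (C * (C + 5) * (C + 1) / F * (ε * (x + Y + w))) +
        C * (C + 1) * ε * (x + Y + w) := by
      rw [hB]; ring
    rw [h2]
    linarith
  have h3 := mul_le_mul_of_nonneg_right hε2 hX0
  rw [← hx, ← hY, ← hw, ← hE]
  linarith

end Algebra

/-! ### Strengths of the classes of fronts and the interaction potential -/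

/-- The strengths of the classes of weak fronts: shocks and rarefaction waves of the first family,
contact discontinuities, shocks and rarefaction waves of the fourth family, non-physical fronts. -/
abbrev WaveVec := Fin 6 → ℝ

/-- The opposite orders of the two parts reflect that, going upwards, pressure rises across a
$1$-shock and across a $4$-rarefaction. -/
def waveVec : NLFamily → ℝ → WaveVec
  | .one, s => ![max s 0, max (-s) 0, 0, 0, 0, 0]
  | .four, s => ![0, 0, 0, max (-s) 0, max s 0, 0]

def contactVec (x : ℝ) : WaveVec := ![0, 0, x, 0, 0, 0]

def npVec (x : ℝ) : WaveVec := ![0, 0, 0, 0, 0, x]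

def mass (x : WaveVec) : ℝ := ∑ i, x i

/-- The interaction of the waves `x` with waves `y` above them that approach them. -/
def approach (x y : WaveVec) : ℝ :=
  x 0 * (y 0 + y 1) + x 1 * y 0 + x 2 * (y 0 + y 1) + x 3 * (y 0 + y 1 + y 2 + y 3 + y 4) +
    x 4 * (y 0 + y 1 + y 2 + y 3) + x 5 * (y 0 + y 1 + y 2 + y 3 + y 4)

theorem mass_eq (x : WaveVec) : mass x = x 0 + x 1 + x 2 + x 3 + x 4 + x 5 := by
  simp [mass, Fin.sum_univ_succ]; ring

theorem mass_add (x y : WaveVec) : mass (x + y) = mass x + mass y := by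
  simp [mass, Finset.sum_add_distrib]

theorem mass_nonneg {x : WaveVec} (h : 0 ≤ x) : 0 ≤ mass x := Finset.sum_nonneg fun i _ => h i

theorem le_mass {x : WaveVec} (h : 0 ≤ x) (i : Fin 6) : x i ≤ mass x :=
  Finset.single_le_sum (fun i _ => h i) (Finset.mem_univ i)

theorem mass_zero : mass 0 = 0 := by simp [mass]

theorem max_add_max_neg (s : ℝ) : max s 0 + max (-s) 0 = |s| := by
  rcases le_total 0 s with h | h
  · rw [max_eq_left h, max_eq_right (by linarith), abs_of_nonneg h, add_zero]
  · rw [max_eq_right h, max_eq_left (by linarith), abs_of_nonpos h, zero_add]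

theorem mass_waveVec (d : NLFamily) (s : ℝ) : mass (waveVec d s) = |s| := by
  cases d <;> simp [waveVec, mass_eq, add_comm]

theorem mass_contactVec (x : ℝ) : mass (contactVec x) = x := by simp [contactVec, mass_eq]

theorem mass_npVec (x : ℝ) : mass (npVec x) = x := by simp [npVec, mass_eq]

theorem waveVec_nonneg (d : NLFamily) (s : ℝ) : 0 ≤ waveVec d s := by
  intro i
  cases d <;> fin_cases i <;> simp [waveVec]

theorem contactVec_nonneg {x : ℝ} (h : 0 ≤ x) : 0 ≤ contactVec x := by
  intro i
  fin_cases i <;> simp [contactVec, h]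

theorem npVec_nonneg {x : ℝ} (h : 0 ≤ x) : 0 ≤ npVec x := by
  intro i
  fin_cases i <;> simp [npVec, h]

theorem waveVec_zero (d : NLFamily) : waveVec d 0 = 0 := by
  funext i
  cases d <;> fin_cases i <;> simp [waveVec]

theorem contactVec_zero : contactVec 0 = 0 := by
  funext i
  fin_cases i <;> simp [contactVec]

theorem npVec_zero : npVec 0 = 0 := by
  funext i
  fin_cases i <;> simp [npVec]

theorem waveVec_add (d : NLFamily) {s t : ℝ} (h : 0 ≤ s * t) :
    waveVec d (s + t) = waveVec d s + waveVec d t := by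
  have h1 : max (s + t) 0 = max s 0 + max t 0 ∧ max (-(s + t)) 0 = max (-s) 0 + max (-t) 0 := by
    rcases mul_nonneg_iff.1 h with ⟨h1, h2⟩ | ⟨h1, h2⟩
    · rw [max_eq_left h1, max_eq_left h2, max_eq_left (by linarith), max_eq_right (by linarith),
        max_eq_right (by linarith), max_eq_right (by linarith)]
      simp
    · rw [max_eq_right h1, max_eq_right h2, max_eq_right (by linarith), max_eq_left (by linarith),
        max_eq_left (by linarith), max_eq_left (by linarith)]
      exact ⟨by ring, by ring⟩
  funext i
  cases d <;> fin_cases i <;> first | exact h1.1 | exact h1.2 | exact (add_zero 0).symm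

/-- Waves of opposite sign cancel, so only an inequality holds, in the favourable direction;
cancellation needs no separate accounting. -/
theorem waveVec_add_le (d : NLFamily) (s t : ℝ) (i : Fin 6) :
    waveVec d (s + t) i ≤ waveVec d s i + waveVec d t i := by
  have h1 : max (s + t) 0 ≤ max s 0 + max t 0 := max_le
    (add_le_add (le_max_left _ _) (le_max_left _ _))
    (add_nonneg (le_max_right _ _) (le_max_right _ _))
  have h2 : max (-(s + t)) 0 ≤ max (-s) 0 + max (-t) 0 := max_le
    (by rw [neg_add]; exact add_le_add (le_max_left _ _) (le_max_left _ _))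
    (add_nonneg (le_max_right _ _) (le_max_right _ _))
  cases d <;> fin_cases i <;> first | exact h1 | exact h2 | exact (add_zero (0 : ℝ)).symm.le

theorem waveVec_le (d : NLFamily) (s t : ℝ) (i : Fin 6) :
    waveVec d s i ≤ waveVec d t i + |s - t| := by
  have h := waveVec_add_le d t (s - t) i
  rw [add_sub_cancel] at h
  have h2 := le_mass (waveVec_nonneg d (s - t)) i
  rw [mass_waveVec] at h2
  linarith

theorem contactVec_le (x y : ℝ) (i : Fin 6) : contactVec x i ≤ contactVec y i + |x - y| := by
  have := le_abs_self (x - y)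
  fin_cases i <;> simp [contactVec]
  linarith

theorem npVec_le (x y : ℝ) (i : Fin 6) : npVec x i ≤ npVec y i + |x - y| := by
  have := le_abs_self (x - y)
  fin_cases i <;> simp [npVec]
  linarith

theorem approach_add_left (x x' y : WaveVec) :
    approach (x + x') y = approach x y + approach x' y := by
  simp only [approach, Pi.add_apply]; ring

theorem approach_add_right (x y y' : WaveVec) :
    approach x (y + y') = approach x y + approach x y' := by
  simp only [approach, Pi.add_apply]; ring

theorem approach_zero_left (y : WaveVec) : approach 0 y = 0 := by simp [approach]

theorem approach_zero_right (x : WaveVec) : approach x 0 = 0 := by simp [approach]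

theorem approach_nonneg {x y : WaveVec} (hx : 0 ≤ x) (hy : 0 ≤ y) : 0 ≤ approach x y := by
  have := hx 0; have := hx 1; have := hx 2; have := hx 3; have := hx 4; have := hx 5
  have := hy 0; have := hy 1; have := hy 2; have := hy 3; have := hy 4
  simp only [Pi.zero_apply] at *
  unfold approach
  positivity

theorem approach_mono_right {x y y' : WaveVec} (hx : 0 ≤ x) (h : y ≤ y') :
    approach x y ≤ approach x y' := by
  have h1 := approach_nonneg hx (sub_nonneg.2 h)
  have h2 := approach_add_right x y (y' - y)
  rw [add_sub_cancel] at h2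
  linarith

theorem approach_mono_left {x x' y : WaveVec} (hy : 0 ≤ y) (h : x ≤ x') :
    approach x y ≤ approach x' y := by
  have h1 := approach_nonneg (sub_nonneg.2 h) hy
  have h2 := approach_add_left x (x' - x) y
  rw [add_sub_cancel] at h2
  linarith

theorem approach_le_mass {x y : WaveVec} (hx : 0 ≤ x) (hy : 0 ≤ y) :
    approach x y ≤ mass x * mass y := by
  have a0 := hx 0; have a1 := hx 1; have a2 := hx 2; have a3 := hx 3
  have a4 := hx 4; have a5 := hx 5
  have b0 := hy 0; have b1 := hy 1; have b2 := hy 2; have b3 := hy 3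
  have b4 := hy 4; have b5 := hy 5
  simp only [Pi.zero_apply] at *
  rw [mass_eq, mass_eq, approach]
  have : 0 ≤ x 0 * (y 2 + y 3 + y 4 + y 5) + x 1 * (y 1 + y 2 + y 3 + y 4 + y 5) +
    x 2 * (y 2 + y 3 + y 4 + y 5) + x 3 * y 5 + x 4 * (y 4 + y 5) + x 5 * y 5 := by positivity
  linarith

/-- The change of the coordinates across a front. -/
def Front.jump (f : Front) : FlowCoord := coord f.hi - coord f.lo

/-- The change of `log p` across a front. -/
def Front.pressureJump (f : Front) : ℝ := (coord f.hi).2.2.1 - (coord f.lo).2.2.1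

/-- Nonlinear waves are measured by $\log p$ because, unlike $\lambda_d$, it does not jump across
contacts and the strong front. The strong front contributes nothing; its deviation from the
background enters the functional separately. -/
def Front.vec (f : Front) : WaveVec :=
  match f.kind with
  | .nonlinear d => waveVec d f.pressureJump
  | .contact => contactVec ‖f.jump‖
  | .strong => 0
  | .nonphysical => npVec ‖f.jump‖

theorem Front.vec_nonneg (f : Front) : 0 ≤ f.vec := by
  unfold Front.vec
  cases f.kind
  · exact waveVec_nonneg _ _
  · exact contactVec_nonneg (norm_nonneg _)
  · exact le_rfl
  · exact npVec_nonneg (norm_nonneg _)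

def vecSum (fs : List Front) : WaveVec := (fs.map Front.vec).sum

theorem vecSum_nil : vecSum [] = 0 := rfl

theorem vecSum_cons (f : Front) (fs : List Front) : vecSum (f :: fs) = f.vec + vecSum fs := by
  simp [vecSum]

theorem vecSum_append (fs gs : List Front) : vecSum (fs ++ gs) = vecSum fs + vecSum gs := by
  simp [vecSum]

theorem vecSum_nonneg (fs : List Front) : 0 ≤ vecSum fs := by
  induction fs with
  | nil => exact le_rfl
  | cons f fs ih => rw [vecSum_cons]; exact add_nonneg f.vec_nonneg ih

/-- The interaction potential. -/
def potential : List Front → ℝ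
  | [] => 0
  | f :: fs => approach f.vec (vecSum fs) + potential fs

theorem potential_append (fs gs : List Front) :
    potential (fs ++ gs) = potential fs + potential gs + approach (vecSum fs) (vecSum gs) := by
  induction fs with
  | nil => simp [potential, vecSum_nil, approach_zero_left]
  | cons f fs ih =>
    rw [List.cons_append, potential, potential, ih, vecSum_append, vecSum_cons, approach_add_left,
      approach_add_right]
    ring

theorem potential_nonneg (fs : List Front) : 0 ≤ potential fs := by
  induction fs with
  | nil => exact le_rfl
  | cons f fs ih => exact add_nonneg (approach_nonneg f.vec_nonneg (vecSum_nonneg fs)) ih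

theorem potential_le (fs : List Front) : potential fs ≤ mass (vecSum fs) ^ 2 := by
  induction fs with
  | nil => simp [potential, vecSum_nil, mass_zero]
  | cons f fs ih =>
    rw [potential, vecSum_cons, mass_add]
    have h1 := approach_le_mass f.vec_nonneg (vecSum_nonneg fs)
    have h2 := mass_nonneg f.vec_nonneg
    have h3 := mass_nonneg (vecSum_nonneg fs)
    have := mul_nonneg h2 h3
    have := sq_nonneg (mass f.vec)
    linarith

/-- The change of the potential when a part of the fronts is replaced. -/
theorem potential_replace_le (pre old new post : List Front) {e : WaveVec} (he : 0 ≤ e)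
    (h : vecSum new ≤ vecSum old + e) :
    potential (pre ++ new ++ post) ≤ potential (pre ++ old ++ post) + potential new -
      potential old + mass e * (mass (vecSum pre) + mass (vecSum post)) := by
  rw [potential_append, potential_append, potential_append, potential_append, vecSum_append,
    vecSum_append, approach_add_left, approach_add_left]
  have h1 := approach_mono_right (vecSum_nonneg pre) h
  have h2 := approach_mono_left (vecSum_nonneg post) h
  rw [approach_add_right] at h1
  rw [approach_add_left] at h2
  have h3 := approach_le_mass (vecSum_nonneg pre) he
  have h4 := approach_le_mass he (vecSum_nonneg post)
  linarith

/-! ### Linked fronts -/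

theorem linked_append {U V : State} {fs gs : List Front} :
    Linked U (fs ++ gs) V ↔ ∃ M, Linked U fs M ∧ Linked M gs V := by
  induction fs generalizing U with
  | nil => simp [Linked]
  | cons f fs ih => simp [Linked, ih, and_assoc]

theorem linked_cons {U V : State} {f : Front} {fs : List Front} :
    Linked U (f :: fs) V ↔ f.lo = U ∧ Linked f.hi fs V := Iff.rfl

theorem linked_singleton {U V : State} {f : Front} : Linked U [f] V ↔ f.lo = U ∧ f.hi = V := Iff.rfl

/-! ### Weak fronts -/

/-- A weak front with both states near `U₀`. -/
structure SmallFront (P : Params) (U₀ : State) (ρ : ℝ) (f : Front) : Prop where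
  admissible : f.Admissible P
  ne_strong : f.kind ≠ .strong
  near_lo : Near U₀ ρ f.lo
  near_hi : Near U₀ ρ f.hi

theorem SmallFront.mono {P : Params} {U₀ : State} {ρ ρ' : ℝ} {f : Front}
    (h : SmallFront P U₀ ρ f) (hρ : ρ ≤ ρ') : SmallFront P U₀ ρ' f :=
  ⟨h.1, h.2, h.3.mono hρ, h.4.mono hρ⟩

theorem Near.sub_norm_le {U₀ U V : State} {ρ : ℝ} (hU : Near U₀ ρ U) (hV : Near U₀ ρ V) :
    ‖coord U - coord V‖ ≤ 2 * ρ := by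
  have := norm_sub_le (coord U - coord U₀) (coord V - coord U₀)
  rw [sub_sub_sub_cancel_right] at this
  linarith [hU.2, hV.2]

theorem Near.pressure_sub_le {U₀ U V : State} {ρ : ℝ} (hU : Near U₀ ρ U) (hV : Near U₀ ρ V) :
    |(coord U).2.2.1 - (coord V).2.2.1| ≤ 2 * ρ :=
  (FlowCoord.abs_trd_le (coord U - coord V)).trans (hU.sub_norm_le hV)

theorem Front.jump_eq_of_contact {f : Front} (hlo : Physical f.lo)
    (h : ∃ σ₃ σ₂, f.hi = contactMap σ₃ σ₂ f.lo) : f.jump = (f.sigma3, f.sigma2, 0, 0) := by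
  obtain ⟨σ₃, σ₂, h⟩ := h
  have h1 := sigma_of_contactMap hlo σ₃ σ₂
  rw [Front.jump, Front.sigma2, Front.sigma3, h, h1.1, h1.2, coord_contactMap hlo]
  simp

section Front

variable {P : Params} {U₀ : State} {C ρ : ℝ} {f : Front} {d : NLFamily}

theorem Region.jump_nonlinear (R : Region P.γ U₀ C ρ) (h : SmallFront P U₀ ρ f)
    (hk : f.kind = .nonlinear d) : f.jump = disp P.γ d f.pressureJump (coord f.lo) := by
  have ha := h.admissible
  unfold Front.Admissible at ha
  rw [hk] at ha
  have h1 := R.wave_eq d f.lo f.hi h.near_lo h.near_hi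
    (ha.2.imp (fun h => h.1) (fun ⟨σ, h⟩ => ⟨σ, h.1⟩))
  rw [Front.jump, Front.pressureJump, h1]
  simp [disp]

theorem SmallFront.jump_contact (h : SmallFront P U₀ ρ f) (hk : f.kind = .contact) :
    f.jump = (f.sigma3, f.sigma2, 0, 0) := by
  have ha := h.admissible
  unfold Front.Admissible at ha
  rw [hk] at ha
  exact Front.jump_eq_of_contact h.near_lo.1 ha.2.1

theorem Region.coord_hi_nonlinear (R : Region P.γ U₀ C ρ) (h : SmallFront P U₀ ρ f)
    (hk : f.kind = .nonlinear d) :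
    coord f.hi = coord f.lo + disp P.γ d f.pressureJump (coord f.lo) := by
  rw [← R.jump_nonlinear h hk, Front.jump, add_sub_cancel]

theorem Front.coord_hi (f : Front) : coord f.hi = coord f.lo + f.jump := by
  rw [Front.jump, add_sub_cancel]

theorem Region.signed_eq (R : Region P.γ U₀ C ρ) (h : SmallFront P U₀ ρ f)
    (hk : f.kind = .nonlinear d) :
    f.signed P.γ d = lamJump P.γ d f.pressureJump (coord f.lo) := by
  rw [Front.signed, lamJump, ← R.coord_hi_nonlinear h hk, lam_eq_lamC R.one_lt h.near_lo.1,
    lam_eq_lamC R.one_lt h.near_hi.1]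

theorem SmallFront.abs_pressureJump_le (h : SmallFront P U₀ ρ f) : |f.pressureJump| ≤ 2 * ρ :=
  h.near_hi.pressure_sub_le h.near_lo

theorem Region.norm_jump_le (R : Region P.γ U₀ C ρ) (h : SmallFront P U₀ (ρ / 2) f) :
    ‖f.jump‖ ≤ C * mass f.vec := by
  have h' := h.mono (by linarith [R.pos] : ρ / 2 ≤ ρ)
  have hs := h.abs_pressureJump_le
  cases hk : f.kind with
  | nonlinear d =>
    rw [R.jump_nonlinear h' hk, Front.vec, hk]
    simp only
    rw [mass_waveVec]
    exact (R.waves d).disp_norm R.pos.le (by linarith) h'.near_lo.2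
  | contact =>
    rw [Front.vec, hk]
    simp only
    rw [mass_contactVec]
    exact le_mul_of_one_le_left (norm_nonneg _) R.one_le
  | strong => exact absurd hk h.ne_strong
  | nonphysical =>
    rw [Front.vec, hk]
    simp only
    rw [mass_npVec]
    exact le_mul_of_one_le_left (norm_nonneg _) R.one_le

theorem Region.dist_le (R : Region P.γ U₀ C ρ) (h : SmallFront P U₀ (ρ / 2) f) :
    dist f.hi f.lo ≤ C * (C * mass f.vec) := by
  have h' := h.mono (by linarith [R.pos] : ρ / 2 ≤ ρ)
  exact (R.coords.dist_le _ _ h.near_hi.1 h.near_lo.1 h'.near_hi.2 h'.near_lo.2).trans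
    (mul_le_mul_of_nonneg_left (R.norm_jump_le h) (by linarith [R.one_le]))

/-- The way back from the measure of the functional to the strengths defined by $\lambda_d$,
$(\sigma_2,\sigma_3)$ and the Euclidean norm: each of these is Lipschitz in the jump of the
coordinates. -/
theorem Region.strength_le (R : Region P.γ U₀ C ρ) (h : SmallFront P U₀ (ρ / 2) f) :
    f.strength P.γ ≤ 2 * (C * (C * mass f.vec)) := by
  have h' := h.mono (by linarith [R.pos] : ρ / 2 ≤ ρ)
  have hC := R.one_le
  have hm := mass_nonneg f.vec_nonneg
  have h1 := R.norm_jump_le h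
  have h2 := mul_le_mul_of_nonneg_left h1 (by linarith : 0 ≤ C)
  have h3 : 0 ≤ C * (C * mass f.vec) := by positivity
  have h4 : C * mass f.vec ≤ C * (C * mass f.vec) := le_mul_of_one_le_left (by positivity) hC
  cases hk : f.kind with
  | nonlinear d =>
    simp only [Front.strength, hk]
    rw [Front.signed, lam_eq_lamC R.one_lt h.near_lo.1, lam_eq_lamC R.one_lt h.near_hi.1]
    have := (R.waves d).lamC_sub _ _ h'.near_hi.2 h'.near_lo.2
    rw [show coord f.hi - coord f.lo = f.jump from rfl] at this
    linarith
  | contact =>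
    simp only [Front.strength, hk]
    have h5 := h.jump_contact hk
    have h6 : |f.sigma3| ≤ ‖f.jump‖ := by
      have := FlowCoord.abs_fst_le f.jump
      rwa [show f.jump.1 = f.sigma3 by rw [h5]] at this
    have h7 : |f.sigma2| ≤ ‖f.jump‖ := by
      have := FlowCoord.abs_snd_le f.jump
      rwa [show f.jump.2.1 = f.sigma2 by rw [h5]] at this
    linarith
  | strong => exact absurd hk h.ne_strong
  | nonphysical =>
    simp only [Front.strength, hk]
    have := R.dist_le h
    rw [dist_eq_norm] at this
    linarith

end Front

/-! ### Fans -/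

theorem IsRarefaction.supersonic {γ : ℝ} {d : NLFamily} {lo hi : State}
    (h : IsRarefaction γ d lo hi) : Supersonic γ lo ∧ Supersonic γ hi := by
  obtain ⟨α, hα, w, h0, h1, hw⟩ := h
  have a := (hw 0 ⟨le_rfl, hα.le⟩).1
  have b := (hw α ⟨hα.le, le_rfl⟩).1
  rw [h0] at a
  rw [h1] at b
  exact ⟨a, b⟩

/-- The partial order in which the coordinates change along rarefaction curves. -/
def RareLE (d : NLFamily) (z z' : FlowCoord) : Prop :=
  0 ≤ d.sign * (z'.1 - z.1) ∧ d.sign * (z'.2.1 - z.2.1) ≤ 0 ∧ 0 ≤ d.sign * (z'.2.2.1 - z.2.2.1) ∧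
    z.2.2.2 ≤ z'.2.2.2

theorem RareLE.refl (d : NLFamily) (z : FlowCoord) : RareLE d z z := by simp [RareLE]

theorem RareLE.trans {d : NLFamily} {x y z : FlowCoord} (h : RareLE d x y) (h' : RareLE d y z) :
    RareLE d x z := by
  obtain ⟨a1, a2, a3, a4⟩ := h
  obtain ⟨b1, b2, b3, b4⟩ := h'
  refine ⟨?_, ?_, ?_, a4.trans b4⟩ <;> linarith

theorem abs_sub_le_of_between {ε a b x m ρ : ℝ} (hε : |ε| = 1) (h1 : 0 ≤ ε * (x - a))
    (h2 : 0 ≤ ε * (b - x)) (ha : |a - m| ≤ ρ) (hb : |b - m| ≤ ρ) : |x - m| ≤ ρ := by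
  rw [abs_le] at *
  rcases (abs_eq zero_le_one).1 hε with h | h <;> rw [h] at h1 h2 <;> constructor <;> linarith

theorem RareLE.norm_sub_le {d : NLFamily} {x y z m : FlowCoord} {ρ : ℝ} (h : RareLE d x y)
    (h' : RareLE d y z) (hx : ‖x - m‖ ≤ ρ) (hz : ‖z - m‖ ≤ ρ) : ‖y - m‖ ≤ ρ := by
  obtain ⟨a1, a2, a3, a4⟩ := h
  obtain ⟨b1, b2, b3, b4⟩ := h'
  have hd := d.abs_sign
  refine FlowCoord.norm_le ?_ ?_ ?_ ?_
  · exact abs_sub_le_of_between hd a1 b1 ((FlowCoord.abs_fst_le _).trans hx)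
      ((FlowCoord.abs_fst_le _).trans hz)
  · exact abs_sub_le_of_between (ε := -d.sign) (by rwa [abs_neg]) (by linarith) (by linarith)
      ((FlowCoord.abs_snd_le _).trans hx) ((FlowCoord.abs_snd_le _).trans hz)
  · exact abs_sub_le_of_between hd a3 b3 ((FlowCoord.abs_trd_le _).trans hx)
      ((FlowCoord.abs_trd_le _).trans hz)
  · exact abs_sub_le_of_between (ε := 1) (by simp) (by linarith) (by linarith)
      ((FlowCoord.abs_fth_le _).trans hx) ((FlowCoord.abs_fth_le _).trans hz)

theorem IsRarefaction.rareLE {γ : ℝ} (hγ : 1 < γ) {d : NLFamily} {lo hi : State}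
    (h : IsRarefaction γ d lo hi) : RareLE d (coord lo) (coord hi) := by
  obtain ⟨h1, -, h2, h3, h4⟩ := h.coord_eq hγ rfl
  exact ⟨h2, h3, h1.le, h4⟩

theorem approach_rarefaction {d : NLFamily} {s t : ℝ} (hs : 0 ≤ d.sign * s)
    (ht : 0 ≤ d.sign * t) : approach (waveVec d s) (waveVec d t) = 0 := by
  cases d <;> simp only [NLFamily.sign] at hs ht
  · have h1 : max s 0 = 0 := max_eq_right (by linarith)
    have h2 : max t 0 = 0 := max_eq_right (by linarith)
    simp [approach, waveVec, h1, h2]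
  · have h1 : max (-s) 0 = 0 := max_eq_right (by linarith)
    have h2 : max (-t) 0 = 0 := max_eq_right (by linarith)
    simp [approach, waveVec, h1, h2]

theorem mul_nonneg_of_sign {d : NLFamily} {s t : ℝ} (hs : 0 ≤ d.sign * s)
    (ht : 0 ≤ d.sign * t) : 0 ≤ s * t := by
  have := mul_nonneg hs ht
  have h := d.sign_mul_self
  rwa [mul_mul_mul_comm, h, one_mul] at this

/-- Every coordinate is monotone along a rarefaction. Thus the intermediate states lie between the
end states and are as close to the background, whatever the number of fronts. The pressure changes
have one sign, so the strengths add exactly and no two fronts of the fan approach. -/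
theorem rarefaction_chain {γ : ℝ} (hγ : 1 < γ) {d : NLFamily} {lo hi : State} {fs : List Front}
    (hl : Linked lo fs hi)
    (hfs : ∀ f ∈ fs, f.kind = .nonlinear d ∧ IsRarefaction γ d f.lo f.hi) :
    RareLE d (coord lo) (coord hi) ∧
      vecSum fs = waveVec d ((coord hi).2.2.1 - (coord lo).2.2.1) ∧ potential fs = 0 ∧
      ∀ f ∈ fs, RareLE d (coord lo) (coord f.lo) ∧ RareLE d (coord f.hi) (coord hi) := by
  induction fs generalizing lo with
  | nil =>
    have : lo = hi := hl
    rw [this]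
    exact ⟨RareLE.refl _ _, by simp [vecSum_nil, waveVec_zero], rfl, by simp⟩
  | cons f fs ih =>
    obtain ⟨h1, h2⟩ := linked_cons.1 hl
    obtain ⟨i1, i2, i3, i4⟩ := ih h2 fun g hg => hfs g (List.mem_cons_of_mem _ hg)
    obtain ⟨hk, hf⟩ := hfs f List.mem_cons_self
    have hr := hf.rareLE hγ
    rw [h1] at hr
    have hv : f.vec = waveVec d ((coord f.hi).2.2.1 - (coord lo).2.2.1) := by
      rw [Front.vec, hk, Front.pressureJump, h1]
    refine ⟨hr.trans i1, ?_, ?_, ?_⟩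
    · rw [vecSum_cons, hv, i2, ← waveVec_add d (mul_nonneg_of_sign hr.2.2.1 i1.2.2.1)]
      congr 1
      ring
    · rw [potential, hv, i2, i3, approach_rarefaction hr.2.2.1 i1.2.2.1, add_zero]
    · intro g hg
      rcases List.mem_cons.1 hg with rfl | hg
      · rw [h1]
        exact ⟨RareLE.refl _ _, i1⟩
      · exact ⟨hr.trans (i4 g hg).1, (i4 g hg).2⟩

section Fan

variable {P : Params} {U₀ : State} {C ρ : ℝ}

theorem Region.fan (R : Region P.γ U₀ C ρ) {ρ₁ : ℝ} (hρ : ρ₁ ≤ ρ) {d : NLFamily} {lo hi : State}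
    {fs : List Front} (h : IsFan P d lo hi fs) (hlo : Near U₀ ρ₁ lo) (hhi : Near U₀ ρ₁ hi) :
    (∀ f ∈ fs, SmallFront P U₀ ρ₁ f) ∧
      vecSum fs = waveVec d ((coord hi).2.2.1 - (coord lo).2.2.1) ∧ potential fs = 0 ∧
      coord hi = coord lo + disp P.γ d ((coord hi).2.2.1 - (coord lo).2.2.1) (coord lo) := by
  obtain ⟨-, hl, ha, h⟩ := h
  rcases h with ⟨rfl, rfl⟩ | ⟨hs, hlen⟩ | ⟨hr, -, hf⟩
  · have hd := (R.waves d).disp_zero (coord lo) (hlo.2.trans hρ)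
    exact ⟨by simp, by simp [vecSum_nil, waveVec_zero], rfl, by simp [hd]⟩
  · obtain ⟨f, rfl⟩ := List.length_eq_one_iff.1 hlen
    obtain ⟨h1, h2⟩ := linked_singleton.1 hl
    obtain ⟨hk, hadm⟩ := ha f List.mem_cons_self
    refine ⟨?_, ?_, ?_, R.wave_eq d lo hi (hlo.mono hρ) (hhi.mono hρ) (Or.inr hs)⟩
    · intro g hg
      rw [List.mem_singleton.1 hg]
      exact ⟨hadm, by simp [hk], h1 ▸ hlo, h2 ▸ hhi⟩
    · rw [vecSum_cons, vecSum_nil, add_zero, Front.vec, hk, Front.pressureJump, h1, h2]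
    · simp [potential, vecSum_nil, approach_zero_right]
  · obtain ⟨-, h2, h3, h4⟩ := rarefaction_chain R.one_lt hl fun f hm => ⟨(ha f hm).1, (hf f hm).1⟩
    refine ⟨?_, h2, h3, R.wave_eq d lo hi (hlo.mono hρ) (hhi.mono hρ) (Or.inl hr)⟩
    intro f hm
    have hw := (hf f hm).1.rareLE R.one_lt
    have hp := (hf f hm).1.supersonic
    exact ⟨(ha f hm).2, by simp [(ha f hm).1],
      ⟨hp.1.physical, (h4 f hm).1.norm_sub_le (hw.trans (h4 f hm).2) hlo.2 hhi.2⟩,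
      ⟨hp.2.physical, ((h4 f hm).1.trans hw).norm_sub_le (h4 f hm).2 hlo.2 hhi.2⟩⟩

/-- The states reached by weak waves from states at distance `ρ₁` of `U₀`. -/
structure SmallScale (P : Params) (C ρ ρ₁ : ℝ) : Prop where
  pos : 0 < ρ₁
  le : 16 * (C * ρ₁) ≤ ρ
  le_one : 16 * (C * (C * ρ₁)) ≤ 1
  weak : C * P.weak ≤ ρ₁

theorem SmallScale.le' (R : Region P.γ U₀ C ρ) {ρ₁ : ℝ} (S : SmallScale P C ρ ρ₁) :
    16 * ρ₁ ≤ ρ := by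
  have := le_mul_of_one_le_left S.pos.le R.one_le
  linarith [S.le]

theorem Region.near_of_dist (R : Region P.γ U₀ C ρ) {ρ₁ σ : ℝ} (S : SmallScale P C ρ ρ₁)
    {U V : State} (hU : Near U₀ σ U) (hd : dist U V ≤ P.weak) (hσ : σ ≤ 2 * ρ₁) :
    Near U₀ (σ + ρ₁) V := by
  have hC := R.one_le
  have h0 : 0 ≤ P.weak := dist_nonneg.trans hd
  have h1 : P.weak ≤ C * P.weak := le_mul_of_one_le_left h0 hC
  have h2 := S.le' R
  have h3 := S.le
  have h4 := mul_le_mul_of_nonneg_left hσ (by linarith : 0 ≤ C)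
  have h5 := S.weak
  have h6 := S.pos
  exact (R.coords.near R.physical (by linarith) hU hd (by linarith) (by linarith)).mono
    (by linarith)

/-- Outgoing waves: a `1`-wave, a contact discontinuity, a `4`-wave and a non-physical front. -/
structure Outgoing (P : Params) (U₀ : State) (ρ : ℝ) (lo hi : State) (new : List Front) (a : ℝ)
    (y : FlowCoord) (b : ℝ) (n : FlowCoord) : Prop where
  small : ∀ f ∈ new, SmallFront P U₀ ρ f
  linked : Linked lo new hi
  potential_eq : potential new = 0
  vec_eq : vecSum new = waveVec .one a + contactVec ‖y‖ + waveVec .four b + npVec ‖n‖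
  coord_eq : coord hi = coord lo + fanDisp P.γ a y b (coord lo) + n
  contact : y.2.2 = 0
  abs_one : |a| ≤ 2 * ρ
  norm_contact : ‖y‖ ≤ 2 * ρ
  abs_four : |b| ≤ 2 * ρ

/-- Waves in increasing order of families do not approach; hence the outgoing fronts of a Riemann
solver have zero potential. -/
theorem approach_ordered (a c b x : ℝ) :
    approach (waveVec .one a) (contactVec c) = 0 ∧
    approach (waveVec .one a) (waveVec .four b) = 0 ∧
    approach (contactVec c) (waveVec .four b) = 0 ∧
    approach (waveVec .one a) (npVec x) = 0 ∧ approach (contactVec c) (npVec x) = 0 ∧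
    approach (waveVec .four b) (npVec x) = 0 := by
  refine ⟨?_, ?_, ?_, ?_, ?_, ?_⟩ <;> simp [approach, waveVec, contactVec, npVec]

theorem AccurateWeak.outgoing (R : Region P.γ U₀ C ρ) {ρ₁ : ℝ} (S : SmallScale P C ρ ρ₁)
    {lo hi : State} {new : List Front} (h : AccurateWeak P lo hi new) (hlo : Near U₀ ρ₁ lo)
    (hhi : Near U₀ ρ₁ hi) : ∃ a y b, Outgoing P U₀ (3 * ρ₁) lo hi new a y b 0 := by
  obtain ⟨m₁, m₂, F₁, F₂, F₄, rfl, h1, h2, h4⟩ := h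
  have h0 := S.pos
  -- The size bound on the two outer waves locates both intermediate states, one from `lo` and one
  -- from `hi`; uniqueness of the Riemann solution is not needed.
  have hm₁ : Near U₀ (3 * ρ₁) m₁ := (R.near_of_dist S hlo h1.1 (by linarith)).mono (by linarith)
  have hm₂ : Near U₀ (3 * ρ₁) m₂ := (R.near_of_dist S hhi (by rw [dist_comm]; exact h4.1)
    (by linarith)).mono (by linarith)
  have hlo' : Near U₀ (3 * ρ₁) lo := hlo.mono (by linarith)
  have hhi' : Near U₀ (3 * ρ₁) hi := hhi.mono (by linarith)
  have hρ : 3 * ρ₁ ≤ ρ := by linarith [S.le' R]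
  obtain ⟨p1, p2, p3, p4⟩ := R.fan hρ h1 hlo' hm₁
  obtain ⟨q1, q2, q3, q4⟩ := R.fan hρ h4 hm₂ hhi'
  have hF₂ : (∀ f ∈ F₂, SmallFront P U₀ (3 * ρ₁) f) ∧ Linked m₁ F₂ m₂ ∧ potential F₂ = 0 ∧
      vecSum F₂ = contactVec ‖coord m₂ - coord m₁‖ ∧ (coord m₂ - coord m₁).2.2 = 0 := by
    rcases h2 with ⟨rfl, rfl⟩ | ⟨f, hk, rfl, rfl, ha, rfl⟩
    · exact ⟨by simp, rfl, rfl, by simp [vecSum_nil, contactVec_zero], by simp⟩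
    · have hf : SmallFront P U₀ (3 * ρ₁) f := ⟨ha, by simp [hk], hm₁, hm₂⟩
      refine ⟨by simpa using hf, linked_singleton.2 ⟨rfl, rfl⟩,
        by simp [potential, vecSum_nil, approach_zero_right], ?_, ?_⟩
      · rw [vecSum_cons, vecSum_nil, add_zero, Front.vec, hk]; rfl
      · change f.jump.2.2 = 0
        rw [hf.jump_contact hk]; rfl
  obtain ⟨r1, r2, r3, r4, r5⟩ := hF₂
  obtain ⟨k1, k2, k3, -⟩ := approach_ordered ((coord m₁).2.2.1 - (coord lo).2.2.1)
    ‖coord m₂ - coord m₁‖ ((coord hi).2.2.1 - (coord m₂).2.2.1) 0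
  refine ⟨(coord m₁).2.2.1 - (coord lo).2.2.1, coord m₂ - coord m₁,
    (coord hi).2.2.1 - (coord m₂).2.2.1, ?_, ?_, ?_, ?_, ?_, r5, hm₁.pressure_sub_le hlo',
    hm₂.sub_norm_le hm₁, hhi'.pressure_sub_le hm₂⟩
  · intro f hf
    rcases List.mem_append.1 hf with hf | hf
    · exact (List.mem_append.1 hf).elim (p1 f) (r1 f)
    · exact q1 f hf
  · exact linked_append.2 ⟨m₂, linked_append.2 ⟨m₁, h1.2.1, r2⟩, h4.2.1⟩
  · rw [potential_append, potential_append, vecSum_append, p3, q3, r3, p2, q2, r4,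
      approach_add_left, k1, k2, k3]
    norm_num
  · rw [vecSum_append, vecSum_append, p2, q2, r4, norm_zero, npVec_zero, add_zero]
  · rw [fanDisp, ← sub_eq_of_eq_add' p4]
    rw [show coord lo + (coord m₁ - coord lo) + (coord m₂ - coord m₁) = coord m₂ by abel,
      ← sub_eq_of_eq_add' q4]
    abel

theorem NPTail.linked {t : List Front} {lo hi : State} {ρ₁ : ℝ} (ht : NPTail t)
    (hl : Linked lo t hi) (ha : ∀ h ∈ t, h.Admissible P) (hlo : Near U₀ ρ₁ lo)
    (hhi : Near U₀ ρ₁ hi) : (∀ f ∈ t, SmallFront P U₀ ρ₁ f) ∧ potential t = 0 ∧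
      vecSum t = npVec ‖coord hi - coord lo‖ := by
  rcases ht with rfl | ⟨n, hk, rfl⟩
  · have : lo = hi := hl
    exact ⟨by simp, rfl, by simp [this, vecSum_nil, npVec_zero]⟩
  · obtain ⟨rfl, rfl⟩ := linked_singleton.1 hl
    refine ⟨?_, by simp [potential, vecSum_nil, approach_zero_right], ?_⟩
    · intro f hf
      rw [List.mem_singleton.1 hf]
      exact ⟨ha n List.mem_cons_self, by simp [hk], hlo, hhi⟩
    · rw [vecSum_cons, vecSum_nil, add_zero, Front.vec, hk]; rfl

/-- The size of a front of the first family, and `0` for other fronts. -/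
def Front.onePart (f : Front) : ℝ :=
  match f.kind with
  | .nonlinear .one => f.pressureJump
  | _ => 0

def Front.contactPart (f : Front) : FlowCoord :=
  match f.kind with
  | .contact => f.jump
  | _ => 0

/-- The size of a front of the fourth family, and `0` for other fronts. -/
def Front.fourPart (f : Front) : ℝ :=
  match f.kind with
  | .nonlinear .four => f.pressureJump
  | _ => 0

theorem Front.weakPhysical_iff {f : Front} :
    f.WeakPhysical ↔ f.kind = .nonlinear .one ∨ f.kind = .contact ∨ f.kind = .nonlinear .four := by
  unfold Front.WeakPhysical
  rcases f.kind with (_ | _) | _ | _ | _ <;> simp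

theorem Front.vec_eq_parts {f : Front} (h : f.WeakPhysical) :
    f.vec = waveVec .one f.onePart + contactVec ‖f.contactPart‖ + waveVec .four f.fourPart := by
  rcases Front.weakPhysical_iff.1 h with hk | hk | hk <;>
    simp [Front.vec, Front.onePart, Front.contactPart, Front.fourPart, hk, waveVec_zero,
      contactVec_zero]

theorem Front.mass_eq_parts {f : Front} (h : f.WeakPhysical) :
    mass f.vec = |f.onePart| + ‖f.contactPart‖ + |f.fourPart| := by
  rw [Front.vec_eq_parts h, mass_add, mass_add, mass_waveVec, mass_waveVec, mass_contactVec]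

theorem approach_eq_mass {f g : Front} (hf : f.kind ≠ .strong) (hg : g.WeakPhysical)
    (h : g.kind.rank < f.kind.rank) : approach f.vec g.vec = mass f.vec * mass g.vec := by
  rcases Front.weakPhysical_iff.1 hg with hk | hk | hk <;>
    rcases hk' : f.kind with (_ | _) | _ | _ | _ <;>
    simp [hk, hk', FrontKind.rank] at h hf <;>
    simp [Front.vec, hk, hk', approach, waveVec, contactVec, npVec, mass_eq] <;> ring

/-- The case complementary to `approach_rarefaction`: exactly the pairs of one family whose merging
need not be exact are charged with the full product. -/
theorem approach_same {d : NLFamily} {s t : ℝ} (h : ¬ (0 ≤ d.sign * s ∧ 0 ≤ d.sign * t)) :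
    approach (waveVec d s) (waveVec d t) = |s| * |t| := by
  rw [← max_add_max_neg s, ← max_add_max_neg t]
  by_cases hs : 0 ≤ d.sign * s
  · have ht : ¬ 0 ≤ d.sign * t := fun h' => h ⟨hs, h'⟩
    cases d <;> simp only [NLFamily.sign] at hs ht
    · rw [max_eq_right (by linarith : s ≤ 0), max_eq_right (by linarith : -t ≤ 0),
        max_eq_left (by linarith : 0 ≤ t), max_eq_left (by linarith : 0 ≤ -s)]
      simp [approach, waveVec, max_eq_right (by linarith : s ≤ 0),
        max_eq_left (by linarith : 0 ≤ -s), max_eq_left (by linarith : 0 ≤ t)]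
    · rw [max_eq_left (by linarith : 0 ≤ s), max_eq_left (by linarith : 0 ≤ -t),
        max_eq_right (by linarith : t ≤ 0), max_eq_right (by linarith : -s ≤ 0)]
      simp [approach, waveVec, max_eq_left (by linarith : 0 ≤ s),
        max_eq_left (by linarith : 0 ≤ -t), max_eq_right (by linarith : -s ≤ 0)]
  · cases d <;> simp only [NLFamily.sign] at hs
    · simp [approach, waveVec, max_eq_left (by linarith : 0 ≤ s),
        max_eq_right (by linarith : -s ≤ 0)]
    · simp [approach, waveVec, max_eq_left (by linarith : 0 ≤ -s), max_eq_right (by linarith : s ≤ 0)]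
      exact Or.inl (by rw [add_comm, max_add_max_neg])

end Fan

/-! ### Collisions of weak fronts -/

section Collision

variable {P : Params} {U₀ : State} {C ρ ρ₁ : ℝ}

/-- The converse of `exists_fanDisp_stability`. It bounds the non-physical front of a simplified
solver, which carries the displacement that the physical outgoing waves miss. -/
theorem norm_fanDisp_sub_le {γ : ℝ} {z₀ : FlowCoord} (h : ∀ d, WaveBounds γ z₀ C ρ d)
    (hC : 1 ≤ C) (hρ : 0 ≤ ρ) {ε : ℝ} (hε : ε * (C + 2) ≤ ρ) (hε1 : ε ≤ 1) {a a' b b' : ℝ}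
    {y y' z : FlowCoord} (ha : |a| ≤ ε) (ha' : |a'| ≤ ε) (hb : |b| ≤ ε) (hb' : |b'| ≤ ε)
    (hy : ‖y‖ ≤ ε) (hy' : ‖y'‖ ≤ ε) (hz : ‖z - z₀‖ ≤ ε) :
    ‖fanDisp γ a y b z - fanDisp γ a' y' b' z‖ ≤
      (C + 1) * (C + 1) * (|a - a'| + ‖y - y'‖ + |b - b'|) := by
  have hC0 : 0 ≤ C := by linarith
  have hε0 : 0 ≤ ε := (abs_nonneg _).trans ha
  have hερ : ε ≤ ρ := by nlinarith
  have key : ∀ (a : ℝ) (y : FlowCoord), |a| ≤ ε → ‖y‖ ≤ ε → ‖z + disp γ .one a z + y - z₀‖ ≤ ρ := by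
    intro a y ha hy
    have n1 := (h .one).disp_norm hρ (ha.trans hερ) (hz.trans hερ)
    have c1 := mul_le_mul_of_nonneg_left ha hC0
    have := norm_add₃_le (a := z - z₀) (b := disp γ .one a z) (c := y)
    rw [show z - z₀ + disp γ .one a z + y = z + disp γ .one a z + y - z₀ by abel] at this
    linarith
  have h1 := (h .one).disp_sub a a' z z (ha.trans hερ) (ha'.trans hερ) (hz.trans hερ)
    (hz.trans hερ)
  rw [sub_self, norm_zero, mul_zero, add_zero] at h1
  have h2 := (h .four).disp_sub b b' (z + disp γ .one a z + y) (z + disp γ .one a' z + y')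
    (hb.trans hερ) (hb'.trans hερ) (key a y ha hy) (key a' y' ha' hy')
  have h3 : ‖z + disp γ .one a z + y - (z + disp γ .one a' z + y')‖ ≤ C * |a - a'| + ‖y - y'‖ := by
    rw [show z + disp γ .one a z + y - (z + disp γ .one a' z + y') =
      (disp γ .one a z - disp γ .one a' z) + (y - y') by abel]
    exact (norm_add_le _ _).trans (by linarith)
  have h4 : |b| * ‖z + disp γ .one a z + y - (z + disp γ .one a' z + y')‖ ≤
      C * |a - a'| + ‖y - y'‖ := (mul_le_of_le_one_left (norm_nonneg _) (hb.trans hε1)).trans h3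
  have h5 := mul_le_mul_of_nonneg_left h4 hC0
  have h6 : ‖fanDisp γ a y b z - fanDisp γ a' y' b' z‖ ≤ ‖disp γ .one a z - disp γ .one a' z‖ +
      ‖y - y'‖ + ‖disp γ .four b (z + disp γ .one a z + y) -
        disp γ .four b' (z + disp γ .one a' z + y')‖ := by
    unfold fanDisp
    rw [show ∀ A A' y y' B B' : FlowCoord, A + y + B - (A' + y' + B') =
      (A - A') + (y - y') + (B - B') by intros; abel]
    exact norm_add₃_le
  have p1 := abs_nonneg (a - a')
  have p2 := abs_nonneg (b - b')
  have p3 := norm_nonneg (y - y')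
  have p4 := mul_nonneg hC0 p1
  have p5 := mul_nonneg hC0 p2
  have p6 := mul_nonneg hC0 p3
  have p7 := mul_nonneg hC0 p5
  have p8 := mul_nonneg hC0 p6
  linarith

/-- The jump across a single front, in terms of its parts. -/
theorem Region.coord_hi_eq (R : Region P.γ U₀ C ρ) {f : Front} (hf : SmallFront P U₀ ρ f)
    (hw : f.WeakPhysical) :
    coord f.hi = coord f.lo + fanDisp P.γ f.onePart f.contactPart f.fourPart (coord f.lo) := by
  have hz : disp P.γ .one 0 (coord f.lo) = 0 := (R.waves .one).disp_zero _ hf.near_lo.2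
  rcases Front.weakPhysical_iff.1 hw with hk | hk | hk
  · simp only [Front.onePart, Front.contactPart, Front.fourPart, hk, fanDisp, add_zero]
    rw [← R.coord_hi_nonlinear hf hk, (R.waves .four).disp_zero _ hf.near_hi.2, add_zero]
    exact R.coord_hi_nonlinear hf hk
  · simp only [Front.onePart, Front.contactPart, Front.fourPart, hk, fanDisp, add_zero, hz, zero_add]
    rw [← f.coord_hi, (R.waves .four).disp_zero _ hf.near_hi.2, add_zero]
    exact f.coord_hi
  · simp only [Front.onePart, Front.contactPart, Front.fourPart, hk, fanDisp, add_zero, hz, zero_add]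
    exact R.coord_hi_nonlinear hf hk

/-- The jump across two fronts in increasing order. -/
theorem Region.coord_hi_eq_pair (R : Region P.γ U₀ C ρ) {f g : Front} (hf : SmallFront P U₀ ρ f)
    (hg : SmallFront P U₀ ρ g) (hwf : f.WeakPhysical) (hwg : g.WeakPhysical) (hl : g.lo = f.hi)
    (hr : f.kind.rank < g.kind.rank) :
    coord g.hi = coord f.lo + fanDisp P.γ (f.onePart + g.onePart)
      (f.contactPart + g.contactPart) (f.fourPart + g.fourPart) (coord f.lo) := by
  have hz : disp P.γ .one 0 (coord f.lo) = 0 := (R.waves .one).disp_zero _ hf.near_lo.2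
  have hz4 : disp P.γ .four 0 (coord g.hi) = 0 := (R.waves .four).disp_zero _ hg.near_hi.2
  rcases Front.weakPhysical_iff.1 hwf with hk | hk | hk <;>
    rcases Front.weakPhysical_iff.1 hwg with hk' | hk' | hk' <;>
    simp only [hk, hk', FrontKind.rank] at hr <;> try omega
  · simp only [Front.onePart, Front.contactPart, Front.fourPart, hk, hk', fanDisp, add_zero,
      zero_add]
    have e : coord f.lo + disp P.γ .one f.pressureJump (coord f.lo) + g.jump = coord g.hi := by
      rw [← R.coord_hi_nonlinear hf hk, ← hl, ← g.coord_hi]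
    rw [e, hz4, add_zero, ← add_assoc, e]
  · simp only [Front.onePart, Front.contactPart, Front.fourPart, hk, hk', fanDisp, add_zero,
      zero_add]
    rw [← R.coord_hi_nonlinear hf hk, ← add_assoc, ← R.coord_hi_nonlinear hf hk, ← hl]
    exact R.coord_hi_nonlinear hg hk'
  · simp only [Front.onePart, Front.contactPart, Front.fourPart, hk, hk', fanDisp, add_zero,
      zero_add, hz]
    rw [← f.coord_hi, ← add_assoc, ← f.coord_hi, ← hl]
    exact R.coord_hi_nonlinear hg hk'

/-- The jump across two fronts in decreasing order. -/
theorem Region.norm_incoming_sub_le (R : Region P.γ U₀ C ρ) (S : SmallScale P C ρ ρ₁)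
    {f g : Front} (hf : SmallFront P U₀ ρ₁ f) (hg : SmallFront P U₀ ρ₁ g) (hwf : f.WeakPhysical)
    (hwg : g.WeakPhysical) (hl : g.lo = f.hi) (hr : g.kind.rank ≤ f.kind.rank) :
    ‖coord g.hi - (coord f.lo + fanDisp P.γ (f.onePart + g.onePart)
      (f.contactPart + g.contactPart) (f.fourPart + g.fourPart) (coord f.lo))‖ ≤
        2 * (C * C) * approach f.vec g.vec := by
  have hC := R.one_le
  have hC0 : 0 ≤ C := by linarith
  have hS := S.pos
  have hS1 := S.le' R
  have hρ := R.pos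
  have hf' := hf.mono (by linarith : ρ₁ ≤ ρ)
  have hg' := hg.mono (by linarith : ρ₁ ≤ ρ)
  have hs := hf.abs_pressureJump_le
  have ht := hg.abs_pressureJump_le
  have hq : 2 * ρ₁ ≤ ρ / (4 * C) := by
    rw [le_div_iff₀ (by positivity)]; linarith [S.le]
  have hz := hf.near_lo.2
  have happ := approach_nonneg f.vec_nonneg g.vec_nonneg
  have hz1 : disp P.γ .one 0 (coord f.lo) = 0 := (R.waves .one).disp_zero _ hf'.near_lo.2
  have hz4 : disp P.γ .four 0 (coord g.hi) = 0 := (R.waves .four).disp_zero _ hg'.near_hi.2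
  have hjf : ‖f.jump‖ ≤ 2 * ρ₁ := hf.near_hi.sub_norm_le hf.near_lo
  have hjg : ‖g.jump‖ ≤ 2 * ρ₁ := hg.near_hi.sub_norm_le hg.near_lo
  have hnear : ∀ x : FlowCoord, ‖x‖ ≤ C * (4 * ρ₁) → ‖coord f.lo + x - coord U₀‖ ≤ ρ := by
    intro x hx
    have := norm_add_le (coord f.lo - coord U₀) x
    rw [show coord f.lo - coord U₀ + x = coord f.lo + x - coord U₀ by abel] at this
    linarith [S.le]
  have hst : |f.pressureJump + g.pressureJump| ≤ 4 * ρ₁ := by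
    have := abs_add_le f.pressureJump g.pressureJump; linarith
  have hone4 : ∀ s, |s| ≤ 4 * ρ₁ →
      disp P.γ .four 0 (coord f.lo + disp P.γ .one s (coord f.lo)) = 0 := by
    intro s hs
    refine (R.waves .four).disp_zero _ (hnear _ ?_)
    exact ((R.waves .one).disp_norm hρ.le (by linarith) hf'.near_lo.2).trans
      (mul_le_mul_of_nonneg_left hs hC0)
  have hgen : ∀ d, f.kind = .nonlinear d → g.kind = .nonlinear d →
      ‖disp P.γ d f.pressureJump (coord f.lo) + disp P.γ d g.pressureJump (coord f.lo +
        disp P.γ d f.pressureJump (coord f.lo)) -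
          disp P.γ d (f.pressureJump + g.pressureJump) (coord f.lo)‖ ≤
        2 * (C * C) * approach f.vec g.vec := by
    intro d hk hk'
    -- For two rarefactions the right side vanishes and the merging must be exact; otherwise the
    -- approach term is the full product and `disp_merge` applies.
    by_cases hrr : 0 ≤ d.sign * f.pressureJump ∧ 0 ≤ d.sign * g.pressureJump
    · rw [(R.waves d).disp_merge_rare _ _ _ (by linarith) (by linarith) hf'.near_lo.2 hrr.1 hrr.2,
        sub_self, norm_zero]
      positivity
    · have h1 := (R.waves d).disp_merge _ _ _ (hs.trans (by linarith)) (ht.trans (by linarith))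
        hf'.near_lo.2
      have h2 : approach f.vec g.vec = |f.pressureJump| * |g.pressureJump| := by
        rw [Front.vec, Front.vec, hk, hk']
        exact approach_same hrr
      rw [h2] at happ ⊢
      refine h1.trans (mul_le_mul_of_nonneg_right ?_ happ)
      have := mul_le_mul_of_nonneg_left hC hC0
      linarith
  have hCC : C ≤ 2 * (C * C) := by
    have := mul_le_mul_of_nonneg_left hC hC0
    linarith
  rcases Front.weakPhysical_iff.1 hwf with hk | hk | hk <;>
    rcases Front.weakPhysical_iff.1 hwg with hk' | hk' | hk' <;>
    simp only [hk, hk', FrontKind.rank] at hr <;> try omega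
  · simp only [Front.onePart, Front.contactPart, Front.fourPart, hk, hk', fanDisp, add_zero]
    rw [hone4 _ hst, add_zero, R.coord_hi_nonlinear hg' hk', hl, R.coord_hi_nonlinear hf' hk]
    rw [add_assoc, add_sub_add_left_eq_sub]
    exact hgen .one hk hk'
  · have h2 : approach f.vec g.vec = ‖f.jump‖ * |g.pressureJump| := by
      rw [approach_eq_mass hf.ne_strong hwg (by simp [hk, hk', FrontKind.rank]), Front.vec,
        Front.vec, hk, hk']
      simp only
      rw [mass_contactVec, mass_waveVec]
    have h3 := norm_disp_add_le (R.waves .one) (s := g.pressureJump) (y := f.jump) (z := coord f.lo)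
      (by linarith) hf'.near_lo.2 (by rw [← f.coord_hi]; exact hf'.near_hi.2)
    have h4 : disp P.γ .four 0 (coord f.lo + disp P.γ .one g.pressureJump (coord f.lo) + f.jump) =
        0 := by
      refine (R.waves .four).disp_zero _ ?_
      rw [add_assoc]
      refine hnear _ ((norm_add_le _ _).trans ?_)
      have := (R.waves .one).disp_norm hρ.le (s := g.pressureJump) (by linarith) hf'.near_lo.2
      have := mul_le_mul_of_nonneg_left ht hC0
      have := mul_le_mul_of_nonneg_right hC (by linarith : 0 ≤ 2 * ρ₁)
      linarith
    simp only [Front.onePart, Front.contactPart, Front.fourPart, hk, hk', fanDisp, add_zero,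
      zero_add]
    rw [h4, add_zero, R.coord_hi_nonlinear hg' hk', hl, f.coord_hi, h2]
    rw [show ∀ a b c d : FlowCoord, a + b + c - (a + (d + b)) = c - d by intros; abel]
    refine h3.trans ?_
    rw [mul_comm |_|]
    exact mul_le_mul_of_nonneg_right hCC (by positivity)
  · simp only [Front.onePart, Front.contactPart, Front.fourPart, hk, hk', fanDisp, add_zero,
      zero_add, hz1]
    have e : coord f.lo + (f.jump + g.jump) = coord g.hi := by
      rw [← add_assoc, ← f.coord_hi, ← hl, ← g.coord_hi]
    rw [e, hz4, add_zero, e, sub_self, norm_zero]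
    positivity
  · have h2 : approach f.vec g.vec = |f.pressureJump| * |g.pressureJump| := by
      rw [approach_eq_mass hf.ne_strong hwg (by simp [hk, hk', FrontKind.rank]), Front.vec,
        Front.vec, hk, hk']
      simp only
      rw [mass_waveVec, mass_waveVec]
    have h3 := norm_disp_comm_le (R.waves .four) (R.waves .one) hC hρ.le (hs.trans hq)
      (ht.trans hq) (z := coord f.lo) (by linarith)
    simp only [Front.onePart, Front.contactPart, Front.fourPart, hk, hk', fanDisp, add_zero,
      zero_add]
    rw [R.coord_hi_nonlinear hg' hk', hl, R.coord_hi_nonlinear hf' hk, h2, add_assoc,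
      add_sub_add_left_eq_sub]
    exact h3
  · have h2 : approach f.vec g.vec = |f.pressureJump| * ‖g.jump‖ := by
      rw [approach_eq_mass hf.ne_strong hwg (by simp [hk, hk', FrontKind.rank]), Front.vec,
        Front.vec, hk, hk']
      simp only
      rw [mass_waveVec, mass_contactVec]
    have h3 := norm_disp_add_le (R.waves .four) (s := f.pressureJump) (y := g.jump)
      (z := coord f.lo) (by linarith) hf'.near_lo.2 (hnear _ (by
        have := mul_le_mul_of_nonneg_right hC (by linarith : 0 ≤ 4 * ρ₁)
        linarith))
    simp only [Front.onePart, Front.contactPart, Front.fourPart, hk, hk', fanDisp, add_zero,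
      zero_add, hz1]
    rw [g.coord_hi, hl, R.coord_hi_nonlinear hf' hk, h2]
    rw [show ∀ a b c d : FlowCoord, a + b + c - (a + (c + d)) = -(d - b) by intros; abel, norm_neg]
    refine h3.trans (mul_le_mul_of_nonneg_right hCC (by positivity))
  · simp only [Front.onePart, Front.contactPart, Front.fourPart, hk, hk', fanDisp, add_zero,
      zero_add, hz1]
    rw [R.coord_hi_nonlinear hg' hk', hl, R.coord_hi_nonlinear hf' hk]
    rw [add_assoc, add_sub_add_left_eq_sub]
    exact hgen .four hk hk'

/-- Waves of the same strength. -/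
theorem Region.sameWave (R : Region P.γ U₀ C ρ) {f f' : Front} (hf : SmallFront P U₀ (ρ / 2) f)
    (hf' : SmallFront P U₀ (ρ / 2) f') (hw : f.WeakPhysical) (h : SameWave P.γ f f') :
    f'.WeakPhysical ∧ f'.kind.rank = f.kind.rank ∧
      |f'.onePart - f.onePart| + ‖f'.contactPart - f.contactPart‖ + |f'.fourPart - f.fourPart| ≤
        C * C * (mass f.vec * ‖coord f.lo - coord f'.lo‖) := by
  obtain ⟨hk, h⟩ := h
  have hρ := R.pos
  have hs := hf.abs_pressureJump_le
  have hs' := hf'.abs_pressureJump_le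
  have hC := R.one_le
  have gf := hf.mono (by linarith : ρ / 2 ≤ ρ)
  have gf' := hf'.mono (by linarith : ρ / 2 ≤ ρ)
  have hgen : ∀ d, f.kind = .nonlinear d → f'.signed P.γ d = f.signed P.γ d →
      |f'.pressureJump - f.pressureJump| ≤
        C * C * (|f.pressureJump| * ‖coord f.lo - coord f'.lo‖) := by
    intro d hd he
    refine (R.waves d).abs_sub_le_of_lamJump_eq (by linarith) (by linarith) (by linarith)
      gf.near_lo.2 gf'.near_lo.2 ?_
    rw [← R.signed_eq gf hd, ← R.signed_eq gf' (hk.trans hd), he]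
  refine ⟨?_, by rw [hk], ?_⟩
  · rw [Front.weakPhysical_iff, hk]; exact Front.weakPhysical_iff.1 hw
  rcases Front.weakPhysical_iff.1 hw with h1 | h1 | h1 <;> rw [h1] at h hk <;> simp only at h
  · have := hgen .one h1 h
    simpa [Front.onePart, Front.contactPart, Front.fourPart, hk, h1, Front.vec, mass_waveVec]
      using this
  · simp only [Front.onePart, Front.contactPart, Front.fourPart, hk, h1]
    rw [hf.jump_contact h1, hf'.jump_contact hk, h.1, h.2]
    simp only [sub_self, abs_zero, norm_zero, add_zero]
    have := mass_nonneg f.vec_nonneg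
    positivity
  · have := hgen .four h1 h
    simpa [Front.onePart, Front.contactPart, Front.fourPart, hk, h1, Front.vec, mass_waveVec]
      using this

end Collision

section Collision

variable {P : Params} {U₀ : State} {C ρ ρ₁ : ℝ}

/-- The simplified solver adds jumps of $\lambda_d$, while the functional counts $\log p$. Since
$\lambda_d$ is strictly monotone along the wave curve, the discrepancy is bounded by the merging
error. The case $x=0$ covers waves that cancel. -/
theorem Region.mergedWave (R : Region P.γ U₀ C ρ) (S : SmallScale P C ρ ρ₁)
    {f g : Front} (hf : SmallFront P U₀ ρ₁ f) (hg : SmallFront P U₀ ρ₁ g) {d : NLFamily}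
    (hk : f.kind = .nonlinear d) (hk' : g.kind = .nonlinear d) (hl : g.lo = f.hi) {x : ℝ}
    (hx : |x| ≤ ρ) (he : lamJump P.γ d x (coord f.lo) = f.signed P.γ d + g.signed P.γ d) :
    |x - (f.pressureJump + g.pressureJump)| ≤ C * C * (C * approach f.vec g.vec) := by
  have hC := R.one_le
  have hC0 : 0 ≤ C := by linarith
  have hS := S.pos
  have hS1 := S.le' R
  have hρ := R.pos
  have hf' := hf.mono (by linarith : ρ₁ ≤ ρ)
  have hg' := hg.mono (by linarith : ρ₁ ≤ ρ)
  have hs := hf.abs_pressureJump_le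
  have ht := hg.abs_pressureJump_le
  have hq : 2 * ρ₁ ≤ ρ / (4 * C) := by
    rw [le_div_iff₀ (by positivity)]; linarith [S.le]
  rw [R.signed_eq hf' hk, R.signed_eq hg' hk', hl, R.coord_hi_nonlinear hf' hk] at he
  refine ((R.waves d).abs_sub_add_le hC hρ.le (hs.trans hq) (ht.trans hq) hx
    (hf.near_lo.2.trans (by linarith)) he).trans (mul_le_mul_of_nonneg_left ?_ (by positivity))
  have happ := approach_nonneg f.vec_nonneg g.vec_nonneg
  by_cases hrr : 0 ≤ d.sign * f.pressureJump ∧ 0 ≤ d.sign * g.pressureJump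
  · rw [(R.waves d).disp_merge_rare _ _ _ (by linarith) (by linarith) hf'.near_lo.2 hrr.1 hrr.2,
      sub_self, norm_zero]
    positivity
  · have h1 := (R.waves d).disp_merge _ _ _ (hs.trans (by linarith)) (ht.trans (by linarith))
      hf'.near_lo.2
    rwa [Front.vec, Front.vec, hk, hk', approach_same hrr]

/-- The waves that leave a collision compared with the incoming waves. -/
def partsError (f g : Front) (a : ℝ) (y : FlowCoord) (b : ℝ) : ℝ :=
  |a - (f.onePart + g.onePart)| + ‖y - (f.contactPart + g.contactPart)‖ +
    |b - (f.fourPart + g.fourPart)|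

theorem Front.parts_bounds {f : Front} (hf : SmallFront P U₀ ρ₁ f) (hρ : 0 ≤ ρ₁) :
    |f.onePart| ≤ 2 * ρ₁ ∧ ‖f.contactPart‖ ≤ 2 * ρ₁ ∧ |f.fourPart| ≤ 2 * ρ₁ := by
  have h1 := hf.abs_pressureJump_le
  have h2 : ‖f.jump‖ ≤ 2 * ρ₁ := hf.near_hi.sub_norm_le hf.near_lo
  rcases hk : f.kind with (_ | _) | _ | _ | _ <;>
    simp only [Front.onePart, Front.contactPart, Front.fourPart, hk, abs_zero, norm_zero] <;>
    refine ⟨?_, ?_, ?_⟩ <;> first | exact h1 | exact h2 | positivity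

theorem Front.contactPart_snd {f : Front} (hf : SmallFront P U₀ ρ₁ f) : f.contactPart.2.2 = 0 := by
  rcases hk : f.kind with (_ | _) | _ | _ | _ <;> simp only [Front.contactPart, hk] <;> try rfl
  rw [hf.jump_contact hk]; rfl

theorem vecSum_le_of_parts {f g : Front} (hwf : f.WeakPhysical) (hwg : g.WeakPhysical)
    {new : List Front} {a b : ℝ} {y n : FlowCoord}
    (h : vecSum new = waveVec .one a + contactVec ‖y‖ + waveVec .four b + npVec ‖n‖) {e : ℝ}
    (he : partsError f g a y b + ‖n‖ ≤ e) : vecSum new ≤ f.vec + g.vec + fun _ => e := by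
  intro i
  rw [h, Front.vec_eq_parts hwf, Front.vec_eq_parts hwg]
  simp only [Pi.add_apply]
  have h1 := waveVec_le .one a (f.onePart + g.onePart) i
  have h2 := waveVec_add_le .one f.onePart g.onePart i
  have h3 := waveVec_le .four b (f.fourPart + g.fourPart) i
  have h4 := waveVec_add_le .four f.fourPart g.fourPart i
  have h5 := contactVec_le ‖y‖ (‖f.contactPart‖ + ‖g.contactPart‖) i
  have h6 : contactVec (‖f.contactPart‖ + ‖g.contactPart‖) i =
      contactVec ‖f.contactPart‖ i + contactVec ‖g.contactPart‖ i := by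
    fin_cases i <;> simp [contactVec]
  have h7 := npVec_le ‖n‖ 0 i
  rw [npVec_zero, sub_zero, abs_norm] at h7
  simp only [Pi.zero_apply, zero_add] at h7
  have h8 : contactVec ‖y‖ i ≤ contactVec (‖f.contactPart‖ + ‖g.contactPart‖) i +
      ‖y - (f.contactPart + g.contactPart)‖ := by
    have k1 := norm_sub_norm_le y (f.contactPart + g.contactPart)
    have k2 := norm_add_le f.contactPart g.contactPart
    have k3 := norm_nonneg (y - (f.contactPart + g.contactPart))
    fin_cases i <;> simp [contactVec]
    linarith
  unfold partsError at he
  linarith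

theorem Front.near_hi_of_weak (R : Region P.γ U₀ C ρ) (S : SmallScale P C ρ ρ₁) {f : Front}
    {σ : ℝ} (hw : f.WeakPhysical) (ha : f.Admissible P) (hlo : Near U₀ σ f.lo)
    (hσ : σ ≤ 2 * ρ₁) : SmallFront P U₀ (σ + ρ₁) f := by
  have hS := S.pos
  rcases Front.weakPhysical_iff.1 hw with hk | hk | hk <;>
    (have ha' := ha
     unfold Front.Admissible at ha'
     rw [hk] at ha'
     exact ⟨ha, by simp [hk], hlo.mono (by linarith), R.near_of_dist S hlo ha'.1 hσ⟩)

/-- One front followed by a non-physical one. -/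
theorem outgoing_single (R : Region P.γ U₀ C ρ) (S : SmallScale P C ρ ρ₁) {h : Front}
    {t : List Front} {lo hi : State} (hw : h.WeakPhysical) (ht : NPTail t)
    (hl : Linked lo (h :: t) hi) (ha : ∀ k ∈ h :: t, k.Admissible P) (hlo : Near U₀ ρ₁ lo)
    (hhi : Near U₀ ρ₁ hi) :
    Outgoing P U₀ (3 * ρ₁) lo hi (h :: t) h.onePart h.contactPart h.fourPart
      (coord hi - coord h.hi) := by
  have hS := S.pos
  have hS1 := S.le' R
  obtain ⟨rfl, hl'⟩ := linked_cons.1 hl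
  have hh := (Front.near_hi_of_weak R S hw (ha h List.mem_cons_self) hlo (by linarith)).mono
    (by linarith : ρ₁ + ρ₁ ≤ 3 * ρ₁)
  obtain ⟨t1, t2, t3⟩ := ht.linked hl' (fun k hk => ha k (List.mem_cons_of_mem _ hk)) hh.near_hi
    (hhi.mono (by linarith))
  obtain ⟨b1, b2, b3⟩ := Front.parts_bounds hh (by linarith)
  obtain ⟨k1, k2, k3, k4, k5, k6⟩ := approach_ordered h.onePart ‖h.contactPart‖ h.fourPart
    ‖coord hi - coord h.hi‖
  refine ⟨?_, hl, ?_, ?_, ?_, Front.contactPart_snd hh, b1, b2, b3⟩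
  · intro k hk
    rcases List.mem_cons.1 hk with rfl | hk
    · exact hh
    · exact t1 k hk
  · rw [potential, t2, t3, Front.vec_eq_parts hw, approach_add_left, approach_add_left, k4, k5, k6]
    norm_num
  · rw [vecSum_cons, t3, Front.vec_eq_parts hw]
  · rw [← R.coord_hi_eq (hh.mono (by linarith)) hw, add_sub_cancel]

/-- Two fronts in increasing order followed by a non-physical one. -/
theorem outgoing_pair (R : Region P.γ U₀ C ρ) (S : SmallScale P C ρ ρ₁) {h k : Front}
    {t : List Front} {lo hi : State} (hwh : h.WeakPhysical) (hwk : k.WeakPhysical)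
    (hr : h.kind.rank < k.kind.rank) (ht : NPTail t)
    (hl : Linked lo (h :: k :: t) hi) (ha : ∀ m ∈ h :: k :: t, m.Admissible P)
    (hlo : Near U₀ ρ₁ lo) (hhi : Near U₀ ρ₁ hi) :
    SmallFront P U₀ (3 * ρ₁) h ∧ SmallFront P U₀ (3 * ρ₁) k ∧
    Outgoing P U₀ (6 * ρ₁) lo hi (h :: k :: t) (h.onePart + k.onePart)
      (h.contactPart + k.contactPart) (h.fourPart + k.fourPart) (coord hi - coord k.hi) := by
  have hS := S.pos
  have hS1 := S.le' R
  obtain ⟨rfl, hl'⟩ := linked_cons.1 hl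
  obtain ⟨hlk, hl''⟩ := linked_cons.1 hl'
  have hh := Front.near_hi_of_weak R S hwh (ha h List.mem_cons_self) hlo (by linarith)
  have hk := (Front.near_hi_of_weak R S hwk (ha k (by simp)) (by rw [hlk]; exact hh.near_hi)
    (by linarith)).mono (by linarith : ρ₁ + ρ₁ + ρ₁ ≤ 3 * ρ₁)
  have hh := hh.mono (by linarith : ρ₁ + ρ₁ ≤ 3 * ρ₁)
  obtain ⟨t1, t2, t3⟩ := ht.linked hl'' (fun m hm => ha m (by simp [hm])) hk.near_hi
    (hhi.mono (by linarith))
  obtain ⟨b1, b2, b3⟩ := Front.parts_bounds hh (by linarith)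
  obtain ⟨c1, c2, c3⟩ := Front.parts_bounds hk (by linarith)
  refine ⟨hh, hk, ?_, hl, ?_, ?_, ?_, ?_, ?_, ?_, ?_⟩
  · intro m hm
    rcases List.mem_cons.1 hm with rfl | hm
    · exact hh.mono (by linarith)
    rcases List.mem_cons.1 hm with rfl | hm
    · exact hk.mono (by linarith)
    · exact (t1 m hm).mono (by linarith)
  · rw [potential, potential, t2, t3, vecSum_cons, t3]
    rcases Front.weakPhysical_iff.1 hwh with q | q | q <;>
      rcases Front.weakPhysical_iff.1 hwk with q' | q' | q' <;>
      simp only [q, q', FrontKind.rank] at hr <;> try omega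
    all_goals simp [Front.vec, q, q', approach, waveVec, contactVec, npVec]
  · rw [vecSum_cons, vecSum_cons, t3]
    rcases Front.weakPhysical_iff.1 hwh with q | q | q <;>
      rcases Front.weakPhysical_iff.1 hwk with q' | q' | q' <;>
      simp only [q, q', FrontKind.rank] at hr <;> try omega
    all_goals
      simp [Front.vec, q, q', Front.onePart, Front.contactPart, Front.fourPart, waveVec_zero,
        contactVec_zero, add_assoc]
  · rw [← R.coord_hi_eq_pair (hh.mono (by linarith)) (hk.mono (by linarith)) hwh hwk hlk hr,
      add_sub_cancel]
  · rw [Prod.snd_add, Prod.snd_add, Front.contactPart_snd hh, Front.contactPart_snd hk, add_zero]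
  · exact (abs_add_le _ _).trans (by linarith)
  · exact (norm_add_le _ _).trans (by linarith)
  · exact (abs_add_le _ _).trans (by linarith)

/-- In a crossing each wave keeps its strength but starts from a state shifted by the other one,
which changes its size by a product of sizes. Merging and cancelling reduce to `Region.mergedWave`;
for contacts they are exact. -/
theorem Region.simplifiedWeak (R : Region P.γ U₀ C ρ) (S : SmallScale P C ρ ρ₁) {f g : Front}
    (hf : SmallFront P U₀ ρ₁ f) (hg : SmallFront P U₀ ρ₁ g) (hwf : f.WeakPhysical)
    (hwg : g.WeakPhysical) (hl : g.lo = f.hi) {new : List Front}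
    (h : SimplifiedWeak P f g new) : ∃ a y b n, Outgoing P U₀ (6 * ρ₁) f.lo g.hi new a y b n ∧
      partsError f g a y b ≤ 4 * (C * C * C) * approach f.vec g.vec := by
  obtain ⟨hlink, hadm, t, ht, h⟩ := h
  have hS := S.pos
  have hS1 := S.le' R
  have hC := R.one_le
  have hC0 : 0 ≤ C := by linarith
  have hρ := R.pos
  have happ := approach_nonneg f.vec_nonneg g.vec_nonneg
  have hCCC : C * C ≤ C * C * C := le_mul_of_one_le_right (by positivity) hC
  have hf2 := hf.mono (by linarith : ρ₁ ≤ ρ / 2)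
  have hg2 := hg.mono (by linarith : ρ₁ ≤ ρ / 2)
  have hwc : ∀ {k : Front}, k.kind = f.kind → k.WeakPhysical := by
    intro k hk
    rw [Front.weakPhysical_iff, hk]
    exact Front.weakPhysical_iff.1 hwf
  rcases h with ⟨hr, g', f', hg', hf', rfl⟩ | ⟨h, ⟨hk, hk', hm⟩, rfl⟩ | ⟨⟨hk, hc⟩, rfl⟩
  · have hwg' : g'.WeakPhysical := by
      rw [Front.weakPhysical_iff, hg'.1]; exact Front.weakPhysical_iff.1 hwg
    have hwf' := hwc hf'.1
    obtain ⟨sg, sf, ho⟩ := outgoing_pair R S hwg' hwf' (by rw [hg'.1, hf'.1]; exact hr) ht hlink hadm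
      hf.near_lo hg.near_hi
    refine ⟨_, _, _, _, ho, ?_⟩
    obtain ⟨-, -, e1⟩ := R.sameWave hg2 (sg.mono (by linarith)) hwg hg'
    obtain ⟨-, -, e2⟩ := R.sameWave hf2 (sf.mono (by linarith)) hwf hf'
    obtain ⟨hlg, hl2⟩ := linked_cons.1 hlink
    obtain ⟨hlf, -⟩ := linked_cons.1 hl2
    have hmf := mass_nonneg f.vec_nonneg
    have hmg := mass_nonneg g.vec_nonneg
    have happ' := approach_eq_mass hf.ne_strong hwg hr
    have j1 := R.norm_jump_le hf2
    have j2 := R.norm_jump_le (sg.mono (by linarith : 3 * ρ₁ ≤ ρ / 2))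
    rw [hlg, hl, show ‖coord f.hi - coord f.lo‖ = ‖f.jump‖ from rfl] at e1
    rw [hlf, ← hlg, norm_sub_rev (coord g'.lo), show ‖coord g'.hi - coord g'.lo‖ = ‖g'.jump‖ from rfl] at e2
    have hjf : ‖f.jump‖ ≤ 2 * ρ₁ := hf.near_hi.sub_norm_le hf.near_lo
    -- The upper outgoing wave is shifted by `g'` and not by `g`; this bound brings the error back
    -- to the incoming sizes.
    have m1 : mass g'.vec ≤ 2 * mass g.vec := by
      rw [Front.mass_eq_parts hwg', Front.mass_eq_parts hwg]
      have a1 := abs_sub_abs_le_abs_sub g'.onePart g.onePart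
      have a2 := norm_sub_norm_le g'.contactPart g.contactPart
      have a3 := abs_sub_abs_le_abs_sub g'.fourPart g.fourPart
      have a4 : C * C * (mass g.vec * ‖f.jump‖) ≤ mass g.vec := by
        have q1 := mul_le_mul_of_nonneg_left hjf hmg
        have q2 := mul_le_mul_of_nonneg_left q1 (mul_nonneg hC0 hC0)
        have q3 := mul_le_mul_of_nonneg_right S.le_one hmg
        have q4 : 0 ≤ C * (C * ρ₁) * mass g.vec := by positivity
        linarith
      rw [Front.mass_eq_parts hwg] at a4 e1
      linarith
    have b1 : C * C * (mass g.vec * ‖f.jump‖) ≤ C * C * C * approach f.vec g.vec := by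
      rw [happ']
      have := mul_le_mul_of_nonneg_left j1 (mul_nonneg (mul_nonneg hC0 hC0) hmg)
      linarith
    have b2 : C * C * (mass f.vec * ‖g'.jump‖) ≤ 2 * (C * C * C * approach f.vec g.vec) := by
      rw [happ']
      have q1 := mul_le_mul_of_nonneg_left j2 (mul_nonneg (mul_nonneg hC0 hC0) hmf)
      have q2 := mul_le_mul_of_nonneg_left m1
        (mul_nonneg (mul_nonneg (mul_nonneg hC0 hC0) hC0) hmf)
      linarith
    have t1 : |g'.onePart + f'.onePart - (f.onePart + g.onePart)| ≤
        |g'.onePart - g.onePart| + |f'.onePart - f.onePart| := by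
      rw [show g'.onePart + f'.onePart - (f.onePart + g.onePart) =
        (g'.onePart - g.onePart) + (f'.onePart - f.onePart) by ring]
      exact abs_add_le _ _
    have t2 : |g'.fourPart + f'.fourPart - (f.fourPart + g.fourPart)| ≤
        |g'.fourPart - g.fourPart| + |f'.fourPart - f.fourPart| := by
      rw [show g'.fourPart + f'.fourPart - (f.fourPart + g.fourPart) =
        (g'.fourPart - g.fourPart) + (f'.fourPart - f.fourPart) by ring]
      exact abs_add_le _ _
    have t3 : ‖g'.contactPart + f'.contactPart - (f.contactPart + g.contactPart)‖ ≤
        ‖g'.contactPart - g.contactPart‖ + ‖f'.contactPart - f.contactPart‖ := by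
      rw [show g'.contactPart + f'.contactPart - (f.contactPart + g.contactPart) =
        (g'.contactPart - g.contactPart) + (f'.contactPart - f.contactPart) by abel]
      exact norm_add_le _ _
    unfold partsError
    have b3 : 0 ≤ C * C * C * approach f.vec g.vec := by positivity
    linarith
  · have hwh := hwc hk'
    have ho := outgoing_single R S hwh ht hlink hadm hf.near_lo hg.near_hi
    have hh : SmallFront P U₀ (3 * ρ₁) h := ho.small h List.mem_cons_self
    obtain ⟨hlh, -⟩ := linked_cons.1 hlink
    have hgen : ∀ d, f.kind = .nonlinear d → h.signed P.γ d = f.signed P.γ d + g.signed P.γ d →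
        |h.pressureJump - (f.pressureJump + g.pressureJump)| ≤
          4 * (C * C * C) * approach f.vec g.vec := by
      intro d hd he
      rw [R.signed_eq (hh.mono (by linarith)) (hk'.trans hd), hlh] at he
      have h1 := R.mergedWave S hf hg hd (hk.trans hd) hl
        (hh.abs_pressureJump_le.trans (by linarith)) he
      have : 0 ≤ C * C * C * approach f.vec g.vec := by positivity
      linarith
    refine ⟨_, _, _, _, ⟨fun k hk => (ho.small k hk).mono (by linarith), ho.linked, ho.potential_eq,
      ho.vec_eq, ho.coord_eq, ho.contact, ho.abs_one.trans (by linarith),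
      ho.norm_contact.trans (by linarith), ho.abs_four.trans (by linarith)⟩, ?_⟩
    rcases Front.weakPhysical_iff.1 hwf with q | q | q <;> rw [q] at hm <;> simp only at hm
    · have := hgen _ q hm
      simpa [partsError, Front.onePart, Front.contactPart, Front.fourPart, hk, hk', q] using this
    · have e1 := hh.jump_contact (hk'.trans q)
      have e2 := hf.jump_contact q
      have e3 := hg.jump_contact (hk.trans q)
      have : h.jump - (f.jump + g.jump) = 0 := by
        rw [e1, e2, e3, hm.1, hm.2]
        simp
      simp only [partsError, Front.onePart, Front.contactPart, Front.fourPart, hk, hk', q, this]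
      simp
      positivity
    · have := hgen _ q hm
      simpa [partsError, Front.onePart, Front.contactPart, Front.fourPart, hk, hk', q] using this
  · obtain ⟨t1, t2, t3⟩ := ht.linked hlink hadm (hf.near_lo.mono (by linarith : ρ₁ ≤ 6 * ρ₁))
      (hg.near_hi.mono (by linarith))
    refine ⟨0, 0, 0, coord g.hi - coord f.lo, ⟨t1, hlink, t2, ?_, ?_, rfl, ?_, ?_, ?_⟩, ?_⟩
    · rw [t3, waveVec_zero, norm_zero, contactVec_zero, waveVec_zero, zero_add, zero_add, zero_add]
    · have h1 := (R.waves .one).disp_zero (coord f.lo) (hf.near_lo.2.trans (by linarith))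
      have h4 := (R.waves .four).disp_zero (coord f.lo) (hf.near_lo.2.trans (by linarith))
      simp [fanDisp, h1, h4]
    · rw [abs_zero]; positivity
    · rw [norm_zero]; positivity
    · rw [abs_zero]; positivity
    have hgen : ∀ d, f.kind = .nonlinear d → f.signed P.γ d + g.signed P.γ d = 0 →
        |f.pressureJump + g.pressureJump| ≤ 4 * (C * C * C) * approach f.vec g.vec := by
      intro d hd he
      have h1 := R.mergedWave S hf hg hd (hk.trans hd) hl (x := 0) (by simpa using hρ.le)
        (by rw [he, (R.waves d).lamJump_zero (hf.near_lo.2.trans (by linarith))])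
      rw [zero_sub, abs_neg] at h1
      have : 0 ≤ C * C * C * approach f.vec g.vec := by positivity
      linarith
    rcases Front.weakPhysical_iff.1 hwf with q | q | q <;> rw [q] at hc <;> simp only at hc
    · have := hgen _ q hc
      rw [← abs_neg, neg_add_rev] at this
      simpa [partsError, Front.onePart, Front.contactPart, Front.fourPart, hk, q] using this
    · have e2 := hf.jump_contact q
      have e3 := hg.jump_contact (hk.trans q)
      have : f.jump + g.jump = 0 := by
        rw [e2, e3, Prod.mk_add_mk, Prod.mk_add_mk, hc.1, hc.2]
        simp
      simp only [partsError, Front.onePart, Front.contactPart, Front.fourPart, hk, q, this]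
      simp
      positivity
    · have := hgen _ q hc
      rw [← abs_neg, neg_add_rev] at this
      simpa [partsError, Front.onePart, Front.contactPart, Front.fourPart, hk, q] using this

theorem Region.norm_jump_sub_le (R : Region P.γ U₀ C ρ) {f f' : Front}
    (hf : SmallFront P U₀ (ρ / 2) f) (hf' : SmallFront P U₀ (ρ / 2) f') (hw : f.WeakPhysical)
    (h : SameWave P.γ f f') :
    ‖f.jump - f'.jump‖ ≤ C * ((C * C + 1) * (mass f.vec * ‖coord f.lo - coord f'.lo‖)) := by
  have hC := R.one_le
  have hρ := R.pos
  have gf := hf.mono (by linarith : ρ / 2 ≤ ρ)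
  have gf' := hf'.mono (by linarith : ρ / 2 ≤ ρ)
  have hs := hf.abs_pressureJump_le
  have hs' := hf'.abs_pressureJump_le
  obtain ⟨-, -, e⟩ := R.sameWave hf hf' hw h
  have hgen : ∀ d, f.kind = .nonlinear d → |f'.pressureJump - f.pressureJump| ≤
      C * C * (mass f.vec * ‖coord f.lo - coord f'.lo‖) → ‖f.jump - f'.jump‖ ≤
        C * ((C * C + 1) * (mass f.vec * ‖coord f.lo - coord f'.lo‖)) := by
    intro d hd he
    rw [R.jump_nonlinear gf hd, R.jump_nonlinear gf' (h.1.trans hd)]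
    refine ((R.waves d).disp_sub _ _ _ _ (by linarith) (by linarith) gf.near_lo.2
      gf'.near_lo.2).trans (mul_le_mul_of_nonneg_left ?_ (by linarith))
    have : mass f.vec = |f.pressureJump| := by rw [Front.vec, hd]; exact mass_waveVec _ _
    rw [this] at he ⊢
    rw [abs_sub_comm]
    linarith
  rcases Front.weakPhysical_iff.1 hw with q | q | q
  · refine hgen _ q ?_
    simpa [Front.onePart, Front.contactPart, Front.fourPart, q, h.1.trans q] using e
  · obtain ⟨hk, h⟩ := h
    rw [q] at h hk
    have hm := mass_nonneg f.vec_nonneg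
    rw [hf.jump_contact q, hf'.jump_contact hk, h.1, h.2, sub_self, norm_zero]
    positivity
  · refine hgen _ q ?_
    simpa [Front.onePart, Front.contactPart, Front.fourPart, q, h.1.trans q] using e

/-- The result of a collision of weak fronts. -/
structure CollisionBound (P : Params) (U₀ : State) (ρ K : ℝ) (f g : Front) (new : List Front) :
    Prop where
  small : ∀ h ∈ new, SmallFront P U₀ ρ h
  linked : Linked f.lo new g.hi
  potential_eq : potential new = 0
  vec_le : vecSum new ≤ f.vec + g.vec + fun _ => K * approach f.vec g.vec

/-- Collisions of weak fronts change the strengths only by a multiple of the product of the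
strengths of approaching waves. -/
theorem Region.exists_collisionBound {γ : ℝ} (R : Region γ U₀ C ρ) :
    ∃ K > (0 : ℝ), ∃ ε > (0 : ℝ), ∀ P : Params, P.γ = γ → ∀ ρ₁ ≤ ε, SmallScale P C ρ ρ₁ →
      ∀ f g new, SmallFront P U₀ ρ₁ f → SmallFront P U₀ ρ₁ g → g.lo = f.hi →
        g.kind.rank ≤ f.kind.rank → CollisionRule P f g new →
        CollisionBound P U₀ (6 * ρ₁) K f g new := by
  obtain ⟨K₀, hK₀, ε₀, hε₀, hstab⟩ := exists_fanDisp_stability R.waves R.one_le R.pos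
    (turnRate_pos R.one_lt R.mach)
  have hC := R.one_le
  have hC0 : 0 ≤ C := by linarith
  have hρ := R.pos
  -- The first term serves the accurate solver, the second and third the simplified one, and the
  -- last two a non-physical front that crosses a weak front.
  obtain ⟨K₁, hK₁⟩ : ∃ K₁, K₁ = K₀ * (2 * (C * C)) + ((C + 1) * (C + 1) + 1) * (4 * (C * C * C)) +
    2 * (C * C) + 3 * (C * C * C) := ⟨_, rfl⟩
  refine ⟨K₁, by rw [hK₁]; positivity, min (ε₀ / 12) (min (1 / 12) (ρ / (12 * (C + 2)))),
    by positivity, ?_⟩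
  rintro P rfl ρ₁ hρ₁ S f g new hf hg hl hr h
  have hS := S.pos
  have hS1 := S.le' R
  have e1 : 12 * ρ₁ ≤ ε₀ := by linarith [hρ₁.trans (min_le_left _ _)]
  have e2 : 12 * ρ₁ ≤ 1 := by
    linarith [hρ₁.trans ((min_le_right _ _).trans (min_le_left _ _))]
  have e3 : 12 * ρ₁ * (C + 2) ≤ ρ := by
    have := hρ₁.trans ((min_le_right _ _).trans (min_le_right _ _))
    rw [le_div_iff₀ (by positivity)] at this
    linarith
  have happ := approach_nonneg f.vec_nonneg g.vec_nonneg
  have pK1 : 0 ≤ K₀ * (2 * (C * C)) * approach f.vec g.vec := by positivity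
  have pK2 : 0 ≤ ((C + 1) * (C + 1) + 1) * (4 * (C * C * C)) * approach f.vec g.vec := by positivity
  have pK3 : 0 ≤ 2 * (C * C) * approach f.vec g.vec := by positivity
  have pK4 : 0 ≤ 3 * (C * C * C) * approach f.vec g.vec := by positivity
  obtain ⟨f1, f2, f3⟩ := Front.parts_bounds hf hS.le
  obtain ⟨g1, g2, g3⟩ := Front.parts_bounds hg hS.le
  have s1 : |f.onePart + g.onePart| ≤ 4 * ρ₁ := (abs_add_le _ _).trans (by linarith)
  have s2 : ‖f.contactPart + g.contactPart‖ ≤ 4 * ρ₁ := (norm_add_le _ _).trans (by linarith)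
  have s3 : |f.fourPart + g.fourPart| ≤ 4 * ρ₁ := (abs_add_le _ _).trans (by linarith)
  have hz := hf.near_lo.2
  cases h with
  | weakAccurate hwf hwg _ h =>
    obtain ⟨a, y, b, ho⟩ := h.outgoing R S hf.near_lo hg.near_hi
    have hin := R.norm_incoming_sub_le S hf hg hwf hwg hl hr
    have o1 := ho.abs_one
    have o2 := ho.norm_contact
    have o3 := ho.abs_four
    have hst := hstab a (f.onePart + g.onePart) b (f.fourPart + g.fourPart) y
      (f.contactPart + g.contactPart) (coord f.lo) (by linarith) (by linarith) (by linarith)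
      (by linarith) (by linarith) (by linarith) (by linarith) ho.contact
      (by rw [Prod.snd_add, Prod.snd_add, Front.contactPart_snd hf, Front.contactPart_snd hg,
        add_zero])
    have heq := ho.coord_eq
    rw [add_zero] at heq
    rw [heq, add_sub_add_left_eq_sub] at hin
    refine ⟨fun k hk => (ho.small k hk).mono (by linarith), ho.linked, ho.potential_eq,
      vecSum_le_of_parts hwf hwg ho.vec_eq ?_⟩
    have hin' := mul_le_mul_of_nonneg_left hin (by linarith : 0 ≤ K₀)
    have := hst.trans hin'
    rw [norm_zero, add_zero, partsError, hK₁]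
    linarith
  | weakSimplified hwf hwg _ h =>
    obtain ⟨a, y, b, n, ho, he⟩ := R.simplifiedWeak S hf hg hwf hwg hl h
    have hin := R.norm_incoming_sub_le S hf hg hwf hwg hl hr
    have hlip := norm_fanDisp_sub_le (a := f.onePart + g.onePart) (a' := a)
      (b := f.fourPart + g.fourPart) (b' := b) (y := f.contactPart + g.contactPart) (y' := y)
      (z := coord f.lo) R.waves hC hρ.le e3 e2 (by linarith)
      (by linarith [ho.abs_one]) (by linarith) (by linarith [ho.abs_four]) (by linarith)
      (by linarith [ho.norm_contact]) (by linarith)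
    have hn : ‖n‖ ≤ 2 * (C * C) * approach f.vec g.vec +
        (C + 1) * (C + 1) * partsError f g a y b := by
      have heq := ho.coord_eq
      have : n = (coord g.hi - (coord f.lo + fanDisp P.γ (f.onePart + g.onePart)
          (f.contactPart + g.contactPart) (f.fourPart + g.fourPart) (coord f.lo))) +
          (fanDisp P.γ (f.onePart + g.onePart)
          (f.contactPart + g.contactPart) (f.fourPart + g.fourPart) (coord f.lo) -
            fanDisp P.γ a y b (coord f.lo)) := by
        rw [heq]; abel
      rw [this]
      refine (norm_add_le _ _).trans (add_le_add hin (hlip.trans (le_of_eq ?_)))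
      rw [partsError, abs_sub_comm a, norm_sub_rev y, abs_sub_comm b]
    refine ⟨ho.small, ho.linked, ho.potential_eq, vecSum_le_of_parts hwf hwg ho.vec_eq ?_⟩
    have := mul_le_mul_of_nonneg_left he (by positivity : 0 ≤ (C + 1) * (C + 1))
    rw [hK₁]
    linarith
  | nonphysicalWeak hkf hwg h =>
    obtain ⟨hlink, hadm, t, k, ht, hk, rfl⟩ := h
    have hwk : k.WeakPhysical := by
      rw [Front.weakPhysical_iff, hk.1]; exact Front.weakPhysical_iff.1 hwg
    have ho := outgoing_single R S hwk ht hlink hadm hf.near_lo hg.near_hi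
    have hks : SmallFront P U₀ (3 * ρ₁) k := ho.small k List.mem_cons_self
    obtain ⟨hlk, -⟩ := linked_cons.1 hlink
    obtain ⟨-, -, e⟩ := R.sameWave (hg.mono (by linarith)) (hks.mono (by linarith)) hwg hk
    rw [hlk, hl, show ‖coord f.hi - coord f.lo‖ = ‖f.jump‖ from rfl] at e
    have happ : approach f.vec g.vec = ‖f.jump‖ * mass g.vec := by
      rw [approach_eq_mass (by simp [hkf]) hwg ?_, Front.vec, hkf]
      · simp only
        rw [mass_npVec]
      · rw [hkf]
        rcases Front.weakPhysical_iff.1 hwg with q | q | q <;> simp [q, FrontKind.rank]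
    have e1 := R.norm_jump_sub_le (hg.mono (by linarith)) (hks.mono (by linarith)) hwg hk
    rw [hlk, hl, show ‖coord f.hi - coord f.lo‖ = ‖f.jump‖ from rfl] at e1
    have hn : coord g.hi - coord k.hi = f.jump + (g.jump - k.jump) := by
      rw [g.coord_hi, k.coord_hi, hl, hlk, f.coord_hi]; abel
    have hn' : ‖coord g.hi - coord k.hi‖ ≤
        ‖f.jump‖ + C * ((C * C + 1) * (mass g.vec * ‖f.jump‖)) := by
      rw [hn]; exact (norm_add_le _ _).trans (by linarith)
    refine ⟨fun m hm => (ho.small m hm).mono (by linarith), ho.linked, ho.potential_eq, ?_⟩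
    intro i
    have hX := approach_nonneg f.vec_nonneg g.vec_nonneg
    generalize approach f.vec g.vec = X at *
    rw [ho.vec_eq, Front.vec_eq_parts hwg, show f.vec = npVec ‖f.jump‖ by rw [Front.vec, hkf]]
    simp only [Pi.add_apply]
    have h1 := waveVec_le .one k.onePart g.onePart i
    have h2 := waveVec_le .four k.fourPart g.fourPart i
    have h3 : contactVec ‖k.contactPart‖ i ≤
        contactVec ‖g.contactPart‖ i + ‖k.contactPart - g.contactPart‖ := by
      have := norm_sub_norm_le k.contactPart g.contactPart
      have := norm_nonneg (k.contactPart - g.contactPart)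
      fin_cases i <;> simp [contactVec]
      linarith
    have hm := mass_nonneg g.vec_nonneg
    have h4 : npVec ‖coord g.hi - coord k.hi‖ i ≤
        npVec ‖f.jump‖ i + C * ((C * C + 1) * (mass g.vec * ‖f.jump‖)) := by
      have : 0 ≤ C * ((C * C + 1) * (mass g.vec * ‖f.jump‖)) := by positivity
      fin_cases i <;> simp only [npVec] <;> simp <;> linarith
    have h5 : C * X ≤ C * C * X := mul_le_mul_of_nonneg_right (le_mul_of_one_le_left hC0 hC) hX
    rw [mul_comm (mass g.vec), ← happ] at h4 e
    have h6 : C * ((C * C + 1) * X) = C * C * C * X + C * X := by ring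
    have h7 : 0 ≤ C * C * C * X := by linarith
    rw [h6] at h4
    rw [hK₁]
    linarith
  | belowAccurate _ hk => exact absurd hk hg.ne_strong
  | belowSimplified _ hk => exact absurd hk hg.ne_strong
  | belowNonphysical _ hk => exact absurd hk hg.ne_strong
  | aboveAccurate hk => exact absurd hk hf.ne_strong
  | aboveSimplified hk => exact absurd hk hf.ne_strong

end Collision

theorem Region.mono {γ : ℝ} {U₀ : State} {C C' ρ ρ' : ℝ} (R : Region γ U₀ C ρ) (hC : C ≤ C')
    (hρ : ρ' ≤ ρ) (h0 : 0 < ρ') : Region γ U₀ C' ρ' where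
  one_lt := R.one_lt
  physical := R.physical
  angle_zero := R.angle_zero
  mach := R.mach
  one_le := R.one_le.trans hC
  pos := h0
  waves d := (R.waves d).mono hC hρ
  coords := R.coords.mono hC hρ
  wave_eq d lo hi hlo hhi := R.wave_eq d lo hi (hlo.mono hρ) (hhi.mono hρ)

/-! ### Linear estimates at the strong front -/

/-- Eliminating $b$ and $\varphi$ from $p=a+b$, $\varphi\approx F_2b-F_1a$ and $\varphi\approx F_1p$
gives $(F_1+F_2)a\approx(F_2-F_1)p$. The hypothesis on $\varepsilon$ makes $\kappa$ exceed the exact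
coefficient by enough to absorb the errors. -/
theorem abs_reflected_le {F₁ F₂ a b p φ ε κ : ℝ} (hF₁ : 0 < F₁) (hF₂ : 0 < F₂)
    (hε0 : 0 ≤ ε) (hε : 2 * ε * (1 + κ) ≤ κ * (F₁ + F₂) - |F₂ - F₁|)
    (hε' : 2 * ε < F₁ + F₂) (hp : p = a + b)
    (h : |φ - (F₂ * b - F₁ * a)| ≤ ε * (|a| + |b|)) (h' : |φ - F₁ * p| ≤ ε * |p|) :
    |a| ≤ κ * |p| := by
  have hb : |b| ≤ |p| + |a| := by
    rw [show b = p - a by linarith]; exact abs_sub _ _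
  have h1 : (F₁ + F₂) * |a| ≤ |F₂ - F₁| * |p| + ε * |p| + ε * (|a| + |b|) := by
    have e : (F₁ + F₂) * a = (F₂ - F₁) * p - (φ - F₁ * p) + (φ - (F₂ * b - F₁ * a)) := by
      rw [hp]; ring
    have h2 : (F₁ + F₂) * |a| = |(F₁ + F₂) * a| := by
      rw [abs_mul, abs_of_pos (by linarith : 0 < F₁ + F₂)]
    rw [h2, e]
    have h3 := abs_add_le ((F₂ - F₁) * p - (φ - F₁ * p)) (φ - (F₂ * b - F₁ * a))
    have h4 := abs_sub ((F₂ - F₁) * p) (φ - F₁ * p)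
    rw [abs_mul] at h4
    linarith
  have h2 : (F₁ + F₂ - 2 * ε) * |a| ≤ (|F₂ - F₁| + 2 * ε) * |p| := by
    have := mul_le_mul_of_nonneg_left hb hε0
    linarith
  have h3 : (|F₂ - F₁| + 2 * ε) * |p| ≤ (κ * (F₁ + F₂ - 2 * ε)) * |p| :=
    mul_le_mul_of_nonneg_right (by linarith) (abs_nonneg _)
  have h4 : (F₁ + F₂ - 2 * ε) * |a| ≤ (F₁ + F₂ - 2 * ε) * (κ * |p|) := by linarith
  exact le_of_mul_le_mul_left h4 (by linarith)

/-- The same elimination for independent data $p$ and $\varphi$: solvability of the linear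
$2\times2$ system, whose determinant is $F_1+F_2>0$. -/
theorem abs_add_abs_le_of_strong {F₁ F₂ a b p φ ε : ℝ} (hF₁ : 0 < F₁) (hF₂ : 0 < F₂)
    (hε0 : 0 ≤ ε) (hε : 4 * ε ≤ F₁ + F₂) (hp : p = a + b)
    (h : |φ - (F₂ * b - F₁ * a)| ≤ ε * (|a| + |b|)) :
    |a| + |b| ≤ (9 + 4 / (F₁ + F₂)) * (|p| + |φ|) := by
  obtain ⟨S, hS⟩ : ∃ S, S = F₁ + F₂ := ⟨_, rfl⟩
  have hb : |b| ≤ |p| + |a| := by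
    rw [show b = p - a by linarith]; exact abs_sub _ _
  have h1 : S * |a| ≤ F₂ * |p| + |φ| + ε * (|a| + |b|) := by
    have e : S * a = F₂ * p - φ + (φ - (F₂ * b - F₁ * a)) := by
      rw [hp, hS]; ring
    have h2 : S * |a| = |S * a| := by
      rw [abs_mul, abs_of_pos (by linarith : 0 < S)]
    rw [h2, e]
    have h3 := abs_add_le (F₂ * p - φ) (φ - (F₂ * b - F₁ * a))
    have h4 := abs_sub (F₂ * p) φ
    rw [abs_mul, abs_of_pos hF₂] at h4
    linarith
  have hpn := abs_nonneg p
  have hφn := abs_nonneg φ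
  have han := abs_nonneg a
  have h2 : S * |a| ≤ 4 * S * |p| + 2 * |φ| := by
    have k1 := mul_le_mul_of_nonneg_left hb hε0
    have k2 := mul_le_mul_of_nonneg_right hε han
    have k3 := mul_le_mul_of_nonneg_right hε hpn
    have k4 := mul_nonneg hF₁.le hpn
    have k5 := mul_nonneg hF₂.le hpn
    rw [hS] at *
    linarith
  have hS0 : 0 < S := by linarith
  have h3 : |a| ≤ 4 * |p| + 2 / S * |φ| := by
    have h4 : S * |a| ≤ S * (4 * |p| + 2 / S * |φ|) := by
      rw [show S * (4 * |p| + 2 / S * |φ|) = 4 * S * |p| + 2 * |φ| by field_simp]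
      exact h2
    exact le_of_mul_le_mul_left h4 hS0
  rw [← hS]
  have h4 : 4 / S * |φ| = 2 * (2 / S * |φ|) := by ring
  have h5 : 0 ≤ 4 / S * |p| := by positivity
  linarith

/-- The waves that leave the strong front. -/
structure StrongFan (P : Params) (Um Up : State) (ρ : ℝ) (lo hi : State) (new F₁ : List Front)
    (st : Front) (F₄ : List Front) : Prop where
  new_eq : new = F₁ ++ st :: F₄
  small_below : ∀ f ∈ F₁, SmallFront P Um ρ f
  small_above : ∀ f ∈ F₄, SmallFront P Up ρ f
  kind : st.kind = .strong
  admissible : st.Admissible P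
  linked_below : Linked lo F₁ st.lo
  linked_above : Linked st.hi F₄ hi
  potential_below : potential F₁ = 0
  potential_above : potential F₄ = 0
  vec_below : ∃ a, vecSum F₁ = waveVec .one a
  vec_above : ∃ b x, 0 ≤ x ∧ vecSum F₄ = waveVec .four b + npVec x
  near_lo : Near Um ρ st.lo
  near_hi : Near Up ρ st.hi

theorem strong_jump {P : Params} {st : Front} (hk : st.kind = .strong) (ha : st.Admissible P)
    (hlo : Physical st.lo) : st.jump = (st.sigma3, st.sigma2, 0, 0) := by
  unfold Front.Admissible at ha
  rw [hk] at ha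
  exact Front.jump_eq_of_contact hlo ha.1

section Strong

variable {P : Params} {Um Up : State} {C ρ ρ₁ : ℝ}

theorem WaveBounds.angle_zero {γ : ℝ} {z₀ z : FlowCoord} {d : NLFamily} {s σ : ℝ}
    (h : WaveBounds γ z₀ C ρ d) (hC : 0 ≤ C) (hs : |s| ≤ 2 * σ) (hz : ‖z - z₀‖ ≤ σ)
    (hσ : 2 * σ ≤ ρ) :
    |(disp γ d s z).2.2.2 - d.sign * turnRate γ (machSq γ z₀) * s| ≤ 3 * (C * σ) * |s| := by
  have hσ0 : 0 ≤ σ := (norm_nonneg _).trans hz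
  have h1 := h.angle s 0 z (by linarith) (by rw [abs_zero]; linarith) (by linarith)
  rw [h.disp_zero z (by linarith), abs_zero, add_zero, sub_zero] at h1
  rw [show (0 : FlowCoord).2.2.2 = 0 from rfl, sub_zero] at h1
  refine h1.trans (mul_le_mul_of_nonneg_right ?_ (abs_nonneg _))
  have := mul_le_mul_of_nonneg_left (by linarith : |s| + ‖z - z₀‖ ≤ 3 * σ) hC
  linarith

/-- The waves of the accurate solver at the strong front. -/
theorem AccurateStrong.strongFan (Rm : Region P.γ Um C ρ) (Rp : Region P.γ Up C ρ)
    (S : SmallScale P C ρ ρ₁) {lo hi : State} {new : List Front} (h : AccurateStrong P lo hi new)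
    (hlo : Near Um ρ₁ lo) (hhi : Near Up ρ₁ hi) : ∃ F₁ st F₄ a b,
      StrongFan P Um Up (3 * ρ₁) lo hi new F₁ st F₄ ∧ vecSum F₁ = waveVec .one a ∧
      vecSum F₄ = waveVec .four b ∧
      ‖coord hi - coord lo - st.jump‖ ≤ C * (|a| + |b|) ∧
      (coord hi).2.2.1 - (coord lo).2.2.1 = a + b ∧
      |(coord hi).2.2.2 - (coord lo).2.2.2 - (turnRate P.γ (machSq P.γ (coord Up)) * b -
        turnRate P.γ (machSq P.γ (coord Um)) * a)| ≤ 9 * (C * ρ₁) * (|a| + |b|) := by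
  obtain ⟨F₁, f, F₄, rfl, h1, hk, hf, h4⟩ := h
  have h0 := S.pos
  have hS1 := S.le' Rm
  have hC := Rm.one_le
  have hC0 : 0 ≤ C := by linarith
  have hm₁ : Near Um (3 * ρ₁) f.lo := (Rm.near_of_dist S hlo h1.1 (by linarith)).mono (by linarith)
  have hm₂ : Near Up (3 * ρ₁) f.hi := (Rp.near_of_dist S hhi (by rw [dist_comm]; exact h4.1)
    (by linarith)).mono (by linarith)
  have hlo' : Near Um (3 * ρ₁) lo := hlo.mono (by linarith)
  have hhi' : Near Up (3 * ρ₁) hi := hhi.mono (by linarith)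
  have hρ : 3 * ρ₁ ≤ ρ := by linarith
  obtain ⟨p1, p2, p3, p4⟩ := Rm.fan hρ h1 hlo' hm₁
  obtain ⟨q1, q2, q3, q4⟩ := Rp.fan hρ h4 hm₂ hhi'
  obtain ⟨a, ha⟩ : ∃ a, a = (coord f.lo).2.2.1 - (coord lo).2.2.1 := ⟨_, rfl⟩
  obtain ⟨b, hb⟩ : ∃ b, b = (coord hi).2.2.1 - (coord f.hi).2.2.1 := ⟨_, rfl⟩
  have ha' : |a| ≤ 2 * (3 * ρ₁) := ha ▸ hm₁.pressure_sub_le hlo'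
  have hb' : |b| ≤ 2 * (3 * ρ₁) := hb ▸ hhi'.pressure_sub_le hm₂
  rw [← ha] at p2 p4
  rw [← hb] at q2 q4
  -- Although the strong jump is large, $\log p$ and $\varphi$ are continuous across it. The two
  -- weak waves therefore satisfy two scalar equations that do not involve its strength.
  have hj := strong_jump hk hf hm₁.1
  have hj3 : f.jump.2.2.1 = 0 := by rw [hj]
  have hj4 : f.jump.2.2.2 = 0 := by rw [hj]
  have hj3' : (coord f.hi).2.2.1 = (coord f.lo).2.2.1 := sub_eq_zero.1 hj3
  have hj4' : (coord f.hi).2.2.2 = (coord f.lo).2.2.2 := sub_eq_zero.1 hj4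
  refine ⟨F₁, f, F₄, a, b, ⟨rfl, p1, q1, hk, hf, h1.2.1, h4.2.1, p3, q3, ⟨a, p2⟩,
    ⟨b, 0, le_rfl, ?_⟩, hm₁, hm₂⟩,
    p2, q2, ?_, ?_, ?_⟩
  · rw [q2, npVec_zero, add_zero]
  · have e : coord hi - coord lo - f.jump =
        disp P.γ .one a (coord lo) + disp P.γ .four b (coord f.hi) := by
      rw [q4, Front.jump, p4]; abel
    rw [e]
    have n1 := (Rm.waves .one).disp_norm Rm.pos.le (s := a) (by linarith) (hlo'.2.trans hρ)
    have n2 := (Rp.waves .four).disp_norm Rm.pos.le (s := b) (by linarith) (hm₂.2.trans hρ)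
    exact (norm_add_le _ _).trans (by linarith)
  · rw [ha, hb, hj3']; ring
  · have n1 := (Rm.waves .one).angle_zero hC0 ha' hlo'.2 (by linarith)
    have n2 := (Rp.waves .four).angle_zero hC0 hb' hm₂.2 (by linarith)
    have e1 : (disp P.γ .one a (coord lo)).2.2.2 = (coord f.lo).2.2.2 - (coord lo).2.2.2 := by
      rw [p4]; simp
    have e2 : (disp P.γ .four b (coord f.hi)).2.2.2 = (coord hi).2.2.2 - (coord f.lo).2.2.2 := by
      rw [q4, ← hj4']; simp
    rw [e1] at n1
    rw [e2] at n2
    simp only [NLFamily.sign] at n1 n2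
    have := abs_add_le ((coord f.lo).2.2.2 - (coord lo).2.2.2 -
      -1 * turnRate P.γ (machSq P.γ (coord Um)) * a) ((coord hi).2.2.2 - (coord f.lo).2.2.2 -
      1 * turnRate P.γ (machSq P.γ (coord Up)) * b)
    rw [show ∀ x y z F G : ℝ, x - y - -1 * F * a + (z - x - 1 * G * b) =
      z - y - (G * b - F * a) by intros; ring] at this
    linarith

/-- The simplified solver at the strong front. -/
theorem SimplifiedKeep.strongFan {σ : ℝ} {k : Front} {lo hi : State} {new : List Front} (hk : k.kind = .strong)
    (hka : k.Admissible P) (hkl : Physical k.lo) (h : SimplifiedKeep P k lo hi new)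
    (hlo : Near Um σ lo) (hhi : Near Up σ hi)
    (hn : ‖coord lo + k.jump - coord Up‖ ≤ σ) : ∃ st F₄,
      StrongFan P Um Up σ lo hi new [] st F₄ ∧ st.jump = k.jump ∧
      mass (vecSum F₄) = ‖coord hi - coord lo - k.jump‖ := by
  obtain ⟨hl, ha, t, st, ht, hs, rfl⟩ := h
  obtain ⟨rfl, hl'⟩ := linked_cons.1 hl
  have hks := hs.1.trans hk
  have hsa := ha st List.mem_cons_self
  have h2 := hs.2
  rw [hk] at h2
  have hj : st.jump = k.jump := by
    rw [strong_jump hks hsa hlo.1, strong_jump hk hka hkl, h2.1, h2.2]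
  have hhi' : Near Up σ st.hi := by
    refine ⟨?_, by rw [st.coord_hi, hj]; exact hn⟩
    unfold Front.Admissible at hsa
    rw [hks] at hsa
    obtain ⟨⟨σ₃, σ₂, he⟩, -⟩ := hsa
    rw [he]
    exact hlo.1.contactMap _ _
  obtain ⟨t1, t2, t3⟩ := ht.linked hl' (fun h hh => ha h (List.mem_cons_of_mem _ hh)) hhi' hhi
  have hX : coord hi - coord st.hi = coord hi - coord st.lo - k.jump := by
    rw [st.coord_hi, hj]; abel
  refine ⟨st, t, ⟨rfl, by simp, t1, hks, hsa, rfl, hl', rfl, t2, ⟨0, ?_⟩,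
    ⟨0, ‖coord hi - coord st.hi‖, norm_nonneg _, ?_⟩, hlo, hhi'⟩, hj, ?_⟩
  · rw [waveVec_zero, vecSum_nil]
  · rw [waveVec_zero, zero_add]; exact t3
  · rw [t3, mass_npVec, hX]

/-- The interaction of weak fronts with the strong front. -/
theorem exists_strong_bound {γ : ℝ} (Rm : Region γ Um C ρ) (Rp : Region γ Up C ρ) :
    ∃ κ K ε : ℝ, 0 < κ ∧ κ < 1 ∧ 1 ≤ K ∧ 0 < ε ∧ ∀ P : Params, P.γ = γ → ∀ ρ₁ ≤ ε,
      SmallScale P C ρ ρ₁ →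
      (∀ lo hi new, AccurateStrong P lo hi new → Near Um ρ₁ lo → Near Up ρ₁ hi → ∃ F₁ st F₄,
        StrongFan P Um Up (3 * ρ₁) lo hi new F₁ st F₄ ∧
        mass (vecSum F₁) + mass (vecSum F₄) + ‖coord hi - coord lo - st.jump‖ ≤
          K * (|(coord hi).2.2.1 - (coord lo).2.2.1| + |(coord hi).2.2.2 - (coord lo).2.2.2|)) ∧
      (∀ f g new, f.kind ≠ .nonlinear .one → SmallFront P Um ρ₁ f → g.kind = .strong →
        g.Admissible P → g.lo = f.hi → Near Up ρ₁ g.hi → CollisionRule P f g new → ∃ F₁ st F₄,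
        StrongFan P Um Up (6 * ρ₁) f.lo g.hi new F₁ st F₄ ∧
        mass (vecSum F₁) ≤ κ * |f.fourPart| ∧
        mass (vecSum F₁) + mass (vecSum F₄) + ‖st.jump - g.jump‖ ≤ K * mass f.vec) ∧
      (∀ f g new, SmallFront P Up ρ₁ g → f.kind = .strong →
        f.Admissible P → g.lo = f.hi → Near Um ρ₁ f.lo → CollisionRule P f g new → ∃ F₁ st F₄,
        StrongFan P Um Up (6 * ρ₁) f.lo g.hi new F₁ st F₄ ∧
        mass (vecSum F₁) + mass (vecSum F₄) + ‖st.jump - f.jump‖ ≤ K * mass g.vec) := by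
  obtain ⟨F₁, hF₁⟩ : ∃ F, F = turnRate γ (machSq γ (coord Um)) := ⟨_, rfl⟩
  obtain ⟨F₂, hF₂⟩ : ∃ F, F = turnRate γ (machSq γ (coord Up)) := ⟨_, rfl⟩
  have p₁ : 0 < F₁ := hF₁ ▸ turnRate_pos Rm.one_lt Rm.mach
  have p₂ : 0 < F₂ := hF₂ ▸ turnRate_pos Rp.one_lt Rp.mach
  have hC := Rm.one_le
  have hC0 : 0 ≤ C := by linarith
  have hρ := Rm.pos
  -- The exact reflection coefficient is less than $1$ because both turning rates are positive; a
  -- value strictly in between leaves room for the higher-order terms.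
  obtain ⟨κ, hκ, hκ0, hκ1⟩ : ∃ κ, |F₂ - F₁| < κ * (F₁ + F₂) ∧ 0 < κ ∧ κ < 1 := by
    have h1 : |F₂ - F₁| / (F₁ + F₂) < 1 := by
      rw [div_lt_one (by linarith), abs_lt]
      constructor <;> linarith
    obtain ⟨κ, h2, h3⟩ := exists_between h1
    refine ⟨κ, ?_, lt_of_le_of_lt (by positivity) h2, h3⟩
    rwa [div_lt_iff₀ (by linarith)] at h2
  obtain ⟨K₀, hK₀⟩ : ∃ K₀, K₀ = 9 + 4 / (F₁ + F₂) := ⟨_, rfl⟩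
  have hK₀1 : 1 ≤ K₀ := by
    have : 0 < 4 / (F₁ + F₂) := by positivity
    linarith
  obtain ⟨ε, hε, hε1, hε2⟩ : ∃ ε > 0, 2 * (9 * (C * ε)) * (1 + κ) ≤ κ * (F₁ + F₂) - |F₂ - F₁| ∧
      4 * (9 * (C * ε)) ≤ F₁ + F₂ := by
    have hd : 0 < κ * (F₁ + F₂) - |F₂ - F₁| := by linarith
    refine ⟨min ((κ * (F₁ + F₂) - |F₂ - F₁|) / (36 * C)) ((F₁ + F₂) / (36 * C)), by positivity,
      ?_, ?_⟩
    · have h1 := min_le_left ((κ * (F₁ + F₂) - |F₂ - F₁|) / (36 * C)) ((F₁ + F₂) / (36 * C))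
      rw [le_div_iff₀ (by positivity)] at h1
      refine (mul_le_mul_of_nonneg_left (by linarith : 1 + κ ≤ 2) (by positivity)).trans ?_
      linarith
    · have h1 := min_le_right ((κ * (F₁ + F₂) - |F₂ - F₁|) / (36 * C)) ((F₁ + F₂) / (36 * C))
      rw [le_div_iff₀ (by positivity)] at h1
      linarith
  obtain ⟨K, hK⟩ : ∃ K, K = 2 * (K₀ * C * (1 + C)) + C + 2 * (K₀ * (1 + C)) := ⟨_, rfl⟩
  refine ⟨κ, K, ε, hκ0, hκ1, ?_, hε, ?_⟩
  · have : 0 ≤ 2 * (K₀ * C * (1 + C)) := by positivity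
    have : 0 ≤ 2 * (K₀ * (1 + C)) := by positivity
    linarith
  rintro P rfl ρ₁ hρ₁ S
  have hS := S.pos
  have hS1 := S.le' Rm
  have hη0 : 0 ≤ 9 * (C * ρ₁) := by positivity
  have hη : 9 * (C * ρ₁) ≤ 9 * (C * ε) := by
    have := mul_le_mul_of_nonneg_left hρ₁ hC0
    linarith
  have hη1 : 2 * (9 * (C * ρ₁)) * (1 + κ) ≤ κ * (F₁ + F₂) - |F₂ - F₁| :=
    (mul_le_mul_of_nonneg_right (by linarith) (by linarith)).trans hε1
  -- Only the jumps of $\log p$ and $\varphi$ enter. The last conclusion is the sharp bound of the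
  -- reflected wave when these jumps are related as in a $4$-wave from below.
  have key : ∀ lo hi new, AccurateStrong P lo hi new → Near Um ρ₁ lo → Near Up ρ₁ hi → ∃ L st F,
        StrongFan P Um Up (3 * ρ₁) lo hi new L st F ∧
        (mass (vecSum L) + mass (vecSum F) ≤ K₀ *
          (|(coord hi).2.2.1 - (coord lo).2.2.1| + |(coord hi).2.2.2 - (coord lo).2.2.2|)) ∧
        (‖coord hi - coord lo - st.jump‖ ≤ C * (mass (vecSum L) + mass (vecSum F))) ∧
        (|(coord hi).2.2.2 - (coord lo).2.2.2 - F₁ * ((coord hi).2.2.1 - (coord lo).2.2.1)| ≤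
          9 * (C * ρ₁) * |(coord hi).2.2.1 - (coord lo).2.2.1| →
          mass (vecSum L) ≤ κ * |(coord hi).2.2.1 - (coord lo).2.2.1|) := by
    intro lo hi new h hlo hhi
    obtain ⟨L, st, F, a, b, hsf, h1, h2, h3, h4, h5⟩ := h.strongFan Rm Rp S hlo hhi
    rw [← hF₁, ← hF₂] at h5
    refine ⟨L, st, F, hsf, ?_, ?_, ?_⟩
    · rw [h1, h2, mass_waveVec, mass_waveVec, hK₀]
      exact abs_add_abs_le_of_strong p₁ p₂ hη0 (by linarith) h4 h5
    · rw [h1, h2, mass_waveVec, mass_waveVec]; exact h3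
    · intro h6
      rw [h1, mass_waveVec]
      exact abs_reflected_le p₁ p₂ hη0 hη1 (by linarith) h4 h5 h6
  have hjsum : ∀ J A B : ℝ, 0 ≤ J → A ≤ K₀ * (J + J) → B ≤ C * A → A + (J + B) ≤
      (2 * (K₀ * (1 + C)) + 1) * J := by
    intro J A B hJ hA hB
    have := mul_le_mul_of_nonneg_left hA hC0
    linarith
  refine ⟨?_, ?_, ?_⟩
  · intro lo hi new h hlo hhi
    obtain ⟨L, st, F, hsf, h1, h2, -⟩ := key lo hi new h hlo hhi
    refine ⟨L, st, F, hsf, ?_⟩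
    have h3 := mul_le_mul_of_nonneg_left h1 hC0
    have hX : 0 ≤ |(coord hi).2.2.1 - (coord lo).2.2.1| + |(coord hi).2.2.2 - (coord lo).2.2.2| := by
      positivity
    generalize |(coord hi).2.2.1 - (coord lo).2.2.1| + |(coord hi).2.2.2 - (coord lo).2.2.2| = X at *
    rw [hK]
    have q1 : 0 ≤ K₀ * C * (1 + C) * X := by positivity
    have q2 : 0 ≤ C * X := by positivity
    have q3 : 0 ≤ K₀ * (1 + C) * X := by positivity
    linarith
  · intro f g new hf1 hf hk hg hl hhi hcol
    have hjp := strong_jump hk hg (hl ▸ hf.near_hi.1)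
    have hjf := Rm.norm_jump_le (hf.mono (by linarith : ρ₁ ≤ ρ / 2))
    have hmf := mass_nonneg f.vec_nonneg
    have hCm : C * mass f.vec ≤ K * mass f.vec := by
      refine mul_le_mul_of_nonneg_right ?_ hmf
      have : 0 ≤ K₀ * C * (1 + C) := by positivity
      have : 0 ≤ K₀ * (1 + C) := by positivity
      linarith
    have htot : coord g.hi - coord f.lo = f.jump + g.jump := by
      rw [g.coord_hi, hl, f.coord_hi]; abel
    have hacc : f.WeakPhysical → AccurateStrong P f.lo g.hi new → ∃ F₁ st F₄,
        StrongFan P Um Up (6 * ρ₁) f.lo g.hi new F₁ st F₄ ∧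
        mass (vecSum F₁) ≤ κ * |f.fourPart| ∧
        mass (vecSum F₁) + mass (vecSum F₄) + ‖st.jump - g.jump‖ ≤ K * mass f.vec := by
      intro hw h
      obtain ⟨L, st, F, hsf, h1, h2, h3⟩ := key _ _ new h hf.near_lo hhi
      have e3 : (coord g.hi).2.2.1 - (coord f.lo).2.2.1 = f.jump.2.2.1 := by
        have : (coord g.hi - coord f.lo).2.2.1 = f.jump.2.2.1 := by rw [htot, hjp]; simp
        exact this
      have e4 : (coord g.hi).2.2.2 - (coord f.lo).2.2.2 = f.jump.2.2.2 := by
        have : (coord g.hi - coord f.lo).2.2.2 = f.jump.2.2.2 := by rw [htot, hjp]; simp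
        exact this
      rw [e3, e4] at h1 h3
      rw [htot] at h2
      have hsf' : StrongFan P Um Up (6 * ρ₁) f.lo g.hi new L st F :=
        ⟨hsf.1, fun k hk => (hsf.2 k hk).mono (by linarith),
          fun k hk => (hsf.3 k hk).mono (by linarith), hsf.4, hsf.5, hsf.6, hsf.7, hsf.8, hsf.9,
          hsf.10, hsf.11, hsf.12.mono (by linarith), hsf.13.mono (by linarith)⟩
      have hD : ‖st.jump - g.jump‖ ≤ ‖f.jump‖ + ‖f.jump + g.jump - st.jump‖ := by
        rw [show st.jump - g.jump = f.jump - (f.jump + g.jump - st.jump) by abel]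
        exact norm_sub_le _ _
      refine ⟨L, st, F, hsf', ?_, ?_⟩
      -- A contact changes neither pressure nor angle and so causes no reflection. With the
      -- convention that its `fourPart` is $0$ it satisfies the same sharp bound as a $4$-wave.
      · have hfour : |f.jump.2.2.1| = |f.fourPart| ∧
            |f.jump.2.2.2 - F₁ * f.jump.2.2.1| ≤ 9 * (C * ρ₁) * |f.jump.2.2.1| := by
          rcases Front.weakPhysical_iff.1 hw with q | q | q
          · exact absurd q hf1
          · rw [hf.jump_contact q]
            simp [Front.fourPart, q]
          · refine ⟨by simp only [Front.fourPart, q]; rfl, ?_⟩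
            have := (Rm.waves .four).angle_zero hC0 hf.abs_pressureJump_le hf.near_lo.2
              (by linarith)
            rw [← Rm.jump_nonlinear (hf.mono (by linarith)) q, ← hF₁] at this
            simp only [NLFamily.sign, one_mul] at this
            refine this.trans (mul_le_mul_of_nonneg_right ?_ (abs_nonneg _))
            linarith
        rw [← hfour.1]
        exact h3 hfour.2
      · have a3 := FlowCoord.abs_trd_le f.jump
        have a4 := FlowCoord.abs_fth_le f.jump
        have h1' := h1.trans (mul_le_mul_of_nonneg_left (add_le_add a3 a4) (by linarith))
        have := hjsum _ _ _ (norm_nonneg _) h1' h2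
        have h5 := mul_le_mul_of_nonneg_left hjf (by positivity : 0 ≤ 2 * (K₀ * (1 + C)) + 1)
        have q1 : 0 ≤ K₀ * (1 + C) * mass f.vec := by positivity
        rw [hK]
        linarith
    have hkeep : SimplifiedKeep P g f.lo g.hi new → ∃ F₁ st F₄,
        StrongFan P Um Up (6 * ρ₁) f.lo g.hi new F₁ st F₄ ∧
        mass (vecSum F₁) ≤ κ * |f.fourPart| ∧
        mass (vecSum F₁) + mass (vecSum F₄) + ‖st.jump - g.jump‖ ≤ K * mass f.vec := by
      intro h
      have hjn : ‖f.jump‖ ≤ 2 * ρ₁ := hf.near_hi.sub_norm_le hf.near_lo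
      obtain ⟨st, F, hsf, hj, hm⟩ := h.strongFan (σ := 6 * ρ₁) hk hg
        (hl ▸ hf.near_hi.1) (hf.near_lo.mono (by linarith)) (hhi.mono (by linarith)) (by
          rw [show coord f.lo + g.jump - coord Up = (coord g.hi - coord Up) - f.jump by
            rw [g.coord_hi, hl, f.coord_hi]; abel]
          exact (norm_sub_le _ _).trans (by linarith [hhi.2]))
      refine ⟨[], st, F, hsf, ?_, ?_⟩
      · rw [vecSum_nil, mass_zero]; positivity
      · rw [hm, htot, add_sub_cancel_right, hj, sub_self, norm_zero, vecSum_nil, mass_zero]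
        linarith
    cases hcol with
    | weakAccurate _ hw => exact absurd hw (by simp [Front.WeakPhysical, hk])
    | weakSimplified _ hw => exact absurd hw (by simp [Front.WeakPhysical, hk])
    | nonphysicalWeak _ hw => exact absurd hw (by simp [Front.WeakPhysical, hk])
    | belowAccurate hw _ _ h => exact hacc hw h
    | belowSimplified _ _ _ h => exact hkeep h
    | belowNonphysical _ _ h => exact hkeep h
    | aboveAccurate hk' => exact absurd hk' hf.ne_strong
    | aboveSimplified hk' => exact absurd hk' hf.ne_strong
  · intro f g new hg hk hf hl hlo hcol
    have hjp := strong_jump hk hf hlo.1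
    have hjg := Rp.norm_jump_le (hg.mono (by linarith : ρ₁ ≤ ρ / 2))
    have hmg := mass_nonneg g.vec_nonneg
    have htot : coord g.hi - coord f.lo = g.jump + f.jump := by
      rw [g.coord_hi, hl, f.coord_hi]; abel
    have hacc : AccurateStrong P f.lo g.hi new → ∃ F₁ st F₄,
        StrongFan P Um Up (6 * ρ₁) f.lo g.hi new F₁ st F₄ ∧
        mass (vecSum F₁) + mass (vecSum F₄) + ‖st.jump - f.jump‖ ≤ K * mass g.vec := by
      intro h
      obtain ⟨L, st, F, hsf, h1, h2, -⟩ := key _ _ new h hlo hg.near_hi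
      have e3 : (coord g.hi).2.2.1 - (coord f.lo).2.2.1 = g.jump.2.2.1 := by
        have : (coord g.hi - coord f.lo).2.2.1 = g.jump.2.2.1 := by rw [htot, hjp]; simp
        exact this
      have e4 : (coord g.hi).2.2.2 - (coord f.lo).2.2.2 = g.jump.2.2.2 := by
        have : (coord g.hi - coord f.lo).2.2.2 = g.jump.2.2.2 := by rw [htot, hjp]; simp
        exact this
      rw [e3, e4] at h1
      rw [htot] at h2
      refine ⟨L, st, F, ⟨hsf.1, fun k hk => (hsf.2 k hk).mono (by linarith),
          fun k hk => (hsf.3 k hk).mono (by linarith), hsf.4, hsf.5, hsf.6, hsf.7, hsf.8, hsf.9,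
          hsf.10, hsf.11, hsf.12.mono (by linarith), hsf.13.mono (by linarith)⟩, ?_⟩
      have hD : ‖st.jump - f.jump‖ ≤ ‖g.jump‖ + ‖g.jump + f.jump - st.jump‖ := by
        rw [show st.jump - f.jump = g.jump - (g.jump + f.jump - st.jump) by abel]
        exact norm_sub_le _ _
      have a3 := FlowCoord.abs_trd_le g.jump
      have a4 := FlowCoord.abs_fth_le g.jump
      have h1' := h1.trans (mul_le_mul_of_nonneg_left (add_le_add a3 a4) (by linarith))
      have := hjsum _ _ _ (norm_nonneg _) h1' h2
      have h5 := mul_le_mul_of_nonneg_left hjg (by positivity : 0 ≤ 2 * (K₀ * (1 + C)) + 1)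
      have q1 : 0 ≤ K₀ * (1 + C) * mass g.vec := by positivity
      rw [hK]
      linarith
    have hkeep : SimplifiedKeep P f f.lo g.hi new → ∃ F₁ st F₄,
        StrongFan P Um Up (6 * ρ₁) f.lo g.hi new F₁ st F₄ ∧
        mass (vecSum F₁) + mass (vecSum F₄) + ‖st.jump - f.jump‖ ≤ K * mass g.vec := by
      intro h
      obtain ⟨st, F, hsf, hj, hm⟩ := h.strongFan (σ := 6 * ρ₁) hk hf
        hlo.1 (hlo.mono (by linarith)) (hg.near_hi.mono (by linarith)) (by
          rw [← f.coord_hi, ← hl]; exact hg.near_lo.2.trans (by linarith))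
      refine ⟨[], st, F, hsf, ?_⟩
      rw [hm, htot, add_sub_cancel_right, hj, sub_self, norm_zero, vecSum_nil, mass_zero, hK]
      have q1 : 0 ≤ K₀ * C * (1 + C) * mass g.vec := by positivity
      have q2 : 0 ≤ K₀ * (1 + C) * mass g.vec := by positivity
      linarith
    have hnw : ¬ f.WeakPhysical := by simp [Front.WeakPhysical, hk]
    cases hcol with
    | weakAccurate hw => exact absurd hw hnw
    | weakSimplified hw => exact absurd hw hnw
    | nonphysicalWeak hk' => rw [hk] at hk'; cases hk'
    | belowAccurate hw => exact absurd hw hnw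
    | belowSimplified hw => exact absurd hw hnw
    | belowNonphysical hk' => rw [hk] at hk'; cases hk'
    | aboveAccurate _ _ _ h => exact hacc h
    | aboveSimplified _ _ _ h => exact hkeep h

end Strong

/-! ### The lateral Riemann problem -/

/-- The result of the lateral Riemann problem. -/
structure LateralFan (P : Params) (U₀ : State) (ρ slope : ℝ) (bot Ua : State) (new : List Front)
    (b : ℝ) : Prop where
  near : Near U₀ ρ bot
  angle : (coord bot).2.2.2 = Real.arctan slope
  small : ∀ f ∈ new, SmallFront P U₀ ρ f
  linked : Linked bot new Ua
  potential_eq : potential new = 0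
  vec_eq : vecSum new = waveVec .four b

/-- The size $b$ is determined by the required turning,
$Fb\approx\varphi(U_a)-\arctan(\text{slope})$. If $U_a$ is the upper state of an incident $1$-wave
of size $s$, the turning in that wave is $-Fs$ with the same $F$, so the reflection coefficient is
$1$ up to $\delta$. A contact does not turn the flow. The mismatch below the incident front enters
with a constant independent of $\delta$. -/
theorem Region.exists_lateral_bound {γ : ℝ} {U₀ : State} {C ρ : ℝ} (R : Region γ U₀ C ρ) :
    ∃ K ≥ (1 : ℝ), ∀ δ > (0 : ℝ), ∃ ε > (0 : ℝ), ∀ P : Params, P.γ = γ → ∀ ρ₁ ≤ ε,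
      SmallScale P C ρ ρ₁ → ∀ slope bot Ua new, AccurateLateral P slope bot Ua new →
        Near U₀ ρ₁ Ua → ∃ b, LateralFan P U₀ (3 * ρ₁) slope bot Ua new b ∧
          |b| ≤ K * |(coord Ua).2.2.2 - Real.arctan slope| ∧
          ∀ f, SmallFront P U₀ ρ₁ f → f.WeakPhysical → f.kind ≠ .nonlinear .four → f.hi = Ua →
            |b| ≤ (1 + δ) * |f.onePart| + K * |(coord f.lo).2.2.2 - Real.arctan slope| := by
  obtain ⟨F, hF⟩ : ∃ F, F = turnRate γ (machSq γ (coord U₀)) := ⟨_, rfl⟩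
  have pF : 0 < F := hF ▸ turnRate_pos R.one_lt R.mach
  have hC := R.one_le
  have hC0 : 0 ≤ C := by linarith
  refine ⟨1 + 2 / F, by linarith [(by positivity : 0 < 2 / F)], fun δ hδ => ?_⟩
  -- With $\eta=9C\rho_1$ the error of the linearized turning, the first bound allows division by
  -- $F-\eta$ and the second says $F+\eta\le(F-\eta)(1+\delta)$.
  obtain ⟨ε, hε, hε1, hε2⟩ : ∃ ε > 0, 9 * (C * ε) ≤ F / 2 ∧ 9 * (C * ε) * (2 + δ) ≤ δ * F := by
    refine ⟨min (F / (18 * C)) (δ * F / (9 * C * (2 + δ))), by positivity, ?_, ?_⟩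
    · have h1 := min_le_left (F / (18 * C)) (δ * F / (9 * C * (2 + δ)))
      rw [le_div_iff₀ (by positivity)] at h1
      linarith
    · have h1 := min_le_right (F / (18 * C)) (δ * F / (9 * C * (2 + δ)))
      rw [le_div_iff₀ (by positivity)] at h1
      linarith
  refine ⟨ε, hε, ?_⟩
  rintro P rfl ρ₁ hρ₁ S slope bot Ua new ⟨hv, h⟩ hUa
  have hS := S.pos
  have hS1 := S.le' R
  have hρ := R.pos
  have hbot : Near U₀ (3 * ρ₁) bot := (R.near_of_dist S hUa (by rw [dist_comm]; exact h.1)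
    (by linarith)).mono (by linarith)
  have hUa' : Near U₀ (3 * ρ₁) Ua := hUa.mono (by linarith)
  obtain ⟨q1, q2, q3, q4⟩ := R.fan (by linarith : 3 * ρ₁ ≤ ρ) h hbot hUa'
  obtain ⟨b, hb⟩ : ∃ b, b = (coord Ua).2.2.1 - (coord bot).2.2.1 := ⟨_, rfl⟩
  have hb' : |b| ≤ 2 * (3 * ρ₁) := hb ▸ hUa'.pressure_sub_le hbot
  rw [← hb] at q2 q4
  have hang : (coord bot).2.2.2 = Real.arctan slope := by
    simp only [coord]
    rw [hv, mul_div_cancel_right₀ _ hbot.1.uu_pos.ne']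
  obtain ⟨η, hη⟩ : ∃ η, η = 9 * (C * ρ₁) := ⟨_, rfl⟩
  have hη0 : 0 ≤ η := by rw [hη]; positivity
  have hηε : η ≤ 9 * (C * ε) := by
    have := mul_le_mul_of_nonneg_left hρ₁ hC0
    linarith
  have hη1 : η ≤ F / 2 := hηε.trans hε1
  have hη2 : η * (2 + δ) ≤ δ * F :=
    (mul_le_mul_of_nonneg_right hηε (by linarith)).trans hε2
  have n2 := (R.waves .four).angle_zero hC0 hb' hbot.2 (by linarith)
  rw [show (disp P.γ .four b (coord bot)).2.2.2 = (coord Ua).2.2.2 - Real.arctan slope by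
    rw [q4, ← hang]; simp, ← hF, show 3 * (C * (3 * ρ₁)) = η by rw [hη]; ring] at n2
  simp only [NLFamily.sign, one_mul] at n2
  have hFb : F * |b| = |F * b| := by rw [abs_mul, abs_of_pos pF]
  have hbn := abs_nonneg b
  refine ⟨b, ⟨hbot, hang, q1, h.2.1, q3, q2⟩, ?_, ?_⟩
  · have h1 : F * |b| ≤ |(coord Ua).2.2.2 - Real.arctan slope| + η * |b| := by
      rw [hFb]
      have := abs_sub ((coord Ua).2.2.2 - Real.arctan slope)
        ((coord Ua).2.2.2 - Real.arctan slope - F * b)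
      rw [sub_sub_cancel] at this
      linarith
    generalize |(coord Ua).2.2.2 - Real.arctan slope| = X at *
    have h2 := mul_le_mul_of_nonneg_right hη1 hbn
    have h3 : |b| ≤ 2 / F * X := by
      rw [div_mul_eq_mul_div, le_div_iff₀ pF]; linarith
    have hX : 0 ≤ X := by
      have : 0 ≤ F / 2 * |b| := by positivity
      linarith
    linarith
  · intro f hf hw hk hhi
    have hs := hf.abs_pressureJump_le
    have h0 : |(coord Ua).2.2.2 - (coord f.lo).2.2.2 + F * f.onePart| ≤ η * |f.onePart| := by
      rw [← hhi, show (coord f.hi).2.2.2 - (coord f.lo).2.2.2 = f.jump.2.2.2 from rfl]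
      rcases Front.weakPhysical_iff.1 hw with q | q | q
      · have := (R.waves .one).angle_zero hC0 hs hf.near_lo.2 (by linarith)
        rw [← R.jump_nonlinear (hf.mono (by linarith)) q, ← hF] at this
        simp only [NLFamily.sign] at this
        simp only [Front.onePart, q]
        rw [show f.jump.2.2.2 + F * f.pressureJump = f.jump.2.2.2 - -1 * F * f.pressureJump by ring]
        refine this.trans (mul_le_mul_of_nonneg_right ?_ (abs_nonneg _))
        have : 0 ≤ C * ρ₁ := by positivity
        linarith
      · rw [hf.jump_contact q]
        simp [Front.onePart, q]
      · exact absurd q hk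
    generalize f.onePart = s at *
    have hsn := abs_nonneg s
    have h1 : F * |b| ≤ |(coord f.lo).2.2.2 - Real.arctan slope| + (F + η) * |s| + η * |b| := by
      rw [hFb, show F * b = ((coord f.lo).2.2.2 - Real.arctan slope) - F * s +
        ((coord Ua).2.2.2 - (coord f.lo).2.2.2 + F * s) -
        ((coord Ua).2.2.2 - Real.arctan slope - F * b) by ring]
      have k1 := abs_sub (((coord f.lo).2.2.2 - Real.arctan slope) - F * s +
        ((coord Ua).2.2.2 - (coord f.lo).2.2.2 + F * s))
        ((coord Ua).2.2.2 - Real.arctan slope - F * b)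
      have k2 := abs_add_le (((coord f.lo).2.2.2 - Real.arctan slope) - F * s)
        ((coord Ua).2.2.2 - (coord f.lo).2.2.2 + F * s)
      have k3 := abs_sub ((coord f.lo).2.2.2 - Real.arctan slope) (F * s)
      rw [abs_mul, abs_of_pos pF] at k3
      linarith
    have hX := abs_nonneg ((coord f.lo).2.2.2 - Real.arctan slope)
    generalize |(coord f.lo).2.2.2 - Real.arctan slope| = X at *
    have hd : 0 < F - η := by linarith
    have h2 : (F - η) * |b| ≤ (F - η) * ((1 + δ) * |s| + 2 / F * X) := by
      have k1 : (F + η) * |s| ≤ (F - η) * (1 + δ) * |s| :=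
        mul_le_mul_of_nonneg_right (by linarith) hsn
      have k2 : X ≤ (F - η) * (2 / F * X) := by
        have : F / 2 * (2 / F * X) ≤ (F - η) * (2 / F * X) :=
          mul_le_mul_of_nonneg_right (by linarith) (by positivity)
        rwa [show F / 2 * (2 / F * X) = X by field_simp] at this
      linarith
    have h3 := le_of_mul_le_mul_left h2 hd
    linarith

/-! ### The Glimm functional -/

def dot (w x : WaveVec) : ℝ := ∑ i, w i * x i

theorem dot_add (w x y : WaveVec) : dot w (x + y) = dot w x + dot w y := by
  simp [dot, mul_add, Finset.sum_add_distrib]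

theorem dot_zero (w : WaveVec) : dot w 0 = 0 := by simp [dot]

theorem dot_mono {w x y : WaveVec} (hw : 0 ≤ w) (h : x ≤ y) : dot w x ≤ dot w y :=
  Finset.sum_le_sum fun i _ => mul_le_mul_of_nonneg_left (h i) (hw i)

theorem dot_eq (w x : WaveVec) :
    dot w x = w 0 * x 0 + w 1 * x 1 + w 2 * x 2 + w 3 * x 3 + w 4 * x 4 + w 5 * x 5 := by
  simp [dot, Fin.sum_univ_succ]; ring

theorem dot_const (w : WaveVec) (c : ℝ) : dot w (fun _ => c) = mass w * c := by
  simp [dot, mass, Finset.sum_mul]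

theorem mul_mass_le_dot {w x : WaveVec} {c : ℝ} (hw : ∀ i, c ≤ w i) (hx : 0 ≤ x) :
    c * mass x ≤ dot w x := by
  rw [mass, Finset.mul_sum]
  exact Finset.sum_le_sum fun i _ => mul_le_mul_of_nonneg_right (hw i) (hx i)

/-- Weights of the Glimm functional; `m` bounds the total strength, and the other constants are
those of the interaction estimates. -/
structure Weights where
  κ : ℝ
  W : ℝ
  e : ℝ
  Λ : ℝ
  kw : ℝ
  m : ℝ
  e_pos : 0 < e
  e_le : e ≤ κ
  κ_le : κ ≤ 1
  one_le : 1 ≤ W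
  Λ_nonneg : 0 ≤ Λ
  kw_pos : 0 < kw

namespace Weights

variable (w : Weights)

/-- Weights of the fronts below the strong front. -/
def below : WaveVec := ![1, 1, w.W, w.κ, w.κ, w.W]

/-- Weights of the fronts above the strong front. -/
def above : WaveVec := ![w.W, w.W, w.W, w.e, w.e, w.e]

theorem e_le_below (i : Fin 6) : w.e ≤ w.below i := by
  have := w.e_le
  have := w.κ_le
  have := w.one_le
  fin_cases i <;> simp [below] <;> linarith

theorem e_le_above (i : Fin 6) : w.e ≤ w.above i := by
  have := w.e_le
  have := w.κ_le
  have := w.one_le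
  fin_cases i <;> simp [above] <;> linarith

theorem below_nonneg : 0 ≤ w.below := fun i => w.e_pos.le.trans (w.e_le_below i)

theorem above_nonneg : 0 ≤ w.above := fun i => w.e_pos.le.trans (w.e_le_above i)

theorem mass_below_le : mass w.below ≤ 6 * w.W := by
  have := w.κ_le
  have := w.one_le
  simp [mass_eq, below]
  linarith

theorem mass_above_le : mass w.above ≤ 6 * w.W := by
  have := w.e_le
  have := w.κ_le
  have := w.one_le
  simp [mass_eq, above]
  linarith

/-- The part of the Glimm functional that depends on the fronts. -/
def energy (D₀ : FlowCoord) (bl : List Front) (st : Front) (ab : List Front) : ℝ :=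
  dot w.below (vecSum bl) + dot w.above (vecSum ab) + w.Λ * (potential bl + potential ab) +
    w.e * ‖st.jump - D₀‖

variable {w}

theorem mass_le_energy (D₀ : FlowCoord) (bl : List Front) (st : Front) (ab : List Front) :
    w.e * mass (vecSum bl) + w.e * mass (vecSum ab) + w.e * ‖st.jump - D₀‖ ≤
      w.energy D₀ bl st ab := by
  have h1 := mul_mass_le_dot w.e_le_below (vecSum_nonneg bl)
  have h2 := mul_mass_le_dot w.e_le_above (vecSum_nonneg ab)
  have h3 := mul_nonneg w.Λ_nonneg (add_nonneg (potential_nonneg bl) (potential_nonneg ab))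
  unfold energy
  linarith

/-- Let $A$ be the approaching product of the colliding fronts. The potential loses $A$. The new
strength, at most $6KA$, interacts with a mass of at most $m$, so `hm` leaves a net loss of $A/2$.
By `hΛ` this loss times $\Lambda$ pays for the growth $6WKA$ of the linear part. -/
theorem energy_le_of_collision_below {P : Params} {U₀ : State} {ρ K : ℝ} {f g : Front}
    {new : List Front} (h : CollisionBound P U₀ ρ K f g new) (hK : 0 < K)
    (hΛ : 12 * w.W * K ≤ w.Λ) (hm : 12 * K * w.m ≤ 1) (D₀ : FlowCoord) (pre post : List Front)
    (st : Front) (ab : List Front) (hmass : mass (vecSum (pre ++ [f, g] ++ post)) ≤ w.m) :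
    w.energy D₀ (pre ++ new ++ post) st ab ≤ w.energy D₀ (pre ++ [f, g] ++ post) st ab := by
  have hA := approach_nonneg f.vec_nonneg g.vec_nonneg
  obtain ⟨A, hAdef⟩ : ∃ A, A = approach f.vec g.vec := ⟨_, rfl⟩
  have hv := h.vec_le
  rw [← hAdef] at hv hA
  have hfg : vecSum [f, g] = f.vec + g.vec := by simp [vecSum]
  rw [← hfg] at hv
  have hq := potential_replace_le pre [f, g] new post (e := fun _ => K * A)
    (fun _ => by simp; positivity) hv
  have hpfg : potential [f, g] = A := by
    simp [potential, vecSum_cons, vecSum_nil, approach_zero_right, hAdef]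
  rw [h.potential_eq, hpfg] at hq
  have hmc : mass (fun _ => K * A) = 6 * (K * A) := by simp [mass]
  rw [hmc] at hq
  rw [vecSum_append, vecSum_append, mass_add, mass_add] at hmass
  have hm0 := mass_nonneg (vecSum_nonneg [f, g])
  have hd := dot_mono w.below_nonneg hv
  rw [dot_add, dot_const] at hd
  have hd2 := mul_le_mul_of_nonneg_right w.mass_below_le (by positivity : 0 ≤ K * A)
  have h1 : 6 * (K * A) * (mass (vecSum pre) + mass (vecSum post)) ≤ 6 * (K * A) * w.m :=
    mul_le_mul_of_nonneg_left (by linarith) (by positivity)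
  have h2 := mul_le_mul_of_nonneg_right hm hA
  have h3 := mul_le_mul_of_nonneg_right hΛ hA
  have h4 : potential (pre ++ new ++ post) ≤ potential (pre ++ [f, g] ++ post) - A / 2 := by
    linarith
  have h5 := mul_le_mul_of_nonneg_left h4 w.Λ_nonneg
  unfold energy
  rw [vecSum_append, vecSum_append, vecSum_append, vecSum_append, dot_add, dot_add, dot_add,
    dot_add]
  linarith

theorem energy_le_of_collision_above {P : Params} {U₀ : State} {ρ K : ℝ} {f g : Front}
    {new : List Front} (h : CollisionBound P U₀ ρ K f g new) (hK : 0 < K)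
    (hΛ : 12 * w.W * K ≤ w.Λ) (hm : 12 * K * w.m ≤ 1) (D₀ : FlowCoord) (bl : List Front)
    (st : Front) (pre post : List Front) (hmass : mass (vecSum (pre ++ [f, g] ++ post)) ≤ w.m) :
    w.energy D₀ bl st (pre ++ new ++ post) ≤ w.energy D₀ bl st (pre ++ [f, g] ++ post) := by
  have hA := approach_nonneg f.vec_nonneg g.vec_nonneg
  obtain ⟨A, hAdef⟩ : ∃ A, A = approach f.vec g.vec := ⟨_, rfl⟩
  have hv := h.vec_le
  rw [← hAdef] at hv hA
  have hfg : vecSum [f, g] = f.vec + g.vec := by simp [vecSum]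
  rw [← hfg] at hv
  have hq := potential_replace_le pre [f, g] new post (e := fun _ => K * A)
    (fun _ => by simp; positivity) hv
  have hpfg : potential [f, g] = A := by
    simp [potential, vecSum_cons, vecSum_nil, approach_zero_right, hAdef]
  rw [h.potential_eq, hpfg] at hq
  have hmc : mass (fun _ => K * A) = 6 * (K * A) := by simp [mass]
  rw [hmc] at hq
  rw [vecSum_append, vecSum_append, mass_add, mass_add] at hmass
  have hm0 := mass_nonneg (vecSum_nonneg [f, g])
  have hd := dot_mono w.above_nonneg hv
  rw [dot_add, dot_const] at hd
  have hd2 := mul_le_mul_of_nonneg_right w.mass_above_le (by positivity : 0 ≤ K * A)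
  have h1 : 6 * (K * A) * (mass (vecSum pre) + mass (vecSum post)) ≤ 6 * (K * A) * w.m :=
    mul_le_mul_of_nonneg_left (by linarith) (by positivity)
  have h2 := mul_le_mul_of_nonneg_right hm hA
  have h3 := mul_le_mul_of_nonneg_right hΛ hA
  have h4 : potential (pre ++ new ++ post) ≤ potential (pre ++ [f, g] ++ post) - A / 2 := by
    linarith
  have h5 := mul_le_mul_of_nonneg_left h4 w.Λ_nonneg
  unfold energy
  rw [vecSum_append, vecSum_append, vecSum_append, vecSum_append, dot_add, dot_add, dot_add,
    dot_add]
  linarith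

theorem dot_below_one (s : ℝ) : dot w.below (waveVec .one s) = |s| := by
  rw [← max_add_max_neg s]
  simp [dot_eq, below, waveVec]

theorem dot_below_four (s : ℝ) : dot w.below (waveVec .four s) = w.κ * |s| := by
  simp [dot_eq, below, waveVec]
  rw [← max_add_max_neg s]
  ring

theorem dot_above_four (s x : ℝ) : dot w.above (waveVec .four s + npVec x) = w.e * (|s| + x) := by
  simp [dot_eq, above, waveVec, npVec]
  rw [← max_add_max_neg s]
  ring

theorem potential_singleton (f : Front) : potential [f] = 0 := by
  simp [potential, vecSum_nil, approach_zero_right]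

/-- The change of the energy when fronts next to the strong front are replaced. -/
theorem energy_strong_le {P : Params} {Um Up : State} {ρ : ℝ} {lo hi : State}
    {new F₁ F₄ old₁ old₄ : List Front} {st : Front}
    (h : StrongFan P Um Up ρ lo hi new F₁ st F₄) (D₀ : FlowCoord) (pre post : List Front)
    (st₀ : Front) (h₁ : potential old₁ = 0) (h₄ : potential old₄ = 0)
    (hm₁ : mass (vecSum pre) ≤ w.m) (hm₄ : mass (vecSum post) ≤ w.m) :
    w.energy D₀ (pre ++ F₁) st (F₄ ++ post) + dot w.below (vecSum old₁) +
        dot w.above (vecSum old₄) ≤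
      w.energy D₀ (pre ++ old₁) st₀ (old₄ ++ post) + mass (vecSum F₁) + w.e * mass (vecSum F₄) +
        w.e * ‖st.jump - st₀.jump‖ + w.Λ * w.m * (mass (vecSum F₁) + mass (vecSum F₄)) := by
  obtain ⟨a, ha⟩ := h.vec_below
  obtain ⟨b, x, hx, hb⟩ := h.vec_above
  have n1 := vecSum_nonneg F₁
  have n4 := vecSum_nonneg F₄
  have q1 := potential_replace_le pre old₁ F₁ [] n1 (le_add_of_nonneg_left (vecSum_nonneg old₁))
  have q4 := potential_replace_le [] old₄ F₄ post n4 (le_add_of_nonneg_left (vecSum_nonneg old₄))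
  simp only [List.append_nil, List.nil_append, vecSum_nil, mass_zero, add_zero, zero_add,
    h.potential_below, h.potential_above, h₁, h₄, sub_zero] at q1 q4
  have m1 : dot w.below (vecSum F₁) = mass (vecSum F₁) := by
    rw [ha, dot_below_one, mass_waveVec]
  have m4 : dot w.above (vecSum F₄) = w.e * mass (vecSum F₄) := by
    rw [hb, dot_above_four, mass_add, mass_waveVec, mass_npVec]
  have r1 := mul_le_mul_of_nonneg_left hm₁ (mass_nonneg n1)
  have r4 := mul_le_mul_of_nonneg_left hm₄ (mass_nonneg n4)
  have r := mul_le_mul_of_nonneg_left (add_le_add (q1.trans (add_le_add le_rfl r1))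
    (q4.trans (add_le_add le_rfl r4))) w.Λ_nonneg
  have hD : ‖st.jump - D₀‖ ≤ ‖st₀.jump - D₀‖ + ‖st.jump - st₀.jump‖ := by
    rw [show st.jump - D₀ = (st₀.jump - D₀) + (st.jump - st₀.jump) by abel]
    exact norm_add_le _ _
  have hD' := mul_le_mul_of_nonneg_left hD w.e_pos.le
  unfold energy
  rw [vecSum_append, vecSum_append, vecSum_append, vecSum_append, dot_add, dot_add, dot_add,
    dot_add, m1, m4]
  linarith

/-- The removed front releases at least $\kappa_0|f_4|+(\kappa-\kappa_0)\|f\|$, where $f_4$ is its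
$4$-part. The first term pays for the reflected $1$-wave, which has weight $1$. The surplus
$\kappa-\kappa_0$ pays for the transmitted fronts, the change of the strong jump and the new
potential, whose coefficients are only $e$ and $\Lambda m$. -/
theorem energy_le_of_strong_below {P : Params} {Um Up : State} {ρ ρ' κ₀ Ks : ℝ} {f g : Front}
    {new F₁ F₄ : List Front} {st : Front} (hf : SmallFront P Um ρ f)
    (hk : f.kind ≠ .nonlinear .one) (hκ₀ : 0 ≤ κ₀)
    (h : StrongFan P Um Up ρ' f.lo g.hi new F₁ st F₄)
    (h1 : mass (vecSum F₁) ≤ κ₀ * |f.fourPart|)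
    (h2 : mass (vecSum F₁) + mass (vecSum F₄) + ‖st.jump - g.jump‖ ≤ Ks * mass f.vec)
    (hΛm : 0 ≤ w.m) (hw : (2 * w.e + w.Λ * w.m) * Ks ≤ w.κ - κ₀) (D₀ : FlowCoord)
    (pre post : List Front) (hm₁ : mass (vecSum pre) ≤ w.m) (hm₄ : mass (vecSum post) ≤ w.m) :
    w.energy D₀ (pre ++ F₁) st (F₄ ++ post) ≤ w.energy D₀ (pre ++ [f]) g post := by
  have key := energy_strong_le (old₁ := [f]) (old₄ := []) h D₀ pre post g (potential_singleton f) rfl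
    hm₁ hm₄
  have hv : vecSum [f] = f.vec := by simp [vecSum]
  rw [vecSum_nil, dot_zero, hv, List.nil_append] at key
  have p1 := mass_nonneg (vecSum_nonneg F₁)
  have p4 := mass_nonneg (vecSum_nonneg F₄)
  have pm := mass_nonneg f.vec_nonneg
  have he := w.e_pos
  have h3 : κ₀ * |f.fourPart| + (w.κ - κ₀) * mass f.vec ≤ dot w.below f.vec := by
    have hW := w.one_le
    have hκ1 := w.κ_le
    rcases hq : f.kind with (_ | _) | _ | _ | _
    · exact absurd hq hk
    · simp only [Front.fourPart, Front.vec, hq, mass_waveVec, dot_below_four]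
      linarith
    · simp only [Front.fourPart, Front.vec, hq, mass_contactVec, abs_zero, mul_zero, zero_add]
      have : dot w.below (contactVec ‖f.jump‖) = w.W * ‖f.jump‖ := by
        simp [dot_eq, below, contactVec]
      rw [this]
      exact mul_le_mul_of_nonneg_right (by linarith) (norm_nonneg _)
    · exact absurd hq hf.ne_strong
    · simp only [Front.fourPart, Front.vec, hq, mass_npVec, abs_zero, mul_zero, zero_add]
      have : dot w.below (npVec ‖f.jump‖) = w.W * ‖f.jump‖ := by
        simp [dot_eq, below, npVec]
      rw [this]
      exact mul_le_mul_of_nonneg_right (by linarith) (norm_nonneg _)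
  have h4 := mul_le_mul_of_nonneg_left h2 (by positivity : 0 ≤ 2 * w.e)
  have hLm := mul_nonneg w.Λ_nonneg hΛm
  have h5 : w.Λ * w.m * (mass (vecSum F₁) + mass (vecSum F₄)) ≤ w.Λ * w.m * (Ks * mass f.vec) :=
    mul_le_mul_of_nonneg_left (by linarith [norm_nonneg (st.jump - g.jump)]) hLm
  have h6 := mul_le_mul_of_nonneg_right hw pm
  have h7 : w.e * mass (vecSum F₄) + w.e * ‖st.jump - g.jump‖ ≤
      2 * w.e * (mass (vecSum F₁) + mass (vecSum F₄) + ‖st.jump - g.jump‖) := by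
    have a1 := mul_nonneg he.le p1
    have a4 := mul_nonneg he.le p4
    have a5 := mul_nonneg he.le (norm_nonneg (st.jump - g.jump))
    linarith
  linarith

/-- Here no sharp coefficient is needed: $W$ is large, and it pays for the transmitted $1$-wave at
weight $1$ together with everything else. -/
theorem energy_le_of_strong_above {P : Params} {Um Up : State} {ρ' Ks : ℝ} {f g : Front}
    {new F₁ F₄ : List Front} {st : Front} (hg : g.WeakPhysical)
    (hk : g.kind ≠ .nonlinear .four)
    (h : StrongFan P Um Up ρ' f.lo g.hi new F₁ st F₄)
    (h2 : mass (vecSum F₁) + mass (vecSum F₄) + ‖st.jump - f.jump‖ ≤ Ks * mass g.vec)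
    (hΛm : 0 ≤ w.m) (hw : (1 + 2 * w.e + w.Λ * w.m) * Ks ≤ w.W) (D₀ : FlowCoord)
    (pre post : List Front) (hm₁ : mass (vecSum pre) ≤ w.m) (hm₄ : mass (vecSum post) ≤ w.m) :
    w.energy D₀ (pre ++ F₁) st (F₄ ++ post) ≤ w.energy D₀ pre f (g :: post) := by
  have key := energy_strong_le (old₁ := []) (old₄ := [g]) h D₀ pre post f rfl (potential_singleton g)
    hm₁ hm₄
  have hv : vecSum [g] = g.vec := by simp [vecSum]
  rw [vecSum_nil, dot_zero, hv, List.append_nil, List.singleton_append] at key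
  have p1 := mass_nonneg (vecSum_nonneg F₁)
  have p4 := mass_nonneg (vecSum_nonneg F₄)
  have pm := mass_nonneg g.vec_nonneg
  have pn := norm_nonneg (st.jump - f.jump)
  have he := w.e_pos
  have h3 : w.W * mass g.vec ≤ dot w.above g.vec := by
    rcases Front.weakPhysical_iff.1 hg with hq | hq | hq
    · simp only [Front.vec, hq]
      rw [mass_waveVec]
      simp [dot_eq, above, waveVec]
      rw [← max_add_max_neg]
      linarith
    · simp only [Front.vec, hq]
      rw [mass_contactVec]
      simp [dot_eq, above, contactVec]
    · exact absurd hq hk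
  have hLm := mul_nonneg w.Λ_nonneg hΛm
  have h4 := mul_le_mul_of_nonneg_left h2 (by positivity : 0 ≤ 1 + 2 * w.e)
  have h5 : w.Λ * w.m * (mass (vecSum F₁) + mass (vecSum F₄)) ≤ w.Λ * w.m * (Ks * mass g.vec) :=
    mul_le_mul_of_nonneg_left (by linarith) hLm
  have h6 := mul_le_mul_of_nonneg_right hw pm
  have a1 := mul_nonneg he.le p1
  have a4 := mul_nonneg he.le p4
  have a5 := mul_nonneg he.le pn
  linarith

/-- The change of the energy when fronts next to the wall are replaced. -/
theorem energy_wall_le {P : Params} {U₀ : State} {ρ slope b : ℝ} {bot Ua : State}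
    {new old : List Front} (h : LateralFan P U₀ ρ slope bot Ua new b) (ho : potential old = 0)
    (D₀ : FlowCoord) (post : List Front) (st : Front) (ab : List Front)
    (hm : mass (vecSum post) ≤ w.m) :
    w.energy D₀ (new ++ post) st ab + dot w.below (vecSum old) ≤
      w.energy D₀ (old ++ post) st ab + (w.κ + w.Λ * w.m) * |b| := by
  have n1 := vecSum_nonneg new
  have q := potential_replace_le [] old new post n1 (le_add_of_nonneg_left (vecSum_nonneg old))
  simp only [List.nil_append, vecSum_nil, mass_zero, zero_add, h.potential_eq, ho, sub_zero,
    add_zero] at q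
  have m1 : dot w.below (vecSum new) = w.κ * |b| := by rw [h.vec_eq, dot_below_four]
  have m2 : mass (vecSum new) = |b| := by rw [h.vec_eq, mass_waveVec]
  rw [m2] at q
  have r := mul_le_mul_of_nonneg_left (q.trans (add_le_add le_rfl
    (mul_le_mul_of_nonneg_left hm (abs_nonneg b)))) w.Λ_nonneg
  unfold energy
  rw [vecSum_append, vecSum_append, dot_add, dot_add, m1]
  linarith

theorem abs_onePart_le_dot_below {f : Front} (hf : f.WeakPhysical) :
    |f.onePart| ≤ dot w.below f.vec := by
  rcases Front.weakPhysical_iff.1 hf with hq | hq | hq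
  · simp only [Front.onePart, Front.vec, hq]
    rw [dot_below_one]
  · simp only [Front.onePart, Front.vec, hq]
    have hW := w.one_le
    simp [dot_eq, below, contactVec]
    positivity
  · simp only [Front.onePart, Front.vec, hq]
    rw [dot_below_four, abs_zero]
    have := w.e_le
    have := w.e_pos
    have : 0 ≤ w.κ := by linarith
    positivity

end Weights

/-! ### States near the background -/

/-- The states are reached downwards from the upper end, the one known to be close to $U_0$, by
adding up the jumps. The radius $\rho/2$ is an a priori bound that the conclusion improves when the
mass is small. -/
theorem linked_mem_near {P : Params} {U₀ V U : State} {C ρ σ : ℝ} (R : Region P.γ U₀ C ρ)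
    {fs : List Front} (hl : Linked U fs V) (hf : ∀ f ∈ fs, SmallFront P U₀ (ρ / 2) f)
    (hU : Physical U) (hV : Near U₀ σ V) :
    Near U₀ (σ + C * mass (vecSum fs)) U ∧ ∀ f ∈ fs,
      SmallFront P U₀ (σ + C * mass (vecSum fs)) f := by
  have hC := R.one_le
  induction fs generalizing U with
  | nil =>
    have : U = V := hl
    rw [vecSum_nil, mass_zero, mul_zero, add_zero, this]
    exact ⟨hV, by simp⟩
  | cons f fs ih =>
    obtain ⟨rfl, hl'⟩ := linked_cons.1 hl
    have hff := hf f List.mem_cons_self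
    obtain ⟨h1, h2⟩ := ih hl' (fun g hg => hf g (List.mem_cons_of_mem _ hg)) hff.near_hi.1
    have hj := R.norm_jump_le hff
    have hm := mass_nonneg f.vec_nonneg
    have hm' := mul_nonneg (by linarith : 0 ≤ C) hm
    have hlo : Near U₀ (σ + C * mass (vecSum (f :: fs))) f.lo := by
      refine ⟨hU, ?_⟩
      rw [show coord f.lo - coord U₀ = (coord f.hi - coord U₀) - f.jump by rw [f.coord_hi]; abel,
        vecSum_cons, mass_add]
      exact (norm_sub_le _ _).trans (by linarith [h1.2])
    have hle : σ + C * mass (vecSum fs) ≤ σ + C * mass (vecSum (f :: fs)) := by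
      rw [vecSum_cons, mass_add]; linarith
    refine ⟨hlo, ?_⟩
    intro g hg
    rcases List.mem_cons.1 hg with rfl | hg
    · exact ⟨hff.admissible, hff.ne_strong, hlo, h1.mono hle⟩
    · exact (h2 g hg).mono hle

/-- The structure of a configuration: weak fronts below and above the strong front. -/
structure Layout (P : Params) (Um Up : State) (ρ : ℝ) (c : Config) (bl : List Front) (st : Front)
    (ab : List Front) : Prop where
  fronts_eq : c.fronts = bl ++ st :: ab
  small_below : ∀ f ∈ bl, SmallFront P Um ρ f
  small_above : ∀ f ∈ ab, SmallFront P Up ρ f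
  kind : st.kind = .strong
  admissible : st.Admissible P
  linked_below : Linked c.bot bl st.lo
  linked_above : Linked st.hi ab Up
  near_bot : Near Um ρ c.bot
  near_lo : Near Um ρ st.lo
  near_hi : Near Up ρ st.hi

/-- A small functional keeps the states near the background. -/
theorem Layout.refine {P : Params} {Um Up : State} {C ρ ρ₁ : ℝ} (Rm : Region P.γ Um C ρ)
    (Rp : Region P.γ Up C ρ) (w : Weights) {c : Config} {bl ab : List Front} {st : Front}
    (L : Layout P Um Up (ρ / 2) c bl st ab) {G : ℝ} (hG : 3 * (C * G) ≤ w.e * ρ₁)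
    (h : w.energy (coord Up - coord Um) bl st ab ≤ G) : Layout P Um Up ρ₁ c bl st ab := by
  have hC := Rm.one_le
  have he := w.e_pos
  have hm := w.mass_le_energy (coord Up - coord Um) bl st ab
  have m1 := mul_nonneg he.le (mass_nonneg (vecSum_nonneg bl))
  have m2 := mul_nonneg he.le (mass_nonneg (vecSum_nonneg ab))
  have m3 := mul_nonneg he.le (norm_nonneg (st.jump - (coord Up - coord Um)))
  have hG0 : 0 ≤ G := by linarith
  have hCG : G ≤ C * G := le_mul_of_one_le_left hG0 hC
  have b1 : C * mass (vecSum bl) ≤ ρ₁ / 3 := by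
    have := mul_le_mul_of_nonneg_left (by linarith : w.e * mass (vecSum bl) ≤ G)
      (by linarith : 0 ≤ C)
    have : w.e * (C * mass (vecSum bl)) ≤ w.e * (ρ₁ / 3) := by linarith
    exact le_of_mul_le_mul_left this he
  have b2 : C * mass (vecSum ab) ≤ ρ₁ / 3 := by
    have := mul_le_mul_of_nonneg_left (by linarith : w.e * mass (vecSum ab) ≤ G)
      (by linarith : 0 ≤ C)
    have : w.e * (C * mass (vecSum ab)) ≤ w.e * (ρ₁ / 3) := by linarith
    exact le_of_mul_le_mul_left this he
  have b3 : ‖st.jump - (coord Up - coord Um)‖ ≤ ρ₁ / 3 := by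
    have : w.e * ‖st.jump - (coord Up - coord Um)‖ ≤ w.e * (ρ₁ / 3) := by linarith
    exact le_of_mul_le_mul_left this he
  have hρ₁ : 0 ≤ ρ₁ := by linarith [norm_nonneg (st.jump - (coord Up - coord Um))]
  -- The descent starts at the top state, which is exactly $U_+$, passes the fronts above the strong
  -- front, then the strong front at the cost of the deviation of its jump, and then the fronts
  -- below. Each of the three parts costs at most $\rho_1/3$.
  have hUp : Near Up 0 Up := ⟨Rp.physical, by simp⟩
  obtain ⟨a1, a2⟩ := linked_mem_near Rp L.linked_above L.small_above L.near_hi.1 hUp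
  have hlo : Near Um (2 * ρ₁ / 3) st.lo := by
    refine ⟨L.near_lo.1, ?_⟩
    rw [show coord st.lo - coord Um = (coord st.hi - coord Up) -
      (st.jump - (coord Up - coord Um)) by rw [st.coord_hi]; abel]
    exact (norm_sub_le _ _).trans (by linarith [a1.2])
  obtain ⟨c1, c2⟩ := linked_mem_near Rm L.linked_below L.small_below L.near_bot.1 hlo
  exact ⟨L.fronts_eq, fun f hf => (c2 f hf).mono (by linarith),
    fun f hf => (a2 f hf).mono (by linarith), L.kind, L.admissible, L.linked_below, L.linked_above,
    c1.mono (by linarith), hlo.mono (by linarith), a1.mono (by linarith)⟩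

/-! ### Speeds of the fronts -/

/-- Bounds that separate the speeds of the families. -/
def Front.SpeedBounds (l M : ℝ) (f : Front) : Prop :=
  match f.kind with
  | .nonlinear .one => f.speed ≤ -l
  | .contact => |f.speed| ≤ l / 2
  | .strong => |f.speed| ≤ l / 2
  | .nonlinear .four => l ≤ f.speed ∧ f.speed ≤ M
  | .nonphysical => M < f.speed

theorem Front.SpeedBounds.rank_le {l M : ℝ} (hl : 0 < l) (hM : l ≤ M) {f g : Front}
    (hf : f.SpeedBounds l M) (hg : g.SpeedBounds l M) (h : g.speed < f.speed) :
    g.kind.rank ≤ f.kind.rank := by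
  rcases qf : f.kind with (_ | _) | _ | _ | _ <;> rcases qg : g.kind with (_ | _) | _ | _ | _ <;>
    simp only [Front.SpeedBounds, qf, qg, abs_le] at hf hg <;> simp only [FrontKind.rank] <;>
    first
    | omega
    | (exfalso
       try obtain ⟨hf, hf'⟩ := hf
       try obtain ⟨hg, hg'⟩ := hg
       linarith)

theorem Front.SpeedBounds.le_two {l M s : ℝ} (hM : l ≤ M) {f : Front}
    (hf : f.SpeedBounds l M) (hs : s < l) (h : f.speed < s) : f.kind.rank ≤ 2 := by
  rcases qf : f.kind with (_ | _) | _ | _ | _ <;>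
    simp only [Front.SpeedBounds, qf] at hf <;> simp only [FrontKind.rank] <;>
    first | omega | (exfalso; linarith [hf.1, hf.2]) | (exfalso; linarith)

/-- For horizontal flow the eigenvalues are $\pm1/\sqrt{N-1}$, so both nonlinear families are
separated from the contact speed $0$. -/
theorem Region.lamC_four_pos {γ : ℝ} {U₀ : State} {C ρ : ℝ} (R : Region γ U₀ C ρ) :
    0 < lamC γ .four (coord U₀) ∧ lamC γ .one (coord U₀) = -lamC γ .four (coord U₀) := by
  have h := R.mach
  have h1 : 0 < Real.sqrt (machSq γ (coord U₀) - 1) := Real.sqrt_pos.2 (by linarith)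
  have h2 : 0 < machSq γ (coord U₀) - 1 := by linarith
  simp only [lamC, R.angle_zero, NLFamily.sign, Real.sin_zero, Real.cos_zero]
  constructor
  · simp only [mul_zero, zero_add, one_mul, one_pow, mul_one]; positivity
  · ring

theorem Region.exists_speed_bound {γ : ℝ} {U₀ : State} {C ρ : ℝ} (R : Region γ U₀ C ρ) {σ : ℝ}
    (hσ : 0 < σ) : ∃ ε > 0, ∀ P : Params, P.γ = γ → P.η ≤ ε → ∀ ρ₁ ≤ ε,
      (∀ (f : Front) (d : NLFamily), SmallFront P U₀ ρ₁ f → f.kind = .nonlinear d →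
        |f.speed - lamC γ d (coord U₀)| ≤ σ) ∧
      (∀ f : Front, f.Admissible P → (f.kind = .contact ∨ f.kind = .strong) → Near U₀ ρ₁ f.lo →
        |f.speed| ≤ σ) := by
  have hC := R.one_le
  have htan : ∀ᶠ φ in 𝓝 (0 : ℝ), |Real.tan φ| < σ / 2 := by
    have hc : ContinuousAt (fun φ => |Real.tan φ|) 0 := (Real.continuousAt_tan.2 (by simp)).abs
    exact hc.tendsto.eventually_lt_const (by simpa using hσ)
  obtain ⟨δ, hδ, htan⟩ := Metric.nhds_basis_closedBall.mem_iff.1 htan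
  refine ⟨min (min δ ρ) (σ / (2 * C)), by have := R.pos; positivity, ?_⟩
  rintro P rfl hη ρ₁ hρ₁
  have h1 : ρ₁ ≤ δ := hρ₁.trans ((min_le_left _ _).trans (min_le_left _ _))
  have h2 : ρ₁ ≤ ρ := hρ₁.trans ((min_le_left _ _).trans (min_le_right _ _))
  have h3 : C * ρ₁ ≤ σ / 2 := by
    have := hρ₁.trans (min_le_right _ _)
    rw [le_div_iff₀ (by positivity)] at this
    linarith
  have h4 : P.η ≤ σ / 2 := by
    refine hη.trans ((min_le_right _ _).trans ?_)
    rw [div_le_div_iff₀ (by positivity) (by positivity)]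
    have := mul_le_mul_of_nonneg_left hC hσ.le
    linarith
  refine ⟨?_, ?_⟩
  · intro f d hf hk
    have hlam : ∀ U, Near U₀ ρ₁ U → |lam P.γ d U - lamC P.γ d (coord U₀)| ≤ σ / 2 := by
      intro U hU
      rw [lam_eq_lamC R.one_lt hU.1]
      have := (R.waves d).lamC_sub (coord U) (coord U₀) (hU.2.trans h2) (by simpa using R.pos.le)
      have := mul_le_mul_of_nonneg_left hU.2 (by linarith : 0 ≤ C)
      linarith
    have ha := hf.admissible
    unfold Front.Admissible at ha
    rw [hk] at ha
    have k1 := abs_le.1 (hlam _ hf.near_lo)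
    have k2 := abs_le.1 (hlam _ hf.near_hi)
    rcases ha.2 with ⟨-, h5, h6⟩ | ⟨s, hs, h5⟩
    · exact abs_le.2 ⟨by linarith, by linarith⟩
    · have h6 := abs_le.1 h5
      have h7 := hs.2.2.2
      exact abs_le.2 ⟨by linarith [h7.1], by linarith [h7.2]⟩
  · intro f ha hk hlo
    have hsp : |f.speed - vv f.lo / uu f.lo| ≤ P.η := by
      unfold Front.Admissible at ha
      rcases hk with hk | hk <;> rw [hk] at ha
      · exact ha.2.2
      · exact ha.2
    have hφ : |(coord f.lo).2.2.2| ≤ ρ₁ := by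
      have := (FlowCoord.abs_fth_le _).trans hlo.2
      rwa [Prod.snd_sub, Prod.snd_sub, Prod.snd_sub, R.angle_zero, sub_zero] at this
    have h5 : |Real.tan (coord f.lo).2.2.2| < σ / 2 := by
      refine htan ?_
      rw [Metric.mem_closedBall, dist_zero_right]
      exact hφ.trans h1
    rw [show Real.tan (coord f.lo).2.2.2 = vv f.lo / uu f.lo from Real.tan_arctan _] at h5
    have h6 := abs_le.1 hsp
    have h7 := abs_lt.1 h5
    exact abs_le.2 ⟨by linarith, by linarith⟩

/-- Uniform bounds of the speeds in both regions. -/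
theorem exists_speedBounds {γ speedNP : ℝ} {Um Up : State} {C ρ : ℝ} (Rm : Region γ Um C ρ)
    (Rp : Region γ Up C ρ) (hm : lam γ .four Um < speedNP) (hp : lam γ .four Up < speedNP) :
    ∃ l M ε : ℝ, 0 < l ∧ l ≤ M ∧ 0 < ε ∧ ∀ P : Params, P.γ = γ → P.speedNP = speedNP → P.η ≤ ε →
      ∀ ρ₁ ≤ ε, (∀ f, SmallFront P Um ρ₁ f → f.SpeedBounds l M) ∧
        (∀ f, SmallFront P Up ρ₁ f → f.SpeedBounds l M) ∧
        ∀ f : Front, f.Admissible P → f.kind = .strong → Near Um ρ₁ f.lo → f.SpeedBounds l M := by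
  rw [lam_eq_lamC Rm.one_lt Rm.physical] at hm
  rw [lam_eq_lamC Rp.one_lt Rp.physical] at hp
  obtain ⟨m1, m2⟩ := Rm.lamC_four_pos
  obtain ⟨p1, p2⟩ := Rp.lamC_four_pos
  generalize hLm : lamC γ .four (coord Um) = Lm at *
  generalize hLp : lamC γ .four (coord Up) = Lp at *
  obtain ⟨l, hl, hl1, hl2⟩ : ∃ l > 0, 2 * l ≤ Lm ∧ 2 * l ≤ Lp :=
    ⟨min Lm Lp / 2, by positivity, by linarith [min_le_left Lm Lp], by linarith [min_le_right Lm Lp]⟩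
  -- $M$ separates the $4$-speeds on both sides from the speed of the non-physical fronts, which
  -- therefore are never overtaken by weak fronts.
  obtain ⟨M, hM1, hM⟩ := exists_between (max_lt hm hp)
  obtain ⟨σ, hσ, hσ1, hσ2, hσ3⟩ : ∃ σ > 0, σ ≤ l / 2 ∧ Lm + σ ≤ M ∧ Lp + σ ≤ M := by
    have h1 := (max_lt_iff.1 hM1).1
    have h2 := (max_lt_iff.1 hM1).2
    exact ⟨min (l / 2) (min (M - Lm) (M - Lp)),
      lt_min (by linarith) (lt_min (by linarith) (by linarith)), min_le_left _ _,
      by linarith [(min_le_right (l / 2) _).trans (min_le_left (M - Lm) (M - Lp))],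
      by linarith [(min_le_right (l / 2) _).trans (min_le_right (M - Lm) (M - Lp))]⟩
  obtain ⟨ε₁, hε₁, h1⟩ := Rm.exists_speed_bound hσ
  obtain ⟨ε₂, hε₂, h2⟩ := Rp.exists_speed_bound hσ
  have gen : ∀ (P : Params) (U₀ : State) (ρ₁ L : ℝ), P.speedNP = speedNP → 2 * l ≤ L →
      L + σ ≤ M → lamC γ .four (coord U₀) = L → lamC γ .one (coord U₀) = -L →
      ((∀ (f : Front) (d : NLFamily), SmallFront P U₀ ρ₁ f → f.kind = .nonlinear d →
        |f.speed - lamC γ d (coord U₀)| ≤ σ) ∧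
      (∀ f : Front, f.Admissible P → (f.kind = .contact ∨ f.kind = .strong) → Near U₀ ρ₁ f.lo →
        |f.speed| ≤ σ)) → ∀ f, SmallFront P U₀ ρ₁ f → f.SpeedBounds l M := by
    intro P U₀ ρ₁ L hNP hL hLM e4 e1 h f hf
    rcases q : f.kind with (_ | _) | _ | _ | _ <;> simp only [Front.SpeedBounds, q]
    · have := abs_le.1 (h.1 f _ hf q)
      rw [e1] at this
      linarith [this.2]
    · have := abs_le.1 (h.1 f _ hf q)
      rw [e4] at this
      exact ⟨by linarith [this.1], by linarith [this.2]⟩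
    · exact (h.2 f hf.admissible (Or.inl q) hf.near_lo).trans hσ1
    · exact absurd q hf.ne_strong
    · have ha := hf.admissible
      unfold Front.Admissible at ha
      rw [q] at ha
      rw [ha, hNP]
      exact hM
  refine ⟨l, M, min ε₁ ε₂, hl, by linarith, lt_min hε₁ hε₂, ?_⟩
  intro P hP hNP hη ρ₁ hρ₁
  have k1 := h1 P hP (hη.trans (min_le_left _ _)) ρ₁ (hρ₁.trans (min_le_left _ _))
  have k2 := h2 P hP (hη.trans (min_le_right _ _)) ρ₁ (hρ₁.trans (min_le_right _ _))
  refine ⟨gen P Um ρ₁ Lm hNP hl1 hσ2 hLm m2 k1, gen P Up ρ₁ Lp hNP hl2 hσ3 hLp p2 k2, ?_⟩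
  intro f ha hk hlo
  simp only [Front.SpeedBounds, hk]
  exact (k1.2 f ha (Or.inr hk) hlo).trans hσ1

/-! ### The wall -/

theorem Wall.index_eq (W : Wall) {x : ℝ} {i : ℕ} (h1 : W.a i ≤ x) (h2 : x < W.a (i + 1)) :
    W.index x = i := by
  have hset : {l : ℕ | W.a l ≤ x} = Iic i := by
    ext l
    simp only [Set.mem_ofPred_eq, mem_Iic]
    constructor
    · intro h
      have := W.a_strictMono.lt_iff_lt.1 (h.trans_lt h2)
      omega
    · intro h
      exact (W.a_strictMono.monotone h).trans h1
  rw [Wall.index, hset]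
  exact csSup_Iic

/-- A front that meets the wall is slower than the wall. -/
theorem speed_lt_slope {W : Wall} {f : Front} {x x' : ℝ} {i : ℕ} (h1 : W.a i ≤ x) (hx : x < x')
    (h2 : x' < W.a (i + 1)) (hf : W.height ((x + x') / 2) < f.pos ((x + x') / 2))
    (he : f.pos x' = W.height x') : f.speed < W.slope i := by
  rw [Wall.height, W.index_eq (i := i) (by linarith) (by linarith), Front.pos] at hf
  rw [Wall.height, W.index_eq (i := i) (by linarith) h2, Front.pos] at he
  by_contra h
  have := mul_le_mul_of_nonneg_right (not_lt.1 h) (by linarith : 0 ≤ (x' - x) / 2)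
  linarith

theorem speed_lt_of_collision {W : Wall} {pre post : List Front} {f g : Front} {x x' : ℝ}
    (hx : x < x') (hs : Separated W (pre ++ f :: g :: post) x) (he : f.pos x' = g.pos x') :
    g.speed < f.speed := by
  have h := (List.pairwise_append.1 hs.2).2.1
  have h1 : f.pos x < g.pos x := (List.pairwise_cons.1 h).1 g List.mem_cons_self
  unfold Front.pos at h1 he
  by_contra h2
  have := mul_le_mul_of_nonneg_right (not_lt.1 h2) (by linarith : 0 ≤ x' - x)
  linarith

/-- A pair of neighbouring fronts lies below the strong front, has it as upper or as lower member,
or lies above it; each position has its own interaction estimate. -/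
theorem split_pair {α : Type*} {bl ab pre post : List α} {st f g : α}
    (h : bl ++ st :: ab = pre ++ f :: g :: post) :
    (∃ q, bl = pre ++ f :: g :: q ∧ post = q ++ st :: ab) ∨
      (bl = pre ++ [f] ∧ g = st ∧ post = ab) ∨ (bl = pre ∧ f = st ∧ ab = g :: post) ∨
      ∃ q, pre = bl ++ st :: q ∧ ab = q ++ f :: g :: post := by
  induction bl generalizing pre with
  | nil =>
    cases pre with
    | nil =>
      simp only [List.nil_append, List.cons.injEq] at h
      exact Or.inr (Or.inr (Or.inl ⟨rfl, h.1.symm, h.2⟩))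
    | cons p pre =>
      simp only [List.nil_append, List.cons_append, List.cons.injEq] at h
      exact Or.inr (Or.inr (Or.inr ⟨pre, by rw [h.1]; rfl, h.2⟩))
  | cons b bl ih =>
    cases pre with
    | nil =>
      simp only [List.nil_append, List.cons_append, List.cons.injEq] at h
      obtain ⟨rfl, h⟩ := h
      cases bl with
      | nil =>
        simp only [List.nil_append, List.cons.injEq] at h
        exact Or.inr (Or.inl ⟨rfl, h.1.symm, h.2.symm⟩)
      | cons c bl =>
        simp only [List.cons_append, List.cons.injEq] at h
        obtain ⟨rfl, h⟩ := h
        exact Or.inl ⟨bl, rfl, h.symm⟩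
    | cons p pre =>
      simp only [List.cons_append, List.cons.injEq] at h
      obtain ⟨rfl, h⟩ := h
      rcases ih h with ⟨q, rfl, h2⟩ | ⟨rfl, h2⟩ | ⟨rfl, h2⟩ | ⟨q, rfl, h2⟩
      · exact Or.inl ⟨q, rfl, h2⟩
      · exact Or.inr (Or.inl ⟨rfl, h2⟩)
      · exact Or.inr (Or.inr (Or.inl ⟨rfl, h2⟩))
      · exact Or.inr (Or.inr (Or.inr ⟨q, rfl, h2⟩))

/-! ### The functional does not increase -/

/-- The constants of the interaction estimates. -/
structure Constants where
  C : ℝ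
  ρ : ℝ
  ρ₁ : ℝ
  l : ℝ
  M : ℝ
  κ₀ : ℝ
  K : ℝ
  Ks : ℝ
  Kw : ℝ
  δ : ℝ

/-- The interaction estimates and the relations between the weights. -/
structure Setup (P : Params) (Um Up : State) (k : Constants) (w : Weights) : Prop where
  region_below : Region P.γ Um k.C k.ρ
  region_above : Region P.γ Up k.C k.ρ
  scale : SmallScale P k.C k.ρ k.ρ₁
  collision_below : ∀ f g new, SmallFront P Um k.ρ₁ f → SmallFront P Um k.ρ₁ g → g.lo = f.hi →
    g.kind.rank ≤ f.kind.rank → CollisionRule P f g new →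
    CollisionBound P Um (6 * k.ρ₁) k.K f g new
  collision_above : ∀ f g new, SmallFront P Up k.ρ₁ f → SmallFront P Up k.ρ₁ g → g.lo = f.hi →
    g.kind.rank ≤ f.kind.rank → CollisionRule P f g new →
    CollisionBound P Up (6 * k.ρ₁) k.K f g new
  strong_initial : ∀ lo hi new, AccurateStrong P lo hi new → Near Um k.ρ₁ lo → Near Up k.ρ₁ hi →
    ∃ F₁ st F₄, StrongFan P Um Up (3 * k.ρ₁) lo hi new F₁ st F₄ ∧
      mass (vecSum F₁) + mass (vecSum F₄) + ‖coord hi - coord lo - st.jump‖ ≤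
        k.Ks * (|(coord hi).2.2.1 - (coord lo).2.2.1| + |(coord hi).2.2.2 - (coord lo).2.2.2|)
  strong_below : ∀ f g new, f.kind ≠ .nonlinear .one → SmallFront P Um k.ρ₁ f →
    g.kind = .strong → g.Admissible P → g.lo = f.hi → Near Up k.ρ₁ g.hi → CollisionRule P f g new →
    ∃ F₁ st F₄, StrongFan P Um Up (6 * k.ρ₁) f.lo g.hi new F₁ st F₄ ∧
      mass (vecSum F₁) ≤ k.κ₀ * |f.fourPart| ∧
      mass (vecSum F₁) + mass (vecSum F₄) + ‖st.jump - g.jump‖ ≤ k.Ks * mass f.vec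
  strong_above : ∀ f g new, SmallFront P Up k.ρ₁ g → f.kind = .strong → f.Admissible P →
    g.lo = f.hi → Near Um k.ρ₁ f.lo → CollisionRule P f g new →
    ∃ F₁ st F₄, StrongFan P Um Up (6 * k.ρ₁) f.lo g.hi new F₁ st F₄ ∧
      mass (vecSum F₁) + mass (vecSum F₄) + ‖st.jump - f.jump‖ ≤ k.Ks * mass g.vec
  lateral : ∀ slope bot Ua new, AccurateLateral P slope bot Ua new → Near Um k.ρ₁ Ua →
    ∃ b, LateralFan P Um (3 * k.ρ₁) slope bot Ua new b ∧
      |b| ≤ k.Kw * |(coord Ua).2.2.2 - Real.arctan slope| ∧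
      ∀ f, SmallFront P Um k.ρ₁ f → f.WeakPhysical → f.kind ≠ .nonlinear .four → f.hi = Ua →
        |b| ≤ (1 + k.δ) * |f.onePart| + k.Kw * |(coord f.lo).2.2.2 - Real.arctan slope|
  speed_below : ∀ f, SmallFront P Um k.ρ₁ f → f.SpeedBounds k.l k.M
  speed_above : ∀ f, SmallFront P Up k.ρ₁ f → f.SpeedBounds k.l k.M
  speed_strong : ∀ f : Front, f.Admissible P → f.kind = .strong → Near Um k.ρ₁ f.lo →
    f.SpeedBounds k.l k.M
  l_pos : 0 < k.l
  l_le : k.l ≤ k.M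
  κ₀_nonneg : 0 ≤ k.κ₀
  K_pos : 0 < k.K
  m_nonneg : 0 ≤ w.m
  Λ_ge : 12 * w.W * k.K ≤ w.Λ
  m_le : 12 * k.K * w.m ≤ 1
  below_le : (2 * w.e + w.Λ * w.m) * k.Ks ≤ w.κ - k.κ₀
  above_le : (1 + 2 * w.e + w.Λ * w.m) * k.Ks ≤ w.W
  wall_le : (w.κ + w.Λ * w.m) * (1 + k.δ) ≤ 1
  kw_ge : (w.κ + w.Λ * w.m) * k.Kw ≤ w.kw

/-- The part of the functional that depends on the wall, when the turning of the wall is at most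
`T` in total. -/
def Wall.remaining (W : Wall) (T : ℝ) (i : ℕ) (bot : State) : ℝ :=
  |(coord bot).2.2.2 - Real.arctan (W.slope i)| + (T - ∑ j ∈ Finset.range i, |W.turn j|)

theorem Layout.mono {P : Params} {Um Up : State} {ρ ρ' : ℝ} {c : Config} {bl ab : List Front}
    {st : Front} (L : Layout P Um Up ρ c bl st ab) (h : ρ ≤ ρ') :
    Layout P Um Up ρ' c bl st ab :=
  ⟨L.1, fun f hf => (L.2 f hf).mono h, fun f hf => (L.3 f hf).mono h, L.4, L.5, L.6, L.7,
    L.8.mono h, L.9.mono h, L.10.mono h⟩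

theorem small_replace {P : Params} {U₀ : State} {ρ ρ' : ℝ} {pre old new post : List Front}
    (h : ∀ f ∈ pre ++ old ++ post, SmallFront P U₀ ρ f) (hρ : ρ ≤ ρ')
    (hn : ∀ f ∈ new, SmallFront P U₀ ρ' f) : ∀ f ∈ pre ++ new ++ post, SmallFront P U₀ ρ' f := by
  intro f hf
  rcases List.mem_append.1 hf with hf | hf
  · rcases List.mem_append.1 hf with hf | hf
    · exact (h f (by simp [hf])).mono hρ
    · exact hn f hf
  · exact (h f (by simp [hf])).mono hρ

theorem linked_pair {U V : State} {pre post : List Front} {f g : Front}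
    (h : Linked U (pre ++ [f, g] ++ post) V) :
    Linked U pre f.lo ∧ g.lo = f.hi ∧ Linked g.hi post V := by
  obtain ⟨M, h1, h2⟩ := linked_append.1 h
  obtain ⟨N, h3, h4⟩ := linked_append.1 h1
  obtain ⟨rfl, h5⟩ := linked_cons.1 h4
  obtain ⟨h6, rfl⟩ := linked_singleton.1 h5
  exact ⟨h3, h6, h2⟩

section Step

variable {P : Params} {Um Up : State} {k : Constants} {w : Weights} {W : Wall}

/-- Collisions do not increase the functional. -/
theorem Setup.collision (H : Setup P Um Up k w) {U : State} {pre post new : List Front}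
    {f g : Front} {bl ab : List Front} {st : Front}
    (L : Layout P Um Up k.ρ₁ ⟨U, pre ++ f :: g :: post⟩ bl st ab)
    (hb : mass (vecSum bl) ≤ w.m) (ha : mass (vecSum ab) ≤ w.m) (hsp : g.speed < f.speed)
    (hc : CollisionRule P f g new) (D₀ : FlowCoord) :
    ∃ bl' st' ab', Layout P Um Up (6 * k.ρ₁) ⟨U, pre ++ new ++ post⟩ bl' st' ab' ∧
      w.energy D₀ bl' st' ab' ≤ w.energy D₀ bl st ab := by
  have hρ := H.scale.pos
  have hle : k.ρ₁ ≤ 6 * k.ρ₁ := by linarith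
  have hfr : pre ++ f :: g :: post = bl ++ st :: ab := L.fronts_eq
  rcases split_pair hfr.symm with ⟨q, rfl, rfl⟩ | ⟨rfl, rfl, rfl⟩ | ⟨rfl, rfl, rfl⟩ | ⟨q, rfl, rfl⟩
  · have e : pre ++ f :: g :: q = pre ++ [f, g] ++ q := by simp
    rw [e] at hb ⊢
    have hs := L.small_below
    rw [e] at hs
    have hlk := L.linked_below
    rw [e] at hlk
    obtain ⟨l1, l2, l3⟩ := linked_pair hlk
    have hf := hs f (by simp)
    have hg := hs g (by simp)
    have hr := (H.speed_below f hf).rank_le H.l_pos H.l_le (H.speed_below g hg) hsp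
    have hcb := H.collision_below f g new hf hg l2 hr hc
    refine ⟨pre ++ new ++ q, st, ab, ⟨by simp, small_replace hs hle hcb.small,
      fun f hf => (L.small_above f hf).mono hle, L.kind, L.admissible,
      linked_append.2 ⟨g.hi, linked_append.2 ⟨f.lo, l1, hcb.linked⟩, l3⟩, L.linked_above,
      L.near_bot.mono hle, L.near_lo.mono hle, L.near_hi.mono hle⟩, ?_⟩
    exact Weights.energy_le_of_collision_below hcb H.K_pos H.Λ_ge H.m_le D₀ pre q st ab hb
  · have hf := L.small_below f (by simp)
    obtain ⟨M, l1, l2⟩ := linked_append.1 L.linked_below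
    obtain ⟨rfl, l3⟩ := linked_singleton.1 l2
    have hr := (H.speed_below f hf).rank_le H.l_pos H.l_le
      (H.speed_strong g L.admissible L.kind L.near_lo) hsp
    -- A $1$-front is too slow to reach the strong front from below. This matters because
    -- `strong_below` gives no bound for such a front.
    have hk : f.kind ≠ .nonlinear .one := by
      intro hk
      rw [hk, L.kind] at hr
      simp [FrontKind.rank] at hr
    obtain ⟨F₁, st', F₄, hsf, h1, h2⟩ := H.strong_below f g new hk hf L.kind L.admissible l3.symm
      L.near_hi hc
    have hb' : mass (vecSum pre) ≤ w.m := by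
      rw [vecSum_append, mass_add] at hb
      have := mass_nonneg (vecSum_nonneg [f])
      linarith
    refine ⟨pre ++ F₁, st', F₄ ++ post, ⟨by simp [hsf.new_eq], ?_, ?_, hsf.kind, hsf.admissible,
      linked_append.2 ⟨f.lo, l1, hsf.linked_below⟩,
      linked_append.2 ⟨g.hi, hsf.linked_above, L.linked_above⟩,
      L.near_bot.mono hle, hsf.near_lo, hsf.near_hi⟩, ?_⟩
    · intro h hh
      exact (List.mem_append.1 hh).elim (fun hh => (L.small_below h (by simp [hh])).mono hle)
        (hsf.small_below h)
    · intro h hh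
      exact (List.mem_append.1 hh).elim (hsf.small_above h)
        (fun hh => (L.small_above h hh).mono hle)
    · exact Weights.energy_le_of_strong_below hf hk H.κ₀_nonneg hsf h1 h2 H.m_nonneg H.below_le D₀
        pre post hb' ha
  · have hg := L.small_above g (by simp)
    obtain ⟨l1, l2⟩ := linked_cons.1 L.linked_above
    have hr := (H.speed_strong f L.admissible L.kind L.near_lo).rank_le H.l_pos H.l_le
      (H.speed_above g hg) hsp
    rw [L.kind] at hr
    have hw : g.WeakPhysical ∧ g.kind ≠ .nonlinear .four := by
      rw [Front.weakPhysical_iff]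
      have := hg.ne_strong
      rcases hq : g.kind with (_ | _) | _ | _ | _ <;> rw [hq] at hr this <;>
        simp [FrontKind.rank] at hr this ⊢
    obtain ⟨F₁, st', F₄, hsf, h2⟩ := H.strong_above f g new hg L.kind L.admissible l1
      L.near_lo hc
    have ha' : mass (vecSum post) ≤ w.m := by
      rw [vecSum_cons, mass_add] at ha
      have := mass_nonneg g.vec_nonneg
      linarith
    refine ⟨bl ++ F₁, st', F₄ ++ post, ⟨by simp [hsf.new_eq], ?_, ?_, hsf.kind, hsf.admissible,
      linked_append.2 ⟨f.lo, L.linked_below, hsf.linked_below⟩,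
      linked_append.2 ⟨g.hi, hsf.linked_above, l2⟩,
      L.near_bot.mono hle, hsf.near_lo, hsf.near_hi⟩, ?_⟩
    · intro h hh
      exact (List.mem_append.1 hh).elim (fun hh => (L.small_below h hh).mono hle)
        (hsf.small_below h)
    · intro h hh
      exact (List.mem_append.1 hh).elim (hsf.small_above h)
        (fun hh => (L.small_above h (by simp [hh])).mono hle)
    · exact Weights.energy_le_of_strong_above hw.1 hw.2 hsf h2 H.m_nonneg H.above_le D₀
        bl post hb ha'
  · have e : q ++ f :: g :: post = q ++ [f, g] ++ post := by simp
    rw [e] at ha ⊢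
    have hs := L.small_above
    rw [e] at hs
    have hlk := L.linked_above
    rw [e] at hlk
    obtain ⟨l1, l2, l3⟩ := linked_pair hlk
    have hf := hs f (by simp)
    have hg := hs g (by simp)
    have hr := (H.speed_above f hf).rank_le H.l_pos H.l_le (H.speed_above g hg) hsp
    have hcb := H.collision_above f g new hf hg l2 hr hc
    refine ⟨bl, st, q ++ new ++ post, ⟨by simp, fun f hf => (L.small_below f hf).mono hle,
      small_replace hs hle hcb.small, L.kind, L.admissible, L.linked_below,
      linked_append.2 ⟨g.hi, linked_append.2 ⟨f.lo, l1, hcb.linked⟩, l3⟩,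
      L.near_bot.mono hle, L.near_lo.mono hle, L.near_hi.mono hle⟩, ?_⟩
    exact Weights.energy_le_of_collision_above hcb H.K_pos H.Λ_ge H.m_le D₀ bl st q post ha

/-- Replacing the fronts next to the wall. -/
theorem Layout.lateral {ρ₁ ρ₂ ρ₃ slope b : ℝ} (hle : ρ₁ ≤ ρ₃) (hle' : ρ₂ ≤ ρ₃) {U U' Ua : State}
    {old new q bl ab post : List Front} {st : Front}
    (L : Layout P Um Up ρ₁ ⟨U, old ++ post⟩ bl st ab) (hbl : bl = old ++ q)
    (hl : Linked U old Ua) (h : LateralFan P Um ρ₂ slope U' Ua new b) :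
    Layout P Um Up ρ₃ ⟨U', new ++ post⟩ (new ++ q) st ab := by
  have hp : post = q ++ st :: ab := by
    have := L.fronts_eq
    rw [hbl] at this
    simpa using this
  have hlq : Linked Ua q st.lo := by
    have h1 := L.linked_below
    rw [hbl] at h1
    obtain ⟨M, h2, h3⟩ := linked_append.1 h1
    have : ∀ (fs : List Front) (A B B' : State), Linked A fs B → Linked A fs B' → B = B' := by
      intro fs
      induction fs with
      | nil => intro A B B' h h'; exact Eq.trans (Eq.symm h) h'
      | cons f fs ih => intro A B B' h h'; exact ih _ _ _ (linked_cons.1 h).2 (linked_cons.1 h').2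
    rwa [this old U Ua M hl h2]
  refine ⟨by simp [hp], ?_, fun f hf => (L.small_above f hf).mono hle, L.kind, L.admissible,
    linked_append.2 ⟨Ua, h.linked, hlq⟩, L.linked_above, h.near.mono hle',
    L.near_lo.mono hle, L.near_hi.mono hle⟩
  intro f hf
  rcases List.mem_append.1 hf with hf | hf
  · exact (h.small f hf).mono hle'
  · exact (L.small_below f (by simp [hbl, hf])).mono hle

/-- The functional does not increase in a step of the front tracking algorithm. -/
theorem Setup.step (H : Setup P Um Up k w) {T : ℝ} (hslope : ∀ i, |W.slope i| < k.l)
    {x x' : ℝ} (hx : x < x') {c c' : Config}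
    (hslab : ∀ y ∈ Ioo x x', W.NoVertex y ∧ Separated W c.fronts y) (hstep : Step P W x' c c')
    {i : ℕ} (hi : W.a i ≤ x) (hi' : x < W.a (i + 1)) {bl ab : List Front} {st : Front}
    (L : Layout P Um Up k.ρ₁ c bl st ab) (hb : mass (vecSum bl) ≤ w.m)
    (ha : mass (vecSum ab) ≤ w.m) (D₀ : FlowCoord) :
    ∃ bl' st' ab' i', Layout P Um Up (6 * k.ρ₁) c' bl' st' ab' ∧ W.a i' ≤ x' ∧
      x' < W.a (i' + 1) ∧
      w.energy D₀ bl' st' ab' + w.kw * W.remaining T i' c'.bot ≤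
        w.energy D₀ bl st ab + w.kw * W.remaining T i c.bot := by
  have hρ := H.scale.pos
  have h6 : k.ρ₁ ≤ 6 * k.ρ₁ := by linarith
  have h36 : 3 * k.ρ₁ ≤ 6 * k.ρ₁ := by linarith
  have hmid : (x + x') / 2 ∈ Ioo x x' := ⟨by linarith, by linarith⟩
  -- The open slab contains no vertex, so the edge index changes at most at $x'$ itself.
  have hle' : x' ≤ W.a (i + 1) := by
    by_contra h
    exact (hslab _ ⟨hi', not_le.1 h⟩).1 i rfl
  have hnv : W.NoVertex x' → x' < W.a (i + 1) := fun h => lt_of_le_of_ne hle' (Ne.symm (h i))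
  have hΛm := mul_nonneg w.Λ_nonneg H.m_nonneg
  have hκ : 0 ≤ w.κ + w.Λ * w.m := by linarith [w.e_pos, w.e_le]
  have hkw := w.kw_pos
  have hvert : ∀ l, x' = W.a (l + 1) → l = i := by
    intro l hl
    have h1 : i < l + 1 := W.a_strictMono.lt_iff_lt.1 (by linarith)
    have h2 : l + 1 ≤ i + 1 := W.a_strictMono.le_iff_le.1 (by linarith)
    omega
  have hnext : ∀ j, W.a j < W.a (j + 1) := fun j => W.a_strictMono (Nat.lt_succ_self j)
  -- At a vertex the term $|\theta_{i+1}|$ leaves the turning still to come and can at most reappear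
  -- in the mismatch, so the wall part does not increase even if the vertex is ignored.
  have hturn : ∀ bot, |(coord bot).2.2.2 - Real.arctan (W.slope (i + 1))| ≤
      |(coord bot).2.2.2 - Real.arctan (W.slope i)| + |W.turn i| := by
    intro bot
    have := abs_sub ((coord bot).2.2.2 - Real.arctan (W.slope i)) (W.turn i)
    rwa [Wall.turn, sub_sub_sub_cancel_right, ← Wall.turn] at this
  cases hstep with
  | nothing _ hn _ => exact ⟨bl, st, ab, i, L.mono (by linarith), by linarith, hnv hn, le_rfl⟩
  | collision U pre f g post new hn he _ _ hc =>
    have hsp := speed_lt_of_collision hmid.2 (hslab _ hmid).2 he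
    obtain ⟨bl', st', ab', L', hE⟩ := H.collision L hb ha hsp hc D₀
    exact ⟨bl', st', ab', i, L', by linarith, hnv hn, by linarith⟩
  | wallPhysical U f post U' new hn he _ _ hw hlat =>
    rw [W.index_eq (by linarith) (hnv hn)] at hlat
    have hsp := speed_lt_slope hi hx (hnv hn)
      ((hslab _ hmid).2.1 f List.mem_cons_self) he
    obtain ⟨q, rfl⟩ : ∃ q, bl = f :: q := by
      cases bl with
      | nil =>
        have := L.fronts_eq
        simp only [List.nil_append, List.cons.injEq] at this
        exact absurd L.kind (by
          rw [← this.1]; rcases Front.weakPhysical_iff.1 hw with h | h | h <;> simp [h])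
      | cons b q =>
        have := L.fronts_eq
        simp only [List.cons_append, List.cons.injEq] at this
        exact ⟨q, by rw [this.1]⟩
    have hf := L.small_below f List.mem_cons_self
    obtain ⟨hlo, -⟩ := linked_cons.1 L.linked_below
    have hr := (H.speed_below f hf).le_two H.l_le ((le_abs_self _).trans_lt (hslope i)) hsp
    have hk : f.kind ≠ .nonlinear .four := by
      intro hk; rw [hk] at hr; simp [FrontKind.rank] at hr
    obtain ⟨b, hfan, -, hbb⟩ := H.lateral _ _ _ _ hlat hf.near_hi
    have hbb := hbb f hf hw hk rfl
    have hq : mass (vecSum q) ≤ w.m := by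
      rw [vecSum_cons, mass_add] at hb
      have := mass_nonneg f.vec_nonneg
      linarith
    have hE := Weights.energy_wall_le (w := w) (old := [f]) hfan (Weights.potential_singleton f) D₀
      q st ab hq
    have hv : vecSum [f] = f.vec := by simp [vecSum]
    rw [hv] at hE
    have h1 := Weights.abs_onePart_le_dot_below (w := w) hw
    have h2 := mul_le_mul_of_nonneg_left hbb hκ
    have h3 := mul_le_mul_of_nonneg_right H.wall_le (abs_nonneg f.onePart)
    have h4 := mul_le_mul_of_nonneg_right H.kw_ge
      (abs_nonneg ((coord f.lo).2.2.2 - Real.arctan (W.slope i)))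
    refine ⟨new ++ q, st, ab, i, Layout.lateral (old := [f]) h6 h36 L rfl
      (linked_singleton.2 ⟨hlo, rfl⟩) hfan, by linarith, hnv hn, ?_⟩
    -- After the lateral solver the flow is parallel to the wall and the mismatch is $0$. The
    -- released mismatch, with weight $k_w$, pays for the part of the reflected wave that it causes;
    -- the incident $1$-wave pays for the rest.
    simp only [Wall.remaining]
    rw [hfan.angle, sub_self, abs_zero, ← show f.lo = U from hlo]
    rw [List.singleton_append] at hE
    linarith
  | wallNonphysical U f post hn he _ hk =>
    -- Non-physical fronts are faster than any edge of the wall, so this rule never applies.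
    exfalso
    have hsp := speed_lt_slope hi hx (hnv hn)
      ((hslab _ hmid).2.1 f List.mem_cons_self) he
    have hf : SmallFront P Um k.ρ₁ f := by
      cases bl with
      | nil =>
        have := L.fronts_eq
        simp only [List.nil_append, List.cons.injEq] at this
        have h := L.kind
        rw [← this.1, hk] at h
        cases h
      | cons b q =>
        have := L.fronts_eq
        simp only [List.cons_append, List.cons.injEq] at this
        rw [this.1]
        exact L.small_below b List.mem_cons_self
    have hr := (H.speed_below f hf).le_two H.l_le ((le_abs_self _).trans_lt (hslope i)) hsp
    rw [hk] at hr
    simp [FrontKind.rank] at hr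
  | vertexAccurate U fs l U' new hl _ _ _ hlat =>
    obtain rfl := hvert l hl
    obtain ⟨b, hfan, hbb, -⟩ := H.lateral _ _ _ _ hlat L.near_bot
    have hE := Weights.energy_wall_le (w := w) (old := []) hfan rfl D₀ bl st ab hb
    rw [vecSum_nil, dot_zero, add_zero, List.nil_append] at hE
    have h2 := mul_le_mul_of_nonneg_left hbb hκ
    have h4 := mul_le_mul_of_nonneg_right H.kw_ge
      (abs_nonneg ((coord U).2.2.2 - Real.arctan (W.slope (l + 1))))
    have h5 := mul_le_mul_of_nonneg_left (hturn U) hkw.le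
    refine ⟨new ++ bl, st, ab, l + 1, Layout.lateral (old := []) h6 h36 L rfl rfl hfan,
      hl.symm.le, hl ▸ hnext (l + 1), ?_⟩
    simp only [Wall.remaining]
    rw [hfan.angle, sub_self, abs_zero, Finset.sum_range_succ]
    linarith
  | vertexIgnored _ l hl _ _ =>
    obtain rfl := hvert l hl
    refine ⟨bl, st, ab, l + 1, L.mono (by linarith), hl.symm.le, hl ▸ hnext (l + 1), ?_⟩
    have h5 := mul_le_mul_of_nonneg_left (hturn c.bot) hkw.le
    simp only [Wall.remaining]
    rw [Finset.sum_range_succ]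
    linarith

end Step

/-! ### Choice of the constants -/

/-- Accurate Riemann solvers for a small jump between states near the background. -/
def InitialBound (P : Params) (U₀ : State) (ρ₁ K : ℝ) : Prop :=
  ∀ lo hi new, AccurateWeak P lo hi new → Near U₀ ρ₁ lo → Near U₀ ρ₁ hi →
    (∀ f ∈ new, SmallFront P U₀ (3 * ρ₁) f) ∧ Linked lo new hi ∧
      mass (vecSum new) ≤ K * dist lo hi

theorem Region.dist_le_of_near {γ : ℝ} {U₀ : State} {C ρ ρ₁ : ℝ} (R : Region γ U₀ C ρ)
    (hρ : ρ₁ ≤ ρ) {U : State} (hU : Near U₀ ρ₁ U) : dist U U₀ ≤ C * ρ₁ := by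
  have h := R.coords.dist_le U U₀ hU.1 R.physical (hU.2.trans hρ) (by simpa using R.pos.le)
  exact h.trans (mul_le_mul_of_nonneg_left hU.2 (by linarith [R.one_le]))

theorem Region.fanDisp_zero {γ : ℝ} {U₀ : State} {C ρ : ℝ} (R : Region γ U₀ C ρ) {z : FlowCoord}
    (hz : ‖z - coord U₀‖ ≤ ρ) : fanDisp γ 0 0 0 z = 0 := by
  simp [fanDisp, (R.waves .one).disp_zero z hz, (R.waves .four).disp_zero z hz]

/-- Stability of the Riemann problem compared with the trivial triple $(0,0,0)$, whose displacement
is $0$: the outgoing strengths are bounded by the jump of the coordinates. -/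
theorem Region.exists_initialBound {γ : ℝ} {U₀ : State} {C ρ : ℝ} (R : Region γ U₀ C ρ) :
    ∃ K ≥ (1 : ℝ), ∃ ε > (0 : ℝ), ∀ P : Params, P.γ = γ → ∀ ρ₁ ≤ ε, SmallScale P C ρ ρ₁ →
      InitialBound P U₀ ρ₁ K := by
  obtain ⟨K, hK, ε, hε, hs⟩ := exists_fanDisp_stability R.waves R.one_le R.pos
    (turnRate_pos R.one_lt R.mach)
  have hC := R.one_le
  refine ⟨K * C, one_le_mul_of_one_le_of_one_le hK hC, ε / 6, by positivity, ?_⟩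
  rintro P rfl ρ₁ hρ₁ S lo hi new h hlo hhi
  have h0 := S.pos
  have hρ := S.le
  have hCρ : ρ₁ ≤ C * ρ₁ := le_mul_of_one_le_left h0.le hC
  obtain ⟨a, y, b, o⟩ := h.outgoing R S hlo hhi
  refine ⟨o.small, o.linked, ?_⟩
  have o1 := o.abs_one
  have o2 := o.norm_contact
  have o3 := o.abs_four
  have hst := hs a 0 b 0 y 0 (coord lo) (by linarith) (by simpa using hε.le) (by linarith)
    (by simpa using hε.le) (by linarith) (by simpa using hε.le) (by linarith [hlo.2]) o.contact rfl
  have e1 : fanDisp P.γ a y b (coord lo) = coord hi - coord lo := by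
    rw [o.coord_eq]; abel
  rw [R.fanDisp_zero (by linarith [hlo.2]), sub_zero, sub_zero, sub_zero, sub_zero, e1] at hst
  have hd := R.coords.coord_sub hi lo ((R.dist_le_of_near (by linarith) hhi).trans (by linarith))
    ((R.dist_le_of_near (by linarith) hlo).trans (by linarith))
  rw [o.vec_eq, mass_add, mass_add, mass_add, mass_waveVec, mass_contactVec, mass_waveVec,
    mass_npVec, norm_zero, add_zero, dist_comm]
  have := mul_le_mul_of_nonneg_left hd (by linarith : 0 ≤ K)
  linarith

theorem CollisionBound.mono {P : Params} {U₀ : State} {ρ K K' : ℝ} {f g : Front}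
    {new : List Front} (h : CollisionBound P U₀ ρ K f g new) (hK : K ≤ K') :
    CollisionBound P U₀ ρ K' f g new := by
  refine ⟨h.1, h.2, h.3, h.4.trans fun i => ?_⟩
  have := mul_le_mul_of_nonneg_right hK (approach_nonneg f.vec_nonneg g.vec_nonneg)
  simp only [Pi.add_apply]
  linarith

/-- The loop strong front, $1$-wave, wall, $4$-wave requires $\kappa_0<\kappa$ at the strong front
and $\kappa<1$ at the wall; $\kappa$ is taken midway between $\kappa_0$ and $1$. Then $W=4K_s$, and
$\Lambda=12WK$. Only afterwards are $m$ and $e$ chosen so small that $\Lambda m$ and $e$ are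
negligible against the gap $d$. Finally $k_w=2K_w$. -/
theorem exists_weights {κ₀ K Ks Kw : ℝ} (h0 : 0 < κ₀) (h1 : κ₀ < 1) (hK : 0 < K) (hKs : 1 ≤ Ks)
    (hKw : 1 ≤ Kw) : ∃ w : Weights, 0 < w.m ∧ 12 * w.W * K ≤ w.Λ ∧ 12 * K * w.m ≤ 1 ∧
      (2 * w.e + w.Λ * w.m) * Ks ≤ w.κ - κ₀ ∧ (1 + 2 * w.e + w.Λ * w.m) * Ks ≤ w.W ∧
      (w.κ + w.Λ * w.m) * (1 + (1 - κ₀) / 4) ≤ 1 ∧ (w.κ + w.Λ * w.m) * Kw ≤ w.kw := by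
  obtain ⟨d, hd⟩ : ∃ d, d = (1 - κ₀) / 2 := ⟨_, rfl⟩
  have hd0 : 0 < d := by linarith
  have hKs0 : 0 < Ks := by linarith
  have hKw0 : 0 < Kw := by linarith
  obtain ⟨Λ, hΛ⟩ : ∃ Λ, Λ = 12 * (4 * Ks) * K := ⟨_, rfl⟩
  have hΛ0 : 0 < Λ := by rw [hΛ]; positivity
  obtain ⟨m, hm0, hm1, hm2⟩ : ∃ m > 0, Λ * m * Ks ≤ d / 4 ∧ 12 * K * m ≤ 1 := by
    refine ⟨min (d / (4 * Λ * Ks)) (1 / (12 * K)), by positivity, ?_, ?_⟩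
    · have := min_le_left (d / (4 * Λ * Ks)) (1 / (12 * K))
      rw [le_div_iff₀ (by positivity)] at this
      linarith
    · have := min_le_right (d / (4 * Λ * Ks)) (1 / (12 * K))
      rw [le_div_iff₀ (by positivity)] at this
      linarith
  have hΛm : 0 < Λ * m := by positivity
  have hΛm' : Λ * m ≤ d / 4 := (le_mul_of_one_le_right hΛm.le hKs).trans hm1
  obtain ⟨e, he⟩ : ∃ e, e = d / (8 * Ks) := ⟨_, rfl⟩
  have he0 : 0 < e := by rw [he]; positivity
  have he1 : e * Ks = d / 8 := by rw [he]; field_simp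
  have he2 : e ≤ d / 8 := (le_mul_of_one_le_right he0.le hKs).trans he1.le
  refine ⟨⟨κ₀ + d, 4 * Ks, e, Λ, 2 * Kw, m, he0, by linarith, by linarith, by linarith, hΛ0.le,
    by linarith⟩, hm0, hΛ.ge, hm2, ?_, ?_, ?_, ?_⟩ <;> dsimp only
  · linarith
  · linarith
  · have h2 : (κ₀ + d + Λ * m) * (1 + (1 - κ₀) / 4) ≤ (κ₀ + d + d / 4) * (1 + (1 - κ₀) / 4) :=
      mul_le_mul_of_nonneg_right (by linarith) (by linarith)
    have h3 : κ₀ = 1 - 2 * d := by linarith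
    rw [h3] at h2 ⊢
    have := mul_pos hd0 hd0
    linarith
  · have : (κ₀ + d + Λ * m) * Kw ≤ 2 * Kw := mul_le_mul_of_nonneg_right (by linarith) hKw0.le
    linarith

/-- All constants are fixed before `P`. The estimates use only its adiabatic exponent, non-physical
speed, wave size bound and speed tolerance, so they are uniform in the approximation parameters. -/
theorem exists_setup {γ speedNP : ℝ} {Um Up : State} (hγ : 1 < γ) (hUm : Supersonic γ Um)
    (hUp : Supersonic γ Up) (hvm : vv Um = 0) (hvp : vv Up = 0) (hm : lam γ .four Um < speedNP)
    (hp : lam γ .four Up < speedNP) :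
    ∃ (k : Constants) (w : Weights) (Ki r η₀ : ℝ), 1 ≤ k.Ks ∧ 1 ≤ k.Kw ∧ 1 ≤ Ki ∧ 0 < r ∧ 0 < η₀ ∧
      0 < w.m ∧ ∀ P : Params, P.γ = γ → P.speedNP = speedNP → P.weak = r → P.η ≤ η₀ →
        Setup P Um Up k w ∧ InitialBound P Um k.ρ₁ Ki ∧ InitialBound P Up k.ρ₁ Ki := by
  obtain ⟨C₁, ρ₁, R₁⟩ := exists_region hγ hUm hvm
  obtain ⟨C₂, ρ₂, R₂⟩ := exists_region hγ hUp hvp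
  obtain ⟨C, hC⟩ : ∃ C, C = max C₁ C₂ := ⟨_, rfl⟩
  obtain ⟨ρ, hρ⟩ : ∃ ρ, ρ = min ρ₁ ρ₂ := ⟨_, rfl⟩
  have hρ0 : 0 < ρ := hρ ▸ lt_min R₁.pos R₂.pos
  have Rm : Region γ Um C ρ := R₁.mono (hC ▸ le_max_left _ _) (hρ ▸ min_le_left _ _) hρ0
  have Rp : Region γ Up C ρ := R₂.mono (hC ▸ le_max_right _ _) (hρ ▸ min_le_right _ _) hρ0
  have hC1 := Rm.one_le
  obtain ⟨κ₀, Ks, ε₁, hκ0, hκ1, hKs, hε₁, hst⟩ := exists_strong_bound Rm Rp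
  obtain ⟨l, M, ε₂, hl, hlM, hε₂, hsp⟩ := exists_speedBounds Rm Rp hm hp
  obtain ⟨Kb, hKb, ε₃, hε₃, hcb⟩ := Rm.exists_collisionBound
  obtain ⟨Ka, hKa, ε₄, hε₄, hca⟩ := Rp.exists_collisionBound
  obtain ⟨Kw, hKw, hlat⟩ := Rm.exists_lateral_bound
  obtain ⟨ε₅, hε₅, hlat⟩ := hlat ((1 - κ₀) / 4) (by linarith)
  obtain ⟨Ki, hKi, ε₆, hε₆, hib⟩ := Rm.exists_initialBound
  obtain ⟨Kj, hKj, ε₇, hε₇, hia⟩ := Rp.exists_initialBound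
  obtain ⟨w, w1, w2, w3, w4, w5, w6, w7⟩ :=
    exists_weights hκ0 hκ1 (lt_max_of_lt_left hKb : 0 < max Kb Ka) hKs hKw
  obtain ⟨s, hs0, s1, s2, s3, s4, s5, s6, s7, s8, s9⟩ : ∃ s > 0, s ≤ ε₁ ∧ s ≤ ε₂ ∧ s ≤ ε₃ ∧
      s ≤ ε₄ ∧ s ≤ ε₅ ∧ s ≤ ε₆ ∧ s ≤ ε₇ ∧ 16 * (C * s) ≤ ρ ∧ 16 * (C * (C * s)) ≤ 1 := by
    obtain ⟨t, ht⟩ : ∃ t, t = min (min (min ε₁ ε₂) (min ε₃ ε₄))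
      (min (min ε₅ ε₆) (min ε₇ (min (ρ / (16 * C)) (1 / (16 * C * C))))) := ⟨_, rfl⟩
    have ht0 : 0 < t := by rw [ht]; positivity
    have := ht.le
    simp only [le_min_iff] at this
    obtain ⟨⟨⟨a1, a2⟩, a3, a4⟩, ⟨a5, a6⟩, a7, a8, a9⟩ := this
    rw [le_div_iff₀ (by positivity)] at a8 a9
    exact ⟨t, ht0, a1, a2, a3, a4, a5, a6, a7, by linarith, by linarith⟩
  -- The wave size bound is $s/C$, so a single wave moves the coordinates by at most $s$. The
  -- tolerance is $\varepsilon_2$, the one that keeps the speeds of the families apart.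
  refine ⟨⟨C, ρ, s, l, M, κ₀, max Kb Ka, Ks, Kw, (1 - κ₀) / 4⟩, w, max Ki Kj, s / C, ε₂, hKs, hKw,
    le_max_of_le_left hKi, by positivity, hε₂, w1, ?_⟩
  rintro P rfl hNP hr hη
  have S : SmallScale P C ρ s := ⟨hs0, s8, s9, by rw [hr]; field_simp; rfl⟩
  obtain ⟨t1, t2, t3⟩ := hst P rfl s s1 S
  obtain ⟨v1, v2, v3⟩ := hsp P rfl hNP hη s s2
  have hmono : ∀ {U₀ : State} {K K' : ℝ}, K ≤ K' → InitialBound P U₀ s K →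
      InitialBound P U₀ s K' := fun hK h lo hi new hn hlo hhi =>
    have ⟨a, b, c⟩ := h lo hi new hn hlo hhi
    ⟨a, b, c.trans (mul_le_mul_of_nonneg_right hK dist_nonneg)⟩
  exact ⟨⟨Rm, Rp, S,
    fun f g new hf hg h1 h2 h3 => (hcb P rfl s s3 S f g new hf hg h1 h2 h3).mono (le_max_left _ _),
    fun f g new hf hg h1 h2 h3 => (hca P rfl s s4 S f g new hf hg h1 h2 h3).mono (le_max_right _ _),
    t1, t2, t3, hlat P rfl s s5 S, v1, v2, v3, hl, hlM, hκ0.le, lt_max_of_lt_left hKb, w1.le,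
    w2, w3, w4, w5, w6, w7⟩, hmono (le_max_left _ _) (hib P rfl s s6 S),
    hmono (le_max_right _ _) (hia P rfl s s7 S)⟩

/-! ### Variation of the slope of the wall -/

theorem abs_arctan_sub_le (x y : ℝ) : |Real.arctan x - Real.arctan y| ≤ |x - y| := by
  have h := convex_univ.norm_image_sub_le_of_norm_hasDerivWithin_le (f := Real.arctan) (C := 1)
    (fun z _ => (Real.hasDerivAt_arctan z).hasDerivWithinAt)
    (fun z _ => by
      rw [Real.norm_eq_abs, abs_of_nonneg (by positivity), div_le_one (by positivity)]
      nlinarith [sq_nonneg z]) (mem_univ y) (mem_univ x)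
  simpa using h

theorem Wall.sum_slope_le {W : Wall} {T : ℝ} (hT : 0 ≤ T)
    (h : W.slopeVariation ≤ ENNReal.ofReal T) (i : ℕ) :
    |W.slope 0| + ∑ j ∈ Finset.range i, |W.slope (j + 1) - W.slope j| ≤ T := by
  rw [← ENNReal.ofReal_le_ofReal_iff hT, ENNReal.ofReal_add (abs_nonneg _)
    (Finset.sum_nonneg fun _ _ => abs_nonneg _),
    ENNReal.ofReal_sum_of_nonneg fun _ _ => abs_nonneg _]
  exact (add_le_add le_rfl (ENNReal.sum_le_tsum _)).trans h

theorem Wall.abs_slope_le {W : Wall} {T : ℝ} (hT : 0 ≤ T)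
    (h : W.slopeVariation ≤ ENNReal.ofReal T) (i : ℕ) : |W.slope i| ≤ T := by
  refine le_trans ?_ (W.sum_slope_le hT h i)
  induction i with
  | zero => simp
  | succ i ih =>
    rw [Finset.sum_range_succ]
    have := abs_add_le (W.slope i) (W.slope (i + 1) - W.slope i)
    rw [add_sub_cancel] at this
    linarith

theorem Wall.sum_turn_le {W : Wall} {T : ℝ} (hT : 0 ≤ T)
    (h : W.slopeVariation ≤ ENNReal.ofReal T) (i : ℕ) :
    ∑ j ∈ Finset.range i, |W.turn j| ≤ T := by
  have h1 := W.sum_slope_le hT h i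
  have h2 : ∑ j ∈ Finset.range i, |W.turn j| ≤
      ∑ j ∈ Finset.range i, |W.slope (j + 1) - W.slope j| :=
    Finset.sum_le_sum fun j _ => abs_arctan_sub_le _ _
  linarith [abs_nonneg (W.slope 0)]

/-! ### Bounds for all times -/

section Invariant

variable {P : Params} {Um Up : State} {y₀ : ℝ} {pert : ℝ → State} {g dg : ℝ → ℝ} {k : Constants}
  {w : Weights}

theorem Wall.remaining_nonneg {W : Wall} {T : ℝ}
    (hT : ∀ i, ∑ j ∈ Finset.range i, |W.turn j| ≤ T) (i : ℕ) (bot : State) :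
    0 ≤ W.remaining T i bot := by
  have := abs_nonneg ((coord bot).2.2.2 - Real.arctan (W.slope i))
  have := hT i
  simp only [Wall.remaining]
  linarith

theorem Weights.mass_le_of_energy_le (w : Weights) {W : Wall} {T : ℝ}
    (hT : ∀ i, ∑ j ∈ Finset.range i, |W.turn j| ≤ T) {G : ℝ} {bl ab : List Front} {st : Front}
    {D₀ : FlowCoord} {i : ℕ} {bot : State}
    (h : w.energy D₀ bl st ab + w.kw * W.remaining T i bot ≤ G) :
    w.energy D₀ bl st ab ≤ G ∧ w.e * (mass (vecSum bl) + mass (vecSum ab)) ≤ G := by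
  have h1 := mul_nonneg w.kw_pos.le (W.remaining_nonneg hT i bot)
  have h2 := w.mass_le_energy D₀ bl st ab
  have h3 := mul_nonneg w.e_pos.le (norm_nonneg (st.jump - D₀))
  constructor <;> linarith

/-- Bootstrap: a step may enlarge the neighbourhood from $\rho_1$ to $6\rho_1$, but the functional
stays below $G$, and `Layout.refine` then restores $\rho_1$. The bound `hGm` keeps the mass below
$m$, as the collision estimates require. -/
theorem Setup.invariant (H : Setup P Um Up k w) (A : FrontTracking P Um Up y₀ pert g dg)
    {T G : ℝ} (hslope : ∀ i, |A.wall.slope i| < k.l)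
    (hT : ∀ i, ∑ j ∈ Finset.range i, |A.wall.turn j| ≤ T) (hGm : G ≤ w.e * w.m)
    (hGρ : 3 * (k.C * G) ≤ w.e * k.ρ₁)
    (h0 : ∃ bl st ab, Layout P Um Up (k.ρ / 2) (A.cfg 0) bl st ab ∧
      w.energy (coord Up - coord Um) bl st ab + w.kw * A.wall.remaining T 0 (A.cfg 0).bot ≤ G)
    (n : ℕ) : ∃ bl st ab i, Layout P Um Up k.ρ₁ (A.cfg n) bl st ab ∧ A.wall.a i ≤ A.τ n ∧
      A.τ n < A.wall.a (i + 1) ∧ w.energy (coord Up - coord Um) bl st ab +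
        w.kw * A.wall.remaining T i (A.cfg n).bot ≤ G := by
  induction n with
  | zero =>
    obtain ⟨bl, st, ab, L, hE⟩ := h0
    refine ⟨bl, st, ab, 0, L.refine H.region_below H.region_above w hGρ (w.mass_le_of_energy_le hT hE).1,
      by rw [A.wall.a_zero, A.τ_zero], ?_, hE⟩
    rw [A.τ_zero, ← A.wall.a_zero]
    exact A.wall.a_strictMono (by norm_num)
  | succ n ih =>
    obtain ⟨bl, st, ab, i, L, hi, hi', hE⟩ := ih
    have hm := (w.mass_le_of_energy_le hT hE).2
    have hm' : mass (vecSum bl) + mass (vecSum ab) ≤ w.m :=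
      le_of_mul_le_mul_left (hm.trans hGm) w.e_pos
    have m1 := mass_nonneg (vecSum_nonneg bl)
    have m2 := mass_nonneg (vecSum_nonneg ab)
    obtain ⟨bl', st', ab', i', L', hj, hj', hE'⟩ := H.step (T := T) hslope
      (A.τ_strictMono (Nat.lt_succ_self n)) (A.slab n) (A.step n) hi hi' L (by linarith)
      (by linarith) (coord Up - coord Um)
    have hG := hE'.trans hE
    have hρ := H.scale.le' H.region_below
    have hpos := H.scale.pos
    exact ⟨bl', st', ab', i', (L'.mono (by linarith)).refine H.region_below H.region_above w hGρ
      (w.mass_le_of_energy_le hT hG).1, hj, hj', hG⟩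

end Invariant

/-! ### Total strength and total variation -/

theorem sum_map_le_mass {fs : List Front} {F : Front → ℝ} {B : ℝ}
    (h : ∀ f ∈ fs, F f ≤ B * mass f.vec) : (fs.map F).sum ≤ B * mass (vecSum fs) := by
  induction fs with
  | nil => simp [vecSum_nil, mass_zero]
  | cons f fs ih =>
    rw [List.map_cons, List.sum_cons, vecSum_cons, mass_add]
    have h1 := h f (by simp)
    have h2 := ih fun f hf => h f (by simp [hf])
    linarith

theorem Front.strength_nonneg (γ : ℝ) (f : Front) : 0 ≤ f.strength γ := by
  unfold Front.strength
  split <;> positivity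

theorem Front.weightedAbove_le (γ kplus : ℝ) (f : Front) :
    f.weightedAbove γ kplus ≤ (1 + |kplus|) * f.strength γ := by
  have h1 := f.strength_nonneg γ
  have h2 := mul_nonneg (abs_nonneg kplus) h1
  have h3 := mul_le_mul_of_nonneg_right (le_abs_self kplus) h1
  unfold Front.weightedAbove
  split <;> linarith

/-- A fixed weight of the $1$-waves above the strong front changes the sum at most by the factor
$1+|k_+|$, so a bound of the unweighted masses suffices. -/
theorem Layout.totalStrength_le {P : Params} {Um Up : State} {C ρ : ℝ} (Rm : Region P.γ Um C ρ)
    (Rp : Region P.γ Up C ρ) {c : Config} {bl ab : List Front} {st : Front}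
    (L : Layout P Um Up (ρ / 2) c bl st ab) (kplus : ℝ) :
    c.totalStrength P.γ kplus ≤
      2 * (C * C) * (1 + |kplus|) * (mass (vecSum bl) + mass (vecSum ab)) := by
  have hbl : ∀ f ∈ bl, (!f.isStrong) = true := by
    intro f hf
    have := (L.small_below f hf).ne_strong
    unfold Front.isStrong
    split <;> simp_all
  have hst : st.isStrong = true := by simp [Front.isStrong, L.kind]
  have hst' : st.weightedAbove P.γ kplus = 0 := by simp [Front.weightedAbove, Front.strength, L.kind]
  have hk : 0 ≤ |kplus| := abs_nonneg _
  rw [Config.totalStrength, L.fronts_eq, List.takeWhile_append_of_pos hbl,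
    List.dropWhile_append_of_pos hbl, List.takeWhile_cons, List.dropWhile_cons, hst]
  simp only [Bool.not_true, Bool.false_eq_true, if_false, List.append_nil, List.map_cons,
    List.sum_cons, hst', zero_add]
  have h1 : (bl.map (Front.strength P.γ)).sum ≤
      2 * (C * C) * (1 + |kplus|) * mass (vecSum bl) := by
    refine sum_map_le_mass fun f hf => ?_
    have := Rm.strength_le (L.small_below f hf)
    have := mul_nonneg hk (mul_nonneg (mul_self_nonneg C) (mass_nonneg f.vec_nonneg))
    linarith
  have h2 : (ab.map (Front.weightedAbove P.γ kplus)).sum ≤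
      2 * (C * C) * (1 + |kplus|) * mass (vecSum ab) := by
    refine sum_map_le_mass fun f hf => ?_
    have h1 := Rp.strength_le (L.small_above f hf)
    have h2 := f.weightedAbove_le P.γ kplus
    have h3 := mul_le_mul_of_nonneg_left h1 (by linarith : 0 ≤ 1 + |kplus|)
    linarith
  linarith

theorem eVariationOn_le_of_dist_le {E : Type*} [PseudoMetricSpace E] {f : ℝ → E} {φ : ℝ → ℝ}
    {s : Set ℝ} {B : ℝ} (h : ∀ a b, a ≤ b → dist (f a) (f b) ≤ φ b - φ a)
    (h0 : ∀ a, 0 ≤ φ a) (hB : ∀ a, φ a ≤ B) : eVariationOn f s ≤ ENNReal.ofReal B := by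
  refine iSup_le fun p => ?_
  obtain ⟨n, u, hu, -⟩ := p
  have h1 : ∀ i, edist (f (u (i + 1))) (f (u i)) ≤ ENNReal.ofReal (φ (u (i + 1)) - φ (u i)) := by
    intro i
    rw [edist_comm, edist_dist]
    exact ENNReal.ofReal_le_ofReal (h _ _ (hu (Nat.le_succ i)))
  refine (Finset.sum_le_sum fun i _ => h1 i).trans ?_
  rw [← ENNReal.ofReal_sum_of_nonneg fun i _ => dist_nonneg.trans (h _ _ (hu (Nat.le_succ i))),
    Finset.sum_range_sub fun i => φ (u i)]
  exact ENNReal.ofReal_le_ofReal (by linarith [h0 (u 0), hB (u n)])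

theorem foldl_state_of_le {x y : ℝ} {fs : List Front} (U : State) (h : ∀ f ∈ fs, y ≤ f.pos x) :
    fs.foldl (fun U f => if f.pos x < y then f.hi else U) U = U := by
  induction fs generalizing U with
  | nil => rfl
  | cons f fs ih =>
    rw [List.foldl_cons, if_neg (not_lt.2 (h f (by simp))), ih _ fun f hf => h f (by simp [hf])]

/-- The monotone majorant at height $y$ is the sum of the jumps of all fronts below $y$. Weak
ordering of the positions is enough, which admits fronts that have just left a common point. -/
theorem eVariationOn_state_le {c : Config} {V : State} {x : ℝ} (hl : Linked c.bot c.fronts V)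
    (hs : c.fronts.Pairwise fun f g => f.pos x ≤ g.pos x) (s : Set ℝ) :
    eVariationOn (c.state x) s ≤
      ENNReal.ofReal ((c.fronts.map fun f => dist f.hi f.lo).sum) := by
  obtain ⟨U, fs⟩ := c
  dsimp only at hl hs ⊢
  let φ : List Front → ℝ → ℝ := fun fs y =>
    (fs.map fun f => if f.pos x < y then dist f.hi f.lo else 0).sum
  have hφ0 : ∀ fs y, 0 ≤ φ fs y := fun fs y => List.sum_nonneg fun z hz => by
    obtain ⟨f, -, rfl⟩ := List.mem_map.1 hz
    positivity
  have hφB : ∀ fs y, φ fs y ≤ (fs.map fun f => dist f.hi f.lo).sum := fun fs y =>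
    List.sum_le_sum fun f _ => by split <;> [rfl; exact dist_nonneg]
  refine eVariationOn_le_of_dist_le (φ := φ fs) ?_ (hφ0 fs) (hφB fs)
  intro a b hab
  simp only [Config.state]
  induction fs generalizing U with
  | nil => simp [φ]
  | cons f fs ih =>
    obtain ⟨rfl, hl'⟩ := linked_cons.1 hl
    obtain ⟨hf, hs⟩ := List.pairwise_cons.1 hs
    have := ih f.hi hl' hs
    simp only [List.foldl_cons, φ, List.map_cons, List.sum_cons] at this ⊢
    rcases lt_or_ge (f.pos x) a with h | h
    · rw [if_pos h, if_pos (h.trans_le hab), if_pos h, if_pos (h.trans_le hab)]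
      linarith
    · rw [if_neg (not_lt.2 h), foldl_state_of_le (y := a) f.lo fun g hg => h.trans (hf g hg)]
      rw [foldl_state_of_le (y := a) f.hi fun g hg => h.trans (hf g hg)] at this
      have hd : dist f.lo f.hi = dist f.hi f.lo := dist_comm _ _
      rcases lt_or_ge (f.pos x) b with h' | h'
      · rw [if_pos h', if_pos h', if_neg (not_lt.2 h)]
        exact (dist_triangle _ f.hi _).trans (by linarith)
      · rw [if_neg (not_lt.2 h'), foldl_state_of_le (y := b) f.lo fun g hg => h'.trans (hf g hg),
          if_neg (not_lt.2 h), if_neg (not_lt.2 h'), dist_self]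
        have : dist f.hi _ ≤ _ := this
        linarith [dist_nonneg.trans this]

theorem Layout.sum_dist_le {P : Params} {Um Up : State} {C ρ : ℝ} (Rm : Region P.γ Um C ρ)
    (Rp : Region P.γ Up C ρ) {c : Config} {bl ab : List Front} {st : Front}
    (L : Layout P Um Up (ρ / 2) c bl st ab) :
    (c.fronts.map fun f => dist f.hi f.lo).sum ≤
      C * C * (mass (vecSum bl) + mass (vecSum ab)) + (dist Up Um + C * ρ) := by
  have hρ := Rm.pos
  rw [L.fronts_eq, List.map_append, List.sum_append, List.map_cons, List.sum_cons]
  have h1 : (bl.map fun f => dist f.hi f.lo).sum ≤ C * C * mass (vecSum bl) :=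
    sum_map_le_mass fun f hf => by linarith [Rm.dist_le (L.small_below f hf)]
  have h2 : (ab.map fun f => dist f.hi f.lo).sum ≤ C * C * mass (vecSum ab) :=
    sum_map_le_mass fun f hf => by linarith [Rp.dist_le (L.small_above f hf)]
  have h3 := Rp.dist_le_of_near (by linarith) L.near_hi
  have h4 := Rm.dist_le_of_near (by linarith) L.near_lo
  have h5 := dist_triangle4 st.hi Up Um st.lo
  rw [dist_comm Um] at h5
  linarith

theorem Layout.linked {P : Params} {Um Up : State} {ρ : ℝ} {c : Config} {bl ab : List Front}
    {st : Front} (L : Layout P Um Up ρ c bl st ab) : Linked c.bot c.fronts Up := by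
  rw [L.fronts_eq]
  exact linked_append.2 ⟨st.lo, L.linked_below, linked_cons.2 ⟨rfl, L.linked_above⟩⟩

namespace FrontTracking

variable {P : Params} {Um Up : State} {y₀ : ℝ} {pert : ℝ → State} {g dg : ℝ → ℝ}

theorem exists_index (A : FrontTracking P Um Up y₀ pert g dg) {x : ℝ} (hx : 0 < x)
    (h : ∃ n, x < A.τ n) : A.τ (A.index x) ≤ x ∧ x < A.τ (A.index x + 1) := by
  obtain ⟨n, hn⟩ := h
  have hb : BddAbove {n : ℕ | A.τ n ≤ x} :=
    ⟨n, fun j hj => (A.τ_strictMono.lt_iff_lt.1 (lt_of_le_of_lt hj hn)).le⟩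
  have hne : {n : ℕ | A.τ n ≤ x}.Nonempty := ⟨0, by simp [A.τ_zero, hx.le]⟩
  refine ⟨Nat.sSup_mem hne hb, ?_⟩
  by_contra hc
  have := le_csSup hb (show A.index x + 1 ∈ {n : ℕ | A.τ n ≤ x} from not_lt.1 hc)
  exact absurd this (by simp [index])

/-- The fronts are ordered up to their starting points. -/
theorem pairwise_pos_le (A : FrontTracking P Um Up y₀ pert g dg) {n : ℕ} {x : ℝ}
    (hx : A.τ n ≤ x) (hx' : x < A.τ (n + 1)) :
    (A.cfg n).fronts.Pairwise fun f g => f.pos x ≤ g.pos x := by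
  have h : ∀ᶠ z in 𝓝[>] x, (A.cfg n).fronts.Pairwise fun f g => f.pos z < g.pos z := by
    filter_upwards [Ioo_mem_nhdsGT hx'] with z hz
    exact (A.slab n z ⟨hx.trans_lt hz.1, hz.2⟩).2.2
  have hcont : ∀ f : Front, Tendsto f.pos (𝓝[>] x) (𝓝 (f.pos x)) := fun f => by
    have : Continuous f.pos := by unfold Front.pos; fun_prop
    exact this.continuousAt.tendsto.mono_left nhdsWithin_le_nhds
  rw [List.pairwise_iff_getElem]
  intro i j hi hj hij
  exact le_of_tendsto_of_tendsto (hcont _) (hcont _)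
    (h.mono fun z hz => (List.pairwise_iff_getElem.1 hz i j hi hj hij).le)

end FrontTracking

/-! ### The incoming flow -/

section Jumps

variable (Um Up : State) (y₀ : ℝ)

/-- The jump of the background flow at `y`. -/
def backgroundJump (y : ℝ) : State := if y = y₀ then Up - Um else 0

/-- The sum of the jumps of the difference of a step function and the background flow. -/
def jumpSum : State → List (ℝ × State) → ℝ
  | _, [] => 0
  | U, j :: js => ‖j.2 - U - backgroundJump Um Up y₀ j.1‖ + jumpSum j.2 js

/-- The value of a step function above all its jumps. -/
def lastState : State → List (ℝ × State) → State
  | U, [] => U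
  | _, j :: js => lastState j.2 js

variable {Um Up y₀}

theorem jumpSum_nonneg (U : State) (js : List (ℝ × State)) : 0 ≤ jumpSum Um Up y₀ U js := by
  induction js generalizing U with
  | nil => exact le_rfl
  | cons j js ih => exact add_nonneg (norm_nonneg _) (ih _)

theorem stepFun_of_le {y : ℝ} (U : State) {js : List (ℝ × State)} (h : ∀ j ∈ js, y ≤ j.1) :
    stepFun U js y = U := by
  induction js with
  | nil => rfl
  | cons j js ih =>
    have := ih fun i hi => h i (by simp [hi])
    rwa [stepFun, List.foldl_cons, if_neg (not_lt.2 (h j (by simp))), ← stepFun]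

theorem stepFun_cons_of_lt {y : ℝ} (U : State) {j : ℝ × State} (js : List (ℝ × State))
    (h : j.1 < y) : stepFun U (j :: js) y = stepFun j.2 js y := by
  rw [stepFun, List.foldl_cons, if_pos h, ← stepFun]

theorem stepFun_of_lt {y : ℝ} (U : State) {js : List (ℝ × State)} (h : ∀ j ∈ js, j.1 < y) :
    stepFun U js y = lastState U js := by
  induction js generalizing U with
  | nil => rfl
  | cons j js ih =>
    rw [stepFun_cons_of_lt U js (h j (by simp)), ih _ fun i hi => h i (by simp [hi]), lastState]

/-- Step functions here take the old value at a jump point and the new one at the next jump point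
$p'$, so the change over $[j,p']$ is the jump minus that of the background. The condition `hy`
ensures that the background does not jump strictly between consecutive listed points. -/
theorem jumpSum_le_eVariationOn {js : List (ℝ × State)} (hs : js.Pairwise fun i j => i.1 < j.1)
    (U : State) {p : ℝ} (hp : ∀ j ∈ js, p ≤ j.1) (hy : (∃ j ∈ js, j.1 = y₀) ∨ y₀ < p) :
    ENNReal.ofReal (jumpSum Um Up y₀ U js) ≤
      eVariationOn (fun y => stepFun U js y - background Um Up y₀ y) (Ici p) := by
  induction js generalizing U p with
  | nil => simp [jumpSum]
  | cons j js ih =>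
    obtain ⟨hj, hs⟩ := List.pairwise_cons.1 hs
    obtain ⟨p', hp', hjs⟩ : ∃ p', j.1 < p' ∧ ∀ i ∈ js, p' ≤ i.1 := by
      cases js with
      | nil => exact ⟨j.1 + 1, by linarith, by simp⟩
      | cons i js =>
        refine ⟨i.1, hj i (by simp), fun l hl => ?_⟩
        rcases List.mem_cons.1 hl with rfl | hl
        · exact le_rfl
        · exact ((List.pairwise_cons.1 hs).1 l hl).le
    have hpj := hp j (by simp)
    have hy' : (∃ i ∈ js, i.1 = y₀) ∨ y₀ < p' := by
      rcases hy with ⟨i, hi, rfl⟩ | h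
      · rcases List.mem_cons.1 hi with rfl | hi
        · exact Or.inr hp'
        · exact Or.inl ⟨i, hi, rfl⟩
      · exact Or.inr (by linarith)
    have h1 := ih hs j.2 hjs hy'
    have h2 : eVariationOn (fun y => stepFun j.2 js y - background Um Up y₀ y) (Ici p') =
        eVariationOn (fun y => stepFun U (j :: js) y - background Um Up y₀ y) (Ici p') :=
      eVariationOn.congr fun z hz => by
        rw [stepFun_cons_of_lt U js (hp'.trans_le hz)]
    have h3 : ENNReal.ofReal ‖j.2 - U - backgroundJump Um Up y₀ j.1‖ ≤
        eVariationOn (fun y => stepFun U (j :: js) y - background Um Up y₀ y) (Icc j.1 p') := by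
      refine le_trans (le_of_eq ?_) (eVariationOn.edist_le _ (right_mem_Icc.2 hp'.le)
        (left_mem_Icc.2 hp'.le))
      rw [edist_dist, dist_eq_norm, stepFun_cons_of_lt U js hp', stepFun_of_le j.2 hjs,
        stepFun_of_le U (js := j :: js) (y := j.1) (by
          simp only [List.mem_cons, forall_eq_or_imp, le_refl, true_and]
          exact fun i hi => (hj i hi).le)]
      congr 2
      have : backgroundJump Um Up y₀ j.1 =
          background Um Up y₀ p' - background Um Up y₀ j.1 := by
        unfold backgroundJump background
        by_cases h : j.1 = y₀
        · rw [if_pos h, if_pos (h ▸ hp'), if_neg (by simp [h])]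
        · rw [if_neg h]
          rcases hy with ⟨i, hi, rfl⟩ | hlt
          · rcases List.mem_cons.1 hi with rfl | hi
            · exact absurd rfl h
            · rw [if_neg (not_lt.2 (hjs i hi)), if_neg (not_lt.2 (hj i hi).le), sub_self]
          · rw [if_pos (by linarith), if_pos (by linarith), sub_self]
      rw [this]
      abel
    rw [jumpSum, ENNReal.ofReal_add (norm_nonneg _) (jumpSum_nonneg _ _)]
    refine (add_le_add h3 (h1.trans_eq h2)).trans
      ((eVariationOn.add_le_union _ fun x hx y hy => hx.2.trans hy).trans
        (eVariationOn.mono _ (union_subset ?_ ?_)))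
    · exact fun z hz => hpj.trans hz.1
    · exact fun z hz => hpj.trans (hp'.le.trans hz)

/-- Far above all jumps the integrand is a constant minus an integrable function on a half-line of
infinite measure; finiteness forces the constant to vanish. -/
theorem lastState_eq {U : State} {js : List (ℝ × State)} {pert : ℝ → State}
    (hint : Integrable pert)
    (h : ∫⁻ y in Ioi (0 : ℝ), ‖stepFun U js y - background Um Up y₀ y - pert y‖ₑ < ⊤) :
    lastState U js = Up := by
  obtain ⟨N, hN0, hNy, hN⟩ : ∃ N : ℝ, 0 ≤ N ∧ y₀ ≤ N ∧ ∀ j ∈ js, j.1 ≤ N := by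
    clear h
    induction js with
    | nil => exact ⟨max 0 y₀, le_max_left _ _, le_max_right _ _, by simp⟩
    | cons i js ih =>
      obtain ⟨N, h1, h2, h3⟩ := ih
      refine ⟨max N i.1, le_max_of_le_left h1, le_max_of_le_left h2, ?_⟩
      simp only [List.mem_cons, forall_eq_or_imp, le_max_right, true_and]
      exact fun l hl => le_max_of_le_left (h3 l hl)
  by_contra hne
  have h1 : ∫⁻ y in Ioi N, ‖lastState U js - Up‖ₑ ≤
      (∫⁻ y in Ioi N, ‖stepFun U js y - background Um Up y₀ y - pert y‖ₑ) +
        ∫⁻ y in Ioi N, ‖pert y‖ₑ := by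
    rw [← lintegral_add_right' _ hint.1.enorm.restrict]
    refine setLIntegral_mono' measurableSet_Ioi fun y hy => ?_
    have hy : N < y := hy
    rw [stepFun_of_lt U fun j hj => (hN j hj).trans_lt hy, background, if_pos (by linarith)]
    calc ‖lastState U js - Up‖ₑ = ‖(lastState U js - Up - pert y) + pert y‖ₑ := by
          rw [sub_add_cancel]
      _ ≤ _ := enorm_add_le _ _
  have h2 : (∫⁻ y in Ioi N, ‖stepFun U js y - background Um Up y₀ y - pert y‖ₑ) < ⊤ :=
    (lintegral_mono_set (Ioi_subset_Ioi hN0)).trans_lt h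
  have h3 : ∫⁻ y in Ioi N, ‖pert y‖ₑ < ⊤ := hint.integrableOn.2
  rw [setLIntegral_const, Real.volume_Ioi, ENNReal.mul_top (by simpa [sub_eq_zero] using hne)] at h1
  exact absurd (h1.trans_lt (ENNReal.add_lt_top.2 ⟨h2, h3⟩)) (lt_irrefl _)

end Jumps

/-! ### The fronts at the entrance -/

section Initial

variable {P : Params} {Um Up : State} {y₀ : ℝ} {k : Constants} {w : Weights} {Ki d : ℝ}

theorem Region.near_of_norm_sub_le {γ : ℝ} {U₀ : State} {C ρ ρ₁ : ℝ} (R : Region γ U₀ C ρ)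
    (hρ : ρ₁ ≤ ρ) {U : State} {s : ℝ} (h : ‖U - U₀‖ ≤ s) (hs : C * s ≤ ρ₁) :
    Near U₀ ρ₁ U ∧ ‖coord U - coord U₀‖ ≤ C * s := by
  have hC := R.one_le
  have h0 : 0 ≤ s := (norm_nonneg _).trans h
  have hsC : s ≤ C * s := le_mul_of_one_le_left h0 hC
  have hd : dist U U₀ ≤ ρ := by rw [dist_eq_norm]; linarith
  have hc := R.coords.coord_sub U U₀ hd (by simpa using R.pos.le)
  rw [dist_eq_norm] at hc
  have := mul_le_mul_of_nonneg_left h (by linarith : 0 ≤ C)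
  exact ⟨⟨R.coords.physical U hd, by linarith⟩, by linarith⟩

/-- The fronts above the strong front. -/
theorem InitialFronts.above (H : Setup P Um Up k w) (hi : InitialBound P Up k.ρ₁ Ki)
    (hd : k.C * d ≤ k.ρ₁) {U : State} {js : List (ℝ × State)} {fs : List Front}
    (h : InitialFronts P y₀ U js fs) (hjs : ∀ j ∈ js, j.1 ≠ y₀) (hl : lastState U js = Up)
    (hJ : jumpSum Um Up y₀ U js ≤ d) :
    ‖U - Up‖ ≤ jumpSum Um Up y₀ U js ∧ (∀ f ∈ fs, SmallFront P Up (3 * k.ρ₁) f) ∧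
      Linked U fs Up ∧ mass (vecSum fs) ≤ Ki * jumpSum Um Up y₀ U js := by
  induction h with
  | nil U =>
    have hl : U = Up := hl
    simp [hl, jumpSum, Linked, vecSum_nil, mass_zero]
  | weak U y v js new fs hy hn _ _ ih =>
    have hρ : k.ρ₁ ≤ k.ρ := by
      linarith [H.scale.le' H.region_above, H.scale.pos]
    have hC0 : 0 ≤ k.C := by linarith [H.region_above.one_le]
    have e : jumpSum Um Up y₀ U ((y, v) :: js) = ‖v - U‖ + jumpSum Um Up y₀ v js := by
      simp [jumpSum, backgroundJump, hy]
    rw [e] at hJ ⊢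
    have hn0 := norm_nonneg (v - U)
    obtain ⟨i1, i2, i3, i4⟩ := ih (fun j hj => hjs j (by simp [hj])) hl (by linarith)
    have hU : ‖U - Up‖ ≤ ‖v - U‖ + jumpSum Um Up y₀ v js := by
      have := norm_sub_le (v - Up) (v - U)
      rw [sub_sub_sub_cancel_left] at this
      linarith
    have hJ' := mul_le_mul_of_nonneg_left hJ hC0
    have hJ₁ := mul_le_mul_of_nonneg_left (by linarith : jumpSum Um Up y₀ v js ≤ d) hC0
    obtain ⟨n1, n2, n3⟩ := hi U v new hn
      (H.region_above.near_of_norm_sub_le hρ hU (by linarith)).1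
      (H.region_above.near_of_norm_sub_le hρ i1 (by linarith)).1
    rw [dist_comm, dist_eq_norm] at n3
    refine ⟨hU, fun f hf => (List.mem_append.1 hf).elim (n1 f) (i2 f),
      linked_append.2 ⟨v, n2, i3⟩, ?_⟩
    rw [vecSum_append, mass_add]
    linarith
  | strong U y v js new fs hy => exact absurd hy (hjs (y, v) (by simp))

/-- The fronts at the entrance. -/
theorem InitialFronts.layout (H : Setup P Um Up k w) (hb : InitialBound P Um k.ρ₁ Ki)
    (ha : InitialBound P Up k.ρ₁ Ki) (hKi : 0 ≤ Ki) (hKs : 0 ≤ k.Ks) (hpp : pp Up = pp Um)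
    (hd : k.C * d ≤ k.ρ₁) {U : State} {js : List (ℝ × State)}
    {fs : List Front} (h : InitialFronts P y₀ U js fs) (hjs : ∃ j ∈ js, j.1 = y₀)
    (hs : js.Pairwise fun i j => i.1 < j.1) (hl : lastState U js = Up)
    (hJ : jumpSum Um Up y₀ U js ≤ d) :
    ‖U - Um‖ ≤ jumpSum Um Up y₀ U js ∧ ∃ bl st ab, Layout P Um Up (3 * k.ρ₁) ⟨U, fs⟩ bl st ab ∧
      mass (vecSum bl) + mass (vecSum ab) + ‖st.jump - (coord Up - coord Um)‖ ≤
        (Ki + 2 * k.C * (1 + 2 * k.Ks)) * jumpSum Um Up y₀ U js := by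
  have hρ0 := H.scale.pos
  have hρ : k.ρ₁ ≤ k.ρ := by
    linarith [H.scale.le' H.region_above, H.scale.pos]
  have hC0 : 0 ≤ k.C := by linarith [H.region_above.one_le]
  induction h with
  | nil U => simp at hjs
  | weak U y v js new fs hy hn _ _ ih =>
    have e : jumpSum Um Up y₀ U ((y, v) :: js) = ‖v - U‖ + jumpSum Um Up y₀ v js := by
      simp [jumpSum, backgroundJump, hy]
    rw [e] at hJ ⊢
    have hn0 := norm_nonneg (v - U)
    have hjs' : ∃ j ∈ js, j.1 = y₀ := by
      obtain ⟨j, hj, hj'⟩ := hjs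
      rcases List.mem_cons.1 hj with rfl | hj
      · exact absurd hj' hy
      · exact ⟨j, hj, hj'⟩
    obtain ⟨i1, bl, st, ab, L, i4⟩ := ih hjs' (List.pairwise_cons.1 hs).2 hl (by linarith)
    have hU : ‖U - Um‖ ≤ ‖v - U‖ + jumpSum Um Up y₀ v js := by
      have := norm_sub_le (v - Um) (v - U)
      rw [sub_sub_sub_cancel_left] at this
      linarith
    have hJ' := mul_le_mul_of_nonneg_left hJ hC0
    have hJ₁ := mul_le_mul_of_nonneg_left (by linarith : jumpSum Um Up y₀ v js ≤ d) hC0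
    have hNU := (H.region_below.near_of_norm_sub_le hρ hU (by linarith)).1
    obtain ⟨n1, n2, n3⟩ := hb U v new hn hNU
      (H.region_below.near_of_norm_sub_le hρ i1 (by linarith)).1
    rw [dist_comm, dist_eq_norm] at n3
    refine ⟨hU, new ++ bl, st, ab, ⟨by simp [show fs = bl ++ st :: ab from L.fronts_eq],
      fun f hf => (List.mem_append.1 hf).elim (n1 f) (L.small_below f), L.small_above, L.kind,
      L.admissible, linked_append.2 ⟨v, n2, L.linked_below⟩, L.linked_above,
      hNU.mono (by linarith), L.near_lo, L.near_hi⟩, ?_⟩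
    rw [vecSum_append, mass_add]
    have : 0 ≤ 2 * k.C * (1 + 2 * k.Ks) * ‖v - U‖ := by positivity
    linarith
  | strong U y v js new fs hy hn _ hfs _ =>
    have e : jumpSum Um Up y₀ U ((y, v) :: js) =
        ‖v - U - (Up - Um)‖ + jumpSum Um Up y₀ v js := by
      simp [jumpSum, backgroundJump, hy]
    obtain ⟨J, hJdef⟩ : ∃ J, J = jumpSum Um Up y₀ U ((y, v) :: js) := ⟨_, rfl⟩
    rw [← hJdef] at e hJ ⊢
    have hn0 := norm_nonneg (v - U - (Up - Um))
    have hJ0 := jumpSum_nonneg (Um := Um) (Up := Up) (y₀ := y₀) v js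
    obtain ⟨i1, i2, i3, i4⟩ := hfs.above H ha hd
      (fun j hj hjy => by
        have := (List.pairwise_cons.1 hs).1 j hj
        simp only at this
        linarith) hl (by linarith)
    have hU : ‖U - Um‖ ≤ J := by
      have := norm_sub_le (v - Up) (v - U - (Up - Um))
      rw [show v - Up - (v - U - (Up - Um)) = U - Um by abel] at this
      linarith
    have hv : ‖v - Up‖ ≤ J := by linarith
    have hJ' := mul_le_mul_of_nonneg_left hJ hC0
    obtain ⟨u1, u2⟩ := H.region_below.near_of_norm_sub_le hρ hU (by linarith)
    obtain ⟨v1, v2⟩ := H.region_above.near_of_norm_sub_le hρ hv (by linarith)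
    obtain ⟨F₁, st, F₄, hsf, hst⟩ := H.strong_initial U v new hn u1 v1
    obtain ⟨Δ, hΔ⟩ : ∃ Δ, Δ = coord v - coord U - (coord Up - coord Um) := ⟨_, rfl⟩
    have hΔn : ‖Δ‖ ≤ 2 * (k.C * J) := by
      rw [hΔ, show coord v - coord U - (coord Up - coord Um) =
        (coord v - coord Up) - (coord U - coord Um) by abel]
      exact (norm_sub_le _ _).trans (by linarith)
    -- The background states have equal pressure and angle $0$. Hence the jumps of $\log p$ and
    -- $\varphi$ across the strong Riemann problem are components of the deviation $\Delta$, and the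
    -- weak waves it emits are bounded by the perturbation.
    have c1 : (coord v).2.2.1 - (coord U).2.2.1 = Δ.2.2.1 := by
      have : (coord Up).2.2.1 = (coord Um).2.2.1 := by simp [coord, hpp]
      rw [hΔ]
      simp [this]
    have c2 : (coord v).2.2.2 - (coord U).2.2.2 = Δ.2.2.2 := by
      rw [hΔ]
      simp [H.region_below.angle_zero, H.region_above.angle_zero]
    rw [c1, c2] at hst
    have hst' := hst.trans (mul_le_mul_of_nonneg_left
      (add_le_add (FlowCoord.abs_trd_le Δ) (FlowCoord.abs_fth_le Δ)) hKs)
    have hjn : ‖st.jump - (coord Up - coord Um)‖ ≤ ‖coord v - coord U - st.jump‖ + ‖Δ‖ := by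
      have := norm_sub_le Δ (coord v - coord U - st.jump)
      rw [hΔ, show coord v - coord U - (coord Up - coord Um) - (coord v - coord U - st.jump) =
        st.jump - (coord Up - coord Um) by abel, ← hΔ] at this
      linarith
    refine ⟨hU, F₁, st, F₄ ++ fs, ⟨by simp [hsf.new_eq], hsf.small_below,
      fun f hf => (List.mem_append.1 hf).elim (hsf.small_above f) (i2 f), hsf.kind,
      hsf.admissible, hsf.linked_below, linked_append.2 ⟨v, hsf.linked_above, i3⟩,
      u1.mono (by linarith), hsf.near_lo, hsf.near_hi⟩, ?_⟩
    rw [vecSum_append, mass_add]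
    have h1 := mul_le_mul_of_nonneg_left hΔn hKs
    have h2 := mul_le_mul_of_nonneg_left (by linarith : jumpSum Um Up y₀ v js ≤ J) hKi
    linarith

end Initial

theorem dot_le_mul_mass {a x : WaveVec} {B : ℝ} (ha : ∀ i, a i ≤ B) (hx : 0 ≤ x) :
    dot a x ≤ B * mass x := by
  rw [dot, mass, Finset.mul_sum]
  exact Finset.sum_le_sum fun i _ => mul_le_mul_of_nonneg_right (ha i) (hx i)

/-- All weights are at most $W$ and the potential is at most quadratic; for small data this bounds
the initial functional linearly. -/
theorem Weights.energy_le_of_mass_le (w : Weights) (D₀ : FlowCoord) {bl ab : List Front}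
    {st : Front} {s : ℝ} (h : mass (vecSum bl) + mass (vecSum ab) + ‖st.jump - D₀‖ ≤ s) :
    w.energy D₀ bl st ab ≤ w.W * s + w.Λ * s ^ 2 := by
  have := w.e_le
  have := w.κ_le
  have := w.one_le
  have h1 : dot w.below (vecSum bl) ≤ w.W * mass (vecSum bl) :=
    dot_le_mul_mass (fun i => by fin_cases i <;> simp [Weights.below] <;> linarith)
      (vecSum_nonneg bl)
  have h2 : dot w.above (vecSum ab) ≤ w.W * mass (vecSum ab) :=
    dot_le_mul_mass (fun i => by fin_cases i <;> simp [Weights.above] <;> linarith)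
      (vecSum_nonneg ab)
  have m1 := mass_nonneg (vecSum_nonneg bl)
  have m2 := mass_nonneg (vecSum_nonneg ab)
  have m3 := norm_nonneg (st.jump - D₀)
  have h3 : w.Λ * (potential bl + potential ab) ≤ w.Λ * s ^ 2 := by
    refine mul_le_mul_of_nonneg_left ?_ w.Λ_nonneg
    have := mul_nonneg m1 m2
    have := pow_le_pow_left₀ (by linarith) (by linarith : mass (vecSum bl) + mass (vecSum ab) ≤ s) 2
    linarith [potential_le bl, potential_le ab]
  have h4 := mul_le_mul_of_nonneg_left h (by linarith : 0 ≤ w.W)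
  have h5 : w.e * ‖st.jump - D₀‖ ≤ w.W * ‖st.jump - D₀‖ :=
    mul_le_mul_of_nonneg_right (by linarith) m3
  unfold Weights.energy
  linarith

section

variable {P : Params} {Um Up : State} {y₀ : ℝ} {pert : ℝ → State} {g dg : ℝ → ℝ}
  {k : Constants} {w : Weights} {Ki v : ℝ}

theorem FrontTracking.jumpSum_le (A : FrontTracking P Um Up y₀ pert g dg) (hv : 0 ≤ v)
    (h : eVariationOn pert univ ≤ ENNReal.ofReal v) :
    jumpSum Um Up y₀ A.initBot A.jumps ≤ v := by
  rw [← ENNReal.ofReal_le_ofReal_iff hv]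
  obtain ⟨p, hp0, hp⟩ : ∃ p, 0 < p ∧ ∀ j ∈ A.jumps, p ≤ j.1 := by
    have hs := A.jumps_sorted
    have h0 := A.jumps_pos
    generalize A.jumps = js at hs h0
    cases js with
    | nil => exact ⟨1, one_pos, by simp⟩
    | cons j js =>
      refine ⟨j.1, h0 j (by simp), ?_⟩
      simp only [List.mem_cons, forall_eq_or_imp, le_refl, true_and]
      exact fun i hi => ((List.pairwise_cons.1 hs).1 i hi).le
  exact (jumpSum_le_eVariationOn A.jumps_sorted A.initBot hp (Or.inl A.jumps_strong)).trans
    ((eVariationOn.mono _ (Ici_subset_Ioi.2 hp0)).trans (A.init_variation.trans h))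

/-- The functional of the incoming flow. -/
theorem FrontTracking.exists_initial_layout (A : FrontTracking P Um Up y₀ pert g dg)
    (H : Setup P Um Up k w) (hb : InitialBound P Um k.ρ₁ Ki) (ha : InitialBound P Up k.ρ₁ Ki)
    (hKi : 0 ≤ Ki) (hKs : 0 ≤ k.Ks) (hKw : 0 ≤ k.Kw) (hpp : pp Up = pp Um)
    (hint : Integrable pert) (hv0 : 0 ≤ v) (hv1 : v ≤ 1) (hvC : k.C * v ≤ k.ρ₁)
    (hpert : eVariationOn pert univ ≤ ENNReal.ofReal v)
    (hwall : A.wall.slopeVariation ≤ ENNReal.ofReal v) {M : ℝ}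
    (hM : Ki + 2 * k.C * (1 + 2 * k.Ks) + k.Kw * (k.C + 1) ≤ M) :
    ∃ bl st ab, Layout P Um Up (k.ρ / 2) (A.cfg 0) bl st ab ∧
      w.energy (coord Up - coord Um) bl st ab + w.kw * A.wall.remaining v 0 (A.cfg 0).bot ≤
        (w.W * M + w.Λ * M ^ 2 + w.kw) * v := by
  have hρ0 := H.scale.pos
  have hC0 : 0 ≤ k.C := by linarith [H.region_above.one_le]
  have hρ := H.scale.le' H.region_below
  have hJ := A.jumpSum_le hv0 hpert
  have hlast : lastState A.initBot A.jumps = Up :=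
    lastState_eq hint (A.init_close.trans_lt ENNReal.ofReal_lt_top)
  obtain ⟨lat, fs, hfr, hlat, -, hinit⟩ := A.init
  obtain ⟨hU, bl, st, ab, L, hm⟩ := hinit.layout H hb ha hKi hKs hpp hvC A.jumps_strong
    A.jumps_sorted hlast hJ
  obtain ⟨hN, hφ⟩ := H.region_below.near_of_norm_sub_le (by linarith) (hU.trans hJ) hvC
  obtain ⟨b, hfan, hbb, -⟩ := H.lateral _ _ _ _ hlat hN
  have hcfg : A.cfg 0 = ⟨(A.cfg 0).bot, lat ++ fs⟩ := by rw [← hfr]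
  have L' := Layout.lateral (old := []) (ρ₃ := k.ρ / 2) (by linarith) (by linarith) L rfl rfl hfan
  rw [← hcfg] at L'
  refine ⟨lat ++ bl, st, ab, L', ?_⟩
  have hang : |(coord A.initBot).2.2.2 - Real.arctan (A.wall.slope 0)| ≤ (k.C + 1) * v := by
    have h1 := (FlowCoord.abs_fth_le (coord A.initBot - coord Um)).trans hφ
    have h2 : (coord A.initBot - coord Um).2.2.2 = (coord A.initBot).2.2.2 := by
      simp [H.region_below.angle_zero]
    rw [h2] at h1
    have h3 := abs_arctan_sub_le (A.wall.slope 0) 0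
    rw [Real.arctan_zero, sub_zero, sub_zero] at h3
    have h4 := Wall.abs_slope_le hv0 hwall 0
    have h5 := abs_sub (coord A.initBot).2.2.2 (Real.arctan (A.wall.slope 0))
    linarith
  have hlm : mass (vecSum lat) ≤ k.Kw * (k.C + 1) * v := by
    rw [hfan.vec_eq, mass_waveVec]
    have := mul_le_mul_of_nonneg_left hang hKw
    linarith
  have hmass : mass (vecSum (lat ++ bl)) + mass (vecSum ab) + ‖st.jump - (coord Up - coord Um)‖ ≤
      M * v := by
    rw [vecSum_append, mass_add]
    have h1 := mul_le_mul_of_nonneg_left hJ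
      (by positivity : 0 ≤ Ki + 2 * k.C * (1 + 2 * k.Ks))
    have h2 := mul_le_mul_of_nonneg_right hM hv0
    linarith
  have hE := w.energy_le_of_mass_le (coord Up - coord Um) hmass
  -- The lateral solver at the origin leaves no mismatch, so the wall part is the whole allowance
  -- $T=v$ for the turning.
  have hrem : A.wall.remaining v 0 (A.cfg 0).bot = v := by
    simp [Wall.remaining, hfan.angle]
  have hsq : w.Λ * (M * v) ^ 2 ≤ w.Λ * M ^ 2 * v := by
    have h1 : v * v ≤ 1 * v := mul_le_mul_of_nonneg_right hv1 hv0
    have h2 := mul_le_mul_of_nonneg_left h1 (mul_nonneg w.Λ_nonneg (sq_nonneg M))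
    linarith
  rw [hrem]
  linarith

end

end SteadyEuler

end

open SteadyEuler in
theorem proposition3p1
    (γ : ℝ) (hγ : 1 < γ)
    (Um Up : SteadyEuler.State)
    (hUm : SteadyEuler.Supersonic γ Um) (hUp : SteadyEuler.Supersonic γ Up)
    (hvm : SteadyEuler.vv Um = 0) (hvp : SteadyEuler.vv Up = 0)
    (hpp : SteadyEuler.pp Up = SteadyEuler.pp Um)
    (y₀ : ℝ) (hy₀ : 0 < y₀)
    (Kstar : ℝ) (hK : SteadyEuler.K11 γ Um Up < Kstar) (hK1 : Kstar < 1)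
    (speedNP : ℝ) (hNPm : SteadyEuler.lam γ .four Um < speedNP)
    (hNPp : SteadyEuler.lam γ .four Up < speedNP) :
    ∃ r > (0 : ℝ), ∃ η₀ > (0 : ℝ), ∃ δ₀ > (0 : ℝ), ∃ C > (0 : ℝ),
      ∀ (pert : ℝ → SteadyEuler.State) (g dg : ℝ → ℝ) (L : NNReal),
        Integrable pert →
        LipschitzOnWith L g (Ici 0) → g 0 = 0 →
        (∀ x, 0 ≤ x → HasDerivWithinAt g (dg x) (Ici x) x) → dg 0 = 0 →
        Tendsto dg atTop (𝓝 0) →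
        eVariationOn pert univ + eVariationOn dg (Ici 0) ≤ ENNReal.ofReal δ₀ →
        ∀ P : SteadyEuler.Params, P.γ = γ → P.speedNP = speedNP → P.weak = r →
          0 < P.ϑ → 0 < P.δ → 0 < P.ω → 0 ≤ P.η → P.η ≤ η₀ →
          ∀ (A : SteadyEuler.FrontTracking P Um Up y₀ pert g dg) (x : ℝ),
            0 < x → (∃ n, x < A.τ n) →
            A.totalStrength (2 * SteadyEuler.K21 γ Um Up / Kstar) x ≤
                C * (eVariationOn pert univ + eVariationOn dg (Ici 0)).toReal ∧
              eVariationOn (A.sol x) (Ioi (A.wall.height x)) ≤ ENNReal.ofReal C := by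
  obtain ⟨k, w, Ki, r, η₀, hKs, hKw, hKi, hr, hη₀, hm0, hsetup⟩ :=
    exists_setup hγ hUm hUp hvm hvp hNPm hNPp
  obtain ⟨M, hM⟩ : ∃ M, M = max 1 (Ki + 2 * k.C * (1 + 2 * k.Ks) + k.Kw * (k.C + 1)) := ⟨_, rfl⟩
  have hM0 : 0 < M := hM ▸ lt_max_of_lt_left one_pos
  have hMle : Ki + 2 * k.C * (1 + 2 * k.Ks) + k.Kw * (k.C + 1) ≤ M := hM ▸ le_max_right _ _
  have hW := w.one_le
  have hΛ := w.Λ_nonneg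
  have hkw := w.kw_pos
  have he := w.e_pos
  obtain ⟨B, hB⟩ : ∃ B, B = w.W * M + w.Λ * M ^ 2 + w.kw := ⟨_, rfl⟩
  have hB0 : 0 < B := by rw [hB]; positivity
  obtain ⟨kp, hkp⟩ : ∃ kp, kp = 2 * K21 γ Um Up / Kstar := ⟨_, rfl⟩
  have hkp0 := abs_nonneg kp
  have hconst : ∀ P : Params, P.γ = γ → P.speedNP = speedNP → P.weak = r → P.η ≤ η₀ →
      0 < k.C ∧ 0 < k.ρ ∧ 0 < k.ρ₁ ∧ 0 < k.l := fun P h1 h2 h3 h4 =>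
    have H := (hsetup P h1 h2 h3 h4).1
    ⟨by linarith [H.region_below.one_le], H.region_below.pos, H.scale.pos, H.l_pos⟩
  -- The constants do not depend on the parameters, so their positivity can be read off from one
  -- arbitrary choice; the zeros are placeholders.
  obtain ⟨hC0, hρ0, hρ₁, hl⟩ := hconst ⟨γ, 0, 0, 0, η₀, speedNP, r⟩ rfl rfl rfl le_rfl
  -- In order: the quadratic part of the initial functional becomes linear; the wall stays less
  -- steep than any $4$-front; the incoming states lie near the background; the masses stay below
  -- $m$; and the bootstrap of `Layout.refine` closes.
  obtain ⟨δ₀, hδ0, hδ1, hδl, hδC, hδm, hδρ⟩ : ∃ δ > 0, δ ≤ 1 ∧ δ < k.l ∧ k.C * δ ≤ k.ρ₁ ∧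
      B * δ ≤ w.e * w.m ∧ 3 * (k.C * (B * δ)) ≤ w.e * k.ρ₁ := by
    obtain ⟨t, ht⟩ : ∃ t, t = min (min 1 (k.l / 2)) (min (k.ρ₁ / k.C)
      (min (w.e * w.m / B) (w.e * k.ρ₁ / (3 * k.C * B)))) := ⟨_, rfl⟩
    have ht0 : 0 < t := by rw [ht]; positivity
    have := ht.le
    simp only [le_min_iff] at this
    obtain ⟨⟨a1, a2⟩, a3, a4, a5⟩ := this
    rw [le_div_iff₀ (by positivity)] at a3 a4 a5
    exact ⟨t, ht0, a1, by linarith, by linarith, by linarith, by linarith⟩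
  refine ⟨r, hr, η₀, hη₀, δ₀, hδ0,
    -- The first summand bounds the weighted strength per unit of variation of the data. The second
    -- bounds the total variation, with the weak jumps at most $C^2m$ and the strong jump at most
    -- $|U_+-U_-|+C\rho$.
    2 * (k.C * k.C) * (1 + |kp|) * (B / w.e) + (k.C * k.C * w.m + (dist Up Um + k.C * k.ρ)),
    by positivity, ?_⟩
  intro pert g dg _ hint _ _ _ _ _ hvar P hPγ hPs hPr _ _ _ _ hPη A x hx hxn
  obtain ⟨H, hb, ha⟩ := hsetup P hPγ hPs hPr hPη
  obtain ⟨v, hv⟩ : ∃ v, v = (eVariationOn pert univ + eVariationOn dg (Ici 0)).toReal := ⟨_, rfl⟩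
  have hv' : eVariationOn pert univ + eVariationOn dg (Ici 0) = ENNReal.ofReal v := by
    rw [hv, ENNReal.ofReal_toReal (ne_top_of_le_ne_top ENNReal.ofReal_ne_top hvar)]
  have hv0 : 0 ≤ v := hv ▸ ENNReal.toReal_nonneg
  have hvδ : v ≤ δ₀ := by rwa [hv', ENNReal.ofReal_le_ofReal_iff hδ0.le] at hvar
  have hwall : A.wall.slopeVariation ≤ ENNReal.ofReal v :=
    A.wall_variation.trans (le_add_self.trans hv'.le)
  have hT := Wall.sum_turn_le hv0 hwall
  have hBv : B * v ≤ B * δ₀ := mul_le_mul_of_nonneg_left hvδ hB0.le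
  have hCBv := mul_le_mul_of_nonneg_left hBv hC0.le
  have hCv := mul_le_mul_of_nonneg_left hvδ hC0.le
  have h0 := A.exists_initial_layout H hb ha (by linarith) (by linarith) (by linarith) hpp hint
    hv0 (hvδ.trans hδ1) (hCv.trans hδC) (le_self_add.trans hv'.le) hwall hMle
  rw [← hB] at h0
  obtain ⟨i1, i2⟩ := A.exists_index hx hxn
  obtain ⟨bl, st, ab, i, Lt, -, -, hE⟩ := H.invariant A
    (fun i => (Wall.abs_slope_le hv0 hwall i).trans_lt (by linarith)) hT (hBv.trans hδm)
    (by linarith) h0 (A.index x)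
  have hmass := (w.mass_le_of_energy_le hT hE).2
  obtain ⟨m, hm⟩ : ∃ m, m = mass (vecSum bl) + mass (vecSum ab) := ⟨_, rfl⟩
  rw [← hm] at hmass
  have hm0' : 0 ≤ m := hm ▸ add_nonneg (mass_nonneg (vecSum_nonneg bl))
    (mass_nonneg (vecSum_nonneg ab))
  have hmv : m ≤ B / w.e * v := by
    rw [div_mul_eq_mul_div, le_div_iff₀ he]
    linarith
  have hmm : m ≤ w.m := le_of_mul_le_mul_left (hmass.trans (hBv.trans hδm)) he
  have Lt' := Lt.mono (by linarith [H.scale.le' H.region_below] : k.ρ₁ ≤ k.ρ / 2)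
  have hdist : 0 ≤ dist Up Um + k.C * k.ρ := by positivity
  rw [← hv, ← hkp]
  constructor
  · have h1 := Lt'.totalStrength_le H.region_below H.region_above kp
    rw [← hm] at h1
    have h2 := mul_le_mul_of_nonneg_left hmv
      (by positivity : 0 ≤ 2 * (k.C * k.C) * (1 + |kp|))
    have h3 : 0 ≤ (k.C * k.C * w.m + (dist Up Um + k.C * k.ρ)) * v := by positivity
    refine h1.trans (h2.trans ?_)
    linarith
  · refine (eVariationOn_state_le Lt.linked (A.pairwise_pos_le i1 i2) _).trans
      (ENNReal.ofReal_le_ofReal ?_)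
    have h1 := Lt'.sum_dist_le H.region_below H.region_above
    rw [← hm] at h1
    have h2 := mul_le_mul_of_nonneg_left hmm (by positivity : 0 ≤ k.C * k.C)
    have h3 : 0 ≤ 2 * (k.C * k.C) * (1 + |kp|) * (B / w.e) := by positivity
    linarith
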